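/- **Setting.** Let $\nu>0$, $2\nu+3\nu'\ge 0$, $\beta>0$, $\gamma>0$, $\tilde\nu:=\nu+\nu'$, and for $\lambda\in\mathbb{C}$ put $\kappa_1(\lambda):=\nu\lambda+\beta^2$, $\kappa_2(\lambda):=(\nu+\tilde\nu)\lambda+\beta^2+\gamma^2$. For $\xi\in\mathbb{R}^3\setminus\{0\}$ (column vectors) let $\widehat{\mathcal P}_c(\xi):=\xi\,{}^\top\xi/|\xi|^2$, $\widehat{\mathcal P}_s(\xi):=I-\widehat{\mathcal P}_c(\xi)$. Let $\widehat f(\xi)=(2\pi)^{-3/2}\int_{\mathbb{R}^3} f(x)e^{-i\xi\cdot x}\,dx$, and let $\mathcal F^{-1}$ be the inverse transform in the sense of tempered distributions. For vector fields and matrix fields, $(\nabla v)^{jk}=\partial_{x_k}v^j$ and $(\mathrm{div}\,F)^j=\sum_k\partial_{x_k}F^{jk}$. Put $B_r:=\{x\in\mathbb{R}^3:|x|<r\}$. Derivatives are distributional, functions are complex valued, and norms of vectors and matrices are sums over components. *Spaces.* For $1<p<\infty$ and $R>0$, $X^p_R(\mathbb{R}^3)$ is the set of $\mathbf f=(f_1,f_2,f_3)\in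 W^{1,p}(\mathbb{R}^3)\times L^p(\mathbb{R}^3)^3\times W^{1,p}(\mathbb{R}^3)^{3\times3}$ that vanish a.e. outside $B_R$ and satisfy $\nabla f_1+\mathrm{div}\,{}^\top f_3=0$ and $f_3\in\nabla W^{2,p}(\mathbb{R}^3)^3$, with norm $\|\mathbf f\|_{X^p}=\|f_1\|_{W^{1,p}}+\|f_2\|_{L^p}+\|f_3\|_{W^{1,p}}$. For an open ball $D$, $Y^p(D)$ is the set of $(\phi,w,G)\in W^{1,p}(D)\times W^{2,p}(D)^3\times W^{1,p}(D)^{3\times3}$ with $\nabla\phi+\mathrm{div}\,{}^\top G=0$ and $G\in\nabla W^{2,p}(D)^3$ (no boundary condition), with norm $\|\phi\|_{W^{1,p}(D)}+\|w\|_{W^{2,p}(D)}+\|G\|_{W^{1,p}(D)}$. *Operators for $\lambda\ne0$.* Put $d_l:=\lambda^2+\kappa_l(\lambda)|\xi|^2$ $(l=1,2)$, $L:=d_1^{-1}\widehat{\mathcal P}_s+d_2^{-1}\widehat{\mathcal P}_c$ and $H:=\frac{\lambda+\nu|\xi|^2}{d_1}\widehat{\mathcal P}_s+\frac{\lambda+(\nu+\tilde\nu)|\xi|^2}{d_2}\widehat{\mathcal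 P}_c$. Then $\mathcal R(\lambda)\mathbf f=(\Phi(\lambda)\mathbf f,\mathcal W(\lambda)\mathbf f,\mathcal G(\lambda)\mathbf f)$ and $\Psi(\lambda)\mathbf f$ are given by $$\Phi(\lambda)\mathbf f=\mathcal F^{-1}\Big[\tfrac{\lambda+(\nu+\tilde\nu)|\xi|^2}{d_2}\widehat f_1\Big]-i\mathcal F^{-1}\Big[\tfrac{\xi\cdot\widehat f_2}{d_2}\Big]-\tfrac{\beta^2}{\lambda}\mathcal F^{-1}\Big[\tfrac{\widehat f_1|\xi|^2+{}^\top\xi\widehat f_3\xi}{d_2}\Big],$$ $$\mathcal W(\lambda)\mathbf f=-i\gamma^2\mathcal F^{-1}\Big[\tfrac{\widehat f_1}{d_2}\xi\Big]+\mathcal F^{-1}[\lambda L\widehat f_2]+i\beta^2\mathcal F^{-1}[L\widehat f_3\xi],$$ $$\mathcal G(\lambda)\mathbf f=i\mathcal F^{-1}[L\widehat f_2\,{}^\top\xi]+\mathcal F^{-1}[H\widehat f_3]+\tfrac{\gamma^2}{\lambda}\mathcal F^{-1}\Big[\tfrac{1}{d_2}\xi\,{}^\top\xi(\widehat f_1I+\widehat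 f_3)\Big]+\tfrac{\beta^2}{\lambda}\mathcal F^{-1}\big[|\xi|^2L\widehat f_3\widehat{\mathcal P}_s\big],$$ $$\Psi(\lambda)\mathbf f=\mathcal F^{-1}[L\widehat f_2]-i\mathcal F^{-1}\Big[H\widehat f_3\tfrac{\xi}{|\xi|^2}\Big].$$ *Operators for $\lambda=0$.* $\mathcal R(0)\mathbf f=(\Phi(0)\mathbf f,\mathcal W(0)\mathbf f,\mathcal G(0)\mathbf f)$ and $\Psi(0)\mathbf f$ are given by $$\Phi(0)\mathbf f=\tfrac{\nu+\tilde\nu}{\beta^2+\gamma^2}f_1-\tfrac{i}{\beta^2+\gamma^2}\mathcal F^{-1}\Big[\tfrac{\xi\cdot\widehat f_2}{|\xi|^2}\Big],$$ $$\mathcal W(0)\mathbf f=-\tfrac{i\gamma^2}{\beta^2+\gamma^2}\mathcal F^{-1}\Big[\tfrac{\widehat f_1}{|\xi|^2}\xi\Big]+i\mathcal F^{-1}\Big[\widehat{\mathcal P}_s\widehat f_3\tfrac{\xi}{|\xi|^2}\Big]+\tfrac{i\beta^2}{\beta^2+\gamma^2}\mathcal F^{-1}\Big[\widehat{\mathcal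 P}_c\widehat f_3\tfrac{\xi}{|\xi|^2}\Big],$$ $$\mathcal G(0)\mathbf f=\tfrac{i}{\beta^2}\mathcal F^{-1}\Big[\widehat{\mathcal P}_s\widehat f_2\tfrac{{}^\top\xi}{|\xi|^2}\Big]+\tfrac{i}{\beta^2+\gamma^2}\mathcal F^{-1}\Big[\widehat{\mathcal P}_c\widehat f_2\tfrac{{}^\top\xi}{|\xi|^2}\Big]+\tfrac{\nu}{\beta^2}\mathcal F^{-1}[\widehat{\mathcal P}_s\widehat f_3]+\tfrac{\nu+\tilde\nu}{\beta^2+\gamma^2}\mathcal F^{-1}[\widehat{\mathcal P}_c\widehat f_3],$$ $$\Psi(0)\mathbf f=\tfrac{1}{\beta^2}\mathcal F^{-1}\Big[\tfrac{\widehat{\mathcal P}_s\widehat f_2}{|\xi|^2}\Big]+\tfrac{1}{\beta^2+\gamma^2}\mathcal F^{-1}\Big[\tfrac{\widehat{\mathcal P}_c\widehat f_2}{|\xi|^2}\Big]-\tfrac{i\nu}{\beta^2}\mathcal F^{-1}\Big[\widehat{\mathcal P}_s\widehat f_3\tfrac{\xi}{|\xi|^2}\Big]-\tfrac{i(\nu+\tilde\nu)}{\beta^2+\gamma^2}\mathcal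 F^{-1}\Big[\widehat{\mathcal P}_c\widehat f_3\tfrac{\xi}{|\xi|^2}\Big].$$ **Proposition 3.4.** Let $1<p<\infty$ and $R>0$. Then: (i) $\mathcal R(0)$ and $\Psi(0)$ are linear on $X^p_R(\mathbb{R}^3)$, and for every $R'>0$ (after restriction to $B_{R'}$) $\mathcal R(0)\in\mathcal L(X^p_R(\mathbb{R}^3),Y^p(B_{R'}))$ and $\Psi(0)\in\mathcal L(X^p_R(\mathbb{R}^3),W^{2,p}(B_{R'})^3)$; moreover $\mathcal G(0)\mathbf f=\nabla\Psi(0)\mathbf f$ in $B_{R'}$. (ii) There is a constant $C$, depending only on $\nu,\nu',\beta,\gamma,p,R$, such that for all $\mathbf f\in X^p_R(\mathbb{R}^3)$ $$\|\nabla\Phi(0)\mathbf f\|_{L^p(\mathbb{R}^3)}+\|\nabla\mathcal W(0)\mathbf f\|_{W^{1,p}(\mathbb{R}^3)}+\|\nabla\mathcal G(0)\mathbf f\|_{L^p(\mathbb{R}^3)}\le C\|\mathbf f\|_{X^p(\mathbb{R}^3)}.$$ (iii) There is a constant $C$, depending only on $\nu,\nu',\beta,\gamma,p,R$, such that for all $\mathbf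 f\in X^p_R(\mathbb{R}^3)$ the distributions $\mathcal R(0)\mathbf f$ and $\Psi(0)\mathbf f$ are continuous functions on $\{|x|>R\}$ and $$|x|^2\,|(\mathcal R(0)\mathbf f)(x)|+|x|\,|(\Psi(0)\mathbf f)(x)|\le C\|\mathbf f\|_{X^p(\mathbb{R}^3)}\qquad(|x|\ge 2R).$$ (iv) For every $R'>0$ and every $\mathbf f\in X^p_R(\mathbb{R}^3)$ $$\lim_{\substack{\lambda\to0,\ \lambda\neq0\\ |\arg\lambda|\le\pi/2}}\Big(\|(\mathcal R(\lambda)-\mathcal R(0))\mathbf f\|_{Y^p(B_{R'})}+\|(\Psi(\lambda)-\Psi(0))\mathbf f\|_{W^{2,p}(B_{R'})}\Big)=0.$$ -/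

import Mathlib

open MeasureTheory Filter Topology SchwartzMap LineDeriv FourierTransform
open scoped ENNReal NNReal

noncomputable section

namespace Viscoelastic

/-- Euclidean space `ℝ³`. -/
abbrev E3 : Type := EuclideanSpace ℝ (Fin 3)

/-! ### Functions as tempered distributions -/

/-- `g` is integrable against some negative power of `1 + |x|`; such a `g` is a tempered
distribution. -/
def IsTempered (g : E3 → ℂ) : Prop :=
  ∃ N : ℕ, Integrable (fun x : E3 => ((1 + ‖x‖) ^ N)⁻¹ • g x)

theorem IsTempered.exists_bound {g : E3 → ℂ} (hg : IsTempered g) :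
    (∀ φ : 𝓢(E3, ℂ), Integrable (fun x => g x * φ x)) ∧
    ∃ (s : Finset (ℕ × ℕ)) (C : ℝ), 0 ≤ C ∧ ∀ φ : 𝓢(E3, ℂ),
      ‖∫ x, g x * φ x‖ ≤ C * s.sup (schwartzSeminormFamily ℂ E3 ℂ) φ := by
  obtain ⟨N, hN⟩ := hg
  have key : ∀ (φ : 𝓢(E3, ℂ)) (x : E3), ‖(((1 + ‖x‖) ^ N : ℝ) : ℂ) * φ x‖ ≤
      2 ^ N * (Finset.Iic (N, 0)).sup (schwartzSeminormFamily ℂ E3 ℂ) φ := by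
    intro φ x
    have h := SchwartzMap.one_add_le_sup_seminorm_apply (𝕜 := ℂ) (m := (N, 0)) (k := N) (n := 0)
      le_rfl le_rfl φ x
    rw [norm_iteratedFDeriv_zero] at h
    rw [norm_mul, Complex.norm_real, Real.norm_of_nonneg (by positivity)]
    exact h
  have eqn : ∀ φ : 𝓢(E3, ℂ), (fun x => g x * φ x) =
      fun x => (((1 + ‖x‖) ^ N)⁻¹ • g x) * ((((1 + ‖x‖) ^ N : ℝ) : ℂ) * φ x) := by
    intro φ
    funext x
    have h0 : (((1 + ‖x‖) ^ N : ℝ) : ℂ) ≠ 0 := by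
      have : (0 : ℝ) < (1 + ‖x‖) ^ N := by positivity
      exact_mod_cast this.ne'
    rw [Complex.real_smul, Complex.ofReal_inv]
    field_simp
  have hmeas : ∀ φ : 𝓢(E3, ℂ), AEStronglyMeasurable
      (fun x : E3 => (((1 + ‖x‖) ^ N : ℝ) : ℂ) * φ x) volume := by
    intro φ
    have hc := φ.continuous
    exact Continuous.aestronglyMeasurable (by fun_prop)
  refine ⟨fun φ => ?_, Finset.Iic (N, 0),
    (∫ x : E3, ‖((1 + ‖x‖) ^ N)⁻¹ • g x‖) * 2 ^ N, by positivity, fun φ => ?_⟩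
  · rw [eqn φ]
    exact hN.mul_bdd (hmeas φ) (Eventually.of_forall (key φ))
  · rw [eqn φ, mul_assoc, ← integral_mul_const]
    refine (norm_integral_le_integral_norm _).trans ?_
    refine integral_mono_of_nonneg (Eventually.of_forall fun x => norm_nonneg _)
      (hN.norm.mul_const _) (Eventually.of_forall fun x => ?_)
    dsimp only
    rw [norm_mul]
    exact mul_le_mul_of_nonneg_left (key φ x) (norm_nonneg _)

/-- The tempered distribution `φ ↦ ∫ g φ` of a function `g` (and `0` if `g` is not tempered). -/
def ofFun (g : E3 → ℂ) : 𝓢'(E3, ℂ) :=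
  open Classical in
  if hg : IsTempered g then
    ContinuousLinearMap.toPointwiseConvergenceCLM _ _ _ _
      (SchwartzMap.mkCLMtoNormedSpace (𝕜 := ℂ) (σ := RingHom.id ℂ)
        (fun φ : 𝓢(E3, ℂ) => ∫ x, g x * φ x)
        (fun φ ψ => by
          have h1 := hg.exists_bound.1 φ
          have h2 := hg.exists_bound.1 ψ
          rw [← integral_add h1 h2]
          exact integral_congr_ae (Eventually.of_forall fun x => by simp [mul_add]))
        (fun a φ => by
          simp only [RingHom.id_apply, smul_eq_mul]
          rw [← integral_const_mul]
          exact integral_congr_ae (Eventually.of_forall fun x => by simp; ring))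
        hg.exists_bound.2)
  else 0

theorem ofFun_apply {g : E3 → ℂ} (hg : IsTempered g) (φ : 𝓢(E3, ℂ)) :
    ofFun g φ = ∫ x, g x * φ x := by
  rw [ofFun, dif_pos hg]
  rfl

/-! ### Fourier transform, normalised with `(2π)^(-3/2)` and phase `e^(-iξ·x)` -/

/-- `f̂(ξ) = (2π)^(-3/2) ∫ f(x) e^(-iξ·x) dx`. -/
def fhat (f : E3 → ℂ) (ξ : E3) : ℂ :=
  (((2 * Real.pi) ^ (-(3 / 2) : ℝ) : ℝ) : ℂ) *
    ∫ x, Complex.exp (-(Complex.I * ((inner ℝ ξ x : ℝ) : ℂ))) * f x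

/-- The inverse Fourier transform `ℱ⁻¹[g]`, in the sense of tempered distributions, of a tempered
function `g`, for the same normalisation: `⟨ℱ⁻¹[g], φ⟩ = ∫ g (ℱ⁻¹φ)` with
`ℱ⁻¹φ (ξ) = (2π)^(-3/2) ∫ φ(x) e^(iξ·x) dx`, see `finv_apply`. The rescaling accounts for
Mathlib's phase `e^(2πi x·ξ)`. -/
def finv (g : E3 → ℂ) : 𝓢'(E3, ℂ) :=
  (((2 * Real.pi) ^ (3 / 2 : ℝ) : ℝ) : ℂ) •
    𝓕⁻ (ofFun (fun η : E3 => g ((2 * Real.pi) • η)))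

theorem IsTempered.comp_smul {g : E3 → ℂ} (hg : IsTempered g) :
    IsTempered (fun η : E3 => g ((2 * Real.pi) • η)) := by
  obtain ⟨N, hN⟩ := hg
  have h2 : (1 : ℝ) ≤ 2 * Real.pi := by have := Real.pi_gt_three; linarith
  refine ⟨N, ?_⟩
  have h := (hN.comp_smul (R := 2 * Real.pi) (by positivity))
  have h' := h.bdd_mul (f := fun x : E3 =>
      ((((1 + ‖(2 * Real.pi) • x‖) ^ N) * ((1 + ‖x‖) ^ N)⁻¹ : ℝ) : ℂ))
      (c := (2 * Real.pi) ^ N) ?_ (Eventually.of_forall fun x => ?_)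
  · refine h'.congr (Eventually.of_forall fun x => ?_)
    have h0 : (((1 + ‖(2 * Real.pi) • x‖) ^ N : ℝ) : ℂ) ≠ 0 := by
      have : (0 : ℝ) < (1 + ‖(2 * Real.pi) • x‖) ^ N := by positivity
      exact_mod_cast this.ne'
    simp only [Complex.real_smul, Complex.ofReal_inv, Complex.ofReal_mul]
    field_simp
  · refine Continuous.aestronglyMeasurable ?_
    refine Complex.continuous_ofReal.comp ?_
    refine Continuous.mul (by fun_prop) (Continuous.inv₀ (by fun_prop) fun x => ?_)
    positivity
  · rw [Complex.norm_real, Real.norm_of_nonneg (by positivity), ← div_eq_mul_inv,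
      div_le_iff₀ (by positivity), ← mul_pow]
    refine pow_le_pow_left₀ (by positivity) ?_ N
    rw [norm_smul, Real.norm_of_nonneg (by positivity)]
    nlinarith [norm_nonneg x]

theorem finv_apply {g : E3 → ℂ} (hg : IsTempered g) (φ : 𝓢(E3, ℂ)) :
    finv g φ = ∫ ξ, g ξ * ((((2 * Real.pi) ^ (-(3 / 2) : ℝ) : ℝ) : ℂ) *
      ∫ x, Complex.exp (Complex.I * ((inner ℝ ξ x : ℝ) : ℂ)) * φ x) := by
  have hpi : (0 : ℝ) < 2 * Real.pi := by positivity
  have hA : finv g φ = (((2 * Real.pi) ^ (3 / 2 : ℝ) : ℝ) : ℂ) *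
      ∫ η : E3, g ((2 * Real.pi) • η) * (𝓕⁻ φ) η := by
    rw [← ofFun_apply hg.comp_smul]
    rfl
  have hB : ∀ η : E3, (𝓕⁻ φ) η =
      ∫ x, Complex.exp (Complex.I * ((inner ℝ ((2 * Real.pi) • η) x : ℝ) : ℂ)) * φ x := by
    intro η
    rw [SchwartzMap.fourierInv_coe, Real.fourierInv_eq']
    refine integral_congr_ae (Eventually.of_forall fun x => ?_)
    simp only [smul_eq_mul]
    congr 2
    rw [inner_smul_left, real_inner_comm]
    simp
    ring
  rw [hA]
  simp_rw [hB]
  have hC := Measure.integral_comp_smul (μ := (volume : Measure E3))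
    (fun ξ : E3 => g ξ * ∫ x, Complex.exp (Complex.I * ((inner ℝ ξ x : ℝ) : ℂ)) * φ x)
    (2 * Real.pi)
  rw [hC, finrank_euclideanSpace_fin, abs_of_nonneg (by positivity), Complex.real_smul,
    ← mul_assoc, ← Complex.ofReal_mul, ← integral_const_mul]
  refine integral_congr_ae (Eventually.of_forall fun x => ?_)
  have hr : (2 * Real.pi) ^ (3 / 2 : ℝ) * ((2 * Real.pi) ^ 3)⁻¹ =
      (2 * Real.pi) ^ (-(3 / 2) : ℝ) := by
    rw [← Real.rpow_natCast, ← Real.rpow_neg hpi.le, ← Real.rpow_add hpi]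
    norm_num
  dsimp only
  rw [hr]
  ring

/-! ### Sobolev norms on open sets -/

/-- The open ball `B_R`. -/
def B (R : ℝ) : Set E3 := Metric.ball 0 R

/-- On the open set `D` the distribution `T` is the locally integrable function `g`. -/
def RepresentedOn (T : 𝓢'(E3, ℂ)) (D : Set E3) (g : E3 → ℂ) : Prop :=
  LocallyIntegrableOn g D ∧
    ∀ φ : 𝓢(E3, ℂ), HasCompactSupport φ → tsupport φ ⊆ D → T φ = ∫ x, g x * φ x

/-- Two distributions agree on the open set `D`. -/
def EqOnOpen (D : Set E3) (S T : 𝓢'(E3, ℂ)) : Prop :=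
  ∀ φ : 𝓢(E3, ℂ), HasCompactSupport φ → tsupport φ ⊆ D → S φ = T φ

/-- `‖T‖_{L^p(D)}`: the `L^p(D)` norm of the function that represents `T` on `D`; it is `⊤`
if there is none. -/
def lpNorm (p : ℝ≥0∞) (D : Set E3) (T : 𝓢'(E3, ℂ)) : ℝ≥0∞ :=
  ⨅ (g : E3 → ℂ) (_ : RepresentedOn T D g), eLpNorm g p (volume.restrict D)

/-- The distributional partial derivative `∂_{x_j}`. -/
def pd (j : Fin 3) (T : 𝓢'(E3, ℂ)) : 𝓢'(E3, ℂ) :=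
  ∂_{(EuclideanSpace.single j 1 : E3)} T

/-- The derivative `∂_x^α` of a multi-index. -/
def mpd (α : Fin 3 → ℕ) (T : 𝓢'(E3, ℂ)) : 𝓢'(E3, ℂ) :=
  (pd 0)^[α 0] ((pd 1)^[α 1] ((pd 2)^[α 2] T))

/-- `‖T‖_{W^{m,p}(D)} = ∑_{|α| ≤ m} ‖∂_x^α T‖_{L^p(D)}`; it is finite if and only if the
restriction of `T` to `D` belongs to `W^{m,p}(D)`. -/
def sobNorm (m : ℕ) (p : ℝ≥0∞) (D : Set E3) (T : 𝓢'(E3, ℂ)) : ℝ≥0∞ :=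
  ∑ k ∈ Finset.range (m + 1), ∑ α ∈ Finset.piAntidiag (Finset.univ : Finset (Fin 3)) k,
    lpNorm p D (mpd α T)

/-- `‖∇T‖_{W^{m,p}(D)}`. -/
def gradNorm (m : ℕ) (p : ℝ≥0∞) (D : Set E3) (T : 𝓢'(E3, ℂ)) : ℝ≥0∞ :=
  ∑ j, sobNorm m p D (pd j T)

/-! ### The spaces of the resolvent problem -/

/-- Triples `(f₁, f₂, f₃)` of a scalar, a vector and a matrix function. -/
abbrev Data : Type := (E3 → ℂ) × (Fin 3 → E3 → ℂ) × (Fin 3 → Fin 3 → E3 → ℂ)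

/-- Triples `(φ, w, G)` of a scalar, a vector and a matrix distribution. -/
abbrev State : Type :=
  𝓢'(E3, ℂ) × (Fin 3 → 𝓢'(E3, ℂ)) × (Fin 3 → Fin 3 → 𝓢'(E3, ℂ))

/-- `∇φ + div ᵀG = 0` on `D`. -/
def DivConstraint (D : Set E3) (φ : 𝓢'(E3, ℂ)) (G : Fin 3 → Fin 3 → 𝓢'(E3, ℂ)) : Prop :=
  ∀ j, EqOnOpen D (pd j φ + ∑ k, pd k (G k j)) 0

/-- `G = ∇ψ` on `D`, that is `G^{jk} = ∂_{x_k} ψ^j`. -/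
def IsGradOn (D : Set E3) (G : Fin 3 → Fin 3 → 𝓢'(E3, ℂ)) (ψ : Fin 3 → 𝓢'(E3, ℂ)) : Prop :=
  ∀ j k, EqOnOpen D (G j k) (pd k (ψ j))

/-- `G ∈ ∇ W^{2,p}(D)³`. -/
def GradConstraint (p : ℝ≥0∞) (D : Set E3) (G : Fin 3 → Fin 3 → 𝓢'(E3, ℂ)) : Prop :=
  ∃ ψ : Fin 3 → 𝓢'(E3, ℂ), (∀ j, sobNorm 2 p D (ψ j) < ⊤) ∧ IsGradOn D G ψ

/-- The norm of `X^p(ℝ³)`. -/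
def xNorm (p : ℝ≥0∞) (f : Data) : ℝ≥0∞ :=
  sobNorm 1 p Set.univ (ofFun f.1) + ∑ j, eLpNorm (f.2.1 j) p volume +
    ∑ j, ∑ k, sobNorm 1 p Set.univ (ofFun (f.2.2 j k))

/-- The space `X_R^p(ℝ³)` of constrained data that vanish outside `B_R`. -/
def XR (p : ℝ≥0∞) (R : ℝ) : Set Data :=
  {f | (MemLp f.1 p ∧ sobNorm 1 p Set.univ (ofFun f.1) < ⊤) ∧
    (∀ j, MemLp (f.2.1 j) p) ∧
    (∀ j k, MemLp (f.2.2 j k) p ∧ sobNorm 1 p Set.univ (ofFun (f.2.2 j k)) < ⊤) ∧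
    DivConstraint Set.univ (ofFun f.1) (fun j k => ofFun (f.2.2 j k)) ∧
    GradConstraint p Set.univ (fun j k => ofFun (f.2.2 j k)) ∧
    ∀ᵐ x : E3, x ∉ B R →
      f.1 x = 0 ∧ (∀ j, f.2.1 j x = 0) ∧ ∀ j k, f.2.2 j k x = 0}

/-- The norm of `Y^p(D)`. -/
def yNorm (p : ℝ≥0∞) (D : Set E3) (u : State) : ℝ≥0∞ :=
  sobNorm 1 p D u.1 + ∑ j, sobNorm 2 p D (u.2.1 j) + ∑ j, ∑ k, sobNorm 1 p D (u.2.2 j k)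

/-- The restriction of `u` to `D` belongs to
`W^{1,p}(D) × W^{2,p}(D)³ × W^{1,p}(D)^{3×3}` and satisfies `∇φ + div ᵀG = 0` and
`G ∈ ∇ W^{2,p}(D)³` there (no boundary condition). -/
def MemY (p : ℝ≥0∞) (D : Set E3) (u : State) : Prop :=
  yNorm p D u < ⊤ ∧ DivConstraint D u.1 u.2.2 ∧ GradConstraint p D u.2.2

/-! ### The resolvent operators -/

/-- The coefficients of the system; `γ² = P'(1)`. -/
structure Coeffs where
  ν : ℝ
  ν' : ℝ
  β : ℝ
  γ : ℝ
  ν_pos : 0 < ν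
  ν'_cond : 0 ≤ 2 * ν + 3 * ν'
  β_pos : 0 < β
  γ_pos : 0 < γ

namespace Coeffs

variable (c : Coeffs)

/-- `ν̃ = ν + ν'`. -/
def νt : ℝ := c.ν + c.ν'

/-- `κ₁(z) = νz + β²`. -/
def κ₁ (z : ℂ) : ℂ := c.ν * z + c.β ^ 2

/-- `κ₂(z) = (ν + ν̃)z + β² + γ²`. -/
def κ₂ (z : ℂ) : ℂ := (c.ν + c.νt) * z + c.β ^ 2 + c.γ ^ 2

end Coeffs

/-- `ξ` as a complex column vector. -/
def vec (ξ : E3) : Fin 3 → ℂ := fun j => (ξ j : ℂ)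

/-- `|ξ|²`. -/
def nsq (ξ : E3) : ℂ := ((‖ξ‖ ^ 2 : ℝ) : ℂ)

/-- The rank one matrix `ξ ᵀξ`. -/
def outer (ξ : E3) : Matrix (Fin 3) (Fin 3) ℂ := Matrix.vecMulVec (vec ξ) (vec ξ)

/-- `P̂_c(ξ) = ξ ᵀξ / |ξ|²`. -/
def Pc (ξ : E3) : Matrix (Fin 3) (Fin 3) ℂ := (nsq ξ)⁻¹ • outer ξ

/-- `P̂_s(ξ) = I - ξ ᵀξ / |ξ|²`. -/
def Ps (ξ : E3) : Matrix (Fin 3) (Fin 3) ℂ := 1 - Pc ξ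

/-- `f̂₁(ξ)`. -/
def hat1 (f : Data) (ξ : E3) : ℂ := fhat f.1 ξ

/-- `f̂₂(ξ)`. -/
def hat2 (f : Data) (ξ : E3) : Fin 3 → ℂ := fun j => fhat (f.2.1 j) ξ

/-- `f̂₃(ξ)`. -/
def hat3 (f : Data) (ξ : E3) : Matrix (Fin 3) (Fin 3) ℂ := fun j k => fhat (f.2.2 j k) ξ

section Resolvent

variable (c : Coeffs) (z : ℂ) (f : Data)

/-- `z² + κ₁(z)|ξ|²`. -/
def den₁ (ξ : E3) : ℂ := z ^ 2 + c.κ₁ z * nsq ξ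

/-- `z² + κ₂(z)|ξ|²`. -/
def den₂ (ξ : E3) : ℂ := z ^ 2 + c.κ₂ z * nsq ξ

/-- `(z² + κ₁(z)|ξ|²)⁻¹ P̂_s(ξ) + (z² + κ₂(z)|ξ|²)⁻¹ P̂_c(ξ)`. -/
def symL (ξ : E3) : Matrix (Fin 3) (Fin 3) ℂ :=
  (den₁ c z ξ)⁻¹ • Ps ξ + (den₂ c z ξ)⁻¹ • Pc ξ

/-- `(z + ν|ξ|²)/(z² + κ₁(z)|ξ|²) P̂_s(ξ) + (z + (ν + ν̃)|ξ|²)/(z² + κ₂(z)|ξ|²) P̂_c(ξ)`. -/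
def symH (ξ : E3) : Matrix (Fin 3) (Fin 3) ℂ :=
  ((z + c.ν * nsq ξ) / den₁ c z ξ) • Ps ξ +
    ((z + (c.ν + c.νt) * nsq ξ) / den₂ c z ξ) • Pc ξ

/-- The term `R̄₁(z)f` of the density. -/
def Rbar₁ : 𝓢'(E3, ℂ) :=
  -(((c.β : ℂ) ^ 2 / z) • finv (fun ξ =>
    (hat1 f ξ * nsq ξ + vec ξ ⬝ᵥ (Matrix.mulVec (hat3 f ξ) (vec ξ))) / den₂ c z ξ))

/-- The term `R̄₃(z)f` of the deformation tensor. -/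
def Rbar₃ (j k : Fin 3) : 𝓢'(E3, ℂ) :=
  ((c.γ : ℂ) ^ 2 / z) • finv (fun ξ =>
      ((den₂ c z ξ)⁻¹ • (outer ξ * (hat1 f ξ • (1 : Matrix (Fin 3) (Fin 3) ℂ) + hat3 f ξ))) j k) +
    ((c.β : ℂ) ^ 2 / z) • finv (fun ξ => (nsq ξ • (symL c z ξ * hat3 f ξ * Ps ξ)) j k)

/-- The density `Φ(z)f`, `z ≠ 0`. -/
def Phi : 𝓢'(E3, ℂ) :=
  finv (fun ξ => (z + (c.ν + c.νt) * nsq ξ) / den₂ c z ξ * hat1 f ξ) -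
    Complex.I • finv (fun ξ => (vec ξ ⬝ᵥ hat2 f ξ) / den₂ c z ξ) + Rbar₁ c z f

/-- The velocity `W(z)f`, `z ≠ 0`. -/
def Wvel (j : Fin 3) : 𝓢'(E3, ℂ) :=
  -((Complex.I * (c.γ : ℂ) ^ 2) • finv (fun ξ => hat1 f ξ / den₂ c z ξ * vec ξ j)) +
    finv (fun ξ => Matrix.mulVec (z • symL c z ξ) (hat2 f ξ) j) +
    (Complex.I * (c.β : ℂ) ^ 2) •
      finv (fun ξ => Matrix.mulVec (symL c z ξ * hat3 f ξ) (vec ξ) j)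

/-- The deformation tensor `G(z)f`, `z ≠ 0`. -/
def Gdef (j k : Fin 3) : 𝓢'(E3, ℂ) :=
  Complex.I • finv (fun ξ =>
      Matrix.vecMulVec (Matrix.mulVec (symL c z ξ) (hat2 f ξ)) (vec ξ) j k) +
    finv (fun ξ => (symH c z ξ * hat3 f ξ) j k) + Rbar₃ c z f j k

/-- The resolvent operator `R(z)f = (Φ(z)f, W(z)f, G(z)f)` of the whole space, `z ≠ 0`. -/
def resolv : State := (Phi c z f, Wvel c z f, Gdef c z f)

/-- The potential `Ψ(z)f`, `z ≠ 0`. -/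
def Psi (j : Fin 3) : 𝓢'(E3, ℂ) :=
  finv (fun ξ => Matrix.mulVec (symL c z ξ) (hat2 f ξ) j) -
    Complex.I • finv (fun ξ =>
      Matrix.mulVec (symH c z ξ * hat3 f ξ) ((nsq ξ)⁻¹ • vec ξ) j)

/-- The density `Φ(0)f`. -/
def Phi0 : 𝓢'(E3, ℂ) :=
  (((c.ν + c.νt) / (c.β ^ 2 + c.γ ^ 2) : ℝ) : ℂ) • ofFun f.1 -
    (Complex.I / ((c.β ^ 2 + c.γ ^ 2 : ℝ) : ℂ)) •
      finv (fun ξ => (vec ξ ⬝ᵥ hat2 f ξ) / nsq ξ)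

/-- The velocity `W(0)f`. -/
def Wvel0 (j : Fin 3) : 𝓢'(E3, ℂ) :=
  -((Complex.I * ((c.γ ^ 2 / (c.β ^ 2 + c.γ ^ 2) : ℝ) : ℂ)) •
      finv (fun ξ => hat1 f ξ / nsq ξ * vec ξ j)) +
    Complex.I • finv (fun ξ =>
      Matrix.mulVec (Ps ξ * hat3 f ξ) ((nsq ξ)⁻¹ • vec ξ) j) +
    (Complex.I * ((c.β ^ 2 / (c.β ^ 2 + c.γ ^ 2) : ℝ) : ℂ)) •
      finv (fun ξ => Matrix.mulVec (Pc ξ * hat3 f ξ) ((nsq ξ)⁻¹ • vec ξ) j)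

/-- The deformation tensor `G(0)f`. -/
def Gdef0 (j k : Fin 3) : 𝓢'(E3, ℂ) :=
  (Complex.I / (c.β : ℂ) ^ 2) • finv (fun ξ =>
      Matrix.vecMulVec (Matrix.mulVec (Ps ξ) (hat2 f ξ)) ((nsq ξ)⁻¹ • vec ξ) j k) +
    (Complex.I / ((c.β ^ 2 + c.γ ^ 2 : ℝ) : ℂ)) • finv (fun ξ =>
      Matrix.vecMulVec (Matrix.mulVec (Pc ξ) (hat2 f ξ)) ((nsq ξ)⁻¹ • vec ξ) j k) +
    ((c.ν / c.β ^ 2 : ℝ) : ℂ) • finv (fun ξ => (Ps ξ * hat3 f ξ) j k) +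
    (((c.ν + c.νt) / (c.β ^ 2 + c.γ ^ 2) : ℝ) : ℂ) • finv (fun ξ => (Pc ξ * hat3 f ξ) j k)

/-- The zero-resolvent operator `R(0)f = (Φ(0)f, W(0)f, G(0)f)` of the whole space. -/
def resolv0 : State := (Phi0 c f, Wvel0 c f, Gdef0 c f)

/-- The potential `Ψ(0)f`. -/
def Psi0 (j : Fin 3) : 𝓢'(E3, ℂ) :=
  ((1 / c.β ^ 2 : ℝ) : ℂ) • finv (fun ξ =>
      (nsq ξ)⁻¹ * Matrix.mulVec (Ps ξ) (hat2 f ξ) j) +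
    ((1 / (c.β ^ 2 + c.γ ^ 2) : ℝ) : ℂ) • finv (fun ξ =>
      (nsq ξ)⁻¹ * Matrix.mulVec (Pc ξ) (hat2 f ξ) j) -
    (Complex.I * ((c.ν / c.β ^ 2 : ℝ) : ℂ)) • finv (fun ξ =>
      Matrix.mulVec (Ps ξ * hat3 f ξ) ((nsq ξ)⁻¹ • vec ξ) j) -
    (Complex.I * (((c.ν + c.νt) / (c.β ^ 2 + c.γ ^ 2) : ℝ) : ℂ)) • finv (fun ξ =>
      Matrix.mulVec (Pc ξ * hat3 f ξ) ((nsq ξ)⁻¹ • vec ξ) j)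

end Resolvent

end Viscoelastic

end

open Viscoelastic

noncomputable section

namespace Viscoelastic

/-! ### Weighted averages in `L^p` -/

/-! The constraints on the data are what make `λ = 0` harmless. In Fourier variables they say that
`ξᵀ f̂₃ = -f̂₁ ξᵀ` and that every row of `f̂₃` is a multiple of `ξᵀ` (`exists_datum`). Hence `P̂_c
f̂₃` equals `-f̂₁ P̂_c` (`Constrained.Pc_hat3`), the terms carrying a factor `1/λ` vanish
identically (`Constrained.Phi_eq`, `Constrained.Rbar₃_eq_zero`), the deformation tensor is the
gradient of the potential (`Constrained.Gdef_eq`, `Constrained.Gdef0_eq`), and the density is minus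
the divergence of the potential (`Constrained.phiForm_add_div`), which gives the divergence
constraint.

What remains are scalar multipliers built from two modes with `d = κ(|ξ|² + μ²)` and `μ = λ/√κ`.
Writing `1/d = κ⁻¹ (|ξ|⁻² - μ² |ξ|⁻² (|ξ|² + μ²)⁻¹)` separates the operator at `λ = 0`, up to the
factor `κ⁻¹`, from a perturbation, and the other symbols split in the same manner.

Symbols of negative order have explicit kernels, obtained from the Yukawa kernel (`fhat_yukawa`) by
partial fractions, differentiation and the limit `μ → 0` (`hasKernel_symN`, `hasKernel_symU`,
`hasKernel_symQ`, `hasKernel_symW`). Local `L^p` bounds are Young's inequality on a ball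
(`HasKernel.lpNorm_op_le`), and the pointwise decay comes from the size `|x|⁻¹` or `|x|⁻²` of the
kernel away from the support (`HasKernel.suppBdd_decayRel`).

Top order derivatives at `λ = 0` lead to symbols of order zero, which are products of two or four
Riesz symbols `ξ_j/|ξ|`. Their `L^p` bounds are proved from scratch. M. Riesz's complex-analytic
argument bounds the Cauchy transform on the line for `1 < p ≤ 2` (`exists_eLpNorm_cauchyInt_le`).
Applied on all lines in a fixed direction, it bounds the multiplier with the indicator of a half
space (`exists_lpBdd_halfSpace_mul`). Averaging half spaces produces the Riesz symbols
(`exists_lpBdd_riesz_mul`), and duality covers `p ≥ 2` (`LpBdd.dual`).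

For the limit `λ → 0`, the parameter `μ` stays in the open right half plane even when `λ` is
imaginary (`re_div_sqrt_pos`). The perturbations are bounded on balls uniformly for `0 < Re μ`, `|μ|
≤ 1`, after normalisation by a power of `μ`, and they enter with coefficients that tend to zero
(`Vanishes.of_two`). -/

theorem lintegral_mul_rpow_le {α : Type*} [MeasurableSpace α] {μ : Measure α} {p : ℝ}
    (hp : 1 ≤ p) {w h : α → ℝ≥0∞} (hw : AEMeasurable w μ) (hh : AEMeasurable h μ) :
    (∫⁻ a, w a * h a ∂μ) ^ p ≤ (∫⁻ a, w a ∂μ) ^ (p - 1) * ∫⁻ a, w a * h a ^ p ∂μ := by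
  rcases hp.eq_or_lt with rfl | hp
  · simp
  have hpq := Real.HolderConjugate.conjExponent hp
  set q := Real.conjExponent p
  have hp0 : 0 < p := by linarith
  have hq0 : 0 < q := hpq.symm.pos
  -- Hölder for the splitting `w h = w^(1/q) · (w^(1/p) h)`.
  have key := ENNReal.lintegral_mul_le_Lp_mul_Lq μ hpq.symm (f := fun a => w a ^ (1 / q))
    (g := fun a => w a ^ (1 / p) * h a) (hw.pow_const _) ((hw.pow_const _).mul hh)
  have e1 : ∀ a, ((fun a => w a ^ (1 / q)) * fun a => w a ^ (1 / p) * h a) a = w a * h a := by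
    intro a
    simp only [Pi.mul_apply]
    rw [← mul_assoc, ← ENNReal.rpow_add_of_nonneg _ _ (by positivity) (by positivity)]
    have : 1 / q + 1 / p = 1 := by
      have := hpq.symm.inv_add_inv_eq_one
      simpa [one_div] using this
    rw [this, ENNReal.rpow_one]
  simp only [e1] at key
  have e2 : ∀ a, (w a ^ (1 / q)) ^ q = w a := by
    intro a
    rw [← ENNReal.rpow_mul, one_div, inv_mul_cancel₀ hq0.ne', ENNReal.rpow_one]
  have e3 : ∀ a, (w a ^ (1 / p) * h a) ^ p = w a * h a ^ p := by
    intro a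
    rw [ENNReal.mul_rpow_of_nonneg _ _ hp0.le, ← ENNReal.rpow_mul, one_div,
      inv_mul_cancel₀ hp0.ne', ENNReal.rpow_one]
  simp only [e2, e3] at key
  calc (∫⁻ a, w a * h a ∂μ) ^ p
      ≤ ((∫⁻ a, w a ∂μ) ^ (1 / q) * (∫⁻ a, w a * h a ^ p ∂μ) ^ (1 / p)) ^ p := by
        gcongr
    _ = _ := by
        rw [ENNReal.mul_rpow_of_nonneg _ _ hp0.le, ← ENNReal.rpow_mul, ← ENNReal.rpow_mul,
          one_div_mul_cancel hp0.ne', ENNReal.rpow_one]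
        congr 2
        have := hpq.inv_add_inv_eq_one
        field_simp at this ⊢
        linarith

/-- Minkowski's inequality for a weighted superposition: Hölder against the weight for each `a`,
then Tonelli. It serves the Poisson integral, averages of multipliers, and convolution with a
locally integrable kernel. -/
theorem lintegral_lintegral_mul_rpow_le {α β : Type*} [MeasurableSpace α] [MeasurableSpace β]
    {μ : Measure α} {ν : Measure β} [SFinite μ] [SFinite ν] {p : ℝ}
    (hp : 1 ≤ p) {w : β → ℝ≥0∞} {h : α → β → ℝ≥0∞} (hw : AEMeasurable w ν)
    (hh : AEMeasurable (Function.uncurry h) (μ.prod ν)) {M : ℝ≥0∞}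
    (hM : ∀ᵐ b ∂ν, ∫⁻ a, h a b ^ p ∂μ ≤ M) :
    ∫⁻ a, (∫⁻ b, w b * h a b ∂ν) ^ p ∂μ ≤ (∫⁻ b, w b ∂ν) ^ p * M := by
  have hae : ∀ᵐ a ∂μ, AEMeasurable (h a) ν := by
    filter_upwards [hh.aestronglyMeasurable.prodMk_left] with a ha using ha.aemeasurable
  have hp0 : 0 < p := by linarith
  calc ∫⁻ a, (∫⁻ b, w b * h a b ∂ν) ^ p ∂μ
      ≤ ∫⁻ a, (∫⁻ b, w b ∂ν) ^ (p - 1) * ∫⁻ b, w b * h a b ^ p ∂ν ∂μ := by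
        refine lintegral_mono_ae ?_
        filter_upwards [hae] with a ha
        exact lintegral_mul_rpow_le hp hw ha
    _ = (∫⁻ b, w b ∂ν) ^ (p - 1) * ∫⁻ a, ∫⁻ b, w b * h a b ^ p ∂ν ∂μ := by
        rw [lintegral_const_mul'']
        exact AEMeasurable.lintegral_prod_right
          ((hw.comp_snd).mul (hh.pow_const p))
    _ = (∫⁻ b, w b ∂ν) ^ (p - 1) * ∫⁻ b, ∫⁻ a, w b * h a b ^ p ∂μ ∂ν := by
        rw [lintegral_lintegral_swap]
        exact ((hw.comp_snd).mul (hh.pow_const p))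
    _ ≤ (∫⁻ b, w b ∂ν) ^ (p - 1) * ∫⁻ b, w b * M ∂ν := by
        refine mul_le_mul_right (lintegral_mono_ae ?_) _
        have h2 : ∀ᵐ b ∂ν, AEMeasurable (fun a => h a b) μ := by
          filter_upwards [hh.prod_swap.aestronglyMeasurable.prodMk_left] with b hb
            using hb.aemeasurable
        filter_upwards [hM, h2] with b hb h2b
        rw [lintegral_const_mul'' _ (h2b.pow_const p)]
        gcongr
    _ = (∫⁻ b, w b ∂ν) ^ p * M := by
        rw [lintegral_mul_const'' _ hw, ← mul_assoc]
        congr 1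
        conv_lhs => rw [← ENNReal.rpow_one (∫⁻ b, w b ∂ν), ← ENNReal.rpow_mul,
          ← ENNReal.rpow_add_of_nonneg _ _ (by linarith) zero_le_one]
        congr 1; ring

/-! ### The Cauchy transform on the line -/

/-- Write `z = |z| e^(iθ)` with `|θ| < π/2`, so that `Re z^p = |z|^p cos pθ`. For small `|θ|` the
power of `Re z` dominates. Near `±π/2` the cosine of `pθ` is negative and bounded away from zero,
which uses `p > 1` and, through `p|θ| ≤ π`, also `p ≤ 2`. -/
theorem exists_norm_rpow_le {p : ℝ} (hp1 : 1 < p) (hp2 : p ≤ 2) :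
    ∃ A B : ℝ, 0 ≤ A ∧ 0 ≤ B ∧ ∀ z : ℂ, 0 < z.re →
      ‖z‖ ^ p ≤ A * z.re ^ p - B * (z ^ (p : ℂ)).re := by
  -- Chosen so that `p θ₀` is the midpoint of `π/2` and `pπ/2`: then `θ₀ < π/2` while `cos (p θ₀) <
  -- 0`.
  set θ₀ : ℝ := (Real.pi / 4 + p * Real.pi / 4) / p with hθ₀
  have hp0 : 0 < p := by linarith
  have hpi := Real.pi_pos
  have hpθ : p * θ₀ = Real.pi / 4 + p * Real.pi / 4 := by rw [hθ₀]; field_simp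
  have hθpos : 0 < θ₀ := by positivity
  have hθlt : θ₀ < Real.pi / 2 := by
    rw [hθ₀, div_lt_iff₀ hp0]; nlinarith
  have hcos : Real.cos (p * θ₀) < 0 := by
    apply Real.cos_neg_of_pi_div_two_lt_of_lt <;> rw [hpθ] <;> nlinarith
  have hcos0 : 0 < Real.cos θ₀ := Real.cos_pos_of_mem_Ioo ⟨by linarith, hθlt⟩
  set B : ℝ := 1 / (-Real.cos (p * θ₀)) with hB
  have hBpos : 0 < B := by rw [hB]; apply one_div_pos.2; linarith
  set A : ℝ := (1 + B) / Real.cos θ₀ ^ p with hA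
  have hApos : 0 < A := by positivity
  refine ⟨A, B, hApos.le, hBpos.le, fun z hz => ?_⟩
  have hz0 : z ≠ 0 := by rintro rfl; simp at hz
  have hnz : 0 < ‖z‖ := norm_pos_iff.2 hz0
  have hre : z.re = ‖z‖ * Real.cos z.arg := (Complex.norm_mul_cos_arg z).symm
  have harg : |z.arg| < Real.pi / 2 := Complex.abs_arg_lt_pi_div_two_iff.2 (Or.inl hz)
  have hcosz : 0 < Real.cos z.arg := Real.cos_pos_of_mem_Ioo (abs_lt.1 harg)
  have hpw : (z ^ (p : ℂ)).re = ‖z‖ ^ p * Real.cos (p * |z.arg|) := by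
    rw [Complex.cpow_ofReal_re, mul_comm z.arg p]
    congr 1
    rw [← Real.cos_abs, abs_mul, abs_of_pos hp0]
  rw [hpw, hre, Real.mul_rpow hnz.le hcosz.le]
  have main : 1 ≤ A * Real.cos z.arg ^ p - B * Real.cos (p * |z.arg|) := by
    rw [← Real.cos_abs z.arg] at hcosz ⊢
    rcases le_total |z.arg| θ₀ with h | h
    · have h1 : Real.cos θ₀ ≤ Real.cos |z.arg| :=
        Real.cos_le_cos_of_nonneg_of_le_pi (abs_nonneg _) (by linarith) h
      have h2 : Real.cos θ₀ ^ p ≤ Real.cos |z.arg| ^ p :=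
        Real.rpow_le_rpow hcos0.le h1 hp0.le
      have h3 : 1 + B ≤ A * Real.cos |z.arg| ^ p := by
        calc 1 + B = A * Real.cos θ₀ ^ p := by
              rw [hA, div_mul_cancel₀]; positivity
          _ ≤ _ := by gcongr
      have h4 : Real.cos (p * |z.arg|) ≤ 1 := Real.cos_le_one _
      nlinarith
    · have h1 : Real.cos (p * |z.arg|) ≤ Real.cos (p * θ₀) := by
        apply Real.cos_le_cos_of_nonneg_of_le_pi (by positivity)
        · nlinarith
        · gcongr
      have h2 : 0 ≤ A * Real.cos |z.arg| ^ p := by positivity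
      have h3 : B * Real.cos (p * θ₀) = -1 := by
        rw [hB, one_div_neg_eq_neg_one_div, neg_mul, one_div_mul_cancel hcos.ne]
      nlinarith
  have : 0 ≤ ‖z‖ ^ p := by positivity
  nlinarith

/-- `∫ h(t) / (w - 2πit) dt`. -/
def cauchyInt (h : ℝ → ℂ) (w : ℂ) : ℂ := ∫ t, h t / (w - 2 * Real.pi * t * Complex.I)

theorem norm_cauchyInt_den (w : ℂ) (t : ℝ) :
    w.re ≤ ‖w - 2 * Real.pi * t * Complex.I‖ := by
  refine le_trans (le_of_eq ?_) ((le_abs_self _).trans (Complex.abs_re_le_norm _))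
  simp

theorem cauchyInt_den_ne {w : ℂ} (hw : 0 < w.re) (t : ℝ) :
    w - 2 * Real.pi * t * Complex.I ≠ 0 :=
  norm_pos_iff.1 (hw.trans_le (norm_cauchyInt_den w t))

theorem integrable_cauchyInt {h : ℝ → ℂ} (hh : Integrable h) {w : ℂ} (hw : 0 < w.re) :
    Integrable (fun t : ℝ => h t / (w - 2 * Real.pi * t * Complex.I)) := by
  simp_rw [div_eq_mul_inv]
  refine hh.mul_bdd (c := w.re⁻¹) (Continuous.aestronglyMeasurable ?_)
    (Eventually.of_forall fun t => ?_)
  · exact Continuous.inv₀ (by fun_prop) (cauchyInt_den_ne hw)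
  · rw [norm_inv]
    exact inv_anti₀ hw (norm_cauchyInt_den w t)

theorem differentiableAt_cauchyInt {h : ℝ → ℂ} (hh : Integrable h) {w : ℂ} (hw : 0 < w.re) :
    DifferentiableAt ℂ (cauchyInt h) w := by
  have hs : {z : ℂ | w.re / 2 < z.re} ∈ 𝓝 w :=
    (isOpen_lt continuous_const Complex.continuous_re).mem_nhds (by simp; linarith)
  have hpos : ∀ z ∈ {z : ℂ | w.re / 2 < z.re}, 0 < z.re := fun z hz => by
    have : w.re / 2 < z.re := hz
    linarith
  have := hasDerivAt_integral_of_dominated_loc_of_deriv_le (𝕜 := ℂ) (μ := (volume : Measure ℝ))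
    (F := fun (z : ℂ) (t : ℝ) => h t / (z - 2 * Real.pi * t * Complex.I))
    (F' := fun (z : ℂ) (t : ℝ) => h t * (-(z - 2 * Real.pi * t * Complex.I)⁻¹ ^ 2))
    (bound := fun t => ‖h t‖ * ((w.re / 2)⁻¹ ^ 2)) (x₀ := w) hs ?_ ?_ ?_ ?_ ?_ ?_
  · exact this.2.differentiableAt
  · filter_upwards [hs] with z hz
    exact (integrable_cauchyInt hh (hpos z hz)).aestronglyMeasurable
  · exact integrable_cauchyInt hh hw
  · refine hh.aestronglyMeasurable.mul (Continuous.aestronglyMeasurable ?_)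
    exact ((Continuous.inv₀ (by fun_prop) (cauchyInt_den_ne hw)).pow 2).neg
  · refine Eventually.of_forall fun t z hz => ?_
    rw [norm_mul, norm_neg, norm_pow, norm_inv]
    gcongr
    exact (le_of_lt hz).trans (norm_cauchyInt_den _ t)
  · exact hh.norm.mul_const _
  · refine Eventually.of_forall fun t z hz => ?_
    have h1 := ((hasDerivAt_id z).sub_const (2 * Real.pi * t * Complex.I : ℂ)).inv
      (cauchyInt_den_ne (hpos z hz) t)
    have h2 := h1.const_mul (h t)
    refine (h2.congr_deriv ?_).congr_of_eventuallyEq ?_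
    · simp [div_eq_mul_inv]
    · exact Eventually.of_forall fun y => by simp [div_eq_mul_inv]

/-- The real part is a Poisson integral. For nonnegative `h` this gives positivity, so that powers
of the transform are holomorphic, and its `L^p` norm is controlled by Minkowski's inequality alone.
-/
theorem cauchyInt_re {h : ℝ → ℝ} (hh : Integrable h) {w : ℂ} (hw : 0 < w.re) :
    (cauchyInt (fun t => (h t : ℂ)) w).re =
      ∫ t, h t * (w.re / (w.re ^ 2 + (w.im - 2 * Real.pi * t) ^ 2)) := by
  have := integral_re (𝕜 := ℂ) (integrable_cauchyInt hh.ofReal hw)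
  rw [cauchyInt]
  refine (this.symm.trans ?_)
  refine integral_congr_ae (Eventually.of_forall fun t => ?_)
  simp [Complex.div_re, Complex.normSq_apply]
  field_simp

theorem norm_cauchyInt_le {h : ℝ → ℂ} (hh : Integrable h) {w : ℂ} (hw : 0 < w.re) :
    ‖cauchyInt h w‖ ≤ (∫ t, ‖h t‖) / w.re := by
  rw [div_eq_mul_inv, ← integral_mul_const]
  refine (norm_integral_le_integral_norm _).trans ?_
  refine integral_mono_of_nonneg (Eventually.of_forall fun t => norm_nonneg _)
    (hh.norm.mul_const _) (Eventually.of_forall fun t => ?_)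
  dsimp only
  rw [norm_div, div_eq_mul_inv]
  gcongr
  exact norm_cauchyInt_den w t

/-- On the support `|2πt| ≤ |w|/2`, so the denominator is at least `|w|/2`. This decay makes `p`-th
powers integrable on vertical lines and lets contours be pushed to infinity. -/
theorem norm_cauchyInt_le_of_support {h : ℝ → ℂ} (hh : Integrable h) {A : ℝ}
    (hA : ∀ t, A < |t| → h t = 0) {w : ℂ} (hw : 4 * Real.pi * A ≤ ‖w‖) (hw0 : w ≠ 0) :
    ‖cauchyInt h w‖ ≤ 2 * (∫ t, ‖h t‖) / ‖w‖ := by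
  have : 2 * (∫ t, ‖h t‖) / ‖w‖ = ∫ t, ‖h t‖ * (2 / ‖w‖) := by
    rw [integral_mul_const]; ring
  rw [this]
  refine (norm_integral_le_integral_norm _).trans ?_
  refine integral_mono_of_nonneg (Eventually.of_forall fun t => norm_nonneg _)
    (hh.norm.mul_const _) (Eventually.of_forall fun t => ?_)
  have hw0' : 0 < ‖w‖ := norm_pos_iff.2 hw0
  by_cases ht : A < |t|
  · simp [hA t ht]
  · push Not at ht
    dsimp only
    rw [norm_div, div_eq_mul_inv]
    gcongr
    rw [← inv_div]
    apply inv_anti₀ (by positivity)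
    have h1 : ‖(2 * Real.pi * t * Complex.I : ℂ)‖ ≤ ‖w‖ / 2 := by
      have h0 : |Real.pi| = Real.pi := abs_of_pos Real.pi_pos
      simp only [norm_mul, Complex.norm_real, Complex.norm_I, Complex.norm_ofNat, Real.norm_eq_abs,
        h0]
      nlinarith [Real.pi_pos]
    have := norm_sub_norm_le w (2 * Real.pi * t * Complex.I : ℂ)
    linarith

theorem integrable_rpow_cauchyInt {h : ℝ → ℂ} (hh : Integrable h) {A : ℝ}
    (hA : ∀ t, A < |t| → h t = 0) {ε p : ℝ} (hε : 0 < ε) (hp : 1 < p) :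
    Integrable (fun y : ℝ => ‖cauchyInt h (ε + y * Complex.I)‖ ^ p) := by
  have hp0 : 0 < p := by linarith
  have hint : Integrable (fun y : ℝ => (1 + ‖y‖) ^ (-p)) := integrable_one_add_norm (by simpa)
  set H := ∫ t, ‖h t‖ with hH
  have hH0 : 0 ≤ H := integral_nonneg fun t => norm_nonneg _
  set L := max 1 (4 * Real.pi * A)
  have hL : 1 ≤ L := le_max_left _ _
  set c := H / ε * (1 + L) + 4 * H
  have hre : ∀ y : ℝ, (ε + y * Complex.I : ℂ).re = ε := by simp
  have hc : Continuous fun y : ℝ => cauchyInt h (ε + y * Complex.I) := by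
    rw [continuous_iff_continuousAt]
    intro y
    exact ContinuousAt.comp (g := cauchyInt h)
      (differentiableAt_cauchyInt hh (by simpa)).continuousAt
      (by fun_prop)
  have hb : ∀ y : ℝ, ‖cauchyInt h (ε + y * Complex.I)‖ ≤ c * (1 + ‖y‖)⁻¹ := by
    intro y
    rw [← div_eq_mul_inv, le_div_iff₀ (by positivity)]
    have hy0 : 0 ≤ ‖y‖ := norm_nonneg y
    rcases le_total ‖y‖ L with hy | hy
    · have := norm_cauchyInt_le hh (w := (ε + y * Complex.I : ℂ)) (by simpa)
      rw [hre] at this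
      calc _ ≤ H / ε * (1 + L) := by gcongr
        _ ≤ c := by simp only [c]; linarith
    · have hy2 : ‖y‖ ≤ ‖(ε + y * Complex.I : ℂ)‖ := by
        have := Complex.abs_im_le_norm (ε + y * Complex.I : ℂ)
        simpa using this
      have hn : 4 * Real.pi * A ≤ ‖(ε + y * Complex.I : ℂ)‖ :=
        (le_max_right _ _).trans (hy.trans hy2)
      have hpos : 0 < ‖(ε + y * Complex.I : ℂ)‖ := by linarith
      have := norm_cauchyInt_le_of_support hh hA hn (norm_pos_iff.1 hpos)
      calc _ ≤ 2 * H / ‖(ε + y * Complex.I : ℂ)‖ * (2 * ‖y‖) := by gcongr; linarith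
        _ ≤ 2 * H / ‖(ε + y * Complex.I : ℂ)‖ * (2 * ‖(ε + y * Complex.I : ℂ)‖) := by gcongr
        _ = 4 * H := by field_simp; ring
        _ ≤ c := by
          simp only [c]
          have : 0 ≤ H / ε * (1 + L) := by positivity
          linarith
  have hc0 : 0 ≤ c := by simp only [c]; positivity
  refine (hint.const_mul (c ^ p)).mono' ?_ (Eventually.of_forall fun y => ?_)
  · exact (hc.norm.rpow_const fun y => Or.inr hp0.le).aestronglyMeasurable
  · rw [Real.norm_of_nonneg (by positivity)]
    calc _ ≤ (c * (1 + ‖y‖)⁻¹) ^ p := by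
          gcongr; exact hb y
      _ = _ := by
        rw [Real.mul_rpow hc0 (by positivity), Real.inv_rpow (by positivity),
          Real.rpow_neg (by positivity)]

/-- Cauchy's theorem on the rectangle `[ε, M] × [-M, M]`: on the three far sides the integrand is
`O(M^(-p))` and the total length is `O(M)`, so their contribution is `O(M^(1-p))`. Positivity of the
real part keeps the transform in the domain of the principal power. -/
theorem integral_cpow_cauchyInt {h : ℝ → ℂ} (hh : Integrable h) {A : ℝ}
    (hA : ∀ t, A < |t| → h t = 0) (hre : ∀ w : ℂ, 0 < w.re → 0 < (cauchyInt h w).re)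
    {ε p : ℝ} (hε : 0 < ε) (hp : 1 < p) :
    Integrable (fun y : ℝ => cauchyInt h (ε + y * Complex.I) ^ (p : ℂ)) ∧
    ∫ y : ℝ, cauchyInt h (ε + y * Complex.I) ^ (p : ℂ) = 0 := by
  have hp0 : 0 < p := by linarith
  have hd : ∀ w : ℂ, 0 < w.re → DifferentiableAt ℂ (fun w => cauchyInt h w ^ (p : ℂ)) w :=
    fun w hw => (differentiableAt_cauchyInt hh hw).cpow_const (Or.inl (hre w hw))
  have hc : Continuous fun y : ℝ => cauchyInt h (ε + y * Complex.I) ^ (p : ℂ) := by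
    rw [continuous_iff_continuousAt]
    intro y
    exact ContinuousAt.comp (g := fun w => cauchyInt h w ^ (p : ℂ))
      (hd _ (by simpa)).continuousAt (by fun_prop)
  have hint : Integrable (fun y : ℝ => cauchyInt h (ε + y * Complex.I) ^ (p : ℂ)) := by
    refine (integrable_rpow_cauchyInt hh hA hε hp).mono' hc.aestronglyMeasurable
      (Eventually.of_forall fun y => ?_)
    rw [Complex.norm_cpow_real]
  refine ⟨hint, ?_⟩
  set H := ∫ t, ‖h t‖ with hH
  have hH0 : 0 ≤ H := integral_nonneg fun t => norm_nonneg _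
  have lim := intervalIntegral_tendsto_integral hint tendsto_neg_atTop_atBot tendsto_id
  refine tendsto_nhds_unique lim ?_
  have hbd : ∀ᶠ M : ℝ in atTop, ‖∫ y in (-M)..M, cauchyInt h (ε + y * Complex.I) ^ (p : ℂ)‖ ≤
      4 * (2 * H) ^ p * M ^ (-(p - 1)) := by
    filter_upwards [eventually_ge_atTop (max (max 1 ε) (4 * Real.pi * A))] with M hM
    have hM1 : 1 ≤ M := (le_max_left _ _).trans ((le_max_left _ _).trans hM)
    have hMε : ε ≤ M := (le_max_right _ _).trans ((le_max_left _ _).trans hM)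
    have hMA : 4 * Real.pi * A ≤ M := (le_max_right _ _).trans hM
    have hM0 : 0 < M := by linarith
    have hfar : ∀ w : ℂ, M ≤ ‖w‖ → ‖cauchyInt h w ^ (p : ℂ)‖ ≤ (2 * H / M) ^ p := by
      intro w hw
      rw [Complex.norm_cpow_real]
      have hw0 : w ≠ 0 := norm_pos_iff.1 (hM0.trans_le hw)
      have := norm_cauchyInt_le_of_support hh hA (hMA.trans hw) hw0
      gcongr
      refine this.trans ?_
      gcongr
    have rect := Complex.integral_boundary_rect_eq_zero_of_differentiableOn
      (fun w => cauchyInt h w ^ (p : ℂ)) (⟨ε, -M⟩ : ℂ) (⟨M, M⟩ : ℂ) (by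
        intro w hw
        refine (hd w ?_).differentiableWithinAt
        have := hw.1
        simp only [Set.mem_preimage, Set.uIcc_of_le hMε] at this
        exact hε.trans_le this.1)
    simp only at rect
    have b1 : ‖∫ x : ℝ in ε..M, cauchyInt h (x + (-M : ℝ) * Complex.I) ^ (p : ℂ)‖ ≤
        (2 * H / M) ^ p * |M - ε| := by
      refine intervalIntegral.norm_integral_le_of_norm_le_const fun x _ => hfar _ ?_
      have := Complex.abs_im_le_norm (x + (-M : ℝ) * Complex.I : ℂ)
      simp only [Complex.add_im, Complex.ofReal_im, Complex.mul_im, Complex.ofReal_re,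
        Complex.I_im, Complex.I_re, mul_one, mul_zero, add_zero, zero_add, abs_neg] at this
      exact (le_abs_self M).trans this
    have b2 : ‖∫ x : ℝ in ε..M, cauchyInt h (x + M * Complex.I) ^ (p : ℂ)‖ ≤
        (2 * H / M) ^ p * |M - ε| := by
      refine intervalIntegral.norm_integral_le_of_norm_le_const fun x _ => hfar _ ?_
      have := Complex.abs_im_le_norm (x + M * Complex.I : ℂ)
      simp only [Complex.add_im, Complex.ofReal_im, Complex.mul_im, Complex.ofReal_re,
        Complex.I_im, Complex.I_re, mul_one, mul_zero, add_zero, zero_add] at this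
      exact (le_abs_self M).trans this
    have b3 : ‖∫ y : ℝ in (-M)..M, cauchyInt h (M + y * Complex.I) ^ (p : ℂ)‖ ≤
        (2 * H / M) ^ p * |M - -M| := by
      refine intervalIntegral.norm_integral_le_of_norm_le_const fun x _ => hfar _ ?_
      have := Complex.abs_re_le_norm (M + x * Complex.I : ℂ)
      simp only [Complex.add_re, Complex.ofReal_im, Complex.mul_re, Complex.ofReal_re,
        Complex.I_im, Complex.I_re, mul_one, mul_zero, sub_zero, add_zero] at this
      exact (le_abs_self M).trans this
    have e4 : ‖∫ y : ℝ in (-M)..M, cauchyInt h (ε + y * Complex.I) ^ (p : ℂ)‖ =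
        ‖(∫ x : ℝ in ε..M, cauchyInt h (x + (-M : ℝ) * Complex.I) ^ (p : ℂ)) -
          (∫ x : ℝ in ε..M, cauchyInt h (x + M * Complex.I) ^ (p : ℂ)) +
          Complex.I • ∫ y : ℝ in (-M)..M, cauchyInt h (M + y * Complex.I) ^ (p : ℂ)‖ := by
      rw [sub_eq_zero] at rect
      rw [rect, norm_smul, Complex.norm_I, one_mul]
    rw [e4]
    refine (norm_add_le _ _).trans ?_
    refine (add_le_add_left (norm_sub_le _ _) _).trans ?_
    rw [norm_smul, Complex.norm_I, one_mul]
    have hQ : 0 ≤ (2 * H / M) ^ p := by positivity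
    rw [abs_of_nonneg (by linarith : 0 ≤ M - ε)] at b1 b2
    rw [abs_of_nonneg (by linarith : 0 ≤ M - -M)] at b3
    have e5 : 4 * (2 * H) ^ p * M ^ (-(p - 1)) = (2 * H / M) ^ p * (4 * M) := by
      rw [Real.div_rpow (by positivity) hM0.le, neg_sub, Real.rpow_sub hM0, Real.rpow_one]
      field_simp
    rw [e5]
    nlinarith
  refine squeeze_zero_norm' hbd ?_
  have := (tendsto_rpow_neg_atTop (show 0 < p - 1 by linarith)).const_mul (4 * (2 * H) ^ p)
  simpa using this

theorem eLpNorm_ofReal_eq {α E : Type*} [MeasurableSpace α] [NormedAddCommGroup E] {μ : Measure α}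
    {p : ℝ} (hp : 0 < p) (f : α → E) :
    eLpNorm f (ENNReal.ofReal p) μ = (∫⁻ x, ‖f x‖ₑ ^ p ∂μ) ^ (1 / p) := by
  rw [eLpNorm_eq_lintegral_rpow_enorm_toReal (by simpa using hp) (by simp),
    ENNReal.toReal_ofReal hp.le]

theorem eLpNorm_ofReal_le_iff {α β E F : Type*} [MeasurableSpace α] [MeasurableSpace β]
    [NormedAddCommGroup E] [NormedAddCommGroup F] {μ : Measure α} {ν : Measure β}
    {p : ℝ} (hp : 0 < p) {f : α → E} {g : β → F} {C : ℝ≥0∞} :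
    eLpNorm f (ENNReal.ofReal p) μ ≤ C * eLpNorm g (ENNReal.ofReal p) ν ↔
      ∫⁻ x, ‖f x‖ₑ ^ p ∂μ ≤ C ^ p * ∫⁻ x, ‖g x‖ₑ ^ p ∂ν := by
  rw [eLpNorm_ofReal_eq hp, eLpNorm_ofReal_eq hp, one_div]
  have : C * (∫⁻ x, ‖g x‖ₑ ^ p ∂ν) ^ p⁻¹ = (C ^ p * ∫⁻ x, ‖g x‖ₑ ^ p ∂ν) ^ p⁻¹ := by
    rw [ENNReal.mul_rpow_of_nonneg _ _ (by positivity), ENNReal.rpow_rpow_inv hp.ne']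
  rw [this, ENNReal.rpow_le_rpow_iff (by positivity)]

theorem lintegral_poisson {ε : ℝ} (hε : 0 < ε) :
    ∫⁻ s : ℝ, ENNReal.ofReal (ε / (ε ^ 2 + (2 * Real.pi * s) ^ 2)) = ENNReal.ofReal (1 / 2) := by
  have e : ∀ s : ℝ, ε / (ε ^ 2 + (2 * Real.pi * s) ^ 2) =
      ε⁻¹ * (1 + (2 * Real.pi / ε * s) ^ 2)⁻¹ := by
    intro s
    have h1 : ε ^ 2 + (2 * Real.pi * s) ^ 2 ≠ 0 := by positivity
    have h2 : 1 + (2 * Real.pi / ε * s) ^ 2 ≠ 0 := by positivity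
    field_simp
  have hpi := Real.pi_pos
  have hint : Integrable (fun s : ℝ => ε⁻¹ * (1 + (2 * Real.pi / ε * s) ^ 2)⁻¹) :=
    (integrable_inv_one_add_sq.comp_mul_left' (R := 2 * Real.pi / ε) (by positivity)).const_mul _
  simp_rw [e]
  rw [← ofReal_integral_eq_lintegral_ofReal hint (Eventually.of_forall fun s => by positivity)]
  congr 1
  rw [integral_const_mul, Measure.integral_comp_mul_left (fun s : ℝ => (1 + s ^ 2)⁻¹),
    integral_univ_inv_one_add_sq, abs_of_pos (by positivity), smul_eq_mul]
  field_simp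

theorem continuous_cauchyInt_line {h : ℝ → ℂ} (hh : Integrable h) {ε : ℝ} (hε : 0 < ε) :
    Continuous fun x : ℝ => cauchyInt h (ε + 2 * Real.pi * x * Complex.I) := by
  rw [continuous_iff_continuousAt]
  intro y
  exact ContinuousAt.comp (g := cauchyInt h)
    (differentiableAt_cauchyInt hh (by simpa)).continuousAt (by fun_prop)

/-- M. Riesz's argument: integrate the inequality of `exists_norm_rpow_le` along a vertical line.
The term with `F^p` integrates to zero, and what is left is the `p`-th power of a Poisson integral,
whose kernel has mass `1/2` in this scaling. The constant depends neither on `ε` nor on the support.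
-/
theorem exists_lintegral_cauchyInt_le {p : ℝ} (hp1 : 1 < p) (hp2 : p ≤ 2) :
    ∃ C : ℝ≥0, ∀ ε : ℝ, 0 < ε → ∀ h : ℝ → ℝ, Integrable h → (∀ t, 0 ≤ h t) →
      ∀ A : ℝ, (∀ t, A < |t| → h t = 0) →
      eLpNorm (fun x : ℝ => cauchyInt (fun t => (h t : ℂ)) (ε + 2 * Real.pi * x * Complex.I))
        (ENNReal.ofReal p) volume ≤ C * eLpNorm h (ENNReal.ofReal p) volume := by
  obtain ⟨A₀, B₀, hA₀, hB₀, hz⟩ := exists_norm_rpow_le hp1 hp2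
  have hp0 : 0 < p := by linarith
  have hpi := Real.pi_pos
  refine ⟨A₀.toNNReal ^ (1 / p), fun ε hε h hh hpos A hA => ?_⟩
  -- If `h` vanishes almost everywhere, the transform is zero and its real part is not strictly
  -- positive, so this case is treated apart.
  by_cases h0 : ∫ t, h t = 0
  · have : h =ᵐ[volume] 0 := (integral_eq_zero_iff_of_nonneg hpos hh).1 h0
    have hz : ∀ w : ℂ, cauchyInt (fun t => (h t : ℂ)) w = 0 := by
      intro w
      rw [cauchyInt]
      refine integral_eq_zero_of_ae ?_
      filter_upwards [this] with t ht
      simp [ht]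
    simp [hz]
  have hint : 0 < ∫ t, h t := lt_of_le_of_ne (integral_nonneg hpos) (Ne.symm h0)
  have hsupp : 0 < volume (Function.support h) :=
    (integral_pos_iff_support_of_nonneg hpos hh).1 hint
  have hre : ∀ w : ℂ, 0 < w.re → 0 < (cauchyInt (fun t => (h t : ℂ)) w).re := by
    intro w hw
    have hI : Integrable fun t => h t * (w.re / (w.re ^ 2 + (w.im - 2 * Real.pi * t) ^ 2)) := by
      refine hh.mul_bdd (c := w.re⁻¹) (Continuous.aestronglyMeasurable ?_)
        (Eventually.of_forall fun t => ?_)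
      · exact Continuous.div (by fun_prop) (by fun_prop) fun t => by positivity
      · rw [Real.norm_of_nonneg (by positivity), div_le_iff₀ (by positivity)]
        have : w.re⁻¹ * w.re ^ 2 = w.re := by field_simp
        have h3 : 0 ≤ w.re⁻¹ * (w.im - 2 * Real.pi * t) ^ 2 := by positivity
        nlinarith
    rw [cauchyInt_re hh hw, integral_pos_iff_support_of_nonneg (fun t => by
      have := hpos t; positivity) hI]
    refine hsupp.trans_le (measure_mono fun t ht => ?_)
    have : w.re / (w.re ^ 2 + (w.im - 2 * Real.pi * t) ^ 2) ≠ 0 := by positivity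
    exact mul_ne_zero ht this
  have hhC : Integrable (fun t => (h t : ℂ)) := hh.ofReal
  have hA' : ∀ t, A < |t| → ((h t : ℝ) : ℂ) = 0 := fun t ht => by simp [hA t ht]
  set F := cauchyInt (fun t => (h t : ℂ)) with hF
  obtain ⟨hi1, hi2⟩ := integral_cpow_cauchyInt hhC hA' hre hε hp1
  have hi3 := integrable_rpow_cauchyInt hhC hA' hε hp1
  have hcF : Continuous fun y : ℝ => F (ε + y * Complex.I) := by
    rw [continuous_iff_continuousAt]
    intro y
    exact ContinuousAt.comp (g := F)
      (differentiableAt_cauchyInt hhC (by simpa)).continuousAt (by fun_prop)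
  have hrepos : ∀ y : ℝ, 0 < (F (ε + y * Complex.I)).re := fun y => hre _ (by simpa)
  have hi4 : Integrable fun y : ℝ => (F (ε + y * Complex.I)).re ^ p := by
    refine hi3.mono' ?_ (Eventually.of_forall fun y => ?_)
    · exact ((Complex.continuous_re.comp hcF).rpow_const fun y => Or.inr hp0.le).aestronglyMeasurable
    · have := hrepos y
      rw [Real.norm_of_nonneg (by positivity)]
      gcongr
      exact Complex.re_le_norm _
  have hi5 : Integrable fun y : ℝ => (F (ε + y * Complex.I) ^ (p : ℂ)).re := hi1.re
  have hmain : ∫ y : ℝ, ‖F (ε + y * Complex.I)‖ ^ p ≤ A₀ * ∫ y : ℝ, (F (ε + y * Complex.I)).re ^ p := by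
    have h1 : ∫ y : ℝ, (F (ε + y * Complex.I) ^ (p : ℂ)).re = 0 := by
      have := integral_re (𝕜 := ℂ) hi1
      simp only [RCLike.re_to_complex] at this
      rw [this, hi2]; simp
    calc ∫ y : ℝ, ‖F (ε + y * Complex.I)‖ ^ p
        ≤ ∫ y : ℝ, (A₀ * (F (ε + y * Complex.I)).re ^ p -
            B₀ * (F (ε + y * Complex.I) ^ (p : ℂ)).re) :=
          integral_mono hi3 ((hi4.const_mul _).sub (hi5.const_mul _)) fun y => hz _ (hrepos y)
      _ = _ := by
          rw [integral_sub (hi4.const_mul _) (hi5.const_mul _), integral_const_mul,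
            integral_const_mul, h1]
          ring
  have hscale : ∀ G : ℝ → ℝ, ∫ y : ℝ, G y = (2 * Real.pi) * ∫ x : ℝ, G (2 * Real.pi * x) := by
    intro G
    rw [Measure.integral_comp_mul_left, abs_of_pos (by positivity), smul_eq_mul]
    field_simp
  rw [hscale (fun y => ‖F (ε + y * Complex.I)‖ ^ p),
    hscale (fun y => (F (ε + y * Complex.I)).re ^ p), mul_left_comm] at hmain
  replace hmain := le_of_mul_le_mul_left hmain (by positivity)
  replace hi3 := hi3.comp_mul_left' (R := 2 * Real.pi) (by positivity)
  replace hi4 := hi4.comp_mul_left' (R := 2 * Real.pi) (by positivity)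
  simp only [Complex.ofReal_mul, Complex.ofReal_ofNat] at hmain hi3 hi4
  rw [eLpNorm_ofReal_le_iff hp0]
  have e1 : ∫⁻ x : ℝ, ‖F (ε + 2 * Real.pi * x * Complex.I)‖ₑ ^ p =
      ENNReal.ofReal (∫ x : ℝ, ‖F (ε + 2 * Real.pi * x * Complex.I)‖ ^ p) := by
    rw [ofReal_integral_eq_lintegral_ofReal hi3 (Eventually.of_forall fun x => by positivity)]
    refine lintegral_congr fun x => ?_
    rw [← ENNReal.ofReal_rpow_of_nonneg (norm_nonneg _) hp0.le, ofReal_norm]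
  rw [e1]
  have e2 : ENNReal.ofReal (∫ x : ℝ, (F (ε + 2 * Real.pi * x * Complex.I)).re ^ p) ≤
      ∫⁻ t, ‖h t‖ₑ ^ p := by
    have hr : ∀ x : ℝ, 0 < (F (ε + 2 * Real.pi * x * Complex.I)).re := fun x => hre _ (by simpa)
    rw [ofReal_integral_eq_lintegral_ofReal hi4 (Eventually.of_forall fun x => by
      have := hr x; positivity)]
    have hmeas : AEMeasurable (Function.uncurry fun a b : ℝ => ENNReal.ofReal (h (a - b)))
        (volume.prod volume) := by
      have h1 : AEMeasurable (fun z : ℝ × ℝ => h (z.1 - z.2)) (volume.prod volume) :=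
        hh.aemeasurable.comp_quasiMeasurePreserving (quasiMeasurePreserving_sub volume volume)
      exact h1.ennreal_ofReal
    have key := lintegral_lintegral_mul_rpow_le (μ := (volume : Measure ℝ))
      (ν := (volume : Measure ℝ)) hp1.le
      (w := fun s => ENNReal.ofReal (ε / (ε ^ 2 + (2 * Real.pi * s) ^ 2)))
      (h := fun a b => ENNReal.ofReal (h (a - b))) (M := ∫⁻ t, ‖h t‖ₑ ^ p) ?_ hmeas ?_
    · rw [lintegral_poisson hε] at key
      refine le_trans (le_of_eq ?_) (key.trans ?_)
      · refine lintegral_congr fun x => ?_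
        rw [← ENNReal.ofReal_rpow_of_nonneg (hr x).le hp0.le]
        congr 1
        have hwre : (0 : ℝ) < (ε + 2 * Real.pi * x * Complex.I : ℂ).re := by simpa
        rw [hF, cauchyInt_re hh hwre, ofReal_integral_eq_lintegral_ofReal]
        · rw [← lintegral_sub_left_eq_self _ x]
          refine lintegral_congr fun t => ?_
          rw [mul_comm, ENNReal.ofReal_mul (by simp; positivity)]
          congr 2
          simp
          ring
        · have h5 := (integrable_cauchyInt hhC hwre).re
          refine h5.congr (Eventually.of_forall fun t => ?_)
          simp [Complex.div_re, Complex.normSq_apply]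
          field_simp
        · refine Eventually.of_forall fun t => ?_
          have := hpos t
          simp only [Pi.zero_apply]
          have : 0 ≤ (ε + 2 * Real.pi * x * Complex.I : ℂ).re := hwre.le
          positivity
      · calc _ ≤ (1 : ℝ≥0∞) ^ p * ∫⁻ t, ‖h t‖ₑ ^ p := by
              gcongr
              rw [← ENNReal.ofReal_one]
              exact ENNReal.ofReal_le_ofReal (by norm_num)
          _ = _ := by simp
    · exact (Measurable.ennreal_ofReal (by fun_prop)).aemeasurable
    · refine Eventually.of_forall fun b => ?_
      rw [lintegral_sub_right_eq_self (fun a => ENNReal.ofReal (h a) ^ p)]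
      refine lintegral_mono fun a => ?_
      gcongr
      exact Real.ofReal_le_enorm _
  calc _ ≤ ENNReal.ofReal (A₀ * ∫ x : ℝ, (F (ε + 2 * Real.pi * x * Complex.I)).re ^ p) :=
        ENNReal.ofReal_le_ofReal hmain
    _ ≤ ENNReal.ofReal A₀ * ∫⁻ t, ‖h t‖ₑ ^ p := by
        rw [ENNReal.ofReal_mul hA₀]
        gcongr
    _ = _ := by
        congr 1
        rw [ENNReal.coe_rpow_of_nonneg _ (by positivity), ← ENNReal.rpow_mul,
          one_div_mul_cancel hp0.ne', ENNReal.rpow_one]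
        rfl

theorem cauchyInt_tendsto {h : ℝ → ℂ} (hh : Integrable h) {w : ℂ} (hw : 0 < w.re) :
    Tendsto (fun n : ℕ => cauchyInt ((Set.Icc (-(n : ℝ)) n).indicator h) w) atTop
      (𝓝 (cauchyInt h w)) := by
  refine tendsto_integral_of_dominated_convergence
    (fun t => ‖h t / (w - 2 * Real.pi * t * Complex.I)‖)
    (fun n => (integrable_cauchyInt (hh.indicator measurableSet_Icc) hw).aestronglyMeasurable)
    (integrable_cauchyInt hh hw).norm (fun n => Eventually.of_forall fun t => ?_)
    (Eventually.of_forall fun t => ?_)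
  · rw [norm_div, norm_div]
    gcongr
    exact norm_indicator_le_norm_self h t
  · refine tendsto_const_nhds.congr' ?_
    obtain ⟨n, hn⟩ := exists_nat_ge |t|
    filter_upwards [eventually_ge_atTop n] with k hk
    have : |t| ≤ k := hn.trans (by exact_mod_cast hk)
    rw [Set.indicator_of_mem (show t ∈ Set.Icc (-(k : ℝ)) k from abs_le.1 this)]

/-- Truncation to `[-n, n]` and Fatou's lemma remove the compact support. Positive and negative
parts of the real and imaginary parts then reduce a complex `h` to four nonnegative functions,
whence the factor 4. -/
theorem exists_eLpNorm_cauchyInt_le {p : ℝ} (hp1 : 1 < p) (hp2 : p ≤ 2) :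
    ∃ C : ℝ≥0, ∀ ε : ℝ, 0 < ε → ∀ h : ℝ → ℂ, Integrable h →
      eLpNorm (fun x : ℝ => cauchyInt h (ε + 2 * Real.pi * x * Complex.I))
        (ENNReal.ofReal p) volume ≤ C * eLpNorm h (ENNReal.ofReal p) volume := by
  obtain ⟨C, hC⟩ := exists_lintegral_cauchyInt_le hp1 hp2
  have hp0 : 0 < p := by linarith
  have hp1' : 1 ≤ ENNReal.ofReal p := by
    rw [← ENNReal.ofReal_one]; exact ENNReal.ofReal_le_ofReal hp1.le
  have step : ∀ ε : ℝ, 0 < ε → ∀ h : ℝ → ℝ, Integrable h → (∀ t, 0 ≤ h t) →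
      eLpNorm (fun x : ℝ => cauchyInt (fun t => (h t : ℂ)) (ε + 2 * Real.pi * x * Complex.I))
        (ENNReal.ofReal p) volume ≤ C * eLpNorm h (ENNReal.ofReal p) volume := by
    intro ε hε h hh hpos
    have hw : ∀ x : ℝ, 0 < (ε + 2 * Real.pi * x * Complex.I : ℂ).re := fun x => by simpa
    refine (Lp.eLpNorm_lim_le_liminf_eLpNorm (f := fun (n : ℕ) (x : ℝ) =>
      cauchyInt ((Set.Icc (-(n : ℝ)) n).indicator fun t => (h t : ℂ))
        (ε + 2 * Real.pi * x * Complex.I)) (fun n => ?_) _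
      (Eventually.of_forall fun x => cauchyInt_tendsto hh.ofReal (hw x))).trans ?_
    · exact (continuous_cauchyInt_line (hh.ofReal.indicator measurableSet_Icc) hε).aestronglyMeasurable
    · refine liminf_le_of_le (by isBoundedDefault) fun b hb => ?_
      obtain ⟨n, hn⟩ := hb.exists
      refine hn.trans ?_
      have e : ((Set.Icc (-(n : ℝ)) n).indicator fun t => (h t : ℂ)) =
          fun t => (((Set.Icc (-(n : ℝ)) n).indicator h t : ℝ) : ℂ) := by
        funext t
        by_cases ht : t ∈ Set.Icc (-(n : ℝ)) n <;> simp [ht]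
      simp only [e]
      refine (hC ε hε _ (hh.indicator measurableSet_Icc)
        (fun t => Set.indicator_nonneg (fun t _ => hpos t) t) n fun t ht => ?_).trans ?_
      · refine Set.indicator_of_notMem (fun h' => ?_) _
        exact absurd (abs_le.2 h') (not_le.2 ht)
      · gcongr
        exact eLpNorm_indicator_le h
  refine ⟨4 * C, fun ε hε h hh => ?_⟩
  have hw : ∀ x : ℝ, 0 < (ε + 2 * Real.pi * x * Complex.I : ℂ).re := fun x => by simpa
  have hre := hh.re
  have him := hh.im
  simp only [RCLike.re_to_complex, RCLike.im_to_complex] at hre him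
  set T : (ℝ → ℝ) → ℝ → ℂ := fun u x =>
    cauchyInt (fun t => (u t : ℂ)) (ε + 2 * Real.pi * x * Complex.I) with hT
  have hdec : (fun x : ℝ => cauchyInt h (ε + 2 * Real.pi * x * Complex.I)) =
      (T (fun t => max (h t).re 0) - T (fun t => max (-(h t).re) 0)) +
      (Complex.I • T (fun t => max (h t).im 0) - Complex.I • T (fun t => max (-(h t).im) 0)) := by
    funext x
    have q1 : Integrable fun t => ((max (h t).re 0 : ℝ) : ℂ) := hre.pos_part.ofReal
    have i1 := integrable_cauchyInt q1 (hw x)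
    have q2 : Integrable fun t => ((max (-(h t).re) 0 : ℝ) : ℂ) := hre.neg_part.ofReal
    have i2 := integrable_cauchyInt q2 (hw x)
    have q3 : Integrable fun t => ((max (h t).im 0 : ℝ) : ℂ) := him.pos_part.ofReal
    have i3 := integrable_cauchyInt q3 (hw x)
    have q4 : Integrable fun t => ((max (-(h t).im) 0 : ℝ) : ℂ) := him.neg_part.ofReal
    have i4 := integrable_cauchyInt q4 (hw x)
    simp only [hT, Pi.add_apply, Pi.sub_apply, Pi.smul_apply, cauchyInt, smul_eq_mul,
      ← integral_const_mul]
    rw [← integral_sub i1 i2, ← integral_sub (i3.const_mul _) (i4.const_mul _)]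
    refine Eq.trans ?_ (integral_add (i1.sub i2) ((i3.const_mul _).sub (i4.const_mul _)))
    refine integral_congr_ae (Eventually.of_forall fun t => ?_)
    simp only
    rw [← mul_sub, ← sub_div, ← sub_div, ← Complex.ofReal_sub, ← Complex.ofReal_sub]
    have e1 : max (h t).re 0 - max (-(h t).re) 0 = (h t).re := posPart_sub_negPart _
    have e2 : max (h t).im 0 - max (-(h t).im) 0 = (h t).im := posPart_sub_negPart _
    rw [e1, e2]
    conv_lhs => rw [← Complex.re_add_im (h t)]
    ring
  have hmT : ∀ u : ℝ → ℝ, Integrable u → AEStronglyMeasurable (T u) volume := fun u hu =>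
    (continuous_cauchyInt_line hu.ofReal hε).aestronglyMeasurable
  have hb : ∀ u : ℝ → ℝ, Integrable u → (∀ t, 0 ≤ u t) → (∀ t, ‖u t‖ ≤ ‖h t‖) →
      eLpNorm (T u) (ENNReal.ofReal p) volume ≤ C * eLpNorm h (ENNReal.ofReal p) volume := by
    intro u hu hu0 hub
    refine (step ε hε u hu hu0).trans ?_
    gcongr
    exact eLpNorm_mono hub
  have hI : ∀ u : ℝ → ℝ, eLpNorm (Complex.I • T u) (ENNReal.ofReal p) volume =
      eLpNorm (T u) (ENNReal.ofReal p) volume := by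
    intro u
    rw [eLpNorm_const_smul, ← ofReal_norm, Complex.norm_I, ENNReal.ofReal_one, one_mul]
  have b1 := hb _ hre.pos_part (fun t => le_max_right _ _) (fun t => by
    rw [Real.norm_of_nonneg (le_max_right _ _)]
    exact (max_le (le_abs_self _) (abs_nonneg _)).trans (Complex.abs_re_le_norm _))
  have b2 := hb _ hre.neg_part (fun t => le_max_right _ _) (fun t => by
    rw [Real.norm_of_nonneg (le_max_right _ _)]
    exact (max_le (neg_le_abs _) (abs_nonneg _)).trans (Complex.abs_re_le_norm _))
  have b3 := hb _ him.pos_part (fun t => le_max_right _ _) (fun t => by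
    rw [Real.norm_of_nonneg (le_max_right _ _)]
    exact (max_le (le_abs_self _) (abs_nonneg _)).trans (Complex.abs_im_le_norm _))
  have b4 := hb _ him.neg_part (fun t => le_max_right _ _) (fun t => by
    rw [Real.norm_of_nonneg (le_max_right _ _)]
    exact (max_le (neg_le_abs _) (abs_nonneg _)).trans (Complex.abs_im_le_norm _))
  have m1 := hmT _ hre.pos_part
  have m2 := hmT _ hre.neg_part
  have m3 := (hmT _ him.pos_part).const_smul Complex.I
  have m4 := (hmT _ him.neg_part).const_smul Complex.I
  rw [hdec]
  refine (eLpNorm_add_le (m1.sub m2) (m3.sub m4) hp1').trans ?_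
  refine (add_le_add (eLpNorm_sub_le m1 m2 hp1') (eLpNorm_sub_le m3 m4 hp1')).trans ?_
  rw [hI, hI]
  refine (add_le_add (add_le_add b1 b2) (add_le_add b3 b4)).trans (le_of_eq ?_)
  push_cast
  ring

/-! ### Smoothed half-line multipliers -/

/-- `e^{-εs} - e^{-Ns}` for `s > 0` and `0` for `s ≤ 0`. -/
def halfMult (ε N s : ℝ) : ℝ := Real.exp (-ε * max s 0) - Real.exp (-N * max s 0)

/-- The Fourier transform of `halfMult ε N`. -/
def halfKer (ε N τ : ℝ) : ℂ :=
  (ε + 2 * Real.pi * τ * Complex.I)⁻¹ - (N + 2 * Real.pi * τ * Complex.I)⁻¹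

theorem continuous_halfMult (ε N : ℝ) : Continuous (halfMult ε N) := by
  unfold halfMult; fun_prop

theorem halfMult_eq_indicator (ε N : ℝ) : halfMult ε N =
    (Set.Ioi 0).indicator fun s => Real.exp (-ε * s) - Real.exp (-N * s) := by
  funext s
  by_cases hs : 0 < s
  · simp [halfMult, hs, max_eq_left hs.le]
  · simp [halfMult, hs, max_eq_right (not_lt.1 hs)]

theorem abs_halfMult_le {ε N : ℝ} (hε : 0 < ε) (hN : 0 < N) (s : ℝ) : |halfMult ε N s| ≤ 1 := by
  have h0 : 0 ≤ max s 0 := le_max_right _ _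
  have h1 : Real.exp (-ε * max s 0) ≤ 1 := Real.exp_le_one_iff.2 (by nlinarith)
  have h2 : Real.exp (-N * max s 0) ≤ 1 := Real.exp_le_one_iff.2 (by nlinarith)
  have h3 := Real.exp_pos (-ε * max s 0)
  have h4 := Real.exp_pos (-N * max s 0)
  rw [halfMult, abs_le]
  constructor <;> linarith

theorem integrable_halfMult {ε N : ℝ} (hε : 0 < ε) (hN : 0 < N) :
    Integrable (fun s => (halfMult ε N s : ℂ)) := by
  have : Integrable (halfMult ε N) := by
    rw [halfMult_eq_indicator, integrable_indicator_iff measurableSet_Ioi]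
    exact (integrableOn_exp_mul_Ioi (by linarith) 0).sub (integrableOn_exp_mul_Ioi (by linarith) 0)
  exact this.ofReal

theorem fourier_halfMult {ε N : ℝ} (hε : 0 < ε) (hN : 0 < N) :
    𝓕 (fun s : ℝ => (halfMult ε N s : ℂ)) = halfKer ε N := by
  funext τ
  rw [Real.fourier_eq']
  have key : ∀ a : ℝ, 0 < a → IntegrableOn (fun s : ℝ =>
      Complex.exp (-(a + 2 * Real.pi * τ * Complex.I) * s)) (Set.Ioi 0) ∧
      ∫ s : ℝ in Set.Ioi 0, Complex.exp (-(a + 2 * Real.pi * τ * Complex.I) * s) =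
      (a + 2 * Real.pi * τ * Complex.I)⁻¹ := by
    intro a ha
    have hre : (-(a + 2 * Real.pi * τ * Complex.I)).re < 0 := by simpa
    refine ⟨integrableOn_exp_mul_complex_Ioi hre 0, ?_⟩
    rw [integral_exp_mul_complex_Ioi hre]
    simp only [Complex.ofReal_zero, mul_zero, Complex.exp_zero]
    rw [neg_div_neg_eq, one_div]
  have e : (fun s : ℝ => Complex.exp (↑(-2 * Real.pi * inner ℝ s τ) * Complex.I) •
      (halfMult ε N s : ℂ)) = (Set.Ioi 0).indicator fun s : ℝ =>
        Complex.exp (-(ε + 2 * Real.pi * τ * Complex.I) * s) -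
        Complex.exp (-(N + 2 * Real.pi * τ * Complex.I) * s) := by
    funext s
    rw [halfMult_eq_indicator]
    by_cases hs : s ∈ Set.Ioi (0 : ℝ)
    · rw [Set.indicator_of_mem hs, Set.indicator_of_mem hs]
      simp only [smul_eq_mul, Complex.ofReal_sub, Complex.ofReal_exp, mul_sub, ← Complex.exp_add]
      congr 2 <;> simp <;> ring
    · rw [Set.indicator_of_notMem hs, Set.indicator_of_notMem hs]
      simp
  rw [e, integral_indicator measurableSet_Ioi, integral_sub (key ε hε).1 (key N hN).1,
    (key ε hε).2, (key N hN).2, halfKer]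

theorem halfKer_den_norm {a : ℝ} (ha : 0 < a) (τ : ℝ) :
    min a 1 * Real.sqrt (1 + τ ^ 2) ≤ ‖(a + 2 * Real.pi * τ * Complex.I : ℂ)‖ := by
  have hm : 0 < min a 1 := lt_min ha one_pos
  have h1 : (min a 1) ^ 2 ≤ a ^ 2 := pow_le_pow_left₀ hm.le (min_le_left _ _) 2
  have h2 : (min a 1) ^ 2 ≤ 1 := by
    have := pow_le_pow_left₀ hm.le (min_le_right a 1) 2
    simpa using this
  have h3 : 1 ≤ (2 * Real.pi) ^ 2 := by nlinarith [Real.pi_gt_three]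
  rw [Complex.norm_def]
  apply Real.le_sqrt_of_sq_le
  rw [mul_pow, Real.sq_sqrt (by positivity)]
  simp [Complex.normSq_apply]
  have : 0 ≤ τ ^ 2 := sq_nonneg τ
  nlinarith [mul_le_mul_of_nonneg_right h2 this, mul_le_mul_of_nonneg_right h3 this]

theorem halfKer_den_ne {a : ℝ} (ha : 0 < a) (τ : ℝ) :
    (a + 2 * Real.pi * τ * Complex.I : ℂ) ≠ 0 := by
  intro h
  have := congrArg Complex.re h
  simp at this
  exact ha.ne' this

theorem continuous_halfKer {ε N : ℝ} (hε : 0 < ε) (hN : 0 < N) : Continuous (halfKer ε N) :=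
  (Continuous.inv₀ (by fun_prop) (halfKer_den_ne hε)).sub
    (Continuous.inv₀ (by fun_prop) (halfKer_den_ne hN))

/-- Subtracting `e^(-Ns)` makes the smoothed half-line multiplier continuous at `0`. On the
transform side the leading terms cancel and leave decay of order `τ⁻²`, so Fourier inversion holds
with absolutely convergent integrals. -/
theorem integrable_halfKer {ε N : ℝ} (hε : 0 < ε) (hN : 0 < N) : Integrable (halfKer ε N) := by
  have hc := continuous_halfKer hε hN
  refine ((integrable_inv_one_add_sq).const_mul (|N - ε| * ((min ε 1)⁻¹ * (min N 1)⁻¹))).mono'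
    hc.aestronglyMeasurable (Eventually.of_forall fun τ => ?_)
  have h1 := halfKer_den_norm hε τ
  have h2 := halfKer_den_norm hN τ
  have hs : 0 < Real.sqrt (1 + τ ^ 2) := by positivity
  have hm1 : 0 < min ε 1 := lt_min hε one_pos
  have hm2 : 0 < min N 1 := lt_min hN one_pos
  have e : halfKer ε N τ = ((N - ε : ℝ) : ℂ) * ((ε + 2 * Real.pi * τ * Complex.I : ℂ)⁻¹ *
      (N + 2 * Real.pi * τ * Complex.I : ℂ)⁻¹) := by
    have := halfKer_den_ne hε τ
    have := halfKer_den_ne hN τ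
    rw [halfKer]
    push_cast
    field_simp
    ring
  rw [e, norm_mul, norm_mul, norm_inv, norm_inv, Complex.norm_real, Real.norm_eq_abs,
    mul_assoc |N - ε|]
  refine mul_le_mul_of_nonneg_left ?_ (abs_nonneg _)
  calc _ ≤ (min ε 1 * Real.sqrt (1 + τ ^ 2))⁻¹ * (min N 1 * Real.sqrt (1 + τ ^ 2))⁻¹ := by
        gcongr
    _ = _ := by
        have : Real.sqrt (1 + τ ^ 2) * Real.sqrt (1 + τ ^ 2) = 1 + τ ^ 2 :=
          Real.mul_self_sqrt (by positivity)
        have e2 : (1 + τ ^ 2)⁻¹ = (Real.sqrt (1 + τ ^ 2))⁻¹ * (Real.sqrt (1 + τ ^ 2))⁻¹ := by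
          rw [← mul_inv, this]
        rw [e2, mul_inv, mul_inv]
        ring

theorem integral_halfKer_mul_exp {ε N : ℝ} (hε : 0 < ε) (hN : 0 < N) (s : ℝ) :
    ∫ τ, halfKer ε N τ * Complex.exp (2 * Real.pi * τ * s * Complex.I) = halfMult ε N s := by
  have hc : Continuous fun s : ℝ => (halfMult ε N s : ℂ) :=
    Complex.continuous_ofReal.comp (continuous_halfMult ε N)
  have := congrFun (hc.fourierInv_fourier_eq (integrable_halfMult hε hN)
    (by rw [fourier_halfMult hε hN]; exact integrable_halfKer hε hN)) s
  rw [fourier_halfMult hε hN, Real.fourierInv_eq'] at this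
  rw [← this]
  refine integral_congr_ae (Eventually.of_forall fun τ => ?_)
  simp only [smul_eq_mul]
  rw [mul_comm]
  congr 2
  simp
  ring

/-- The substitution `t = x - ρτ` turns each half of the kernel into a Cauchy transform at `ρa +
2πix`, so the bound is uniform in `ε`, `N` and `ρ`. Since `h` is merely bounded and continuous, it
is truncated and Fatou's lemma is applied. -/
theorem exists_eLpNorm_halfKer_le {p : ℝ} (hp1 : 1 < p) (hp2 : p ≤ 2) :
    ∃ C : ℝ≥0, ∀ ε N ρ : ℝ, 0 < ε → 0 < N → 0 < ρ → ∀ (h : ℝ → ℂ) (M : ℝ), Continuous h →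
      (∀ t, ‖h t‖ ≤ M) →
      eLpNorm (fun x : ℝ => ∫ τ, halfKer ε N τ * h (x - ρ * τ))
        (ENNReal.ofReal p) volume ≤ C * eLpNorm h (ENNReal.ofReal p) volume := by
  obtain ⟨C, hC⟩ := exists_eLpNorm_cauchyInt_le hp1 hp2
  have hp1' : 1 ≤ ENNReal.ofReal p := by
    rw [← ENNReal.ofReal_one]; exact ENNReal.ofReal_le_ofReal hp1.le
  refine ⟨2 * C, fun ε N ρ hε hN hρ h M hh hM => ?_⟩
  have hsub : ∀ (a : ℝ), 0 < a → ∀ (g : ℝ → ℂ) (x : ℝ), Integrable g →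
      Integrable (fun τ : ℝ => (a + 2 * Real.pi * τ * Complex.I : ℂ)⁻¹ * g (x - ρ * τ)) ∧
      ∫ τ : ℝ, (a + 2 * Real.pi * τ * Complex.I : ℂ)⁻¹ * g (x - ρ * τ) =
        cauchyInt g ((ρ * a : ℝ) + 2 * Real.pi * x * Complex.I) := by
    intro a ha g x hg
    have hw : 0 < (((ρ * a : ℝ) : ℂ) + 2 * Real.pi * x * Complex.I).re := by
      have := mul_pos hρ ha
      simpa using this
    have hI := integrable_cauchyInt hg hw
    have e : ∀ τ : ℝ, (a + 2 * Real.pi * τ * Complex.I : ℂ)⁻¹ * g (x - ρ * τ) =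
        (ρ : ℂ) * (fun t : ℝ => g t / (((ρ * a : ℝ) : ℂ) + 2 * Real.pi * x * Complex.I -
          2 * Real.pi * t * Complex.I)) (x - ρ * τ) := by
      intro τ
      have h1 := halfKer_den_ne ha τ
      have h2 : (ρ : ℂ) ≠ 0 := by exact_mod_cast hρ.ne'
      have h3 : ((ρ * a : ℝ) : ℂ) + 2 * Real.pi * x * Complex.I -
          2 * Real.pi * ((x - ρ * τ : ℝ) : ℂ) * Complex.I =
          ρ * (a + 2 * Real.pi * τ * Complex.I) := by push_cast; ring
      simp only [h3]
      field_simp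
    simp only [e]
    constructor
    · refine Integrable.const_mul ?_ _
      exact ((hI.comp_sub_left x).comp_mul_left' hρ.ne')
    · rw [integral_const_mul, Measure.integral_comp_mul_left (fun s : ℝ =>
        (fun t : ℝ => g t / (((ρ * a : ℝ) : ℂ) + 2 * Real.pi * x * Complex.I -
          2 * Real.pi * t * Complex.I)) (x - s)), integral_sub_left_eq_self (fun t : ℝ => g t / (((ρ * a : ℝ) : ℂ) +
          2 * Real.pi * x * Complex.I - 2 * Real.pi * t * Complex.I)) volume x, cauchyInt,
        abs_of_pos (by positivity), Complex.real_smul, ← mul_assoc]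
      rw [← Complex.ofReal_mul, mul_inv_cancel₀ hρ.ne', Complex.ofReal_one, one_mul]
  have step : ∀ g : ℝ → ℂ, Integrable g →
      AEStronglyMeasurable (fun x : ℝ => ∫ τ, halfKer ε N τ * g (x - ρ * τ)) volume ∧
      eLpNorm (fun x : ℝ => ∫ τ, halfKer ε N τ * g (x - ρ * τ))
        (ENNReal.ofReal p) volume ≤ (2 * C : ℝ≥0) * eLpNorm g (ENNReal.ofReal p) volume := by
    intro g hg
    have e : (fun x : ℝ => ∫ τ, halfKer ε N τ * g (x - ρ * τ)) =
        (fun x : ℝ => cauchyInt g ((ρ * ε : ℝ) + 2 * Real.pi * x * Complex.I)) -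
        (fun x : ℝ => cauchyInt g ((ρ * N : ℝ) + 2 * Real.pi * x * Complex.I)) := by
      funext x
      simp only [Pi.sub_apply, halfKer, sub_mul]
      rw [integral_sub (hsub ε hε g x hg).1 (hsub N hN g x hg).1, (hsub ε hε g x hg).2,
        (hsub N hN g x hg).2]
    have m1 := (continuous_cauchyInt_line hg (mul_pos hρ hε)).aestronglyMeasurable (μ := volume)
    have m2 := (continuous_cauchyInt_line hg (mul_pos hρ hN)).aestronglyMeasurable (μ := volume)
    rw [e]
    refine ⟨m1.sub m2, (eLpNorm_sub_le m1 m2 hp1').trans ?_⟩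
    refine (add_le_add (hC _ (mul_pos hρ hε) g hg) (hC _ (mul_pos hρ hN) g hg)).trans
      (le_of_eq ?_)
    push_cast; ring
  have hI : ∀ n : ℕ, Integrable ((Set.Icc (-(n : ℝ)) n).indicator h) := fun n => by
    rw [integrable_indicator_iff measurableSet_Icc]
    exact hh.continuousOn.integrableOn_Icc
  refine (Lp.eLpNorm_lim_le_liminf_eLpNorm (f := fun (n : ℕ) (x : ℝ) =>
    ∫ τ, halfKer ε N τ * (Set.Icc (-(n : ℝ)) n).indicator h (x - ρ * τ))
    (fun n => (step _ (hI n)).1) _ (Eventually.of_forall fun x => ?_)).trans ?_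
  · refine tendsto_integral_of_dominated_convergence (fun τ => ‖halfKer ε N τ‖ * M)
      (fun n => ?_) ((integrable_halfKer hε hN).norm.mul_const M)
      (fun n => Eventually.of_forall fun τ => ?_) (Eventually.of_forall fun τ => ?_)
    · refine (continuous_halfKer hε hN).aestronglyMeasurable.mul ?_
      exact (((hh.measurable.indicator measurableSet_Icc)).comp (by fun_prop)).aestronglyMeasurable
    · rw [norm_mul]
      gcongr
      exact (norm_indicator_le_norm_self h _).trans (hM _)
    · refine tendsto_const_nhds.congr' ?_
      obtain ⟨n, hn⟩ := exists_nat_ge |x - ρ * τ|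
      filter_upwards [eventually_ge_atTop n] with k hk
      have : |x - ρ * τ| ≤ k := hn.trans (by exact_mod_cast hk)
      rw [Set.indicator_of_mem (show x - ρ * τ ∈ Set.Icc (-(k : ℝ)) k from abs_le.1 this)]
  · refine liminf_le_of_le (by isBoundedDefault) fun b hb => ?_
    obtain ⟨n, hn⟩ := hb.exists
    refine hn.trans ((step _ (hI n)).2.trans ?_)
    gcongr
    exact eLpNorm_indicator_le h

/-! ### Directional singular integrals in space -/

/-- The convolution of `h` with `halfKer ε N` in the direction `y`. -/
def dirConv (ε N : ℝ) (y : E3) (h : E3 → ℂ) (x : E3) : ℂ :=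
  ∫ τ, halfKer ε N τ * h (x - (2 * Real.pi * τ) • y)

theorem continuous_dirConv {ε N : ℝ} (hε : 0 < ε) (hN : 0 < N) (y : E3) {h : E3 → ℂ} {M : ℝ}
    (hh : Continuous h) (hM : ∀ x, ‖h x‖ ≤ M) : Continuous (dirConv ε N y h) := by
  refine continuous_of_dominated (bound := fun τ => ‖halfKer ε N τ‖ * M) (fun x => ?_)
    (fun x => Eventually.of_forall fun τ => ?_) ((integrable_halfKer hε hN).norm.mul_const M)
    (Eventually.of_forall fun τ => ?_)
  · exact ((continuous_halfKer hε hN).mul (by fun_prop)).aestronglyMeasurable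
  · rw [norm_mul]
    gcongr
    exact hM _
  · fun_prop

/-- `ℝ × ℝ²` as a measure space is `ℝ³`. -/
def splitE3 : ℝ × (Fin 2 → ℝ) ≃ᵐ E3 :=
  (MeasurableEquiv.piFinSuccAbove (fun _ : Fin 3 => ℝ) 0).symm.trans
    (MeasurableEquiv.toLp 2 (Fin 3 → ℝ))

theorem measurePreserving_splitE3 : MeasurePreserving splitE3 :=
  ((volume_preserving_piFinSuccAbove (fun _ : Fin 3 => ℝ) 0).symm _).trans
    (PiLp.volume_preserving_toLp (Fin 3))

theorem splitE3_sub (s t : ℝ) (x : Fin 2 → ℝ) :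
    splitE3 (s - t, x) = splitE3 (s, x) - t • EuclideanSpace.single 0 1 := by
  ext i
  refine Fin.cases ?_ (fun j => ?_) i <;> simp [splitE3]

/-- The reflection in the plane orthogonal to `v - y`. It replaces rotations wherever a direction is
moved to the first axis. -/
theorem exists_reflection {y : E3} {v : E3} (h : ‖v‖ = ‖y‖) : ∃ A : E3 ≃ₗᵢ[ℝ] E3, A v = y :=
  ⟨_, Submodule.reflection_sub h⟩

/-- After an isometry taking `|y| e₀` to `y`, Fubini splits space into lines parallel to `y`. On
each of them the one-dimensional bound applies with `ρ = 2π|y|`, and its uniformity in `ρ` makes the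
constant independent of `y`. -/
theorem exists_eLpNorm_dirConv_le {p : ℝ} (hp1 : 1 < p) (hp2 : p ≤ 2) :
    ∃ C : ℝ≥0, ∀ ε N : ℝ, 0 < ε → 0 < N → ∀ (y : E3), y ≠ 0 → ∀ (h : E3 → ℂ) (M : ℝ),
      Continuous h → (∀ t, ‖h t‖ ≤ M) →
      eLpNorm (dirConv ε N y h) (ENNReal.ofReal p) volume ≤
        C * eLpNorm h (ENNReal.ofReal p) volume := by
  obtain ⟨C, hC⟩ := exists_eLpNorm_halfKer_le hp1 hp2
  have hp0 : 0 < p := by linarith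
  refine ⟨C, fun ε N hε hN y hy h M hh hM => ?_⟩
  have hny : 0 < ‖y‖ := norm_pos_iff.2 hy
  obtain ⟨A, hA⟩ := exists_reflection (y := y) (v := ‖y‖ • (EuclideanSpace.single 0 1 : E3))
    (by simp [norm_smul])
  set S : ℝ × (Fin 2 → ℝ) → E3 := fun z => A (splitE3 z) with hS
  have hmp : MeasurePreserving S := A.measurePreserving.comp measurePreserving_splitE3
  have hSc : ∀ x : Fin 2 → ℝ, Continuous fun s => S (s, x) := by
    intro x
    refine A.continuous.comp ?_
    have : (fun s => splitE3 (s, x)) =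
        fun s => splitE3 (0, x) - (-s) • EuclideanSpace.single 0 1 := by
      funext s; rw [← splitE3_sub, zero_sub, neg_neg]
    rw [this]
    fun_prop
  rw [eLpNorm_ofReal_le_iff hp0]
  have hc := continuous_dirConv hε hN y hh hM
  have m1 : Measurable fun x => ‖dirConv ε N y h x‖ₑ ^ p := (hc.measurable.enorm).pow_const p
  have m2 : Measurable fun x => ‖h x‖ₑ ^ p := (hh.measurable.enorm).pow_const p
  rw [← hmp.lintegral_comp m1, ← hmp.lintegral_comp m2, Measure.volume_eq_prod,
    lintegral_prod_symm' (fun z => ‖dirConv ε N y h (S z)‖ₑ ^ p) (m1.comp hmp.measurable),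
    lintegral_prod_symm' (fun z => ‖h (S z)‖ₑ ^ p) (m2.comp hmp.measurable),
    ← lintegral_const_mul']
  · refine lintegral_mono fun x => ?_
    have := hC ε N (2 * Real.pi * ‖y‖) hε hN (by positivity) (fun s => h (S (s, x))) M
      (hh.comp (hSc x)) (fun t => hM _)
    rw [eLpNorm_ofReal_le_iff hp0] at this
    refine le_trans (le_of_eq ?_) this
    refine lintegral_congr fun s => ?_
    congr 2
    refine integral_congr_ae (Eventually.of_forall fun τ => ?_)
    simp only [hS]
    congr 2
    rw [splitE3_sub, map_sub]
    congr 1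
    have e : (2 * Real.pi * ‖y‖ * τ) • (EuclideanSpace.single 0 1 : E3) =
        (2 * Real.pi * τ) • (‖y‖ • (EuclideanSpace.single 0 1 : E3)) := by
      rw [smul_smul]; congr 1; ring
    rw [e, A.map_smul, hA]
  · exact ENNReal.rpow_ne_top_of_nonneg hp0.le ENNReal.coe_ne_top

/-! ### The Fourier transform on Schwartz functions -/

/-- `(2π)^(-3/2)`. -/
def C0 : ℝ := (2 * Real.pi) ^ (-(3 / 2) : ℝ)

theorem C0_pos : 0 < C0 := by unfold C0; positivity

theorem C0_sq : C0 * C0 * (2 * Real.pi) ^ 3 = 1 := by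
  have hpi : (0 : ℝ) < 2 * Real.pi := by positivity
  rw [C0, ← Real.rpow_natCast, ← Real.rpow_add hpi, ← Real.rpow_add hpi]
  norm_num

theorem fhat_eq (f : E3 → ℂ) (ξ : E3) :
    fhat f ξ = C0 * ∫ x, Complex.exp (-(Complex.I * ((inner ℝ ξ x : ℝ) : ℂ))) * f x := rfl

theorem norm_phase (a : ℝ) : ‖Complex.exp (-(Complex.I * (a : ℂ)))‖ = 1 := by
  rw [show -(Complex.I * (a : ℂ)) = ((-a : ℝ) : ℂ) * Complex.I by push_cast; ring,
    Complex.norm_exp_ofReal_mul_I]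

theorem integrable_phase_mul {f : E3 → ℂ} (hf : Integrable f) (ξ : E3) :
    Integrable fun x => Complex.exp (-(Complex.I * ((inner ℝ ξ x : ℝ) : ℂ))) * f x := by
  refine hf.bdd_mul (c := 1) (Continuous.aestronglyMeasurable (by fun_prop))
    (Eventually.of_forall fun x => (norm_phase _).le)

theorem norm_fhat_le (f : E3 → ℂ) (ξ : E3) : ‖fhat f ξ‖ ≤ C0 * ∫ x, ‖f x‖ := by
  rw [fhat_eq, norm_mul, Complex.norm_real, Real.norm_of_nonneg C0_pos.le]
  have := C0_pos
  gcongr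
  refine (norm_integral_le_integral_norm _).trans (le_of_eq ?_)
  simp_rw [norm_mul, norm_phase, one_mul]

theorem continuous_fhat {f : E3 → ℂ} (hf : Integrable f) : Continuous (fhat f) := by
  unfold fhat
  refine continuous_const.mul (continuous_of_dominated (bound := fun x => ‖f x‖) (fun ξ => ?_)
    (fun ξ => Eventually.of_forall fun x => ?_) hf.norm (Eventually.of_forall fun x => ?_))
  · exact (integrable_phase_mul hf ξ).aestronglyMeasurable
  · rw [norm_mul, norm_phase, one_mul]
  · fun_prop

theorem fhat_add {f g : E3 → ℂ} (hf : Integrable f) (hg : Integrable g) (ξ : E3) :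
    fhat (f + g) ξ = fhat f ξ + fhat g ξ := by
  simp only [fhat_eq, Pi.add_apply, mul_add]
  rw [integral_add (integrable_phase_mul hf ξ) (integrable_phase_mul hg ξ), mul_add]

theorem fhat_smul (a : ℂ) (f : E3 → ℂ) (ξ : E3) : fhat (a • f) ξ = a * fhat f ξ := by
  simp only [fhat_eq, Pi.smul_apply, smul_eq_mul]
  rw [mul_left_comm, ← integral_const_mul a]
  congr 2
  funext x
  ring

theorem fhat_congr {f g : E3 → ℂ} (h : f =ᵐ[volume] g) : fhat f = fhat g := by
  funext ξ
  rw [fhat_eq, fhat_eq]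
  congr 1
  refine integral_congr_ae ?_
  filter_upwards [h] with x hx
  rw [hx]

theorem integral_fhat_mul {f g : E3 → ℂ} (hf : Integrable f) (hg : Integrable g) :
    ∫ x, fhat f x * g x = ∫ x, f x * fhat g x := by
  have key : Integrable (fun z : E3 × E3 =>
      Complex.exp (-(Complex.I * ((inner ℝ z.1 z.2 : ℝ) : ℂ))) * (g z.1 * f z.2))
      (volume.prod volume) := by
    refine (hg.mul_prod hf).bdd_mul (c := 1) (Continuous.aestronglyMeasurable (by fun_prop))
      (Eventually.of_forall fun x => (norm_phase _).le)
  simp only [fhat_eq]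
  calc _ = ∫ x, ∫ y, C0 * (Complex.exp (-(Complex.I * ((inner ℝ x y : ℝ) : ℂ))) * (g x * f y)) := by
        refine integral_congr_ae (Eventually.of_forall fun x => ?_)
        simp only
        rw [mul_assoc, mul_comm _ (g x), ← integral_const_mul, ← integral_const_mul]
        congr 1; funext y; ring
    _ = ∫ y, ∫ x, C0 * (Complex.exp (-(Complex.I * ((inner ℝ x y : ℝ) : ℂ))) * (g x * f y)) :=
        integral_integral_swap (key.const_mul _)
    _ = _ := by
        refine integral_congr_ae (Eventually.of_forall fun x => ?_)
        simp only
        rw [← integral_const_mul, ← integral_const_mul]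
        congr 1; funext y
        rw [real_inner_comm]
        ring

/-- The dilation by `1 / (2π)`. -/
def dilEquiv : E3 ≃L[ℝ] E3 :=
  ContinuousLinearEquiv.smulLeft (Units.mk0 ((2 * Real.pi)⁻¹ : ℝ) (by positivity))

theorem dilEquiv_apply (x : E3) : dilEquiv x = (2 * Real.pi)⁻¹ • x := rfl

/-- The inverse Fourier transform `(2π)^(-3/2) ∫ φ(x) e^(iξ·x) dx` of a Schwartz function. -/
def ivS (φ : 𝓢(E3, ℂ)) : 𝓢(E3, ℂ) :=
  (C0 : ℂ) • SchwartzMap.compCLMOfContinuousLinearEquiv ℂ dilEquiv (𝓕⁻ φ)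

theorem ivS_apply (φ : 𝓢(E3, ℂ)) (ξ : E3) :
    ivS φ ξ = C0 * ∫ x, Complex.exp (Complex.I * ((inner ℝ ξ x : ℝ) : ℂ)) * φ x := by
  rw [ivS, _root_.smul_apply, SchwartzMap.compCLMOfContinuousLinearEquiv_apply,
    Function.comp_apply, dilEquiv_apply, smul_eq_mul, SchwartzMap.fourierInv_coe,
    Real.fourierInv_eq']
  congr 1
  refine integral_congr_ae (Eventually.of_forall fun x => ?_)
  simp only [smul_eq_mul]
  congr 2
  rw [inner_smul_right, real_inner_comm]
  push_cast
  have : (Real.pi : ℂ) ≠ 0 := by exact_mod_cast Real.pi_ne_zero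
  field_simp

theorem fhat_ivS (φ : 𝓢(E3, ℂ)) : fhat (ivS φ) = φ := by
  have hpi : (0 : ℝ) < 2 * Real.pi := by positivity
  funext x
  have h1 : (𝓕 (𝓕⁻ φ)) x = φ x := by rw [FourierTransform.fourier_fourierInv_eq]
  rw [← h1, SchwartzMap.fourier_coe, Real.fourier_eq', fhat_eq]
  have h2 : ∀ ξ : E3, ivS φ ξ = C0 * (𝓕⁻ φ) ((2 * Real.pi)⁻¹ • ξ) := by
    intro ξ
    rw [ivS, _root_.smul_apply, SchwartzMap.compCLMOfContinuousLinearEquiv_apply,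
      Function.comp_apply, dilEquiv_apply, smul_eq_mul]
  have h3 := Measure.integral_comp_smul (μ := (volume : Measure E3))
    (fun v : E3 => Complex.exp (↑(-2 * Real.pi * inner ℝ v x) * Complex.I) • (𝓕⁻ φ) v)
    (2 * Real.pi)⁻¹
  rw [finrank_euclideanSpace_fin, abs_of_nonneg (by positivity), Complex.real_smul] at h3
  have h4 : (∫ ξ, Complex.exp (-(Complex.I * ((inner ℝ x ξ : ℝ) : ℂ))) * ivS φ ξ) =
      C0 * ∫ ξ : E3, Complex.exp (↑(-2 * Real.pi * inner ℝ ((2 * Real.pi)⁻¹ • ξ) x) * Complex.I) •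
        (𝓕⁻ φ) ((2 * Real.pi)⁻¹ • ξ) := by
    rw [← integral_const_mul]
    refine integral_congr_ae (Eventually.of_forall fun ξ => ?_)
    simp only [h2, smul_eq_mul]
    rw [inner_smul_left, real_inner_comm]
    have : Complex.exp (↑(-2 * Real.pi * ((starRingEnd ℝ) (2 * Real.pi)⁻¹ * inner ℝ ξ x)) *
        Complex.I) = Complex.exp (-(Complex.I * ((inner ℝ ξ x : ℝ) : ℂ))) := by
      congr 1
      have : (Real.pi : ℂ) ≠ 0 := by exact_mod_cast Real.pi_ne_zero
      push_cast
      simp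
      field_simp
    rw [this]
    ring
  rw [h4, h3, ← mul_assoc, ← mul_assoc, ← Complex.ofReal_mul, ← Complex.ofReal_mul]
  have : C0 * C0 * (((2 * Real.pi)⁻¹ ^ 3)⁻¹) = 1 := by
    rw [inv_pow, inv_inv]; exact C0_sq
  rw [this, Complex.ofReal_one, one_mul]

theorem fhat_eq_ivS_neg (φ : 𝓢(E3, ℂ)) (ξ : E3) : fhat φ ξ = ivS φ (-ξ) := by
  rw [fhat_eq, ivS_apply]
  congr 2
  funext x
  rw [inner_neg_left]
  push_cast
  ring_nf

theorem finv_apply_ivS {g : E3 → ℂ} (hg : IsTempered g) (φ : 𝓢(E3, ℂ)) :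
    finv g φ = ∫ ξ, g ξ * ivS φ ξ := by
  rw [finv_apply hg]
  simp_rw [ivS_apply]
  rfl

/-! ### Fourier multipliers on Schwartz functions -/

/-- The Fourier multiplier with symbol `m`. -/
def multOp (m : E3 → ℂ) (φ : 𝓢(E3, ℂ)) : E3 → ℂ := fhat fun ξ => m ξ * ivS φ ξ

/-- `m` is a bounded measurable symbol. -/
def BddSym (m : E3 → ℂ) : Prop := Measurable m ∧ ∃ M : ℝ, ∀ ξ, ‖m ξ‖ ≤ M

theorem BddSym.integrable {m : E3 → ℂ} (hm : BddSym m) (φ : 𝓢(E3, ℂ)) :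
    Integrable fun ξ => m ξ * ivS φ ξ := by
  obtain ⟨h1, M, h2⟩ := hm
  exact (ivS φ).integrable.bdd_mul h1.aestronglyMeasurable (Eventually.of_forall h2)

theorem BddSym.mul {m n : E3 → ℂ} (hm : BddSym m) (hn : BddSym n) :
    BddSym fun ξ => m ξ * n ξ := by
  obtain ⟨h1, M, h2⟩ := hm
  obtain ⟨h3, N, h4⟩ := hn
  refine ⟨h1.mul h3, M * N, fun ξ => ?_⟩
  rw [norm_mul]
  gcongr
  · exact (norm_nonneg _).trans (h2 ξ)
  · exact h2 ξ
  · exact h4 ξ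

/-- The multiplier with symbol `m` is bounded by `C` on `L^p`. -/
def LpBdd (p : ℝ) (C : ℝ≥0) (m : E3 → ℂ) : Prop :=
  ∀ φ : 𝓢(E3, ℂ), eLpNorm (multOp m φ) (ENNReal.ofReal p) volume ≤
    C * eLpNorm φ (ENNReal.ofReal p) volume

theorem continuous_multOp {m : E3 → ℂ} (hm : BddSym m) (φ : 𝓢(E3, ℂ)) :
    Continuous (multOp m φ) := continuous_fhat (hm.integrable φ)

theorem lpBdd_one (p : ℝ) : LpBdd p 1 fun _ => 1 := by
  intro φ
  simp [multOp, fhat_ivS]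

theorem LpBdd.congr {p : ℝ} {C : ℝ≥0} {m n : E3 → ℂ} (h : LpBdd p C m) (hmn : m =ᵐ[volume] n) :
    LpBdd p C n := by
  intro φ
  have : multOp n φ = multOp m φ := fhat_congr (by filter_upwards [hmn] with x hx; rw [hx])
  rw [this]
  exact h φ

theorem LpBdd.const_mul {p : ℝ} {C : ℝ≥0} {m : E3 → ℂ} (h : LpBdd p C m) (a : ℂ) :
    LpBdd p (‖a‖₊ * C) fun ξ => a * m ξ := by
  intro φ
  have : multOp (fun ξ => a * m ξ) φ = a • multOp m φ := by
    funext x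
    rw [Pi.smul_apply, smul_eq_mul, multOp, multOp, ← fhat_smul]
    congr 1
    funext ξ
    simp [mul_assoc]
  rw [this, eLpNorm_const_smul]
  push_cast
  rw [mul_assoc]
  gcongr
  · exact le_rfl
  · exact h φ

/-- Fubini moves the `τ` integral inside, where the translations produce phases `e^(2πiτ y·ξ)`.
Fourier inversion of `halfKer` then evaluates it. -/
theorem dirConv_fhat {ε N : ℝ} (hε : 0 < ε) (hN : 0 < N) (y : E3) {g : E3 → ℂ}
    (hg : Integrable g) :
    dirConv ε N y (fhat g) = fhat fun ξ => (halfMult ε N (inner ℝ y ξ) : ℂ) * g ξ := by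
  funext x
  have key : Integrable (fun z : ℝ × E3 =>
      Complex.exp (-(Complex.I * ((inner ℝ (x - (2 * Real.pi * z.1) • y) z.2 : ℝ) : ℂ))) *
      (halfKer ε N z.1 * g z.2)) (volume.prod volume) := by
    refine ((integrable_halfKer hε hN).mul_prod hg).bdd_mul (c := 1)
      (Continuous.aestronglyMeasurable (by fun_prop))
      (Eventually.of_forall fun x => (norm_phase _).le)
  simp only [dirConv, fhat_eq]
  calc _ = ∫ τ, ∫ ξ, C0 * (Complex.exp (-(Complex.I *
          ((inner ℝ (x - (2 * Real.pi * τ) • y) ξ : ℝ) : ℂ))) * (halfKer ε N τ * g ξ)) := by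
        refine integral_congr_ae (Eventually.of_forall fun τ => ?_)
        simp only
        rw [← integral_const_mul, ← integral_const_mul]
        congr 1; funext y; ring
    _ = ∫ ξ, ∫ τ, C0 * (Complex.exp (-(Complex.I *
          ((inner ℝ (x - (2 * Real.pi * τ) • y) ξ : ℝ) : ℂ))) * (halfKer ε N τ * g ξ)) :=
        integral_integral_swap (key.const_mul _)
    _ = _ := by
        rw [← integral_const_mul]
        refine integral_congr_ae (Eventually.of_forall fun ξ => ?_)
        simp only
        rw [← integral_halfKer_mul_exp hε hN, ← integral_mul_const, ← integral_const_mul,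
          ← integral_const_mul]
        congr 1; funext τ
        rw [inner_sub_left, inner_smul_left]
        have : Complex.exp (-(Complex.I * (((inner ℝ x ξ -
            (starRingEnd ℝ) (2 * Real.pi * τ) * inner ℝ y ξ : ℝ)) : ℂ))) =
            Complex.exp (-(Complex.I * ((inner ℝ x ξ : ℝ) : ℂ))) *
            Complex.exp (2 * Real.pi * τ * ((inner ℝ y ξ : ℝ) : ℂ) * Complex.I) := by
          rw [← Complex.exp_add]
          congr 1
          simp
          ring
        rw [this]
        ring

theorem bddSym_halfMult {ε N : ℝ} (hε : 0 < ε) (hN : 0 < N) (y : E3) :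
    BddSym fun ξ => (halfMult ε N (inner ℝ y ξ) : ℂ) := by
  refine ⟨Continuous.measurable ?_, 1, fun ξ => ?_⟩
  · exact Complex.continuous_ofReal.comp ((continuous_halfMult ε N).comp (by fun_prop))
  · rw [Complex.norm_real]; exact abs_halfMult_le hε hN _

/-- Uniformly bounded symbols converging almost everywhere give pointwise convergence of the
operators on Schwartz functions by domination, and Fatou's lemma carries the `L^p` bound to the
limit. -/
theorem LpBdd.of_tendsto {p : ℝ} {C : ℝ≥0} {m : ℕ → E3 → ℂ} {m' : E3 → ℂ} {M : ℝ}
    (hm : ∀ n, Measurable (m n)) (hM : ∀ n ξ, ‖m n ξ‖ ≤ M)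
    (h : ∀ n, LpBdd p C (m n)) (hlim : ∀ᵐ ξ, Tendsto (fun n => m n ξ) atTop (𝓝 (m' ξ))) :
    LpBdd p C m' := by
  intro φ
  refine (Lp.eLpNorm_lim_le_liminf_eLpNorm (f := fun (n : ℕ) => multOp (m n) φ)
    (fun n => (continuous_multOp ⟨hm n, M, hM n⟩ φ).aestronglyMeasurable) _
    (Eventually.of_forall fun x => ?_)).trans ?_
  · simp only [multOp, fhat_eq]
    refine Tendsto.const_mul _ ?_
    refine tendsto_integral_of_dominated_convergence (fun ξ => M * ‖ivS φ ξ‖)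
      (fun n => ?_) ((ivS φ).integrable.norm.const_mul M)
      (fun n => Eventually.of_forall fun ξ => ?_) ?_
    · exact (integrable_phase_mul (BddSym.integrable ⟨hm n, M, hM n⟩ φ) x).aestronglyMeasurable
    · rw [norm_mul, norm_phase, one_mul, norm_mul]
      gcongr
      exact hM n ξ
    · filter_upwards [hlim] with ξ hξ
      exact (hξ.mul_const _).const_mul _
  · refine liminf_le_of_le (by isBoundedDefault) fun b hb => ?_
    obtain ⟨n, hn⟩ := hb.exists
    exact hn.trans (h n φ)

/-- The indicator of the half space `y·ξ > 0`. -/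
def halfSpace (y ξ : E3) : ℂ := if 0 < (inner ℝ y ξ : ℝ) then 1 else 0

theorem halfMult_tendsto (s : ℝ) :
    Tendsto (fun n : ℕ => halfMult (1 / ((n : ℝ) + 1)) ((n : ℝ) + 1) s) atTop
      (𝓝 (if 0 < s then 1 else 0)) := by
  by_cases hs : 0 < s
  · simp only [halfMult, hs, max_eq_left hs.le, if_true]
    have h1 : Tendsto (fun n : ℕ => Real.exp (-(1 / ((n : ℝ) + 1)) * s)) atTop (𝓝 1) := by
      have : Tendsto (fun n : ℕ => -(1 / ((n : ℝ) + 1)) * s) atTop (𝓝 (-0 * s)) :=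
        (tendsto_one_div_add_atTop_nhds_zero_nat.neg).mul_const s
      simpa [Function.comp_def] using (Real.continuous_exp.tendsto _).comp this
    have h2 : Tendsto (fun n : ℕ => Real.exp (-((n : ℝ) + 1) * s)) atTop (𝓝 0) := by
      refine Real.tendsto_exp_atBot.comp ?_
      have : Tendsto (fun n : ℕ => ((n : ℝ) + 1) * s) atTop atTop :=
        (tendsto_natCast_atTop_atTop.atTop_add tendsto_const_nhds).atTop_mul_const hs
      refine (tendsto_neg_atTop_atBot.comp this).congr fun n => ?_
      simp only [Function.comp_apply]; ring
    simpa using h1.sub h2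
  · simp [halfMult, hs, max_eq_right (not_lt.1 hs)]

/-- Smoothed half-line multipliers with `ε = 1/(n+1)` and `N = n+1` converge to the indicator of the
half space, with bounds independent of `n` and `y`. The extra symbol `m` is carried along so that
such bounds can be iterated, the composite operator acting on functions that need not be Schwartz.
-/
theorem exists_lpBdd_halfSpace_mul {p : ℝ} (hp1 : 1 < p) (hp2 : p ≤ 2) :
    ∃ K : ℝ≥0, ∀ (y : E3), y ≠ 0 → ∀ (C : ℝ≥0) (m : E3 → ℂ), BddSym m → LpBdd p C m →
      LpBdd p (K * C) fun ξ => halfSpace y ξ * m ξ := by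
  obtain ⟨K, hK⟩ := exists_eLpNorm_dirConv_le hp1 hp2
  refine ⟨K, fun y hy C m hm hC => ?_⟩
  obtain ⟨M, hM⟩ := hm.2
  have hpos : ∀ n : ℕ, (0 : ℝ) < 1 / ((n : ℝ) + 1) := fun n => by positivity
  have hpos' : ∀ n : ℕ, (0 : ℝ) < (n : ℝ) + 1 := fun n => by positivity
  refine LpBdd.of_tendsto (m := fun n ξ =>
    (halfMult (1 / ((n : ℝ) + 1)) ((n : ℝ) + 1) (inner ℝ y ξ) : ℂ) * m ξ) (M := 1 * M)
    (fun n => ((bddSym_halfMult (hpos n) (hpos' n) y).mul hm).1) (fun n ξ => ?_) (fun n φ => ?_)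
    (Eventually.of_forall fun ξ => ?_)
  · rw [norm_mul, Complex.norm_real]
    have := abs_halfMult_le (hpos n) (hpos' n) (inner ℝ y ξ)
    gcongr
    · exact this
    · exact hM ξ
  · have e : multOp (fun ξ => (halfMult (1 / ((n : ℝ) + 1)) ((n : ℝ) + 1) (inner ℝ y ξ) : ℂ) * m ξ) φ
        = dirConv (1 / ((n : ℝ) + 1)) ((n : ℝ) + 1) y (multOp m φ) := by
      rw [multOp, multOp, dirConv_fhat (hpos n) (hpos' n) y (hm.integrable φ)]
      congr 1; funext ξ; ring
    rw [e]
    refine (hK _ _ (hpos n) (hpos' n) y hy _ _ (continuous_multOp hm φ)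
      (fun t => norm_fhat_le _ t)).trans ?_
    push_cast
    rw [mul_assoc]
    gcongr
    exact hC φ
  · refine Tendsto.mul_const _ ?_
    have := (Complex.continuous_ofReal.tendsto _).comp (halfMult_tendsto (inner ℝ y ξ))
    simp only [halfSpace]
    convert! this using 2
    split_ifs <;> simp

/-! ### Averages of multipliers -/

/-- By Fubini the operator of an averaged symbol is the average of the operators, and Minkowski's
inequality bounds it by the mass of the weight. -/
theorem LpBdd.average {p : ℝ} (hp1 : 1 < p) {C : ℝ≥0} {w : E3 → ℂ} (hw : Integrable w)
    {m : E3 → E3 → ℂ} (hm : Measurable (Function.uncurry m))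
    {M : ℝ} (hM : ∀ y ξ, ‖m y ξ‖ ≤ M) (h : ∀ᵐ y, LpBdd p C (m y)) :
    LpBdd p ((∫⁻ y, ‖w y‖ₑ).toNNReal * C) fun ξ => ∫ y, w y * m y ξ := by
  have hp0 : 0 < p := by linarith
  intro φ
  have hW : ∫⁻ y, ‖w y‖ₑ ≠ ⊤ := hw.2.ne
  have hφ : Integrable (ivS φ) := (ivS φ).integrable
  have hint : ∀ x : E3, Integrable (fun z : E3 × E3 =>
      Complex.exp (-(Complex.I * ((inner ℝ x z.2 : ℝ) : ℂ))) * (m z.1 z.2 * (w z.1 * ivS φ z.2)))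
      (volume.prod volume) := by
    intro x
    refine Integrable.bdd_mul (c := 1) ?_ (Continuous.aestronglyMeasurable (by fun_prop))
      (Eventually.of_forall fun x => (norm_phase _).le)
    exact (hw.mul_prod hφ).bdd_mul hm.aestronglyMeasurable (Eventually.of_forall fun z => hM _ _)
  have hrep : ∀ x, multOp (fun ξ => ∫ y, w y * m y ξ) φ x = ∫ y, w y * multOp (m y) φ x := by
    intro x
    simp only [multOp, fhat_eq]
    calc _ = ∫ ξ, ∫ y, C0 * (Complex.exp (-(Complex.I * ((inner ℝ x ξ : ℝ) : ℂ))) *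
            (m y ξ * (w y * ivS φ ξ))) := by
          rw [← integral_const_mul]
          refine integral_congr_ae (Eventually.of_forall fun ξ => ?_)
          simp only
          rw [← integral_mul_const, ← integral_const_mul, ← integral_const_mul]
          congr 1; funext y; ring
      _ = ∫ y, ∫ ξ, C0 * (Complex.exp (-(Complex.I * ((inner ℝ x ξ : ℝ) : ℂ))) *
            (m y ξ * (w y * ivS φ ξ))) :=
          (integral_integral_swap ((hint x).const_mul _)).symm
      _ = _ := by
          refine integral_congr_ae (Eventually.of_forall fun y => ?_)
          simp only
          rw [← integral_const_mul, ← integral_const_mul]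
          congr 1; funext ξ; ring
  have hmeas : AEStronglyMeasurable (fun z : E3 × E3 => multOp (m z.2) φ z.1)
      (volume.prod volume) := by
    simp only [multOp, fhat_eq]
    refine AEStronglyMeasurable.const_mul ?_ _
    refine AEStronglyMeasurable.integral_prod_right' (f := fun z : (E3 × E3) × E3 =>
      Complex.exp (-(Complex.I * ((inner ℝ z.1.1 z.2 : ℝ) : ℂ))) * (m z.1.2 z.2 * ivS φ z.2)) ?_
    have h1 : AEStronglyMeasurable (fun z : (E3 × E3) × E3 => m z.1.2 z.2)
        ((volume.prod volume).prod volume) :=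
      (hm.comp ((measurable_snd.comp measurable_fst).prodMk measurable_snd)).aestronglyMeasurable
    refine AEStronglyMeasurable.mul (Continuous.aestronglyMeasurable (by fun_prop))
      (h1.mul (Continuous.aestronglyMeasurable ?_))
    exact (ivS φ).continuous.comp continuous_snd
  rw [eLpNorm_ofReal_le_iff hp0]
  have key := lintegral_lintegral_mul_rpow_le (μ := (volume : Measure E3))
    (ν := (volume : Measure E3)) hp1.le (w := fun y => ‖w y‖ₑ)
    (h := fun x y => ‖multOp (m y) φ x‖ₑ) (M := (C : ℝ≥0∞) ^ p * ∫⁻ t, ‖φ t‖ₑ ^ p)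
    hw.aestronglyMeasurable.enorm hmeas.enorm (by
      filter_upwards [h] with y hy
      exact (eLpNorm_ofReal_le_iff hp0).1 (hy φ))
  refine (lintegral_mono fun x => ?_).trans (key.trans (le_of_eq ?_))
  · gcongr
    rw [hrep]
    refine (enorm_integral_le_lintegral_enorm _).trans (le_of_eq ?_)
    simp_rw [enorm_mul]
  · rw [ENNReal.coe_mul, ENNReal.coe_toNNReal hW, ENNReal.mul_rpow_of_nonneg _ _ hp0.le, mul_assoc]

theorem measurable_halfSpace : Measurable (Function.uncurry halfSpace) := by
  refine Measurable.ite ?_ measurable_const measurable_const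
  exact measurableSet_lt measurable_const (by fun_prop)

theorem norm_halfSpace_le (y ξ : E3) : ‖halfSpace y ξ‖ ≤ 1 := by
  unfold halfSpace; split_ifs <;> simp

theorem integrableOn_ball_of_continuous {f : E3 → ℝ} (hf : Continuous f) :
    IntegrableOn f (Metric.ball 0 1) :=
  (hf.continuousOn.integrableOn_compact (isCompact_closedBall 0 1)).mono_set
    Metric.ball_subset_closedBall

/-- `∫_{|y| < 1} (y·u)₊ dy` for a unit vector `u`. -/
def halfMoment : ℝ := ∫ y in Metric.ball (0 : E3) 1, max (inner ℝ y (EuclideanSpace.single 0 1)) 0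

theorem setIntegral_ball_comp_isometry (A : E3 ≃ₗᵢ[ℝ] E3) (f : E3 → ℝ) :
    ∫ y in Metric.ball (0 : E3) 1, f (A y) = ∫ y in Metric.ball (0 : E3) 1, f y := by
  have := A.measurePreserving.setIntegral_preimage_emb
    A.toHomeomorph.measurableEmbedding f (Metric.ball 0 1)
  rw [← this]
  congr 2
  ext y
  simp

theorem halfMoment_eq {u : E3} (hu : ‖u‖ = 1) :
    ∫ y in Metric.ball (0 : E3) 1, max (inner ℝ y u) 0 = halfMoment := by
  obtain ⟨A, hA⟩ := exists_reflection (y := u) (v := EuclideanSpace.single 0 1) (by simp [hu])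
  rw [halfMoment, ← setIntegral_ball_comp_isometry A]
  simp_rw [← hA, LinearIsometryEquiv.inner_map_map]

theorem halfMoment_pos : 0 < halfMoment := by
  set u : E3 := EuclideanSpace.single 0 1 with hu
  have hnu : ‖u‖ = 1 := by simp [hu]
  have hc : Continuous fun y : E3 => max (inner ℝ y u : ℝ) 0 := by fun_prop
  have h0 : 0 ≤ᵐ[volume.restrict (Metric.ball (0 : E3) 1)] fun y : E3 => max (inner ℝ y u : ℝ) 0 :=
    Eventually.of_forall fun y => le_max_right _ _
  rw [halfMoment, setIntegral_pos_iff_support_of_nonneg_ae h0 (integrableOn_ball_of_continuous hc)]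
  have hopen : IsOpen ({y : E3 | 0 < (inner ℝ y u : ℝ)} ∩ Metric.ball 0 1) :=
    (isOpen_lt continuous_const (by fun_prop)).inter Metric.isOpen_ball
  refine (hopen.measure_pos volume ⟨(1 / 2 : ℝ) • u, ?_, ?_⟩).trans_le (measure_mono ?_)
  · simp [inner_smul_left, hnu]
  · simp [norm_smul, hnu]; norm_num
  · rintro y ⟨hy, hy'⟩
    refine ⟨?_, hy'⟩
    have : (0 : ℝ) < inner ℝ y u := hy
    simp only [Function.mem_support]
    rw [max_eq_left this.le]
    exact this.ne'

/-- Split `v` into its part along `u` and its part orthogonal to `u`. The reflection that reverses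
the orthogonal part preserves both the ball and the half space, so that part integrates to zero. The
part along `u` gives the half moment. -/
theorem integral_halfSpace_inner {u : E3} (hu : ‖u‖ = 1) (v : E3) :
    ∫ y in Metric.ball (0 : E3) 1, (if 0 < (inner ℝ y u : ℝ) then (inner ℝ y v : ℝ) else 0) =
      halfMoment * inner ℝ u v := by
  have hmeas : MeasurableSet {y : E3 | 0 < (inner ℝ y u : ℝ)} :=
    measurableSet_lt measurable_const (by fun_prop)
  have hint : ∀ v : E3, IntegrableOn
      (fun y : E3 => if 0 < (inner ℝ y u : ℝ) then (inner ℝ y v : ℝ) else 0)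
      (Metric.ball 0 1) := by
    intro v
    have h1 : IntegrableOn (fun y : E3 => (inner ℝ y v : ℝ)) (Metric.ball 0 1) :=
      integrableOn_ball_of_continuous (by fun_prop)
    exact Integrable.indicator h1 hmeas
  have hperp : ∀ v : E3, (inner ℝ u v : ℝ) = 0 →
      ∫ y in Metric.ball (0 : E3) 1,
        (if 0 < (inner ℝ y u : ℝ) then (inner ℝ y v : ℝ) else 0) = 0 := by
    intro v hv
    set A := Submodule.reflection (ℝ ∙ v)ᗮ with hA
    have hAv : A v = -v := Submodule.reflection_orthogonalComplement_singleton_eq_neg v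
    have hAu : A u = u := by
      rw [hA, Submodule.reflection_eq_self_iff, Submodule.mem_orthogonal_singleton_iff_inner_right,
        real_inner_comm, hv]
    have h1 := setIntegral_ball_comp_isometry A
      (fun y => if 0 < (inner ℝ y u : ℝ) then (inner ℝ y v : ℝ) else 0)
    have h2 : ∀ y, (inner ℝ (A y) u : ℝ) = inner ℝ y u := fun y => by
      conv_lhs => rw [← hAu]
      exact A.inner_map_map y u
    have h3 : ∀ y, (inner ℝ (A y) v : ℝ) = -inner ℝ y v := fun y => by
      have := A.inner_map_map y v
      rw [hAv, inner_neg_right] at this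
      linarith
    simp only [h2, h3] at h1
    have h4 : ∀ y : E3, (if 0 < (inner ℝ y u : ℝ) then -(inner ℝ y v : ℝ) else 0) =
        -(if 0 < (inner ℝ y u : ℝ) then (inner ℝ y v : ℝ) else 0) := by
      intro y; split_ifs <;> simp
    simp only [h4, integral_neg] at h1
    linarith
  have hdec : v = (inner ℝ u v : ℝ) • u + (v - (inner ℝ u v : ℝ) • u) := by abel
  have hvp : (inner ℝ u (v - (inner ℝ u v : ℝ) • u) : ℝ) = 0 := by
    rw [inner_sub_right, inner_smul_right, real_inner_self_eq_norm_sq, hu]; ring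
  have e : ∀ y : E3, (if 0 < (inner ℝ y u : ℝ) then (inner ℝ y v : ℝ) else 0) =
      (inner ℝ u v : ℝ) * max (inner ℝ y u) 0 +
      (if 0 < (inner ℝ y u : ℝ) then (inner ℝ y (v - (inner ℝ u v : ℝ) • u) : ℝ) else 0) := by
    intro y
    split_ifs with h
    · rw [max_eq_left h.le, inner_sub_right, inner_smul_right]; ring
    · rw [max_eq_right (not_lt.1 h)]; ring
  have hmax : IntegrableOn (fun y : E3 => max (inner ℝ y u : ℝ) 0) (Metric.ball 0 1) :=
    integrableOn_ball_of_continuous (by fun_prop)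
  simp_rw [e]
  rw [integral_add (hmax.const_mul _) (hint _), hperp _ hvp, integral_const_mul, halfMoment_eq hu]
  ring

/-- The symbol `ξ_j / |ξ|` of a Riesz transform. -/
def riesz (j : Fin 3) (ξ : E3) : ℂ := ((ξ j / ‖ξ‖ : ℝ) : ℂ)

theorem norm_riesz_le (j : Fin 3) (ξ : E3) : ‖riesz j ξ‖ ≤ 1 := by
  rw [riesz, Complex.norm_real, norm_div, norm_norm]
  exact div_le_one_of_le₀ (PiLp.norm_apply_le ξ j) (norm_nonneg _)

theorem measurable_riesz (j : Fin 3) : Measurable (riesz j) := by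
  unfold riesz
  exact Complex.measurable_ofReal.comp (Measurable.div (by fun_prop) measurable_norm)

theorem bddSym_riesz (j : Fin 3) : BddSym (riesz j) :=
  ⟨measurable_riesz j, 1, norm_riesz_le j⟩

theorem riesz_eq_integral (j : Fin 3) {ξ : E3} (hξ : ξ ≠ 0) :
    ∫ y, (Metric.ball (0 : E3) 1).indicator (fun y => (y j : ℂ)) y * halfSpace y ξ =
      halfMoment * riesz j ξ := by
  have hn : 0 < ‖ξ‖ := norm_pos_iff.2 hξ
  set u : E3 := ‖ξ‖⁻¹ • ξ with hu
  have hnu : ‖u‖ = 1 := by rw [hu, norm_smul, norm_inv, norm_norm, inv_mul_cancel₀ hn.ne']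
  have h1 := integral_halfSpace_inner hnu (EuclideanSpace.single j 1)
  have h2 : (inner ℝ u (EuclideanSpace.single j 1) : ℝ) = ξ j / ‖ξ‖ := by
    rw [EuclideanSpace.inner_single_right]
    simp [hu]
    ring
  rw [h2] at h1
  rw [riesz, ← Complex.ofReal_mul, ← h1, ← integral_complex_ofReal,
    ← integral_indicator measurableSet_ball]
  refine integral_congr_ae (Eventually.of_forall fun y => ?_)
  by_cases hy : y ∈ Metric.ball (0 : E3) 1
  · simp only [Set.indicator_of_mem hy, halfSpace]
    have h3 : (0 < (inner ℝ y u : ℝ)) ↔ 0 < (inner ℝ y ξ : ℝ) := by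
      rw [hu, inner_smul_right]
      constructor
      · intro h; by_contra h'
        push Not at h'
        have : ‖ξ‖⁻¹ * inner ℝ y ξ ≤ 0 := mul_nonpos_of_nonneg_of_nonpos (by positivity) h'
        linarith
      · intro h; positivity
    by_cases h : 0 < (inner ℝ y ξ : ℝ)
    · rw [if_pos h, if_pos (h3.2 h), EuclideanSpace.inner_single_right]; simp
    · rw [if_neg h, if_neg (fun h' => h (h3.1 h'))]; simp
  · simp [Set.indicator_of_notMem hy]

/-- Up to the positive constant `halfMoment`, the Riesz symbol is the average of half space
indicators over the unit ball with weight `y_j` (`riesz_eq_integral`). As with half spaces, a factor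
`m` is retained to permit products. -/
theorem exists_lpBdd_riesz_mul {p : ℝ} (hp1 : 1 < p) (hp2 : p ≤ 2) :
    ∃ K : ℝ≥0, ∀ (j : Fin 3) (C : ℝ≥0) (m : E3 → ℂ), BddSym m → LpBdd p C m →
      LpBdd p (K * C) fun ξ => riesz j ξ * m ξ := by
  obtain ⟨K, hK⟩ := exists_lpBdd_halfSpace_mul hp1 hp2
  set w : Fin 3 → E3 → ℂ := fun j => (Metric.ball (0 : E3) 1).indicator (fun y => (y j : ℂ)) with hw
  have hwi : ∀ j, Integrable (w j) := by
    intro j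
    rw [hw, integrable_indicator_iff measurableSet_ball]
    exact (integrableOn_ball_of_continuous (f := fun y : E3 => y j) (by fun_prop)).ofReal
  set W : ℝ≥0 := ∑ j, (∫⁻ y, ‖w j y‖ₑ).toNNReal with hW
  refine ⟨‖(halfMoment : ℂ)⁻¹‖₊ * (W * K), fun j C m hm hC => ?_⟩
  obtain ⟨M, hM⟩ := hm.2
  have hav := LpBdd.average hp1 (hwi j) (m := fun y ξ => halfSpace y ξ * m ξ) (C := K * C)
    (M := 1 * M) ?_ (fun y ξ => ?_) ?_
  · have h1 := hav.const_mul (halfMoment : ℂ)⁻¹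
    have h2 := h1.congr (n := fun ξ => riesz j ξ * m ξ) ?_
    · intro φ
      refine (h2 φ).trans ?_
      gcongr ?_ * _
      have : (∫⁻ y, ‖w j y‖ₑ).toNNReal ≤ W :=
        Finset.single_le_sum (f := fun j => (∫⁻ y, ‖w j y‖ₑ).toNNReal)
          (fun _ _ => zero_le) (Finset.mem_univ j)
      refine ENNReal.coe_le_coe.2 ?_
      calc _ ≤ ‖(halfMoment : ℂ)⁻¹‖₊ * (W * (K * C)) := by gcongr
        _ = _ := by ring
    · have h0 : ∀ᵐ ξ : E3, ξ ≠ 0 := by simp [ae_iff]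
      filter_upwards [h0] with ξ hξ
      simp_rw [← mul_assoc]
      rw [integral_mul_const, riesz_eq_integral j hξ]
      have : (halfMoment : ℂ) ≠ 0 := by exact_mod_cast halfMoment_pos.ne'
      field_simp
  · exact measurable_halfSpace.mul (hm.1.comp measurable_snd)
  · rw [norm_mul]
    gcongr
    · exact norm_halfSpace_le y ξ
    · exact hM ξ
  · have h0 : ∀ᵐ ξ : E3, ξ ≠ 0 := by simp [ae_iff]
    filter_upwards [h0] with y hy
    exact hK y hy C m hm hC

/-! ### Duality -/

theorem one_le_ofReal {p : ℝ} (hp : 1 < p) : 1 ≤ ENNReal.ofReal p := by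
  rw [← ENNReal.ofReal_one]; exact ENNReal.ofReal_le_ofReal hp.le

theorem holderTriple_ofReal {p q : ℝ} (hpq : p.HolderConjugate q) :
    ENNReal.HolderTriple (ENNReal.ofReal p) (ENNReal.ofReal q) 1 := by
  constructor
  have := hpq.inv_add_inv_eq_one
  rw [← ENNReal.ofReal_inv_of_pos hpq.pos, ← ENNReal.ofReal_inv_of_pos hpq.symm.pos,
    ← ENNReal.ofReal_add (by have := hpq.pos; positivity) (by have := hpq.symm.pos; positivity),
    this]
  simp

theorem enorm_integral_mul_le {p q : ℝ} (hpq : p.HolderConjugate q) {f g : E3 → ℂ}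
    (hf : AEStronglyMeasurable f volume) (hg : AEStronglyMeasurable g volume) :
    ‖∫ x, f x * g x‖ₑ ≤
      eLpNorm f (ENNReal.ofReal p) volume * eLpNorm g (ENNReal.ofReal q) volume := by
  refine (enorm_integral_le_lintegral_enorm _).trans ?_
  rw [eLpNorm_ofReal_eq hpq.pos, eLpNorm_ofReal_eq hpq.symm.pos]
  simp_rw [enorm_mul]
  exact ENNReal.lintegral_mul_le_Lp_mul_Lq _ hpq hf.enorm hg.enorm

theorem integrable_mul_of_memLp {p q : ℝ} (hpq : p.HolderConjugate q) {f g : E3 → ℂ}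
    (hf : MemLp f (ENNReal.ofReal p)) (hg : MemLp g (ENNReal.ofReal q)) :
    Integrable fun x => f x * g x := by
  have := holderTriple_ofReal hpq
  have h : MemLp (f * g) 1 volume := MemLp.mul' hg hf
  exact memLp_one_iff_integrable.1 h

theorem exists_schwartz_approx {p : ℝ} (hp : 1 < p) {g : E3 → ℂ}
    (hg : MemLp g (ENNReal.ofReal p)) {δ : ℝ≥0∞} (hδ : δ ≠ 0) :
    ∃ φ : 𝓢(E3, ℂ), eLpNorm (g - (φ : E3 → ℂ)) (ENNReal.ofReal p) volume < δ := by
  have : Fact (1 ≤ ENNReal.ofReal p) := ⟨one_le_ofReal hp⟩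
  have hd := SchwartzMap.denseRange_toLpCLM (E := E3) (F := ℂ) (p := ENNReal.ofReal p) (μ := volume)
    (by simp)
  obtain ⟨y, ⟨φ, hφ⟩, hy⟩ := EMetric.mem_closure_iff.1 (hd (hg.toLp g)) δ hδ.bot_lt
  refine ⟨φ, ?_⟩
  rw [← hφ, Lp.edist_def] at hy
  refine lt_of_le_of_lt (le_of_eq (eLpNorm_congr_ae ?_)) hy
  filter_upwards [hg.coeFn_toLp, φ.coeFn_toLp (ENNReal.ofReal p) volume] with x h1 h2
  simp only [Pi.sub_apply, SchwartzMap.toLpCLM_apply]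
  rw [h1, h2]

/-- Schwartz functions are dense in `L^q`. The a priori finiteness of the `L^p` norm of `h` controls
the approximation error by Hölder and disappears in the limit. -/
theorem enorm_integral_mul_le_of_schwartz {p q : ℝ} (hpq : p.HolderConjugate q) {h : E3 → ℂ}
    (hh : MemLp h (ENNReal.ofReal p)) {K : ℝ≥0∞} (hK : K ≠ ⊤)
    (hs : ∀ φ : 𝓢(E3, ℂ), ‖∫ x, h x * φ x‖ₑ ≤ K * eLpNorm φ (ENNReal.ofReal q) volume)
    {ψ : E3 → ℂ} (hψ : MemLp ψ (ENNReal.ofReal q)) :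
    ‖∫ x, h x * ψ x‖ₑ ≤ K * eLpNorm ψ (ENNReal.ofReal q) volume := by
  have hq1 := one_le_ofReal hpq.symm.lt
  set P := eLpNorm h (ENNReal.ofReal p) volume
  have hP : P ≠ ⊤ := hh.2.ne
  have key : ∀ δ : ℝ≥0, 0 < δ → ‖∫ x, h x * ψ x‖ₑ ≤
      K * eLpNorm ψ (ENNReal.ofReal q) volume + (K + P) * δ := by
    intro δ hδ
    obtain ⟨φ, hφ⟩ := exists_schwartz_approx hpq.symm.lt hψ (δ := δ) (by exact_mod_cast hδ.ne')
    have hφm : MemLp φ (ENNReal.ofReal q) := φ.memLp _ _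
    have e : ∫ x, h x * ψ x = (∫ x, h x * φ x) + ∫ x, h x * (ψ - (φ : E3 → ℂ)) x := by
      rw [← integral_add (integrable_mul_of_memLp hpq hh hφm)
        (integrable_mul_of_memLp hpq hh (hψ.sub hφm))]
      congr 1; funext x; simp; ring
    have h1 : eLpNorm φ (ENNReal.ofReal q) volume ≤ eLpNorm ψ (ENNReal.ofReal q) volume + δ := by
      have : (φ : E3 → ℂ) = ψ - (ψ - (φ : E3 → ℂ)) := by abel
      rw [this]
      refine (eLpNorm_sub_le hψ.1 (hψ.sub hφm).1 hq1).trans ?_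
      gcongr
    rw [e]
    calc _ ≤ ‖∫ x, h x * φ x‖ₑ + ‖∫ x, h x * (ψ - (φ : E3 → ℂ)) x‖ₑ := enorm_add_le _ _
      _ ≤ K * (eLpNorm ψ (ENNReal.ofReal q) volume + δ) + P * δ := by
          refine add_le_add ((hs φ).trans (by gcongr)) ?_
          refine (enorm_integral_mul_le hpq hh.1 (hψ.sub hφm).1).trans ?_
          gcongr
      _ = _ := by ring
  refine le_of_tendsto_of_tendsto (b := 𝓝[>] (0 : ℝ≥0)) tendsto_const_nhds (f := fun _ => _)
    (g := fun δ : ℝ≥0 => K * eLpNorm ψ (ENNReal.ofReal q) volume + (K + P) * δ) ?_ ?_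
  · have h1 : Tendsto (fun δ : ℝ≥0 => (δ : ℝ≥0∞)) (𝓝[>] (0 : ℝ≥0)) (𝓝 0) :=
      (ENNReal.continuous_coe.tendsto' 0 0 (by simp)).mono_left nhdsWithin_le_nhds
    have h2 := ENNReal.Tendsto.const_mul (a := K + P) h1 (Or.inr (by simp [hK, hP]))
    simpa using tendsto_const_nhds.add h2
  · filter_upwards [self_mem_nhdsWithin] with δ hδ using key δ hδ

/-- The converse of Hölder, by testing with the extremal function. Finiteness of the norm is assumed
beforehand because one power of it is cancelled at the end. -/
theorem eLpNorm_le_of_schwartz_dual {p q : ℝ} (hpq : p.HolderConjugate q) {h : E3 → ℂ}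
    (hh : MemLp h (ENNReal.ofReal p)) {K : ℝ≥0∞} (hK : K ≠ ⊤)
    (hs : ∀ φ : 𝓢(E3, ℂ), ‖∫ x, h x * φ x‖ₑ ≤ K * eLpNorm φ (ENNReal.ofReal q) volume) :
    eLpNorm h (ENNReal.ofReal p) volume ≤ K := by
  have hp := hpq.pos
  have hq := hpq.symm.pos
  have hp1 := hpq.lt
  -- The extremal function `|h|^(p-2) h̄`: then `hψ = |h|^p` and `|ψ|^q = |h|^p`.
  set ψ : E3 → ℂ := fun x => ((‖h x‖ ^ (p - 2) : ℝ) : ℂ) * (starRingEnd ℂ) (h x) with hψ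
  have hmul : ∀ x, h x * ψ x = ((‖h x‖ ^ p : ℝ) : ℂ) := by
    intro x
    simp only [hψ]
    rw [mul_left_comm, Complex.mul_conj, ← Complex.ofReal_mul, Complex.normSq_eq_norm_sq]
    congr 1
    by_cases h0 : ‖h x‖ = 0
    · rw [h0, Real.zero_rpow hp.ne']; simp
    · rw [← Real.rpow_natCast, ← Real.rpow_add (lt_of_le_of_ne (norm_nonneg _) (Ne.symm h0))]
      norm_num
  have hnorm : ∀ x, ‖ψ x‖ₑ ^ q = ‖h x‖ₑ ^ p := by
    intro x
    have h1 : ‖ψ x‖ = ‖h x‖ ^ (p - 1) := by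
      simp only [hψ]
      rw [norm_mul, Complex.norm_real, RCLike.norm_conj, Real.norm_of_nonneg (by positivity)]
      by_cases h0 : ‖h x‖ = 0
      · rw [h0, mul_zero, Real.zero_rpow (by linarith)]
      · rw [← Real.rpow_add_one h0]
        congr 1; ring
    rw [← ofReal_norm, h1, ← ofReal_norm, ENNReal.ofReal_rpow_of_nonneg (by positivity) hq.le,
      ENNReal.ofReal_rpow_of_nonneg (by positivity) hp.le, ← Real.rpow_mul (norm_nonneg _),
      hpq.sub_one_mul_conj]
  set I := ∫⁻ x, ‖h x‖ₑ ^ p with hI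
  have hIfin : I ≠ ⊤ := by
    have := hh.2
    rw [eLpNorm_ofReal_eq hp] at this
    intro h'
    rw [← hI, h', ENNReal.top_rpow_of_pos (by positivity)] at this
    exact lt_irrefl _ this
  have hψn : eLpNorm ψ (ENNReal.ofReal q) volume = I ^ (1 / q) := by
    rw [eLpNorm_ofReal_eq hq]
    simp_rw [hnorm]
    rfl
  have hψm : AEStronglyMeasurable ψ volume := by
    have h1 : AEStronglyMeasurable (fun x => ‖h x‖ ^ (p - 2)) volume :=
      (hh.1.norm.aemeasurable.pow_const _).aestronglyMeasurable
    exact (Complex.continuous_ofReal.comp_aestronglyMeasurable h1).mul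
      (Complex.continuous_conj.comp_aestronglyMeasurable hh.1)
  have hψL : MemLp ψ (ENNReal.ofReal q) := ⟨hψm, by
    rw [hψn]; exact ENNReal.rpow_lt_top_of_nonneg (by positivity) hIfin⟩
  have hint : ‖∫ x, h x * ψ x‖ₑ = I := by
    simp_rw [hmul]
    rw [integral_complex_ofReal, ← ofReal_norm, Complex.norm_real,
      Real.norm_of_nonneg (integral_nonneg fun x => by positivity), ofReal_integral_eq_lintegral_ofReal]
    · refine lintegral_congr fun x => ?_
      rw [← ENNReal.ofReal_rpow_of_nonneg (norm_nonneg _) hp.le, ofReal_norm]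
    · have := hh.integrable_norm_rpow (by simpa using hp) (by simp)
      rwa [ENNReal.toReal_ofReal hp.le] at this
    · exact Eventually.of_forall fun x => by positivity
  have main := enorm_integral_mul_le_of_schwartz hpq hh hK hs hψL
  rw [hint, hψn] at main
  rw [eLpNorm_ofReal_eq hp, ← hI]
  by_cases h0 : I = 0
  · rw [h0, ENNReal.zero_rpow_of_pos (by positivity)]; exact zero_le
  have hpos : I ^ (1 / q) ≠ 0 := by
    simp [ENNReal.rpow_eq_zero_iff, h0, hIfin]
  have hfin : I ^ (1 / q) ≠ ⊤ := ENNReal.rpow_ne_top_of_nonneg (by positivity) hIfin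
  have e : I = I ^ (1 / p) * I ^ (1 / q) := by
    rw [← ENNReal.rpow_add _ _ h0 hIfin]
    have := hpq.inv_add_inv_eq_one
    rw [one_div, one_div, this, ENNReal.rpow_one]
  exact (ENNReal.mul_le_mul_iff_left hpos hfin).1 (e.symm.le.trans main)

/-- The multiplication formula moves the transform to `ψ`, and the two transforms differ only by `ξ
↦ -ξ`. An even symbol therefore has a symmetric operator, which is why odd symbols are kept out of
`LpMult`. -/
theorem integral_multOp_mul {m : E3 → ℂ} (hm : BddSym m) (heven : ∀ ξ, m (-ξ) = m ξ)
    (φ ψ : 𝓢(E3, ℂ)) : ∫ x, multOp m φ x * ψ x = ∫ x, multOp m ψ x * φ x := by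
  have h1 : ∀ φ ψ : 𝓢(E3, ℂ), ∫ x, multOp m φ x * ψ x = ∫ ξ, m ξ * ivS φ ξ * fhat ψ ξ :=
    fun φ ψ => integral_fhat_mul (hm.integrable φ) ψ.integrable
  rw [h1, h1, ← integral_neg_eq_self]
  refine integral_congr_ae (Eventually.of_forall fun ξ => ?_)
  simp only
  rw [heven, ← fhat_eq_ivS_neg, fhat_eq_ivS_neg ψ, neg_neg]
  ring

theorem MemLp.of_two_of_bounded {p : ℝ} (hp : 2 ≤ p) {h : E3 → ℂ} {M : ℝ}
    (hM : ∀ x, ‖h x‖ ≤ M) (h2 : MemLp h (ENNReal.ofReal 2)) : MemLp h (ENNReal.ofReal p) := by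
  have hp0 : 0 < p := by linarith
  refine ⟨h2.1, ?_⟩
  have h3 := h2.2
  rw [eLpNorm_ofReal_eq (by norm_num)] at h3
  have h4 : ∫⁻ x, ‖h x‖ₑ ^ (2 : ℝ) < ⊤ := by
    by_contra h'
    rw [not_lt_top_iff.1 h', ENNReal.top_rpow_of_pos (by norm_num)] at h3
    exact lt_irrefl _ h3
  rw [eLpNorm_ofReal_eq hp0]
  refine ENNReal.rpow_lt_top_of_nonneg (by positivity) (ne_of_lt ?_)
  have hb : ∀ x, ‖h x‖ₑ ^ p ≤ (ENNReal.ofReal M) ^ (p - 2) * ‖h x‖ₑ ^ (2 : ℝ) := by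
    intro x
    have : ‖h x‖ₑ ^ p = ‖h x‖ₑ ^ (p - 2) * ‖h x‖ₑ ^ (2 : ℝ) := by
      rw [← ENNReal.rpow_add_of_nonneg _ _ (by linarith) (by norm_num)]; congr 1; ring
    rw [this]
    gcongr
    rw [← ofReal_norm]
    exact ENNReal.ofReal_le_ofReal (hM x)
  refine (lintegral_mono hb).trans_lt ?_
  rw [lintegral_const_mul' _ _ (ENNReal.rpow_ne_top_of_nonneg (by linarith) ENNReal.ofReal_ne_top)]
  exact ENNReal.mul_lt_top (ENNReal.rpow_lt_top_of_nonneg (by linarith) ENNReal.ofReal_ne_top) h4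

/-- Symmetry and Hölder transfer the bound from `q` to `p`. The a priori membership in `L^p` comes
from the `L²` bound together with the boundedness of `multOp m φ`, and this is where `p ≥ 2` enters.
-/
theorem LpBdd.dual {p q : ℝ} (hpq : p.HolderConjugate q) (hp : 2 ≤ p) {m : E3 → ℂ} (hm : BddSym m)
    (heven : ∀ ξ, m (-ξ) = m ξ) {C C₂ : ℝ≥0} (h2 : LpBdd 2 C₂ m) (hq : LpBdd q C m) :
    LpBdd p C m := by
  intro φ
  have hc := continuous_multOp hm φ
  have hmem : MemLp (multOp m φ) (ENNReal.ofReal p) := by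
    refine MemLp.of_two_of_bounded hp (fun x => norm_fhat_le _ x) ⟨hc.aestronglyMeasurable, ?_⟩
    exact (h2 φ).trans_lt (ENNReal.mul_lt_top ENNReal.coe_lt_top (φ.memLp _ _).2)
  refine eLpNorm_le_of_schwartz_dual hpq hmem
    (ENNReal.mul_ne_top ENNReal.coe_ne_top (φ.memLp _ _).2.ne) fun ψ => ?_
  rw [integral_multOp_mul hm heven]
  refine (enorm_integral_mul_le hpq.symm (continuous_multOp hm ψ).aestronglyMeasurable
    φ.continuous.aestronglyMeasurable).trans ?_
  refine (mul_le_mul_left (hq ψ) _).trans (le_of_eq ?_)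
  ring

/-! ### Multipliers bounded on every `L^p` -/

/-- `m` is an even bounded symbol whose multiplier is bounded on `L^p` for `1 < p < ∞`. -/
structure LpMult (m : E3 → ℂ) : Prop where
  bdd : BddSym m
  even : ∀ ξ, m (-ξ) = m ξ
  bound : ∀ p : ℝ, 1 < p → ∃ C : ℝ≥0, LpBdd p C m

theorem LpMult.of_le_two {m : E3 → ℂ} (hm : BddSym m) (heven : ∀ ξ, m (-ξ) = m ξ)
    (h : ∀ p : ℝ, 1 < p → p ≤ 2 → ∃ C : ℝ≥0, LpBdd p C m) : LpMult m := by
  refine ⟨hm, heven, fun p hp => ?_⟩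
  rcases le_total p 2 with h2 | h2
  · exact h p hp h2
  · have hpq := Real.HolderConjugate.conjExponent hp
    obtain ⟨C, hC⟩ := h _ hpq.symm.lt (by
      rw [Real.conjExponent, div_le_iff₀ (by linarith)]; linarith)
    obtain ⟨C₂, hC₂⟩ := h 2 one_lt_two le_rfl
    exact ⟨C, hC₂.dual hpq h2 hm heven hC⟩

theorem riesz_neg (j : Fin 3) (ξ : E3) : riesz j (-ξ) = -riesz j ξ := by
  simp [riesz, neg_div]

/-- The symbol `ξ_i ξ_j / |ξ|²`. -/
def rr (i j : Fin 3) (ξ : E3) : ℂ := riesz i ξ * riesz j ξ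

/-- A single Riesz symbol is odd, but a product of two is even. It is bounded for `p ≤ 2` by
multiplying in one Riesz factor at a time, starting from the symbol `1`, and duality does the rest.
-/
theorem lpMult_rr (i j : Fin 3) : LpMult (rr i j) := by
  refine LpMult.of_le_two ((bddSym_riesz i).mul (bddSym_riesz j)) (fun ξ => ?_) fun p h1 h2 => ?_
  · simp [rr, riesz_neg]
  · obtain ⟨K, hK⟩ := exists_lpBdd_riesz_mul h1 h2
    have a1 : BddSym fun _ : E3 => (1 : ℂ) := ⟨measurable_const, 1, fun _ => by simp⟩
    have h3 := hK j 1 _ a1 (lpBdd_one p)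
    have h4 := hK i _ _ ((bddSym_riesz j).mul a1) h3
    exact ⟨_, h4.congr (Eventually.of_forall fun ξ => by simp [rr])⟩

theorem lpMult_rr_mul_rr (i j k l : Fin 3) : LpMult fun ξ => rr i j ξ * rr k l ξ := by
  refine LpMult.of_le_two ((lpMult_rr i j).bdd.mul (lpMult_rr k l).bdd) (fun ξ => ?_)
    fun p h1 h2 => ?_
  · simp [rr, riesz_neg]
  · obtain ⟨K, hK⟩ := exists_lpBdd_riesz_mul h1 h2
    obtain ⟨C, hC⟩ := (lpMult_rr k l).bound p h1
    have h3 := hK j _ _ (lpMult_rr k l).bdd hC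
    have h4 := hK i _ _ ((bddSym_riesz j).mul (lpMult_rr k l).bdd) h3
    exact ⟨_, h4.congr (Eventually.of_forall fun ξ => by simp [rr, mul_assoc])⟩

theorem isTempered_of_bounded {g : E3 → ℂ} (hg : AEStronglyMeasurable g volume) {M : ℝ}
    (hM : ∀ x, ‖g x‖ ≤ M) : IsTempered g := by
  refine ⟨4, ?_⟩
  have h1 : Integrable (fun x : E3 => (1 + ‖x‖) ^ (-(4 : ℝ))) :=
    integrable_one_add_norm (by simp; norm_num)
  have h2 : Integrable (fun x : E3 => ((1 + ‖x‖) ^ 4)⁻¹) := by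
    refine h1.congr (Eventually.of_forall fun x => ?_)
    simp only
    rw [Real.rpow_neg (by positivity)]
    norm_cast
  exact h2.smul_bdd M hg (Eventually.of_forall hM)

/-- Approximate `g` in `L^p` by Schwartz functions. Their images form a Cauchy sequence whose limit
represents the distribution: the pairing with `ψ` can be computed either with `g` against the
operator applied to `ψ` or with the images against `ψ`, by symmetry, and both converge by Hölder. -/
theorem LpMult.exists_finv {m : E3 → ℂ} (hm : LpMult m) {p : ℝ} (hp : 1 < p) :
    ∃ C : ℝ≥0, ∀ g : E3 → ℂ, Integrable g → MemLp g (ENNReal.ofReal p) →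
      ∃ h : E3 → ℂ, MemLp h (ENNReal.ofReal p) ∧
        eLpNorm h (ENNReal.ofReal p) volume ≤ C * eLpNorm g (ENNReal.ofReal p) volume ∧
        ∀ φ : 𝓢(E3, ℂ), finv (fun ξ => m ξ * fhat g ξ) φ = ∫ x, h x * φ x := by
  obtain ⟨C, hC⟩ := hm.bound p hp
  have hpq := Real.HolderConjugate.conjExponent hp
  set q := Real.conjExponent p
  obtain ⟨C', hC'⟩ := hm.bound q hpq.symm.lt
  have hp1 := one_le_ofReal hp
  have : Fact (1 ≤ ENNReal.ofReal p) := ⟨hp1⟩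
  refine ⟨C, fun g hgi hg => ?_⟩
  obtain ⟨M, hM⟩ := hm.bdd.2
  have hgc := continuous_fhat hgi
  have htemp : IsTempered (fun ξ => m ξ * fhat g ξ) := by
    refine isTempered_of_bounded (M := M * (C0 * ∫ x, ‖g x‖))
      (hm.bdd.1.aestronglyMeasurable.mul hgc.aestronglyMeasurable) fun ξ => ?_
    rw [norm_mul]
    have := (norm_nonneg _).trans (hM ξ)
    gcongr
    · exact hM ξ
    · exact norm_fhat_le g ξ
  have hB : ∀ n : ℕ, ((2 : ℝ≥0∞)⁻¹) ^ n ≠ 0 := fun n => pow_ne_zero _ (by simp)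
  choose φ hφ using fun n => exists_schwartz_approx hp hg (hB n)
  have hmem : ∀ n, MemLp (multOp m (φ n)) (ENNReal.ofReal p) := fun n =>
    ⟨(continuous_multOp hm.bdd _).aestronglyMeasurable,
      (hC _).trans_lt (ENNReal.mul_lt_top ENNReal.coe_lt_top ((φ n).memLp _ _).2)⟩
  have hφm : ∀ n, MemLp (φ n) (ENNReal.ofReal p) := fun n => (φ n).memLp _ _
  have hsub : ∀ n k, multOp m (φ n) - multOp m (φ k) = multOp m (φ n - φ k) := by
    intro n k
    have e : (fun ξ => m ξ * ivS (φ n - φ k) ξ) =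
        (fun ξ => m ξ * ivS (φ n) ξ) + (-1 : ℂ) • fun ξ => m ξ * ivS (φ k) ξ := by
      funext ξ
      have : ivS (φ n - φ k) = ivS (φ n) - ivS (φ k) := by
        unfold ivS
        rw [← smul_sub]
        congr 1
        rw [← map_sub]
        congr 1
        exact map_sub (FourierTransform.fourierInvCLM ℂ 𝓢(E3, ℂ)) (φ n) (φ k)
      rw [this]
      simp
      ring
    funext x
    rw [show multOp m (φ n - φ k) = fhat _ from rfl, e, fhat_add (hm.bdd.integrable _) ((hm.bdd.integrable _).smul _), fhat_smul]
    simp [multOp]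
    ring
  -- The factor `C + 1` instead of `C` makes the inequality strict, also when `C = 0`. The bounds
  -- form a geometric series, as the completeness statement requires.
  have hcau : ∀ N n k : ℕ, N ≤ n → N ≤ k → eLpNorm (multOp m (φ n) - multOp m (φ k))
      (ENNReal.ofReal p) volume < (C + 1) * (2 * (2 : ℝ≥0∞)⁻¹ ^ N) := by
    intro N n k hn hk
    rw [hsub]
    have hd : eLpNorm (φ n - φ k : 𝓢(E3, ℂ)) (ENNReal.ofReal p) volume ≤ 2 * (2 : ℝ≥0∞)⁻¹ ^ N := by
      have e : ((φ n - φ k : 𝓢(E3, ℂ)) : E3 → ℂ) = (g - (φ k : E3 → ℂ)) - (g - (φ n : E3 → ℂ)) := by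
        funext x; simp
      rw [e]
      refine (eLpNorm_sub_le (hg.sub (hφm k)).1 (hg.sub (hφm n)).1 hp1).trans ?_
      rw [two_mul]
      have hle : (2 : ℝ≥0∞)⁻¹ ≤ 1 := by simp
      refine add_le_add ((hφ k).le.trans ?_) ((hφ n).le.trans ?_)
      · exact pow_le_pow_right_of_le_one' hle hk
      · exact pow_le_pow_right_of_le_one' hle hn
    have hpos : (2 : ℝ≥0∞) * (2 : ℝ≥0∞)⁻¹ ^ N ≠ 0 := mul_ne_zero (by simp) (hB N)
    have hfin : (2 : ℝ≥0∞) * (2 : ℝ≥0∞)⁻¹ ^ N ≠ ⊤ := ENNReal.mul_ne_top (by simp) (by simp)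
    refine ((hC _).trans (mul_le_mul_right hd _)).trans_lt ?_
    refine ENNReal.mul_lt_mul_left hpos hfin ?_
    exact_mod_cast lt_add_one C
  obtain ⟨h, hh, hlim⟩ := Lp.cauchy_complete_eLpNorm hp1 hmem (B := fun N =>
    (C + 1) * (2 * (2 : ℝ≥0∞)⁻¹ ^ N)) (by
      simp_rw [← mul_assoc]
      rw [ENNReal.tsum_mul_left, ENNReal.tsum_geometric]
      exact ENNReal.mul_ne_top (ENNReal.mul_ne_top (by simp) (by simp)) (by simp)) hcau
  have hφlim : Tendsto (fun n => eLpNorm (g - (φ n : E3 → ℂ)) (ENNReal.ofReal p) volume) atTop (𝓝 0) :=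
    tendsto_of_tendsto_of_tendsto_of_le_of_le tendsto_const_nhds
      (ENNReal.tendsto_pow_atTop_nhds_zero_of_lt_one (by simp [ENNReal.inv_lt_one]))
      (fun n => zero_le) fun n => (hφ n).le
  refine ⟨h, hh, ?_, fun ψ => ?_⟩
  · have hb : ∀ n, eLpNorm h (ENNReal.ofReal p) volume ≤
        eLpNorm (multOp m (φ n) - h) (ENNReal.ofReal p) volume +
        C * (eLpNorm g (ENNReal.ofReal p) volume +
          eLpNorm (g - (φ n : E3 → ℂ)) (ENNReal.ofReal p) volume) := by
      intro n
      have e : h = multOp m (φ n) - (multOp m (φ n) - h) := by abel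
      have e' : (φ n : E3 → ℂ) = g - (g - (φ n : E3 → ℂ)) := by abel
      calc eLpNorm h (ENNReal.ofReal p) volume
          = eLpNorm (multOp m (φ n) - (multOp m (φ n) - h)) (ENNReal.ofReal p) volume := by
            rw [← e]
        _ ≤ eLpNorm (multOp m (φ n)) (ENNReal.ofReal p) volume +
            eLpNorm (multOp m (φ n) - h) (ENNReal.ofReal p) volume :=
          eLpNorm_sub_le (hmem n).1 ((hmem n).sub hh).1 hp1
        _ ≤ _ := by
          rw [add_comm]
          gcongr
          refine (hC _).trans ?_
          gcongr
          conv_lhs => rw [e']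
          exact eLpNorm_sub_le hg.1 (hg.sub (hφm n)).1 hp1
    have ht := hlim.add (ENNReal.Tendsto.const_mul (a := (C : ℝ≥0∞))
      ((tendsto_const_nhds (x := eLpNorm g (ENNReal.ofReal p) volume)).add hφlim)
      (Or.inr ENNReal.coe_ne_top))
    rw [zero_add, add_zero] at ht
    exact ge_of_tendsto' ht hb
  · rw [finv_apply_ivS htemp]
    have e1 : ∫ ξ, m ξ * fhat g ξ * ivS ψ ξ = ∫ x, g x * multOp m ψ x := by
      rw [multOp, ← integral_fhat_mul hgi (hm.bdd.integrable ψ)]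
      congr 1; funext ξ; ring
    have hTψ : MemLp (multOp m ψ) (ENNReal.ofReal q) :=
      ⟨(continuous_multOp hm.bdd _).aestronglyMeasurable,
        (hC' _).trans_lt (ENNReal.mul_lt_top ENNReal.coe_lt_top (ψ.memLp _ _).2)⟩
    have hψq : MemLp ψ (ENNReal.ofReal q) := ψ.memLp _ _
    rw [e1]
    have l1 : Tendsto (fun n => ∫ x, φ n x * multOp m ψ x) atTop (𝓝 (∫ x, g x * multOp m ψ x)) := by
      rw [tendsto_iff_edist_tendsto_0]
      refine tendsto_of_tendsto_of_tendsto_of_le_of_le tendsto_const_nhds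
        (h := fun n => eLpNorm (g - (φ n : E3 → ℂ)) (ENNReal.ofReal p) volume *
          eLpNorm (multOp m ψ) (ENNReal.ofReal q) volume) ?_ (fun n => zero_le) fun n => ?_
      · have := ENNReal.Tendsto.mul_const (b := eLpNorm (multOp m ψ) (ENNReal.ofReal q) volume)
          hφlim (Or.inr hTψ.2.ne)
        simpa using this
      · rw [edist_comm, edist_eq_enorm_sub, ← integral_sub (integrable_mul_of_memLp hpq hg hTψ)
          (integrable_mul_of_memLp hpq (hφm n) hTψ)]
        refine le_trans (le_of_eq ?_) (enorm_integral_mul_le hpq (hg.sub (hφm n)).1 hTψ.1)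
        congr 2; funext x; simp; ring
    have l2 : Tendsto (fun n => ∫ x, φ n x * multOp m ψ x) atTop (𝓝 (∫ x, h x * ψ x)) := by
      rw [tendsto_iff_edist_tendsto_0]
      refine tendsto_of_tendsto_of_tendsto_of_le_of_le tendsto_const_nhds
        (h := fun n => eLpNorm (multOp m (φ n) - h) (ENNReal.ofReal p) volume *
          eLpNorm ψ (ENNReal.ofReal q) volume) ?_ (fun n => zero_le) fun n => ?_
      · have := ENNReal.Tendsto.mul_const (b := eLpNorm ψ (ENNReal.ofReal q) volume)
          hlim (Or.inr hψq.2.ne)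
        simpa using this
      · have e2 : ∫ x, φ n x * multOp m ψ x = ∫ x, multOp m (φ n) x * ψ x := by
          rw [integral_multOp_mul hm.bdd hm.even]
          congr 1; funext x; ring
        simp only
        rw [e2, edist_eq_enorm_sub, ← integral_sub (integrable_mul_of_memLp hpq (hmem n) hψq)
          (integrable_mul_of_memLp hpq hh hψq)]
        refine le_trans (le_of_eq ?_) (enorm_integral_mul_le hpq ((hmem n).sub hh).1 hψq.1)
        congr 2; funext x; simp; ring
    exact tendsto_nhds_unique l1 l2

/-! ### Symbols and kernels with a singularity of order two at the origin -/

/-- The weight `(1 + |x|)^N (1 + |x|⁻²)`. -/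
def growth (N : ℕ) (x : E3) : ℝ := (1 + ‖x‖) ^ N * (1 + (‖x‖ ^ 2)⁻¹)

theorem growth_pos (N : ℕ) (x : E3) : 0 < growth N x := by unfold growth; positivity

theorem growth_mono {M N : ℕ} (h : M ≤ N) (x : E3) : growth M x ≤ growth N x := by
  unfold growth
  gcongr
  linarith [norm_nonneg x]

theorem measurable_growth (N : ℕ) : Measurable (growth N) := by unfold growth; fun_prop

/-- In three dimensions the Jacobian `r²` absorbs the singularity `r⁻²`, and four spare powers of
decay suffice at infinity. -/
theorem integrable_decay_growth (N : ℕ) :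
    Integrable fun x : E3 => ((1 + ‖x‖) ^ (N + 4))⁻¹ * growth N x := by
  have h4 : Integrable fun x : E3 => ((1 + ‖x‖) ^ 4)⁻¹ := by
    have h1 : Integrable (fun x : E3 => (1 + ‖x‖) ^ (-(4 : ℝ))) :=
      integrable_one_add_norm (by simp; norm_num)
    refine h1.congr (Eventually.of_forall fun x => ?_)
    simp only
    rw [Real.rpow_neg (by positivity)]
    norm_cast
  have h5 : Integrable fun x : E3 => (fun r : ℝ => ((1 + r) ^ 4)⁻¹ * (r ^ 2)⁻¹) ‖x‖ := by
    refine (integrable_fun_norm_addHaar volume (f := fun r : ℝ => ((1 + r) ^ 4)⁻¹ * (r ^ 2)⁻¹)).2 ?_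
    have h1 : Integrable (fun x : ℝ => (1 + ‖x‖) ^ (-(4 : ℝ))) :=
      integrable_one_add_norm (by simp)
    refine h1.integrableOn.congr_fun (fun y hy => ?_) measurableSet_Ioi
    have hy : 0 < y := hy
    simp only [finrank_euclideanSpace_fin, smul_eq_mul]
    rw [Real.rpow_neg (by positivity), Real.norm_of_nonneg hy.le]
    norm_cast
    field_simp
  refine (h4.add h5).congr (Eventually.of_forall fun x => ?_)
  simp only [Pi.add_apply, growth]
  rw [pow_add]
  field_simp

/-- Measurable functions with polynomial growth and a singularity of order at most two at `0`. -/
def Mild (m : E3 → ℂ) : Prop :=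
  Measurable m ∧ ∃ (C : ℝ) (N : ℕ), 0 ≤ C ∧ ∀ x, ‖m x‖ ≤ C * growth N x

theorem Mild.isTempered {m : E3 → ℂ} (hm : Mild m) : IsTempered m := by
  obtain ⟨hmm, C, N, hC, hb⟩ := hm
  refine ⟨N + 4, ((integrable_decay_growth N).const_mul C).mono' ?_ (Eventually.of_forall fun x => ?_)⟩
  · have h1 : Measurable fun x : E3 => ((1 + ‖x‖) ^ (N + 4))⁻¹ := by fun_prop
    exact (h1.smul hmm).aestronglyMeasurable
  · rw [norm_smul, norm_inv, norm_pow, Real.norm_of_nonneg (by positivity : 0 ≤ 1 + ‖x‖)]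
    calc _ ≤ ((1 + ‖x‖) ^ (N + 4))⁻¹ * (C * growth N x) := by gcongr; exact hb x
      _ = _ := by ring

theorem Mild.integrable_mul {m : E3 → ℂ} (hm : Mild m) (φ : 𝓢(E3, ℂ)) :
    Integrable fun x => m x * φ x := hm.isTempered.exists_bound.1 φ

theorem Mild.add {m n : E3 → ℂ} (hm : Mild m) (hn : Mild n) : Mild fun x => m x + n x := by
  obtain ⟨h1, C, N, hC, hb⟩ := hm
  obtain ⟨h2, D, M, hD, hd⟩ := hn
  refine ⟨h1.add h2, C + D, max N M, by positivity, fun x => ?_⟩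
  rw [add_mul]
  refine (norm_add_le _ _).trans (add_le_add ((hb x).trans ?_) ((hd x).trans ?_))
  · gcongr; exact growth_mono (le_max_left _ _) x
  · gcongr; exact growth_mono (le_max_right _ _) x

theorem Mild.mul_growing {m n : E3 → ℂ} (hm : Mild m) (hn : Measurable n) {D : ℝ} {k : ℕ}
    (hb : ∀ x, ‖n x‖ ≤ D * (1 + ‖x‖) ^ k) : Mild fun x => n x * m x := by
  obtain ⟨h1, C, N, hC, hc⟩ := hm
  have hD : 0 ≤ D := by
    have := (norm_nonneg _).trans (hb 0)
    simpa using this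
  refine ⟨hn.mul h1, D * C, N + k, by positivity, fun x => ?_⟩
  rw [norm_mul]
  calc _ ≤ (D * (1 + ‖x‖) ^ k) * (C * growth N x) :=
        mul_le_mul (hb x) (hc x) (norm_nonneg _) ((norm_nonneg _).trans (hb x))
    _ = _ := by unfold growth; ring

theorem Mild.mul_bdd {m n : E3 → ℂ} (hm : Mild m) (hn : Measurable n) {D : ℝ}
    (hb : ∀ x, ‖n x‖ ≤ D) : Mild fun x => n x * m x :=
  hm.mul_growing hn (D := D) (k := 0) (by simpa using hb)

theorem Mild.const_mul {m : E3 → ℂ} (hm : Mild m) (a : ℂ) : Mild fun x => a * m x :=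
  hm.mul_bdd measurable_const (D := ‖a‖) fun _ => le_rfl

theorem measurable_coord (j : Fin 3) : Measurable fun ξ : E3 => ((ξ j : ℝ) : ℂ) := by
  have : Continuous fun ξ : E3 => ((ξ j : ℝ) : ℂ) := by fun_prop
  exact this.measurable

theorem norm_coord_le (ξ : E3) (j : Fin 3) : ‖((ξ j : ℝ) : ℂ)‖ ≤ ‖ξ‖ := by
  rw [Complex.norm_real]; exact PiLp.norm_apply_le ξ j

theorem Mild.coord_mul {m : E3 → ℂ} (hm : Mild m) (j : Fin 3) : Mild fun ξ => (ξ j : ℂ) * m ξ :=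
  hm.mul_growing (measurable_coord j) (D := 1) (k := 1) fun x => by
    rw [one_mul, pow_one]; linarith [norm_coord_le x j]

theorem BddSym.mild {m : E3 → ℂ} (hm : BddSym m) : Mild m := by
  obtain ⟨h, M, hM⟩ := hm
  refine ⟨h, M, 0, (norm_nonneg _).trans (hM 0), fun x => (hM x).trans ?_⟩
  refine le_mul_of_one_le_right ((norm_nonneg _).trans (hM 0)) ?_
  unfold growth
  have : 0 ≤ (‖x‖ ^ 2)⁻¹ := by positivity
  simp [this]

theorem Mild.mul_fhat {m g : E3 → ℂ} (hm : Mild m) (hg : Integrable g) :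
    Mild fun ξ => m ξ * fhat g ξ := by
  have := hm.mul_bdd (continuous_fhat hg).measurable (norm_fhat_le g)
  simpa only [mul_comm] using this

/-! ### Fourier multipliers on integrable functions -/

/-- The multiplier operator `ℱ⁻¹[m ĝ]`. -/
def op (m g : E3 → ℂ) : 𝓢'(E3, ℂ) := finv (fun ξ => m ξ * fhat g ξ)

theorem Mild.finv_apply {m : E3 → ℂ} (hm : Mild m) (φ : 𝓢(E3, ℂ)) :
    finv m φ = ∫ ξ, m ξ * ivS φ ξ := finv_apply_ivS hm.isTempered φ

theorem op_apply {m g : E3 → ℂ} (hm : Mild m) (hg : Integrable g) (φ : 𝓢(E3, ℂ)) :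
    op m g φ = ∫ ξ, m ξ * fhat g ξ * ivS φ ξ := (hm.mul_fhat hg).finv_apply φ

theorem finv_congr {m n : E3 → ℂ} (hm : Mild m) (hn : Mild n) (h : ∀ ξ, ξ ≠ 0 → m ξ = n ξ) :
    finv m = finv n := by
  ext φ
  rw [hm.finv_apply, hn.finv_apply]
  have : ∀ᵐ ξ : E3, ξ ≠ 0 := by simp [ae_iff]
  refine integral_congr_ae ?_
  filter_upwards [this] with ξ hξ
  rw [h ξ hξ]

theorem finv_add {m n : E3 → ℂ} (hm : Mild m) (hn : Mild n) :
    finv (fun ξ => m ξ + n ξ) = finv m + finv n := by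
  ext φ
  rw [_root_.add_apply, (hm.add hn).finv_apply, hm.finv_apply, hn.finv_apply,
    ← integral_add (hm.integrable_mul _) (hn.integrable_mul _)]
  simp_rw [add_mul]

theorem finv_smul {m : E3 → ℂ} (hm : Mild m) (a : ℂ) :
    finv (fun ξ => a * m ξ) = a • finv m := by
  ext φ
  rw [_root_.smul_apply, (hm.const_mul a).finv_apply, hm.finv_apply, smul_eq_mul,
    ← integral_const_mul]
  simp_rw [mul_assoc]

theorem mild_zero : Mild fun _ => 0 := BddSym.mild ⟨measurable_const, 0, by simp⟩

theorem Mild.sum {ι : Type*} (s : Finset ι) {m : ι → E3 → ℂ} (hm : ∀ i ∈ s, Mild (m i)) :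
    Mild fun ξ => ∑ i ∈ s, m i ξ := by
  classical
  induction s using Finset.induction_on with
  | empty => simpa using mild_zero
  | insert a s ha ih =>
    simp_rw [Finset.sum_insert ha]
    exact (hm a (Finset.mem_insert_self _ _)).add (ih fun i hi => hm i (Finset.mem_insert_of_mem hi))

theorem finv_zero : finv (fun _ => 0) = 0 := by
  ext φ
  rw [mild_zero.finv_apply]
  simp

theorem finv_sum {ι : Type*} (s : Finset ι) {m : ι → E3 → ℂ} (hm : ∀ i ∈ s, Mild (m i)) :
    finv (fun ξ => ∑ i ∈ s, m i ξ) = ∑ i ∈ s, finv (m i) := by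
  classical
  induction s using Finset.induction_on with
  | empty => simpa using finv_zero
  | insert a s ha ih =>
    simp_rw [Finset.sum_insert ha]
    rw [finv_add (hm a (Finset.mem_insert_self _ _))
      (Mild.sum s fun i hi => hm i (Finset.mem_insert_of_mem hi)),
      ih fun i hi => hm i (Finset.mem_insert_of_mem hi)]

/-! ### Distributional derivatives of inverse transforms and of multiplier operators. -/

theorem ivS_lineDeriv (φ : 𝓢(E3, ℂ)) (j : Fin 3) (ξ : E3) :
    ivS (∂_{(EuclideanSpace.single j 1 : E3)} φ) ξ = -(Complex.I * ξ j * ivS φ ξ) := by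
  have ht : (fun x : E3 => inner ℝ x (EuclideanSpace.single j 1 : E3)).HasTemperateGrowth := by
    fun_prop
  have e : (𝓕⁻ (∂_{(EuclideanSpace.single j 1 : E3)} φ)) = -(2 * Real.pi * Complex.I) •
      smulLeftCLM ℂ (fun x : E3 => inner ℝ x (EuclideanSpace.single j 1 : E3)) (𝓕⁻ φ) :=
    SchwartzMap.fourierInv_lineDerivOp_eq φ _
  simp only [ivS, _root_.smul_apply, SchwartzMap.compCLMOfContinuousLinearEquiv_apply,
    Function.comp_apply, dilEquiv_apply, smul_eq_mul, e, smulLeftCLM_apply_apply ht]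
  rw [inner_smul_left, EuclideanSpace.inner_single_right]
  simp only [Complex.real_smul]
  push_cast
  have : (Real.pi : ℂ) ≠ 0 := by exact_mod_cast Real.pi_ne_zero
  simp
  field_simp

theorem pd_apply (j : Fin 3) (T : 𝓢'(E3, ℂ)) (φ : 𝓢(E3, ℂ)) :
    pd j T φ = -T (∂_{(EuclideanSpace.single j 1 : E3)} φ) := by
  rw [pd, TemperedDistribution.lineDerivOp_apply_apply, map_neg]

theorem pd_add (j : Fin 3) (S T : 𝓢'(E3, ℂ)) : pd j (S + T) = pd j S + pd j T := by
  ext φ; simp only [pd_apply, _root_.add_apply]; ring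

theorem pd_smul (j : Fin 3) (a : ℂ) (T : 𝓢'(E3, ℂ)) : pd j (a • T) = a • pd j T := by
  ext φ; simp only [pd_apply, _root_.smul_apply, smul_eq_mul]; ring

theorem pd_sub (j : Fin 3) (S T : 𝓢'(E3, ℂ)) : pd j (S - T) = pd j S - pd j T := by
  ext φ; simp only [pd_apply, _root_.sub_apply]; ring

theorem pd_zero (j : Fin 3) : pd j (0 : 𝓢'(E3, ℂ)) = 0 := by
  ext φ; simp [pd_apply]

theorem pd_sum {ι : Type*} (j : Fin 3) (s : Finset ι) (T : ι → 𝓢'(E3, ℂ)) :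
    pd j (∑ i ∈ s, T i) = ∑ i ∈ s, pd j (T i) := by
  classical
  induction s using Finset.induction_on with
  | empty => simpa using pd_zero j
  | insert a s ha ih => rw [Finset.sum_insert ha, Finset.sum_insert ha, pd_add, ih]

theorem pd_finv {m : E3 → ℂ} (hm : Mild m) (j : Fin 3) :
    pd j (finv m) = finv (fun ξ => Complex.I * (ξ j * m ξ)) := by
  ext φ
  rw [pd_apply, hm.finv_apply, ((hm.coord_mul j).const_mul _).finv_apply, ← integral_neg]
  congr 1
  funext ξ
  rw [ivS_lineDeriv]
  ring

theorem pd_op {m g : E3 → ℂ} (hm : Mild m) (hg : Integrable g) (j : Fin 3) :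
    pd j (op m g) = Complex.I • op (fun ξ => ξ j * m ξ) g := by
  rw [op, pd_finv (hm.mul_fhat hg), op, ← finv_smul ((hm.coord_mul j).mul_fhat hg)]
  congr 1; funext ξ; ring

/-- When the datum has a weak gradient, a factor `ξ_j` of the symbol can be moved onto it. This
gains one derivative for data in `W^{1,p}`. -/
theorem op_coord_mul {m g d : E3 → ℂ} (j : Fin 3)
    (hd : ∀ ξ, fhat d ξ = Complex.I * ξ j * fhat g ξ) (hm : Mild m) (hdi : Integrable d) :
    op (fun ξ => ξ j * m ξ) g = -Complex.I • op m d := by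
  rw [op, op, ← finv_smul (hm.mul_fhat hdi)]
  congr 1; funext ξ
  rw [hd]
  linear_combination (ξ j * m ξ * fhat g ξ) * Complex.I_sq

theorem op_add {m g h : E3 → ℂ} (hm : Mild m) (hg : Integrable g) (hh : Integrable h) :
    op m (g + h) = op m g + op m h := by
  rw [op, op, op, ← finv_add (hm.mul_fhat hg) (hm.mul_fhat hh)]
  congr 1; funext ξ
  rw [fhat_add hg hh]; ring

theorem op_smul {m g : E3 → ℂ} (hm : Mild m) (hg : Integrable g) (a : ℂ) :
    op m (a • g) = a • op m g := by
  rw [op, op, ← finv_smul (hm.mul_fhat hg)]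
  congr 1; funext ξ
  rw [fhat_smul]; ring

theorem op_const_mul {m g : E3 → ℂ} (hm : Mild m) (hg : Integrable g) (a : ℂ) :
    op (fun ξ => a * m ξ) g = a • op m g := by
  rw [op, op, ← finv_smul (hm.mul_fhat hg)]
  congr 1; funext ξ; ring

theorem op_congr {m n g : E3 → ℂ} (hm : Mild m) (hn : Mild n) (hg : Integrable g)
    (h : ∀ ξ, ξ ≠ 0 → m ξ = n ξ) : op m g = op n g :=
  finv_congr (hm.mul_fhat hg) (hn.mul_fhat hg) fun ξ hξ => by rw [h ξ hξ]

theorem isTempered_of_integrable {g : E3 → ℂ} (hg : Integrable g) : IsTempered g :=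
  ⟨0, by simpa using hg⟩

theorem ofFun_eq_finv {g : E3 → ℂ} (hg : Integrable g) : ofFun g = finv (fhat g) := by
  have hm : Mild (fhat g) := BddSym.mild ⟨(continuous_fhat hg).measurable, _, norm_fhat_le g⟩
  ext φ
  rw [ofFun_apply (isTempered_of_integrable hg), hm.finv_apply, integral_fhat_mul hg
    (ivS φ).integrable, fhat_ivS]

theorem op_one {g : E3 → ℂ} (hg : Integrable g) : op (fun _ => 1) g = ofFun g := by
  rw [op, ofFun_eq_finv hg]; simp

/-! ### The norms `lpNorm` and `sobNorm` -/

theorem RepresentedOn.integrable {T : 𝓢'(E3, ℂ)} {D : Set E3} {g : E3 → ℂ}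
    (h : RepresentedOn T D g) {φ : 𝓢(E3, ℂ)} (hc : HasCompactSupport φ) (hs : tsupport φ ⊆ D) :
    Integrable fun x => g x * φ x := by
  have h1 : IntegrableOn g (tsupport φ) := h.1.integrableOn_compact_subset hs hc
  obtain ⟨M, hM⟩ := φ.continuous.bounded_above_of_compact_support hc
  have h2 : IntegrableOn (fun x => g x * φ x) (tsupport φ) :=
    Integrable.mul_bdd (c := M) h1 φ.continuous.aestronglyMeasurable (Eventually.of_forall hM)
  refine (integrableOn_iff_integrable_of_support_subset fun x hx => ?_).1 h2
  refine subset_tsupport _ fun h0 => hx ?_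
  simp [h0]

theorem RepresentedOn.add {S T : 𝓢'(E3, ℂ)} {D : Set E3} {g h : E3 → ℂ}
    (hg : RepresentedOn S D g) (hh : RepresentedOn T D h) : RepresentedOn (S + T) D (g + h) := by
  refine ⟨hg.1.add hh.1, fun φ hc hs => ?_⟩
  rw [_root_.add_apply, hg.2 φ hc hs, hh.2 φ hc hs,
    ← integral_add (hg.integrable hc hs) (hh.integrable hc hs)]
  simp [add_mul]

theorem RepresentedOn.smul {T : 𝓢'(E3, ℂ)} {D : Set E3} {g : E3 → ℂ}
    (hg : RepresentedOn T D g) (a : ℂ) : RepresentedOn (a • T) D (a • g) := by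
  refine ⟨hg.1.smul a, fun φ hc hs => ?_⟩
  rw [_root_.smul_apply, hg.2 φ hc hs, smul_eq_mul, ← integral_const_mul]
  simp [mul_assoc]

theorem RepresentedOn.zero (D : Set E3) : RepresentedOn 0 D 0 :=
  ⟨(locallyIntegrable_zero (μ := volume)).locallyIntegrableOn D, fun φ _ _ => by simp⟩

theorem RepresentedOn.mono {T : 𝓢'(E3, ℂ)} {D D' : Set E3} {g : E3 → ℂ}
    (hg : RepresentedOn T D g) (h : D' ⊆ D) : RepresentedOn T D' g :=
  ⟨hg.1.mono_set h, fun φ hc hs => hg.2 φ hc (hs.trans h)⟩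

theorem RepresentedOn.congr_ae {T : 𝓢'(E3, ℂ)} {D : Set E3} {g h : E3 → ℂ}
    (hg : RepresentedOn T D g) (hD : IsOpen D) (e : ∀ᵐ x, x ∈ D → g x = h x) :
    RepresentedOn T D h := by
  constructor
  · intro x hx
    obtain ⟨u, hu, hi⟩ := hg.1 x hx
    refine ⟨u ∩ D, inter_mem hu self_mem_nhdsWithin, ?_⟩
    have h1 : IntegrableOn g (u ∩ D) := hi.mono_set Set.inter_subset_left
    refine h1.congr ?_
    refine ae_restrict_of_ae_restrict_of_subset Set.inter_subset_right ?_
    exact (ae_restrict_iff' hD.measurableSet).2 e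
  · intro φ hc hs
    rw [hg.2 φ hc hs]
    refine integral_congr_ae ?_
    filter_upwards [e] with x hx
    by_cases hxD : x ∈ D
    · rw [hx hxD]
    · rw [image_eq_zero_of_notMem_tsupport fun h' => hxD (hs h')]; simp

/-- The difference of the two functions is annihilated by all smooth bumps supported in `D`, so it
vanishes almost everywhere there. The infimum in `lpNorm` thus ranges over a single class of
functions, which turns bounds for one representative into values of the norm. -/
theorem RepresentedOn.unique {T : 𝓢'(E3, ℂ)} {D : Set E3} {g h : E3 → ℂ} (hD : IsOpen D)
    (hg : RepresentedOn T D g) (hh : RepresentedOn T D h) : g =ᵐ[volume.restrict D] h := by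
  have hd := hg.add (hh.smul (-1))
  have h0 : ∀ᵐ x, x ∈ D → (g + (-1 : ℂ) • h) x = 0 := by
    refine hD.ae_eq_zero_of_integral_contDiff_smul_eq_zero hd.1 fun φ hφ hc hs => ?_
    have hc' : HasCompactSupport fun x => ((φ x : ℝ) : ℂ) := hc.comp_left (g := Complex.ofReal) rfl
    have hφ' : ContDiff ℝ ((⊤ : ℕ∞) : WithTop ℕ∞) fun x => ((φ x : ℝ) : ℂ) := Complex.ofRealCLM.contDiff.comp hφ
    set ψ : 𝓢(E3, ℂ) := hc'.toSchwartzMap hφ' with hψ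
    have hψe : ∀ x, ψ x = ((φ x : ℝ) : ℂ) := fun x => rfl
    have hs' : tsupport ψ ⊆ D := by
      refine (closure_mono (Function.support_subset_iff'.2 fun x hx => ?_)).trans hs
      rw [hψe, Function.notMem_support.1 hx]; simp
    have := hd.2 ψ hc' hs'
    rw [_root_.add_apply, _root_.smul_apply] at this
    rw [show ∫ x, φ x • (g + (-1 : ℂ) • h) x = ∫ x, (g + (-1 : ℂ) • h) x * ψ x from by
      congr 1; funext x; rw [hψe, Complex.real_smul, mul_comm], ← this]
    simp
  refine (ae_restrict_iff' hD.measurableSet).2 ?_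
  filter_upwards [h0] with x hx hxD
  have := hx hxD
  simp only [Pi.add_apply, Pi.smul_apply, smul_eq_mul] at this
  linear_combination this

theorem lpNorm_le {T : 𝓢'(E3, ℂ)} {D : Set E3} {g : E3 → ℂ} (h : RepresentedOn T D g)
    (p : ℝ≥0∞) : lpNorm p D T ≤ eLpNorm g p (volume.restrict D) :=
  iInf₂_le g h

theorem lpNorm_eq {T : 𝓢'(E3, ℂ)} {D : Set E3} {g : E3 → ℂ} (hD : IsOpen D)
    (h : RepresentedOn T D g) (p : ℝ≥0∞) : lpNorm p D T = eLpNorm g p (volume.restrict D) :=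
  le_antisymm (lpNorm_le h p) <| le_iInf₂ fun _ hg' => (eLpNorm_congr_ae (h.unique hD hg')).le

theorem exists_represented {T : 𝓢'(E3, ℂ)} {D : Set E3} {p : ℝ≥0∞} (hD : IsOpen D)
    (h : lpNorm p D T < ⊤) : ∃ g, RepresentedOn T D g ∧
      eLpNorm g p (volume.restrict D) = lpNorm p D T := by
  obtain ⟨g, hg⟩ := iInf_lt_iff.1 h
  obtain ⟨hg, -⟩ := iInf_lt_iff.1 hg
  exact ⟨g, hg, (lpNorm_eq hD hg p).symm⟩

theorem lpNorm_zero (p : ℝ≥0∞) (D : Set E3) : lpNorm p D 0 = 0 := by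
  simpa using lpNorm_le (RepresentedOn.zero D) p

theorem lpNorm_add_le {p : ℝ≥0∞} (hp : 1 ≤ p) {D : Set E3} (hD : IsOpen D) (S T : 𝓢'(E3, ℂ)) :
    lpNorm p D (S + T) ≤ lpNorm p D S + lpNorm p D T := by
  by_cases hS : lpNorm p D S = ⊤
  · simp [hS]
  by_cases hT : lpNorm p D T = ⊤
  · simp [hT]
  obtain ⟨g, hg, eg⟩ := exists_represented hD (lt_top_iff_ne_top.2 hS)
  obtain ⟨h, hh, eh⟩ := exists_represented hD (lt_top_iff_ne_top.2 hT)
  rw [← eg, ← eh]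
  exact (lpNorm_le (hg.add hh) p).trans (eLpNorm_add_le hg.1.aestronglyMeasurable
    hh.1.aestronglyMeasurable hp)

theorem lpNorm_smul_le {p : ℝ≥0∞} {D : Set E3} (hD : IsOpen D) (a : ℂ) (T : 𝓢'(E3, ℂ)) :
    lpNorm p D (a • T) ≤ ‖a‖ₑ * lpNorm p D T := by
  by_cases hT : lpNorm p D T = ⊤
  · by_cases ha : a = 0
    · have h0 : (0 : ℂ) • T = 0 := by
        ext φ; rw [_root_.smul_apply, zero_smul]; rfl
      rw [ha, h0, lpNorm_zero]; exact zero_le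
    · rw [hT, ENNReal.mul_top (by simpa using ha)]; exact le_top
  obtain ⟨g, hg, eg⟩ := exists_represented hD (lt_top_iff_ne_top.2 hT)
  rw [← eg, ← eLpNorm_const_smul]
  exact lpNorm_le (hg.smul a) p

theorem isOpen_B (R : ℝ) : IsOpen (B R) := Metric.isOpen_ball

theorem lpNorm_mono {p : ℝ≥0∞} {D D' : Set E3} (hD : IsOpen D) (h : D' ⊆ D)
    (T : 𝓢'(E3, ℂ)) : lpNorm p D' T ≤ lpNorm p D T := by
  by_cases hT : lpNorm p D T = ⊤
  · simp [hT]
  obtain ⟨g, hg, eg⟩ := exists_represented hD (lt_top_iff_ne_top.2 hT)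
  rw [← eg]
  exact (lpNorm_le (hg.mono h) p).trans (eLpNorm_mono_measure g (Measure.restrict_mono h le_rfl))

theorem piAntidiag_zero_fin : Finset.piAntidiag (Finset.univ : Finset (Fin 3)) 0 = {![0, 0, 0]} := by
  decide

theorem piAntidiag_one_fin : Finset.piAntidiag (Finset.univ : Finset (Fin 3)) 1 =
    {![1, 0, 0], ![0, 1, 0], ![0, 0, 1]} := by
  decide

theorem piAntidiag_two_fin : Finset.piAntidiag (Finset.univ : Finset (Fin 3)) 2 =
    {![2, 0, 0], ![0, 2, 0], ![0, 0, 2], ![1, 1, 0], ![1, 0, 1], ![0, 1, 1]} := by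
  decide

theorem sobNorm_zero (p : ℝ≥0∞) (D : Set E3) (T : 𝓢'(E3, ℂ)) :
    sobNorm 0 p D T = lpNorm p D T := by
  simp [sobNorm, mpd]

theorem sobNorm_one (p : ℝ≥0∞) (D : Set E3) (T : 𝓢'(E3, ℂ)) :
    sobNorm 1 p D T = lpNorm p D T + ∑ j, lpNorm p D (pd j T) := by
  rw [sobNorm, Finset.sum_range_succ, Finset.sum_range_one, piAntidiag_one_fin, piAntidiag_zero_fin]
  rw [Finset.sum_singleton, Finset.sum_insert (by decide), Finset.sum_insert (by decide),
    Finset.sum_singleton, Fin.sum_univ_three]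
  simp [mpd, add_assoc]

/-- The sum of the `L^p` norms of all derivatives of order at most two, with repetitions. -/
def sobSum (p : ℝ≥0∞) (D : Set E3) (T : 𝓢'(E3, ℂ)) : ℝ≥0∞ :=
  lpNorm p D T + ∑ j, lpNorm p D (pd j T) + ∑ j, ∑ k, lpNorm p D (pd j (pd k T))

theorem sobNorm_two_le (p : ℝ≥0∞) (D : Set E3) (T : 𝓢'(E3, ℂ)) :
    sobNorm 2 p D T ≤ sobSum p D T := by
  have h := sobNorm_one p D T
  rw [sobNorm] at h
  rw [sobNorm, Finset.sum_range_succ, h, sobSum, piAntidiag_two_fin]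
  refine add_le_add le_rfl ?_
  rw [Finset.sum_insert (by decide), Finset.sum_insert (by decide), Finset.sum_insert (by decide),
    Finset.sum_insert (by decide), Finset.sum_insert (by decide), Finset.sum_singleton]
  simp only [Fin.sum_univ_three]
  simp only [mpd, Matrix.cons_val_zero, Matrix.cons_val_one, Matrix.cons_val, Function.iterate_zero,
    Function.iterate_succ, Function.comp_apply, id_eq]
  generalize lpNorm p D (pd 0 (pd 0 T)) = a0
  generalize lpNorm p D (pd 0 (pd 1 T)) = a1
  generalize lpNorm p D (pd 0 (pd 2 T)) = a2
  generalize lpNorm p D (pd 1 (pd 0 T)) = a3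
  generalize lpNorm p D (pd 1 (pd 1 T)) = a4
  generalize lpNorm p D (pd 1 (pd 2 T)) = a5
  generalize lpNorm p D (pd 2 (pd 0 T)) = a6
  generalize lpNorm p D (pd 2 (pd 1 T)) = a7
  generalize lpNorm p D (pd 2 (pd 2 T)) = a8
  calc _ ≤ a0 + (a4 + (a8 + (a1 + (a2 + a5)))) + (a3 + a6 + a7) := le_self_add
    _ = _ := by ring

theorem sobNorm_one_le (p : ℝ≥0∞) (D : Set E3) (T : 𝓢'(E3, ℂ)) :
    sobNorm 1 p D T ≤ sobSum p D T := by
  rw [sobNorm_one, sobSum]; exact le_self_add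

theorem sobNorm_one_pd_le (p : ℝ≥0∞) (D : Set E3) (T : 𝓢'(E3, ℂ)) (k : Fin 3) :
    sobNorm 1 p D (pd k T) ≤ sobSum p D T := by
  rw [sobNorm_one, sobSum, Finset.sum_comm]
  refine add_le_add ?_ ?_
  · exact (Finset.single_le_sum (f := fun k => lpNorm p D (pd k T)) (fun _ _ => zero_le)
      (Finset.mem_univ k)).trans le_add_self
  · exact Finset.single_le_sum (f := fun k => ∑ j, lpNorm p D (pd j (pd k T)))
      (fun _ _ => zero_le) (Finset.mem_univ k)

theorem sobSum_add_le {p : ℝ≥0∞} (hp : 1 ≤ p) {D : Set E3} (hD : IsOpen D) (S T : 𝓢'(E3, ℂ)) :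
    sobSum p D (S + T) ≤ sobSum p D S + sobSum p D T := by
  simp only [sobSum, pd_add]
  calc _ ≤ (lpNorm p D S + lpNorm p D T) + ∑ j, (lpNorm p D (pd j S) + lpNorm p D (pd j T)) +
        ∑ j, ∑ k, (lpNorm p D (pd j (pd k S)) + lpNorm p D (pd j (pd k T))) := by
        gcongr <;> exact lpNorm_add_le hp hD _ _
    _ = _ := by simp only [Finset.sum_add_distrib]; ring

theorem sobSum_smul_le {p : ℝ≥0∞} {D : Set E3} (hD : IsOpen D) (a : ℂ) (T : 𝓢'(E3, ℂ)) :
    sobSum p D (a • T) ≤ ‖a‖ₑ * sobSum p D T := by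
  simp only [sobSum, pd_smul, mul_add, Finset.mul_sum]
  gcongr <;> exact lpNorm_smul_le hD _ _

theorem sobNorm_one_add_le {p : ℝ≥0∞} (hp : 1 ≤ p) {D : Set E3} (hD : IsOpen D)
    (S T : 𝓢'(E3, ℂ)) : sobNorm 1 p D (S + T) ≤ sobNorm 1 p D S + sobNorm 1 p D T := by
  simp only [sobNorm_one, pd_add]
  calc _ ≤ (lpNorm p D S + lpNorm p D T) + ∑ j, (lpNorm p D (pd j S) + lpNorm p D (pd j T)) := by
        gcongr <;> exact lpNorm_add_le hp hD _ _
    _ = _ := by simp only [Finset.sum_add_distrib]; ring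

theorem sobNorm_one_smul_le {p : ℝ≥0∞} {D : Set E3} (hD : IsOpen D) (a : ℂ) (T : 𝓢'(E3, ℂ)) :
    sobNorm 1 p D (a • T) ≤ ‖a‖ₑ * sobNorm 1 p D T := by
  simp only [sobNorm_one, pd_smul, mul_add, Finset.mul_sum]
  gcongr <;> exact lpNorm_smul_le hD _ _

/-! ### The Yukawa kernel -/

/-- The kernel `e^(-μ|x|) / (4π|x|)`. -/
def yukawa (μ : ℂ) (x : E3) : ℂ := Complex.exp (-μ * ‖x‖) / (4 * Real.pi * ‖x‖)

theorem norm_exp_neg_mul (μ : ℂ) (r : ℝ) : ‖Complex.exp (-μ * r)‖ = Real.exp (-μ.re * r) := by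
  rw [Complex.norm_exp]; simp

theorem integrable_yukawa {μ : ℂ} (hμ : 0 < μ.re) : Integrable (yukawa μ) := by
  refine (integrable_fun_norm_addHaar volume
    (f := fun r : ℝ => Complex.exp (-μ * r) / (4 * Real.pi * r))).2 ?_
  have h := (integrableOn_rpow_mul_exp_neg_mul_rpow (s := 1) (p := 1) (by norm_num) one_pos hμ).const_mul
    ((4 * Real.pi)⁻¹)
  refine Integrable.mono' h ?_ ?_
  · have : Measurable fun r : ℝ => r ^ (Module.finrank ℝ E3 - 1) •
      (Complex.exp (-μ * r) / (4 * Real.pi * r)) := by fun_prop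
    exact this.aestronglyMeasurable
  · filter_upwards [ae_restrict_mem measurableSet_Ioi] with r hr
    have hr : 0 < r := hr
    rw [norm_smul, norm_div, norm_exp_neg_mul]
    have e : ‖(4 * Real.pi * r : ℂ)‖ = 4 * Real.pi * r := by
      rw [show (4 * Real.pi * r : ℂ) = ((4 * Real.pi * r : ℝ) : ℂ) by push_cast; ring,
        Complex.norm_real, Real.norm_of_nonneg (by positivity)]
    rw [e, finrank_euclideanSpace_fin, Real.rpow_one,
      Real.norm_of_nonneg (by positivity)]
    refine le_of_eq ?_
    field_simp

theorem hasDerivAt_sqrt_add_sq {t : ℝ} (ht : t ≠ 0) (s : ℝ) :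
    HasDerivAt (fun s : ℝ => Real.sqrt (t ^ 2 + s ^ 2)) (s / Real.sqrt (t ^ 2 + s ^ 2)) s := by
  have h0 : t ^ 2 + s ^ 2 ≠ 0 := by positivity
  have := ((hasDerivAt_pow 2 s).const_add (t ^ 2)).sqrt h0
  convert this using 1
  have : Real.sqrt (t ^ 2 + s ^ 2) ≠ 0 := by positivity
  field_simp
  norm_num
  ring

theorem tendsto_sqrt_add_sq (t : ℝ) :
    Tendsto (fun s : ℝ => Real.sqrt (t ^ 2 + s ^ 2)) atTop atTop := by
  refine tendsto_atTop_mono (fun s => ?_) tendsto_id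
  refine Real.le_sqrt_of_sq_le ?_
  simp only [id]
  nlinarith [sq_nonneg t]

/-- The integrand is the exact `s`-derivative of `-e^(-μ√(t²+s²)) / (4πμ)`, which vanishes at
infinity. -/
theorem integral_radial_yukawa {μ : ℂ} (hμ : 0 < μ.re) {t : ℝ} (ht : t ≠ 0) :
    ∫ s in Set.Ioi (0 : ℝ), (s : ℂ) * (Complex.exp (-μ * Real.sqrt (t ^ 2 + s ^ 2)) /
      (4 * Real.pi * Real.sqrt (t ^ 2 + s ^ 2))) = Complex.exp (-μ * |t|) / (4 * Real.pi * μ) := by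
  have hμ0 : μ ≠ 0 := fun h => by simp [h] at hμ
  have hpi : (Real.pi : ℂ) ≠ 0 := by exact_mod_cast Real.pi_ne_zero
  have hd : ∀ s ∈ Set.Ici (0 : ℝ), HasDerivAt
      (fun s : ℝ => -(Complex.exp (-μ * Real.sqrt (t ^ 2 + s ^ 2)) / (4 * Real.pi * μ)))
      ((s : ℂ) * (Complex.exp (-μ * Real.sqrt (t ^ 2 + s ^ 2)) /
        (4 * Real.pi * Real.sqrt (t ^ 2 + s ^ 2)))) s := by
    intro s _
    have h1 := ((hasDerivAt_sqrt_add_sq ht s).ofReal_comp.const_mul (-μ)).cexp.div_const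
      (4 * Real.pi * μ)
    refine h1.neg.congr_deriv ?_
    have : (Real.sqrt (t ^ 2 + s ^ 2) : ℂ) ≠ 0 := by
      have : Real.sqrt (t ^ 2 + s ^ 2) ≠ 0 := by positivity
      exact_mod_cast this
    push_cast
    field_simp
  have hdr : ∀ s ∈ Set.Ici (0 : ℝ), HasDerivAt
      (fun s : ℝ => -(Real.exp (-μ.re * Real.sqrt (t ^ 2 + s ^ 2)) / (4 * Real.pi * μ.re)))
      (s * (Real.exp (-μ.re * Real.sqrt (t ^ 2 + s ^ 2)) /
        (4 * Real.pi * Real.sqrt (t ^ 2 + s ^ 2)))) s := by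
    intro s _
    have h1 := ((hasDerivAt_sqrt_add_sq ht s).const_mul (-μ.re)).exp.div_const
      (4 * Real.pi * μ.re)
    refine h1.neg.congr_deriv ?_
    have : Real.sqrt (t ^ 2 + s ^ 2) ≠ 0 := by positivity
    field_simp
  have hlimr : Tendsto (fun s : ℝ => -(Real.exp (-μ.re * Real.sqrt (t ^ 2 + s ^ 2)) /
      (4 * Real.pi * μ.re))) atTop (𝓝 0) := by
    have h1 : Tendsto (fun s : ℝ => Real.exp (-μ.re * Real.sqrt (t ^ 2 + s ^ 2))) atTop (𝓝 0) :=
      Real.tendsto_exp_atBot.comp ((tendsto_sqrt_add_sq t).const_mul_atTop_of_neg (by linarith))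
    simpa using (h1.div_const (4 * Real.pi * μ.re)).neg
  -- Replacing `μ` by its real part gives the modulus of the integrand. It is a nonnegative
  -- derivative with a finite limit of its primitive, hence integrable, and it serves as the
  -- dominating function.
  have hintr := integrableOn_Ioi_deriv_of_nonneg' hdr (fun s hs => by
    have : 0 < s := hs
    positivity) hlimr
  have hint : IntegrableOn (fun s : ℝ => (s : ℂ) * (Complex.exp (-μ * Real.sqrt (t ^ 2 + s ^ 2)) /
        (4 * Real.pi * Real.sqrt (t ^ 2 + s ^ 2)))) (Set.Ioi 0) := by
    refine Integrable.mono' hintr ?_ ?_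
    · refine Measurable.aestronglyMeasurable ?_
      fun_prop
    · filter_upwards [ae_restrict_mem measurableSet_Ioi] with s hs
      have hs : 0 < s := hs
      rw [norm_mul, norm_div, norm_exp_neg_mul, Complex.norm_real, Real.norm_of_nonneg hs.le]
      rw [show (4 * Real.pi * Real.sqrt (t ^ 2 + s ^ 2) : ℂ) =
        ((4 * Real.pi * Real.sqrt (t ^ 2 + s ^ 2) : ℝ) : ℂ) by push_cast; ring,
        Complex.norm_real, Real.norm_of_nonneg (by positivity)]
  have hlim : Tendsto (fun s : ℝ => -(Complex.exp (-μ * Real.sqrt (t ^ 2 + s ^ 2)) /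
      (4 * Real.pi * μ))) atTop (𝓝 0) := by
    have h1 : Tendsto (fun s : ℝ => Complex.exp (-μ * Real.sqrt (t ^ 2 + s ^ 2))) atTop (𝓝 0) := by
      rw [tendsto_zero_iff_norm_tendsto_zero]
      simp_rw [norm_exp_neg_mul]
      exact Real.tendsto_exp_atBot.comp ((tendsto_sqrt_add_sq t).const_mul_atTop_of_neg (by linarith))
    simpa using (h1.div_const (4 * Real.pi * μ)).neg
  rw [integral_Ioi_of_hasDerivAt_of_tendsto' hd hint hlim]
  simp [Real.sqrt_sq_eq_abs]

theorem norm_splitE3 (t : ℝ) (y : Fin 2 → ℝ) :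
    ‖splitE3 (t, y)‖ = Real.sqrt (t ^ 2 + ‖(WithLp.toLp 2 y : EuclideanSpace ℝ (Fin 2))‖ ^ 2) := by
  rw [EuclideanSpace.norm_eq, EuclideanSpace.norm_sq_eq]
  congr 1
  rw [Fin.sum_univ_succ]
  simp [splitE3]

theorem splitE3_apply_zero (t : ℝ) (y : Fin 2 → ℝ) : splitE3 (t, y) 0 = t := by
  simp [splitE3]

theorem integral_yukawa_slice {μ : ℂ} (hμ : 0 < μ.re) {t : ℝ} (ht : t ≠ 0) :
    ∫ y : Fin 2 → ℝ, yukawa μ (splitE3 (t, y)) = Complex.exp (-μ * |t|) / (2 * μ) := by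
  have hμ0 : μ ≠ 0 := fun h => by simp [h] at hμ
  have hpi : (Real.pi : ℂ) ≠ 0 := by exact_mod_cast Real.pi_ne_zero
  simp_rw [yukawa, norm_splitE3]
  have h1 := (PiLp.volume_preserving_toLp (Fin 2)).integral_comp
    (MeasurableEquiv.toLp 2 (Fin 2 → ℝ)).measurableEmbedding
    (fun y : EuclideanSpace ℝ (Fin 2) => Complex.exp (-μ * Real.sqrt (t ^ 2 + ‖y‖ ^ 2)) /
      (4 * Real.pi * Real.sqrt (t ^ 2 + ‖y‖ ^ 2)))
  rw [h1, integral_fun_norm_addHaar volume (fun r : ℝ =>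
    Complex.exp (-μ * Real.sqrt (t ^ 2 + r ^ 2)) / (4 * Real.pi * Real.sqrt (t ^ 2 + r ^ 2)))]
  have h2 := integral_radial_yukawa hμ ht
  simp only [finrank_euclideanSpace_fin, Nat.add_one_sub_one, pow_one, Complex.real_smul]
  rw [h2, Measure.real, EuclideanSpace.volume_ball_fin_two]
  simp
  field_simp
  norm_num
  exact Real.pi_pos.le

theorem integral_exp_abs {μ : ℂ} (hμ : 0 < μ.re) (ρ : ℝ) :
    ∫ t : ℝ, Complex.exp (-(Complex.I * (ρ * t : ℝ))) * (Complex.exp (-μ * |t|) / (2 * μ)) =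
      (ρ ^ 2 + μ ^ 2 : ℂ)⁻¹ := by
  have hμ0 : μ ≠ 0 := fun h => by simp [h] at hμ
  have a1 : (-μ - Complex.I * ρ).re < 0 := by simp [hμ]
  have a2 : 0 < (μ - Complex.I * ρ).re := by simp [hμ]
  have n1 : (-μ - Complex.I * ρ) ≠ 0 := fun h => by simp [h] at a1
  have n2 : (μ - Complex.I * ρ) ≠ 0 := fun h => by simp [h] at a2
  have e1 : ∀ t ∈ Set.Ioi (0 : ℝ), Complex.exp (-(Complex.I * (ρ * t : ℝ))) *
      (Complex.exp (-μ * |t|) / (2 * μ)) = (2 * μ)⁻¹ * Complex.exp ((-μ - Complex.I * ρ) * t) := by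
    intro t ht
    rw [abs_of_pos ht, div_eq_mul_inv, ← mul_assoc, ← Complex.exp_add, mul_comm]
    congr 2; push_cast; ring
  have e2 : ∀ t ∈ Set.Iic (0 : ℝ), Complex.exp (-(Complex.I * (ρ * t : ℝ))) *
      (Complex.exp (-μ * |t|) / (2 * μ)) = (2 * μ)⁻¹ * Complex.exp ((μ - Complex.I * ρ) * t) := by
    intro t ht
    rw [abs_of_nonpos ht, div_eq_mul_inv, ← mul_assoc, ← Complex.exp_add, mul_comm]
    congr 2; push_cast; ring
  have i1 : IntegrableOn (fun t : ℝ => Complex.exp (-(Complex.I * (ρ * t : ℝ))) *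
      (Complex.exp (-μ * |t|) / (2 * μ))) (Set.Ioi 0) :=
    IntegrableOn.congr_fun ((integrableOn_exp_mul_complex_Ioi a1 0).const_mul ((2 * μ)⁻¹))
      (fun t ht => (e1 t ht).symm) measurableSet_Ioi
  have i2 : IntegrableOn (fun t : ℝ => Complex.exp (-(Complex.I * (ρ * t : ℝ))) *
      (Complex.exp (-μ * |t|) / (2 * μ))) (Set.Iic 0) :=
    IntegrableOn.congr_fun ((integrableOn_exp_mul_complex_Iic a2 0).const_mul ((2 * μ)⁻¹))
      (fun t ht => (e2 t ht).symm) measurableSet_Iic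
  rw [← intervalIntegral.integral_Iic_add_Ioi i2 i1, setIntegral_congr_fun measurableSet_Ioi e1,
    setIntegral_congr_fun measurableSet_Iic e2, integral_const_mul, integral_const_mul,
    integral_exp_mul_complex_Ioi a1, integral_exp_mul_complex_Iic a2]
  have e3 : (ρ ^ 2 + μ ^ 2 : ℂ) = -((-μ - Complex.I * ρ) * (μ - Complex.I * ρ)) := by
    linear_combination ((ρ : ℂ) ^ 2) * Complex.I_sq
  rw [e3]
  simp only [Complex.ofReal_zero, mul_zero, Complex.exp_zero]
  field_simp
  ring

/-- A reflection aligns `ξ` with the first axis, so the phase depends on one coordinate only.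
Integration over the orthogonal planes leaves `e^(-μ|t|) / (2μ)`, whose one-dimensional transform is
elementary. -/
theorem fhat_yukawa {μ : ℂ} (hμ : 0 < μ.re) (ξ : E3) :
    fhat (yukawa μ) ξ = C0 * (nsq ξ + μ ^ 2)⁻¹ := by
  rw [fhat_eq]
  congr 1
  obtain ⟨A, hA⟩ := exists_reflection (y := ξ) (v := ‖ξ‖ • (EuclideanSpace.single 0 1 : E3))
    (by simp [norm_smul])
  set S : ℝ × (Fin 2 → ℝ) → E3 := fun z => A (splitE3 z) with hS
  have hmp : MeasurePreserving S := A.measurePreserving.comp measurePreserving_splitE3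
  have hme : MeasurableEmbedding S :=
    (A.toHomeomorph.measurableEmbedding).comp splitE3.measurableEmbedding
  have hint : Integrable fun x => Complex.exp (-(Complex.I * ((inner ℝ ξ x : ℝ) : ℂ))) * yukawa μ x :=
    integrable_phase_mul (integrable_yukawa hμ) ξ
  rw [← hmp.integral_comp hme]
  have hint' := (hmp.integrable_comp_emb hme).2 hint
  have e : ∀ z : ℝ × (Fin 2 → ℝ), Complex.exp (-(Complex.I * ((inner ℝ ξ (S z) : ℝ) : ℂ))) *
      yukawa μ (S z) = Complex.exp (-(Complex.I * (‖ξ‖ * z.1 : ℝ))) * yukawa μ (splitE3 z) := by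
    rintro ⟨t, y⟩
    have h1 : inner ℝ ξ (S (t, y)) = ‖ξ‖ * t := by
      rw [hS]
      conv_lhs => rw [← hA]
      simp only
      rw [LinearIsometryEquiv.inner_map_map, inner_smul_left, EuclideanSpace.inner_single_left,
        splitE3_apply_zero]
      simp
    rw [h1]
    simp [hS, yukawa]
  have hint'' : Integrable (fun z : ℝ × (Fin 2 → ℝ) =>
      Complex.exp (-(Complex.I * (‖ξ‖ * z.1 : ℝ))) * yukawa μ (splitE3 z)) :=
    hint'.congr (Eventually.of_forall fun z => e z)
  simp_rw [e]
  rw [Measure.volume_eq_prod, integral_prod _ hint'']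
  simp_rw [integral_const_mul]
  rw [show (nsq ξ + μ ^ 2 : ℂ) = ((‖ξ‖ : ℝ) : ℂ) ^ 2 + μ ^ 2 by simp [nsq],
    ← integral_exp_abs hμ ‖ξ‖]
  refine integral_congr_ae ?_
  have : ∀ᵐ t : ℝ, t ≠ 0 := by simp [ae_iff]
  filter_upwards [this] with t ht
  rw [integral_yukawa_slice hμ ht]

/-! ### Kernels of multiplier operators -/

/-- `(2π)^(-3/2) ℱ⁻¹ m = K`: the operator `ℱ⁻¹ m ℱ` is the convolution with `K`. -/
structure HasKernel (m K : E3 → ℂ) : Prop where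
  sym : Mild m
  ker : Mild K
  eq : ∀ φ : 𝓢(E3, ℂ), C0 * ∫ ξ, m ξ * ivS φ ξ = ∫ x, K x * φ x

theorem HasKernel.add {m n K L : E3 → ℂ} (h : HasKernel m K) (h' : HasKernel n L) :
    HasKernel (fun ξ => m ξ + n ξ) (fun x => K x + L x) := by
  refine ⟨h.sym.add h'.sym, h.ker.add h'.ker, fun φ => ?_⟩
  simp_rw [add_mul]
  rw [integral_add (h.sym.integrable_mul _) (h'.sym.integrable_mul _),
    integral_add (h.ker.integrable_mul _) (h'.ker.integrable_mul _), mul_add, h.eq, h'.eq]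

theorem HasKernel.const_mul {m K : E3 → ℂ} (h : HasKernel m K) (a : ℂ) :
    HasKernel (fun ξ => a * m ξ) (fun x => a * K x) := by
  refine ⟨h.sym.const_mul a, h.ker.const_mul a, fun φ => ?_⟩
  simp_rw [mul_assoc]
  rw [integral_const_mul, integral_const_mul, ← h.eq]
  ring

theorem ae_ne_zero : ∀ᵐ x : E3, x ≠ 0 := by simp [ae_iff]

theorem HasKernel.congr {m n K L : E3 → ℂ} (h : HasKernel m K) (hn : Mild n) (hL : Mild L)
    (hmn : ∀ ξ, ξ ≠ 0 → m ξ = n ξ) (hKL : ∀ x, x ≠ 0 → K x = L x) : HasKernel n L := by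
  refine ⟨hn, hL, fun φ => ?_⟩
  rw [show ∫ ξ, n ξ * ivS φ ξ = ∫ ξ, m ξ * ivS φ ξ from integral_congr_ae (by
      filter_upwards [ae_ne_zero] with ξ hξ; rw [hmn ξ hξ]),
    h.eq φ]
  refine integral_congr_ae ?_
  filter_upwards [ae_ne_zero] with ξ hξ; rw [hKL ξ hξ]

theorem Mild.tendsto_integral {m : ℕ → E3 → ℂ} {n : E3 → ℂ} (hm : ∀ k, Measurable (m k)) {C : ℝ}
    {N : ℕ} (hb : ∀ k x, x ≠ 0 → ‖m k x‖ ≤ C * growth N x)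
    (hl : ∀ x, x ≠ 0 → Tendsto (fun k => m k x) atTop (𝓝 (n x))) (φ : 𝓢(E3, ℂ)) :
    Tendsto (fun k => ∫ x, m k x * φ x) atTop (𝓝 (∫ x, n x * φ x)) := by
  have hg : Mild fun x => ((C * growth N x : ℝ) : ℂ) := by
    refine ⟨Complex.measurable_ofReal.comp ((measurable_growth N).const_mul C), |C|, N,
      abs_nonneg _, fun x => ?_⟩
    rw [Complex.norm_real, norm_mul, Real.norm_eq_abs, Real.norm_of_nonneg (growth_pos N x).le]
  refine tendsto_integral_of_dominated_convergence (fun x => ‖((C * growth N x : ℝ) : ℂ) * φ x‖)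
    (fun k => ((hm k).mul φ.continuous.measurable).aestronglyMeasurable)
    (hg.integrable_mul φ).norm (fun k => ?_) ?_
  · filter_upwards [ae_ne_zero] with x hx
    rw [norm_mul, norm_mul, Complex.norm_real]
    gcongr
    exact (hb k x hx).trans (le_abs_self _)
  · filter_upwards [ae_ne_zero] with x hx
    exact (hl x hx).mul_const _

theorem HasKernel.of_tendsto {m K : ℕ → E3 → ℂ} {n L : E3 → ℂ} (h : ∀ k, HasKernel (m k) (K k))
    (hn : Mild n) (hL : Mild L) {C D : ℝ} {N M : ℕ}
    (hb : ∀ k x, x ≠ 0 → ‖m k x‖ ≤ C * growth N x) (hb' : ∀ k x, x ≠ 0 → ‖K k x‖ ≤ D * growth M x)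
    (hl : ∀ x, x ≠ 0 → Tendsto (fun k => m k x) atTop (𝓝 (n x)))
    (hl' : ∀ x, x ≠ 0 → Tendsto (fun k => K k x) atTop (𝓝 (L x))) : HasKernel n L := by
  refine ⟨hn, hL, fun φ => ?_⟩
  have h1 := (Mild.tendsto_integral (fun k => (h k).sym.1) hb hl (ivS φ)).const_mul (C0 : ℂ)
  have h2 := Mild.tendsto_integral (fun k => (h k).ker.1) hb' hl' φ
  simp_rw [(h _).eq φ] at h1
  exact tendsto_nhds_unique h1 h2

/-- Integration by parts for a function that is differentiable off the origin. -/
theorem integral_mul_lineDeriv_eq_neg {K K' : E3 → ℂ} (hK : Mild K) (hK' : Mild K') (j : Fin 3)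
    (hd : ∀ x, x ≠ 0 →
      HasDerivAt (fun t : ℝ => K (x + t • (EuclideanSpace.single j 1 : E3))) (K' x) 0)
    (φ : 𝓢(E3, ℂ)) :
    ∫ x, K x * (∂_{(EuclideanSpace.single j 1 : E3)} φ) x = -∫ x, K' x * φ x := by
  set e : E3 := EuclideanSpace.single j 1 with he
  have i1 := hK.integrable_mul (∂_{e} φ)
  have i2 := hK'.integrable_mul φ
  have i3 := hK.integrable_mul φ
  rw [eq_neg_iff_add_eq_zero, ← integral_add i1 i2]
  obtain ⟨A, hA⟩ := exists_reflection (y := e) (v := (EuclideanSpace.single 0 1 : E3))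
    (by simp [he])
  set S : (Fin 2 → ℝ) × ℝ → E3 := fun z => A (splitE3 (z.2, z.1)) with hS
  have hmp : MeasurePreserving S :=
    (A.measurePreserving.comp measurePreserving_splitE3).comp Measure.measurePreserving_swap
  have hme : MeasurableEmbedding S :=
    ((A.toHomeomorph.measurableEmbedding).comp splitE3.measurableEmbedding).comp
      MeasurableEquiv.prodComm.measurableEmbedding
  have i12 : Integrable fun z => K (S z) * (∂_{e} φ) (S z) + K' (S z) * φ (S z) := (hmp.integrable_comp_emb hme).2 (i1.add i2)
  have i3' : Integrable fun z => K (S z) * φ (S z) := (hmp.integrable_comp_emb hme).2 i3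
  rw [← hmp.integral_comp hme, Measure.volume_eq_prod, integral_prod _ i12]
  rw [Measure.volume_eq_prod] at i12 i3'
  refine (integral_congr_ae ?_).trans (integral_zero _ _)
  -- Almost every line parallel to the axis misses the origin. On such a line the product is
  -- differentiable everywhere, and the integral of its derivative vanishes because function and
  -- derivative are integrable.
  have hne : ∀ᵐ y : Fin 2 → ℝ, y ≠ 0 := by simp [ae_iff]
  filter_upwards [hne, i12.prod_right_ae, i3'.prod_right_ae] with y hy j1 j2
  have hSadd : ∀ s t : ℝ, S (y, s + t) = S (y, s) + t • e := by
    intro s t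
    have := splitE3_sub s (-t) y
    rw [sub_neg_eq_add] at this
    simp only [hS]
    rw [this, neg_smul, sub_neg_eq_add, map_add, map_smul, hA]
  have hS0 : ∀ t, S (y, t) ≠ 0 := by
    intro t h0
    have h1 : splitE3 (t, y) = 0 := by simpa [hS] using h0
    apply hy
    funext i
    have := congrArg (fun v : E3 => v i.succ) h1
    simpa [splitE3] using this
  refine integral_eq_zero_of_hasDerivAt_of_integrable
    (f := fun t => K (S (y, t)) * φ (S (y, t))) (fun t => ?_) j1 j2
  have g1 : HasDerivAt (fun s => K (S (y, s))) (K' (S (y, t))) t := by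
    have h := hd (S (y, t)) (hS0 t)
    rw [← sub_self t] at h
    refine (HasDerivAt.comp_sub_const t t h).congr_of_eventuallyEq (Eventually.of_forall fun s => ?_)
    simp only
    rw [← hSadd, add_sub_cancel]
  have g2 : HasDerivAt (fun s => φ (S (y, s))) ((∂_{e} φ) (S (y, t))) t := by
    have h : HasDerivAt (fun s : ℝ => φ (S (y, t) + s • e)) ((∂_{e} φ) (S (y, t))) 0 := by
      rw [SchwartzMap.lineDerivOp_apply]
      exact (φ.differentiableAt.lineDifferentiableAt).hasLineDerivAt
    rw [← sub_self t] at h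
    refine (HasDerivAt.comp_sub_const t t h).congr_of_eventuallyEq (Eventually.of_forall fun s => ?_)
    simp only
    rw [← hSadd, add_sub_cancel]
  exact (g1.mul g2).congr_deriv (add_comm _ _)

/-- Test the kernel identity against `∂_j φ`. On the Fourier side this is multiplication by `-iξ_j`,
on the kernel side integration by parts across a singularity too weak to contribute. -/
theorem HasKernel.deriv {m K K' : E3 → ℂ} (h : HasKernel m K) (hK' : Mild K') (j : Fin 3)
    (hd : ∀ x, x ≠ 0 →
      HasDerivAt (fun t : ℝ => K (x + t • (EuclideanSpace.single j 1 : E3))) (K' x) 0) :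
    HasKernel (fun ξ => Complex.I * (ξ j * m ξ)) K' := by
  refine ⟨(h.sym.coord_mul j).const_mul _, hK', fun φ => ?_⟩
  have h1 := h.eq (∂_{(EuclideanSpace.single j 1 : E3)} φ)
  rw [integral_mul_lineDeriv_eq_neg h.ker hK' j hd] at h1
  rw [← neg_eq_iff_eq_neg] at h1
  rw [← h1, ← mul_neg, ← integral_neg]
  congr 2
  funext ξ
  rw [ivS_lineDeriv]
  ring

/-! ### Bounds by the weight, and the kernels of `(|ξ|² + μ²)⁻¹` and `|ξ|⁻²`. -/

theorem norm_nsq (ξ : E3) : ‖nsq ξ‖ = ‖ξ‖ ^ 2 := by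
  rw [nsq, Complex.norm_real, Real.norm_of_nonneg (by positivity)]

theorem nsq_ne_zero {ξ : E3} (h : ξ ≠ 0) : nsq ξ ≠ 0 := by
  rw [← norm_ne_zero_iff, norm_nsq]
  have := norm_pos_iff.2 h
  positivity

theorem measurable_nsq : Measurable nsq := by unfold nsq; fun_prop

theorem nsq_add_sq_ne_zero {μ : ℂ} (hμ : 0 < μ.re) (ξ : E3) : nsq ξ + μ ^ 2 ≠ 0 := by
  intro h
  have h1 := congrArg Complex.im h
  have h2 := congrArg Complex.re h
  simp only [nsq, Complex.add_re, Complex.add_im, Complex.ofReal_re, Complex.ofReal_im, sq,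
    Complex.mul_re, Complex.mul_im, Complex.zero_re, Complex.zero_im] at h1 h2
  have h3 : μ.im = 0 := by
    have : μ.re * μ.im = 0 := by linarith
    exact (mul_eq_zero.1 this).resolve_left hμ.ne'
  rw [h3] at h2
  nlinarith [norm_nonneg ξ, mul_self_nonneg ‖ξ‖, mul_pos hμ hμ]

theorem one_le_growth (N : ℕ) (x : E3) : 1 ≤ growth N x := by
  unfold growth
  have h1 : 1 ≤ (1 + ‖x‖) ^ N := one_le_pow₀ (by linarith [norm_nonneg x])
  have h2 : (0 : ℝ) ≤ (‖x‖ ^ 2)⁻¹ := by positivity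
  nlinarith

theorem inv_sq_le_growth (N : ℕ) (x : E3) : (‖x‖ ^ 2)⁻¹ ≤ growth N x := by
  unfold growth
  have h1 : 1 ≤ (1 + ‖x‖) ^ N := one_le_pow₀ (by linarith [norm_nonneg x])
  have h2 : (0 : ℝ) ≤ (‖x‖ ^ 2)⁻¹ := by positivity
  nlinarith

theorem inv_le_growth (N : ℕ) (x : E3) : ‖x‖⁻¹ ≤ growth N x := by
  have h1 : ‖x‖⁻¹ ≤ growth 0 x := by
    unfold growth
    rw [pow_zero, one_mul, ← inv_pow]
    nlinarith [sq_nonneg (‖x‖⁻¹ - 1), inv_nonneg.2 (norm_nonneg x)]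
  exact h1.trans (growth_mono (Nat.zero_le N) x)

theorem Mild.of_bound {m : E3 → ℂ} (hm : Measurable m) {C : ℝ} {N : ℕ} (hC : 0 ≤ C)
    (hb : ∀ x, x ≠ 0 → ‖m x‖ ≤ C * growth N x) : Mild m := by
  refine ⟨hm, C + ‖m 0‖, N, by positivity, fun x => ?_⟩
  by_cases hx : x = 0
  · rw [hx]
    nlinarith [one_le_growth N 0, norm_nonneg (m 0)]
  · exact (hb x hx).trans (mul_le_mul_of_nonneg_right (by linarith [norm_nonneg (m 0)])
      (growth_pos N x).le)

theorem mild_inv_nsq : Mild fun ξ => (nsq ξ)⁻¹ := by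
  refine ⟨measurable_nsq.inv, 1, 0, zero_le_one, fun x => ?_⟩
  rw [norm_inv, norm_nsq, one_mul]
  exact inv_sq_le_growth 0 x

theorem measurable_yukawa (μ : ℂ) : Measurable (yukawa μ) := by unfold yukawa; fun_prop

theorem norm_yukawa_le {μ : ℂ} (hμ : 0 ≤ μ.re) (x : E3) : ‖yukawa μ x‖ ≤ ‖x‖⁻¹ := by
  rw [yukawa, norm_div, norm_exp_neg_mul,
    show (4 * Real.pi * ‖x‖ : ℂ) = ((4 * Real.pi * ‖x‖ : ℝ) : ℂ) by push_cast; ring,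
    Complex.norm_real, Real.norm_of_nonneg (by positivity)]
  have h1 : Real.exp (-μ.re * ‖x‖) ≤ 1 :=
    Real.exp_le_one_iff.2 (by nlinarith [mul_nonneg hμ (norm_nonneg x)])
  have h2 : 1 ≤ 4 * Real.pi := by linarith [Real.pi_gt_three]
  rw [div_eq_mul_inv, mul_inv]
  have h3 : (4 * Real.pi)⁻¹ ≤ 1 := inv_le_one_of_one_le₀ h2
  calc _ ≤ 1 * (1 * ‖x‖⁻¹) := by gcongr
    _ = _ := by ring

theorem mild_yukawa {μ : ℂ} (hμ : 0 ≤ μ.re) : Mild (yukawa μ) :=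
  ⟨measurable_yukawa μ, 1, 0, zero_le_one, fun x =>
    (norm_yukawa_le hμ x).trans (by rw [one_mul]; exact inv_le_growth 0 x)⟩

/-- The symbol is, up to a constant, the transform of an integrable function. This bounds it without
estimating `|ξ|² + μ²` from below for complex `μ`. -/
theorem norm_fhat_yukawa_bound {μ : ℂ} (hμ : 0 < μ.re) :
    BddSym fun ξ => (nsq ξ + μ ^ 2)⁻¹ := by
  refine ⟨(measurable_nsq.add_const _).inv, C0⁻¹ * (C0 * ∫ x, ‖yukawa μ x‖), fun ξ => ?_⟩
  have h1 := norm_fhat_le (yukawa μ) ξ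
  rw [fhat_yukawa hμ, norm_mul, Complex.norm_real, Real.norm_of_nonneg C0_pos.le] at h1
  rw [inv_mul_eq_div, le_div_iff₀ C0_pos, mul_comm]
  exact h1

theorem hasKernel_yukawa {μ : ℂ} (hμ : 0 < μ.re) :
    HasKernel (fun ξ => (nsq ξ + μ ^ 2)⁻¹) (yukawa μ) := by
  refine ⟨(norm_fhat_yukawa_bound hμ).mild, mild_yukawa hμ.le, fun φ => ?_⟩
  have h := integral_fhat_mul (integrable_yukawa hμ) (ivS φ).integrable
  rw [fhat_ivS] at h
  rw [← h, ← integral_const_mul]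
  congr 1; funext ξ
  rw [fhat_yukawa hμ]; ring

/-- The Newtonian kernel is the kernel of `|ξ|⁻²`. -/
theorem hasKernel_newton : HasKernel (fun ξ => (nsq ξ)⁻¹) (yukawa 0) := by
  have hpos : ∀ k : ℕ, 0 < ((1 / ((k : ℝ) + 1) : ℝ) : ℂ).re := fun k => by
    rw [Complex.ofReal_re]; positivity
  have ht : Tendsto (fun k : ℕ => ((1 / ((k : ℝ) + 1) : ℝ) : ℂ)) atTop (𝓝 0) := by
    have := (Complex.continuous_ofReal.tendsto 0).comp tendsto_one_div_add_atTop_nhds_zero_nat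
    simpa [Function.comp_def] using this
  refine HasKernel.of_tendsto (fun k => hasKernel_yukawa (hpos k)) mild_inv_nsq
    (mild_yukawa (by simp)) (C := 1) (N := 0) (D := 1) (M := 0) (fun k x hx => ?_) (fun k x _ => ?_)
    (fun x hx => ?_) (fun x _ => ?_)
  · rw [norm_inv, one_mul]
    refine le_trans ?_ (inv_sq_le_growth 0 x)
    have hx' := norm_pos_iff.2 hx
    refine inv_anti₀ (by positivity) ?_
    rw [nsq, ← Complex.ofReal_pow, ← Complex.ofReal_add, Complex.norm_real,
      Real.norm_of_nonneg (by positivity)]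
    have : 0 ≤ (1 / ((k : ℝ) + 1)) ^ 2 := by positivity
    linarith
  · rw [one_mul]
    exact (norm_yukawa_le (hpos k).le x).trans (inv_le_growth 0 x)
  · refine Tendsto.inv₀ ?_ (nsq_ne_zero hx)
    simpa using (ht.pow 2).const_add (nsq x)
  · unfold yukawa
    refine Tendsto.div_const ?_ _
    exact ((Complex.continuous_exp.tendsto _).comp (ht.neg.mul_const _))

/-! ### Convolution with singular kernels -/

/-- The convolution of a kernel and a function. -/
def conv (K g : E3 → ℂ) (x : E3) : ℂ := ∫ y, K (x - y) * g y

/-- `g` is integrable and vanishes outside `B_R`. -/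
structure SuppIn (R : ℝ) (g : E3 → ℂ) : Prop where
  int : Integrable g
  supp : ∀ᵐ x, R ≤ ‖x‖ → g x = 0

theorem exists_norm_schwartz_le (φ : 𝓢(E3, ℂ)) (k : ℕ) :
    ∃ A : ℝ, 0 ≤ A ∧ ∀ x, ‖φ x‖ ≤ A * ((1 + ‖x‖) ^ k)⁻¹ := by
  refine ⟨2 ^ k * (Finset.Iic (k, 0)).sup (schwartzSeminormFamily ℂ E3 ℂ) φ, by positivity,
    fun x => ?_⟩
  have h := SchwartzMap.one_add_le_sup_seminorm_apply (𝕜 := ℂ) (m := (k, 0)) (k := k) (n := 0)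
    le_rfl le_rfl φ x
  rw [norm_iteratedFDeriv_zero] at h
  rw [← div_eq_mul_inv, le_div_iff₀ (by positivity), mul_comm]
  exact h

/-- For `|y| < R` one has `1 + |x - y| ≤ (1 + |x|)(1 + R)`, so the decay of `φ` in `x` can be traded
for decay in `x - y`. The resulting bound is uniform in `y`, as Fubini requires for data supported
in the ball. -/
theorem exists_integral_norm_le {K : E3 → ℂ} (hK : Mild K) (φ : 𝓢(E3, ℂ)) (R : ℝ) (hR : 0 < R) :
    ∃ M : ℝ, ∀ y : E3, ‖y‖ < R → Integrable (fun x => K (x - y) * φ x) ∧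
      ∫ x, ‖K (x - y) * φ x‖ ≤ M := by
  obtain ⟨hKm, C, N, hC, hb⟩ := hK
  obtain ⟨A, hA, hφ⟩ := exists_norm_schwartz_le φ (N + 4)
  set F : E3 → ℝ := fun w => C * A * (1 + R) ^ (N + 4) * (((1 + ‖w‖) ^ (N + 4))⁻¹ * growth N w)
  have hF : Integrable F := (integrable_decay_growth N).const_mul _
  refine ⟨∫ w, F w, fun y hy => ?_⟩
  have hle : ∀ x, ‖K (x - y) * φ x‖ ≤ F (x - y) := by
    intro x
    have h1 : 1 + ‖x - y‖ ≤ (1 + ‖x‖) * (1 + R) := by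
      have := norm_sub_le x y
      nlinarith [norm_nonneg x]
    have h2 : ((1 + ‖x‖) ^ (N + 4))⁻¹ ≤ (1 + R) ^ (N + 4) * ((1 + ‖x - y‖) ^ (N + 4))⁻¹ := by
      rw [← div_eq_mul_inv, le_div_iff₀ (by positivity), inv_mul_le_iff₀ (by positivity), ← mul_pow]
      gcongr
    rw [norm_mul]
    calc _ ≤ (C * growth N (x - y)) * (A * ((1 + R) ^ (N + 4) * ((1 + ‖x - y‖) ^ (N + 4))⁻¹)) := by
          refine mul_le_mul (hb _) ((hφ x).trans (by gcongr)) (norm_nonneg _) ?_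
          exact mul_nonneg hC (growth_pos _ _).le
      _ = _ := by simp only [F]; ring
  have hFy : Integrable fun x => F (x - y) := hF.comp_sub_right y
  have hm : AEStronglyMeasurable (fun x => K (x - y) * φ x) volume :=
    ((hKm.comp (measurable_id.sub_const y)).mul φ.continuous.measurable).aestronglyMeasurable
  have hi : Integrable fun x => K (x - y) * φ x := hFy.mono' hm (Eventually.of_forall hle)
  refine ⟨hi, ?_⟩
  rw [← integral_sub_right_eq_self F y]
  exact integral_mono hi.norm hFy hle

theorem aestronglyMeasurable_conv_kernel {K g : E3 → ℂ} (hK : Measurable K) (hg : Integrable g) :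
    AEStronglyMeasurable (fun z : E3 × E3 => K (z.1 - z.2) * g z.2)
      (volume.prod volume) :=
  (hK.comp (measurable_fst.sub measurable_snd)).aestronglyMeasurable.mul hg.1.comp_snd

theorem aestronglyMeasurable_conv {K g : E3 → ℂ} (hK : Measurable K) (hg : Integrable g) :
    AEStronglyMeasurable (conv K g) volume :=
  (aestronglyMeasurable_conv_kernel hK hg).integral_prod_right'

/-- The kernel identity applied to the translate of `φ` by `y`, whose inverse transform only
acquires a phase. -/
theorem fhat_mul_ivS {m K : E3 → ℂ} (h : HasKernel m K) (φ : 𝓢(E3, ℂ)) (y : E3) :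
    fhat (fun ξ => m ξ * ivS φ ξ) y = ∫ x, K (x - y) * φ x := by
  have h1 := h.eq (φ.compSubConstCLM ℂ (-y))
  have h2 : ∀ ξ, ivS (φ.compSubConstCLM ℂ (-y)) ξ =
      Complex.exp (-(Complex.I * ((inner ℝ y ξ : ℝ) : ℂ))) * ivS φ ξ := by
    intro ξ
    rw [ivS_apply, ivS_apply, mul_left_comm]
    congr 1
    rw [← integral_const_mul, ← integral_sub_right_eq_self _ y]
    congr 1; funext x
    rw [SchwartzMap.compSubConstCLM_apply, sub_neg_eq_add, sub_add_cancel, ← mul_assoc,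
      ← Complex.exp_add, inner_sub_right, real_inner_comm y ξ]
    congr 2
    push_cast; ring
  rw [fhat_eq, ← integral_sub_right_eq_self (fun x => K (x - y) * φ x) (-y)]
  simp only [SchwartzMap.compSubConstCLM_apply, h2] at h1
  simp only [sub_neg_eq_add, add_sub_cancel_right] at h1 ⊢
  rw [← h1]
  congr 2; funext ξ; ring

/-- The multiplication formula takes the transform off `g`. The transform of `m · ivS φ` is the
kernel integrated against `φ`, and Fubini reassembles the convolution. -/
theorem HasKernel.op_apply {m K : E3 → ℂ} (h : HasKernel m K) {R : ℝ} (hR : 0 < R) {g : E3 → ℂ}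
    (hg : SuppIn R g) (φ : 𝓢(E3, ℂ)) : op m g φ = ∫ x, conv K g x * φ x := by
  obtain ⟨M, hM⟩ := exists_integral_norm_le h.ker φ R hR
  have hGm : AEStronglyMeasurable (fun z : E3 × E3 => K (z.1 - z.2) * φ z.1 * g z.2)
      (volume.prod volume) := by
    refine AEStronglyMeasurable.mul (Measurable.aestronglyMeasurable ?_) hg.int.1.comp_snd
    exact (h.ker.1.comp (measurable_fst.sub measurable_snd)).mul
      (φ.continuous.measurable.comp measurable_fst)
  have hG : Integrable (fun z : E3 × E3 => K (z.1 - z.2) * φ z.1 * g z.2) (volume.prod volume) := by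
    rw [integrable_prod_iff' hGm]
    constructor
    · filter_upwards [hg.supp] with y hy
      by_cases hyR : R ≤ ‖y‖
      · simp [hy hyR]
      · exact (hM y (not_le.1 hyR)).1.mul_const _
    · refine (hg.int.norm.const_mul M).mono' (AEStronglyMeasurable.prod_swap hGm.norm).integral_prod_right' ?_
      filter_upwards [hg.supp] with y hy
      by_cases hyR : R ≤ ‖y‖
      · simp [hy hyR]
      · rw [Real.norm_of_nonneg (integral_nonneg fun x => norm_nonneg _)]
        simp_rw [norm_mul _ (g y)]
        rw [integral_mul_const]
        gcongr
        exact (hM y (not_le.1 hyR)).2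
  rw [Viscoelastic.op_apply h.sym hg.int]
  have e1 : ∫ ξ, m ξ * fhat g ξ * ivS φ ξ = ∫ ξ, fhat g ξ * (m ξ * ivS φ ξ) := by
    congr 1; funext ξ; ring
  rw [e1, integral_fhat_mul hg.int (h.sym.integrable_mul _)]
  calc ∫ y, g y * fhat (fun ξ => m ξ * ivS φ ξ) y
      = ∫ y, ∫ x, K (x - y) * φ x * g y := by
        congr 1; funext y
        rw [fhat_mul_ivS h, integral_mul_const, mul_comm]
    _ = ∫ x, ∫ y, K (x - y) * φ x * g y := (integral_integral_swap hG).symm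
    _ = _ := by
        congr 1; funext x
        rw [conv, ← integral_mul_const]
        congr 1; funext y; ring

/-- Young's inequality in local form: if `|x| < R'` and `|y| < R`, only values of the kernel on
`B_{R+R'}` matter, so local integrability of the kernel is enough. -/
theorem lintegral_conv_rpow_le {K g : E3 → ℂ} (hK : Measurable K) {R : ℝ} (hg : SuppIn R g)
    {p : ℝ} (hp : 1 ≤ p) (R' : ℝ) :
    ∫⁻ x in B R', ‖conv K g x‖ₑ ^ p ≤ (∫⁻ w in B (R + R'), ‖K w‖ₑ) ^ p * ∫⁻ x, ‖g x‖ₑ ^ p := by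
  set w : E3 → ℝ≥0∞ := (B (R + R')).indicator fun w => ‖K w‖ₑ with hw
  have hwm : Measurable w := hK.enorm.indicator (isOpen_B _).measurableSet
  have h1 : ∀ x ∈ B R', ‖conv K g x‖ₑ ≤ ∫⁻ b, w b * ‖g (x - b)‖ₑ := by
    intro x hx
    refine (enorm_integral_le_lintegral_enorm _).trans ?_
    rw [← lintegral_sub_left_eq_self (fun b => w b * ‖g (x - b)‖ₑ) x]
    refine lintegral_mono_ae ?_
    filter_upwards [hg.supp] with y hy
    rw [sub_sub_cancel, enorm_mul]
    by_cases hyR : R ≤ ‖y‖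
    · simp [hy hyR]
    · have : x - y ∈ B (R + R') := by
        have hx' : ‖x‖ < R' := by simpa [B] using hx
        simp only [B, Metric.mem_ball, dist_zero_right]
        linarith [norm_sub_le x y, not_le.1 hyR]
      rw [hw, Set.indicator_of_mem this]
  calc ∫⁻ x in B R', ‖conv K g x‖ₑ ^ p
      ≤ ∫⁻ x in B R', (∫⁻ b, w b * ‖g (x - b)‖ₑ) ^ p := by
        refine lintegral_mono_ae ?_
        filter_upwards [ae_restrict_mem (isOpen_B R').measurableSet] with x hx
        gcongr
        exact h1 x hx
    _ ≤ ∫⁻ x, (∫⁻ b, w b * ‖g (x - b)‖ₑ) ^ p := setLIntegral_le_lintegral _ _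
    _ ≤ (∫⁻ b, w b) ^ p * ∫⁻ x, ‖g x‖ₑ ^ p := by
        refine lintegral_lintegral_mul_rpow_le hp hwm.aemeasurable (h := fun x b => ‖g (x - b)‖ₑ)
          ?_ (Eventually.of_forall fun b => ?_)
        · exact (hg.int.1.comp_quasiMeasurePreserving
            (quasiMeasurePreserving_sub volume volume)).enorm
        · exact (lintegral_sub_right_eq_self (fun x => ‖g x‖ₑ ^ p) b).le
    _ = _ := by rw [hw, lintegral_indicator (isOpen_B _).measurableSet]

/-- `∫_{B_ρ} (1 + |x|)^N (1 + |x|⁻²) dx`. -/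
def growthMass (N : ℕ) (ρ : ℝ) : ℝ≥0∞ := ∫⁻ x in B ρ, ENNReal.ofReal (growth N x)

theorem growthMass_lt_top (N : ℕ) (ρ : ℝ) : growthMass N ρ < ⊤ := by
  rcases le_or_gt ρ 0 with h | h
  · simp [growthMass, B, Metric.ball_eq_empty.2 h]
  have hi := ((integrable_decay_growth N).const_mul ((1 + ρ) ^ (N + 4))).integrableOn (s := B ρ)
  have h2 : IntegrableOn (growth N) (B ρ) := by
    refine Integrable.mono' hi (measurable_growth N).aestronglyMeasurable ?_
    filter_upwards [ae_restrict_mem (isOpen_B ρ).measurableSet] with x hx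
    have hx' : ‖x‖ < ρ := by simpa [B] using hx
    rw [Real.norm_of_nonneg (growth_pos N x).le, ← mul_assoc]
    refine le_mul_of_one_le_left (growth_pos N x).le ?_
    rw [← div_eq_mul_inv, one_le_div₀ (by positivity)]
    gcongr
  have := h2.2
  rw [hasFiniteIntegral_iff_ofReal (Eventually.of_forall fun x => (growth_pos N x).le)] at this
  exact this

theorem setLIntegral_enorm_le {K : E3 → ℂ} {A : ℝ} {N : ℕ} (hA : 0 ≤ A)
    (hb : ∀ x, x ≠ 0 → ‖K x‖ ≤ A * growth N x) (ρ : ℝ) :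
    ∫⁻ w in B ρ, ‖K w‖ₑ ≤ ENNReal.ofReal A * growthMass N ρ := by
  rw [growthMass, ← lintegral_const_mul' _ _ ENNReal.ofReal_ne_top]
  refine lintegral_mono_ae (ae_restrict_of_ae ?_)
  filter_upwards [ae_ne_zero] with x hx
  rw [← ofReal_norm, ← ENNReal.ofReal_mul hA]
  exact ENNReal.ofReal_le_ofReal (hb x hx)

theorem HasKernel.represented {m K : E3 → ℂ} (h : HasKernel m K) {R : ℝ} (hR : 0 < R)
    {g : E3 → ℂ} (hg : SuppIn R g) : RepresentedOn (op m g) Set.univ (conv K g) := by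
  refine ⟨?_, fun φ _ _ => h.op_apply hR hg φ⟩
  rw [locallyIntegrableOn_univ]
  intro x
  refine ⟨B (‖x‖ + 1), (isOpen_B _).mem_nhds (by simp [B]), ?_⟩
  obtain ⟨hKm, C, N, hC, hb⟩ := h.ker
  refine ⟨(aestronglyMeasurable_conv hKm hg.int).restrict, ?_⟩
  have h1 := lintegral_conv_rpow_le hKm hg le_rfl (‖x‖ + 1)
  simp only [ENNReal.rpow_one] at h1
  refine h1.trans_lt (ENNReal.mul_lt_top ?_ hg.int.2)
  exact (setLIntegral_enorm_le hC (fun x _ => hb x) _).trans_lt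
    (ENNReal.mul_lt_top ENNReal.ofReal_lt_top (growthMass_lt_top _ _))

theorem HasKernel.lpNorm_op_le {m K : E3 → ℂ} (h : HasKernel m K) {A : ℝ} {N : ℕ} (hA : 0 ≤ A)
    (hb : ∀ x, x ≠ 0 → ‖K x‖ ≤ A * growth N x) {R : ℝ} (hR : 0 < R) {p : ℝ} (hp : 1 ≤ p)
    (R' : ℝ) {g : E3 → ℂ} (hg : SuppIn R g) :
    lpNorm (ENNReal.ofReal p) (B R') (op m g) ≤
      ENNReal.ofReal A * growthMass N (R + R') * eLpNorm g (ENNReal.ofReal p) volume := by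
  have hp0 : 0 < p := by linarith
  refine (lpNorm_le ((h.represented hR hg).mono (Set.subset_univ _)) _).trans ?_
  rw [eLpNorm_ofReal_eq hp0, eLpNorm_ofReal_eq hp0, one_div, ENNReal.rpow_inv_le_iff hp0,
    ENNReal.mul_rpow_of_nonneg _ _ hp0.le, ← ENNReal.rpow_mul, inv_mul_cancel₀ hp0.ne',
    ENNReal.rpow_one]
  refine (lintegral_conv_rpow_le h.ker.1 hg hp R').trans ?_
  gcongr
  exact setLIntegral_enorm_le hA hb _

/-! ### Continuity and decay away from the support -/

theorem norm_sub_ge_of_lt {R : ℝ} {x y : E3} (hy : ¬R ≤ ‖y‖) : ‖x‖ - R ≤ ‖x - y‖ := by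
  linarith [norm_sub_norm_le x y, not_le.1 hy]

/-- Near a point outside the closed ball the difference `x - y` stays at a positive distance from
the singularity for all `y` in the support, so dominated convergence applies. -/
theorem continuousOn_conv {K g : E3 → ℂ} (hK : Measurable K) (hc : ContinuousOn K {0}ᶜ) {A : ℝ}
    {s : ℕ} (hA : 0 ≤ A) (hb : ∀ x, x ≠ 0 → ‖K x‖ ≤ A * (‖x‖ ^ s)⁻¹) {R : ℝ} (hg : SuppIn R g) :
    ContinuousOn (conv K g) {x | R < ‖x‖} := by
  intro x₀ hx₀
  have hx₀ : R < ‖x₀‖ := hx₀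
  refine ContinuousAt.continuousWithinAt ?_
  set δ := (‖x₀‖ - R) / 2
  have hδ : 0 < δ := by simp only [δ]; linarith
  have hev : ∀ᶠ x in 𝓝 x₀, R + δ < ‖x‖ :=
    continuous_norm.continuousAt.eventually (lt_mem_nhds (by simp only [δ]; linarith))
  refine continuousAt_of_dominated (bound := fun y => A * (δ ^ s)⁻¹ * ‖g y‖) ?_ ?_
    (hg.int.norm.const_mul _) ?_
  · refine Eventually.of_forall fun x => ?_
    exact (hK.comp (measurable_const.sub measurable_id)).aestronglyMeasurable.mul hg.int.1
  · filter_upwards [hev] with x hx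
    filter_upwards [hg.supp] with y hy
    by_cases hyR : R ≤ ‖y‖
    · simp [hy hyR]
    · have h1 := norm_sub_ge_of_lt (x := x) hyR
      have h2 : δ ≤ ‖x - y‖ := by linarith
      rw [norm_mul]
      gcongr
      refine (hb _ (norm_pos_iff.1 (hδ.trans_le h2))).trans ?_
      gcongr
  · filter_upwards [hg.supp] with y hy
    by_cases hyR : R ≤ ‖y‖
    · simp only [hy hyR, mul_zero]; exact continuousAt_const
    · have h1 := norm_sub_ge_of_lt (x := x₀) hyR
      have h2 : x₀ - y ≠ 0 := norm_pos_iff.1 (by linarith)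
      have h3 : ContinuousAt K (x₀ - y) := hc.continuousAt (isOpen_compl_singleton.mem_nhds h2)
      refine ContinuousAt.mul ?_ continuousAt_const
      exact ContinuousAt.comp (f := fun x => x - y) h3 (by fun_prop)

/-- For `|x| ≥ 2R` and `|y| < R` one has `|x - y| ≥ |x|/2`, so the convolution inherits the decay of
the kernel. -/
theorem norm_conv_le {K g : E3 → ℂ} {A : ℝ} {s : ℕ} (hA : 0 ≤ A)
    (hb : ∀ x, x ≠ 0 → ‖K x‖ ≤ A * (‖x‖ ^ s)⁻¹) {R : ℝ} (hR : 0 < R) (hg : SuppIn R g) {x : E3}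
    (hx : 2 * R ≤ ‖x‖) : ‖x‖ ^ s * ‖conv K g x‖ ≤ 2 ^ s * A * ∫ y, ‖g y‖ := by
  have hx0 : 0 < ‖x‖ := by linarith
  have h1 : ‖conv K g x‖ ≤ ∫ y, A * ((‖x‖ / 2) ^ s)⁻¹ * ‖g y‖ := by
    refine norm_integral_le_of_norm_le (hg.int.norm.const_mul _) ?_
    filter_upwards [hg.supp] with y hy
    by_cases hyR : R ≤ ‖y‖
    · simp [hy hyR]
    · have h1 := norm_sub_ge_of_lt (x := x) hyR
      have h2 : ‖x‖ / 2 ≤ ‖x - y‖ := by linarith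
      rw [norm_mul]
      gcongr
      refine (hb _ (norm_pos_iff.1 (lt_of_lt_of_le (by positivity) h2))).trans ?_
      gcongr
  rw [integral_const_mul] at h1
  calc _ ≤ ‖x‖ ^ s * (A * ((‖x‖ / 2) ^ s)⁻¹ * ∫ y, ‖g y‖) := by gcongr
    _ = _ := by rw [div_pow]; field_simp

theorem integral_norm_le_eLpNorm {p : ℝ} (hp : 1 < p) {R : ℝ} {g : E3 → ℂ} (hg : SuppIn R g) :
    ENNReal.ofReal (∫ y, ‖g y‖) ≤ volume (B R) ^ (1 - 1 / p) *
      eLpNorm g (ENNReal.ofReal p) volume := by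
  have h0 : ∫⁻ y, ‖g y‖ₑ = ∫⁻ y in B R, ‖g y‖ₑ := by
    rw [← lintegral_indicator (isOpen_B R).measurableSet]
    refine lintegral_congr_ae ?_
    filter_upwards [hg.supp] with y hy
    by_cases hyR : y ∈ B R
    · rw [Set.indicator_of_mem hyR]
    · rw [Set.indicator_of_notMem hyR, hy (by simpa [B] using hyR)]; simp
  rw [ofReal_integral_norm_eq_lintegral_enorm hg.int, h0, ← eLpNorm_one_eq_lintegral_enorm]
  refine (eLpNorm_le_eLpNorm_mul_rpow_measure_univ (one_le_ofReal hp) hg.int.1.restrict).trans ?_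
  rw [Measure.restrict_apply_univ, mul_comm, ENNReal.toReal_ofReal (by linarith), ENNReal.toReal_one,
    one_div_one]
  gcongr
  exact Measure.restrict_le_self

/-! ### Derivatives of radial functions -/

/-- `K' = ∂_{x_j} K` off the origin. -/
def IsPartial (j : Fin 3) (K K' : E3 → ℂ) : Prop :=
  ∀ x, x ≠ 0 → HasDerivAt (fun t : ℝ => K (x + t • (EuclideanSpace.single j 1 : E3))) (K' x) 0

/-- Kronecker's symbol. -/
def kd (i j : Fin 3) : ℂ := if i = j then 1 else 0

theorem norm_kd_le (i j : Fin 3) : ‖kd i j‖ ≤ 1 := by unfold kd; split_ifs <;> simp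

theorem IsPartial.add {j : Fin 3} {K K' L L' : E3 → ℂ} (h : IsPartial j K K')
    (h' : IsPartial j L L') : IsPartial j (fun x => K x + L x) (fun x => K' x + L' x) :=
  fun x hx => (h x hx).add (h' x hx)

theorem IsPartial.mul {j : Fin 3} {K K' L L' : E3 → ℂ} (h : IsPartial j K K')
    (h' : IsPartial j L L') : IsPartial j (fun x => K x * L x) (fun x => K' x * L x + K x * L' x) :=
  fun x hx => by
    have := (h x hx).mul (h' x hx)
    simp only [zero_smul, add_zero] at this
    exact this

theorem IsPartial.const (j : Fin 3) (a : ℂ) : IsPartial j (fun _ => a) (fun _ => 0) :=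
  fun _ _ => hasDerivAt_const _ _

theorem IsPartial.coord (j i : Fin 3) : IsPartial j (fun x => (x i : ℂ)) (fun _ => kd i j) := by
  intro x _
  have h : HasDerivAt (fun t : ℝ => x i + t * (if i = j then 1 else 0)) (if i = j then 1 else 0) 0 := by
    simpa using ((hasDerivAt_id (0 : ℝ)).mul_const (if i = j then (1 : ℝ) else 0)).const_add (x i)
  have h2 := h.ofReal_comp
  convert h2 using 1
  · funext t; simp
  · unfold kd; split_ifs <;> simp

theorem hasDerivAt_norm_line {x : E3} (hx : x ≠ 0) (j : Fin 3) :
    HasDerivAt (fun t : ℝ => ‖x + t • (EuclideanSpace.single j 1 : E3)‖) (x j / ‖x‖) 0 := by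
  have hx' := norm_pos_iff.2 hx
  have e : (fun t : ℝ => ‖x + t • (EuclideanSpace.single j 1 : E3)‖) =
      fun t => Real.sqrt (‖x‖ ^ 2 + (2 * x j * t + t ^ 2)) := by
    funext t
    rw [← Real.sqrt_sq (norm_nonneg (x + t • (EuclideanSpace.single j 1 : E3))), norm_add_sq_real,
      inner_smul_right, EuclideanSpace.inner_single_right, norm_smul]
    congr 1
    simp
    ring
  rw [e]
  have h1 : HasDerivAt (fun t : ℝ => ‖x‖ ^ 2 + (2 * x j * t + t ^ 2)) (2 * x j) 0 := by
    have := (((hasDerivAt_id (0 : ℝ)).const_mul (2 * x j)).add (hasDerivAt_pow 2 (0 : ℝ))).const_add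
      (‖x‖ ^ 2)
    simpa using this
  have h2 := h1.sqrt (by simp [hx])
  convert h2 using 1
  simp
  field_simp

/-- Since `∂_j |x| = x_j/|x|`, a profile derivative of the form `r f'(r)` cancels the denominator.
This is why a `Tower` records successive quotients `f_n'/r`: all partial derivatives are then
polynomials in `x` times profiles. -/
theorem IsPartial.radial {f f' : ℝ → ℂ} (h : ∀ r, 0 < r → HasDerivAt f (r * f' r) r) (j : Fin 3) :
    IsPartial j (fun x => f ‖x‖) (fun x => x j * f' ‖x‖) := by
  intro x hx
  have hx' := norm_pos_iff.2 hx
  have h0 := h ‖x‖ hx'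
  have e : ‖x‖ = ‖x + (0 : ℝ) • (EuclideanSpace.single j 1 : E3)‖ := by simp
  rw [e] at h0
  have h1 := h0.scomp (0 : ℝ) (hasDerivAt_norm_line hx j)
  rw [← e] at h1
  refine h1.congr_deriv ?_
  rw [Complex.real_smul]
  have : (‖x‖ : ℂ) ≠ 0 := by exact_mod_cast hx'.ne'
  push_cast
  field_simp

theorem IsPartial.congr {j : Fin 3} {K K' L' : E3 → ℂ} (h : IsPartial j K K')
    (e : ∀ x, K' x = L' x) : IsPartial j K L' := fun x hx => (h x hx).congr_deriv (e x)

/-- A sequence of radial profiles with `f_{n+1} = f_n' / r`. -/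
def Tower (f : ℕ → ℝ → ℂ) (N : ℕ) : Prop :=
  (∀ n, Measurable (f n)) ∧ ∀ n < N, ∀ r, 0 < r → HasDerivAt (f n) (r * f (n + 1) r) r

/-- First derivatives of a radial function. -/
def rad₁ (f : ℕ → ℝ → ℂ) (j : Fin 3) (x : E3) : ℂ := x j * f 1 ‖x‖

/-- Second derivatives of a radial function. -/
def rad₂ (f : ℕ → ℝ → ℂ) (j k : Fin 3) (x : E3) : ℂ := kd j k * f 1 ‖x‖ + x j * x k * f 2 ‖x‖

/-- Third derivatives of a radial function. -/
def rad₃ (f : ℕ → ℝ → ℂ) (j k l : Fin 3) (x : E3) : ℂ :=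
  (kd j k * x l + kd j l * x k + kd k l * x j) * f 2 ‖x‖ + x j * x k * x l * f 3 ‖x‖

/-- Fourth derivatives of a radial function. -/
def rad₄ (f : ℕ → ℝ → ℂ) (j k l m : Fin 3) (x : E3) : ℂ :=
  (kd j k * kd l m + kd j l * kd k m + kd k l * kd j m) * f 2 ‖x‖ +
    (kd j k * x l * x m + kd j l * x k * x m + kd k l * x j * x m + kd j m * x k * x l +
      kd k m * x j * x l + kd l m * x j * x k) * f 3 ‖x‖ + x j * x k * x l * x m * f 4 ‖x‖

theorem Tower.isPartial₁ {f : ℕ → ℝ → ℂ} (h : Tower f 1) (j : Fin 3) :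
    IsPartial j (fun x => f 0 ‖x‖) (rad₁ f j) := IsPartial.radial (h.2 0 (by norm_num)) j

theorem Tower.isPartial₂ {f : ℕ → ℝ → ℂ} (h : Tower f 2) (j k : Fin 3) :
    IsPartial k (rad₁ f j) (rad₂ f j k) :=
  ((IsPartial.coord k j).mul (IsPartial.radial (h.2 1 (by norm_num)) k)).congr fun x => by
    unfold rad₂; ring

theorem Tower.isPartial₃ {f : ℕ → ℝ → ℂ} (h : Tower f 3) (j k l : Fin 3) :
    IsPartial l (rad₂ f j k) (rad₃ f j k l) :=
  (((IsPartial.const l (kd j k)).mul (IsPartial.radial (h.2 1 (by norm_num)) l)).add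
    (((IsPartial.coord l j).mul (IsPartial.coord l k)).mul
      (IsPartial.radial (h.2 2 (by norm_num)) l))).congr fun x => by
    unfold rad₃; ring

theorem Tower.isPartial₄ {f : ℕ → ℝ → ℂ} (h : Tower f 4) (j k l m : Fin 3) :
    IsPartial m (rad₃ f j k l) (rad₄ f j k l m) :=
  (((((IsPartial.const m (kd j k)).mul (IsPartial.coord m l)).add
    ((IsPartial.const m (kd j l)).mul (IsPartial.coord m k))).add
    ((IsPartial.const m (kd k l)).mul (IsPartial.coord m j))).mul
      (IsPartial.radial (h.2 2 (by norm_num)) m) |>.add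
    ((((IsPartial.coord m j).mul (IsPartial.coord m k)).mul (IsPartial.coord m l)).mul
      (IsPartial.radial (h.2 3 (by norm_num)) m))).congr fun x => by
    unfold rad₄; ring

theorem measurable_rad₁ {f : ℕ → ℝ → ℂ} (h : ∀ n, Measurable (f n)) (j : Fin 3) :
    Measurable (rad₁ f j) := by
  have hc := measurable_coord
  have := fun n => (h n).comp (measurable_norm (α := E3))
  exact (hc j).mul (this 1)

theorem measurable_rad₂ {f : ℕ → ℝ → ℂ} (h : ∀ n, Measurable (f n)) (j k : Fin 3) :
    Measurable (rad₂ f j k) := by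
  have hc := measurable_coord
  have := fun n => (h n).comp (measurable_norm (α := E3))
  exact ((this 1).const_mul _).add (((hc j).mul (hc k)).mul (this 2))

theorem measurable_rad₃ {f : ℕ → ℝ → ℂ} (h : ∀ n, Measurable (f n)) (j k l : Fin 3) :
    Measurable (rad₃ f j k l) := by
  have hc := measurable_coord
  have := fun n => (h n).comp (measurable_norm (α := E3))
  exact (((((hc l).const_mul _).add ((hc k).const_mul _)).add ((hc j).const_mul _)).mul
    (this 2)).add ((((hc j).mul (hc k)).mul (hc l)).mul (this 3))

theorem measurable_rad₄ {f : ℕ → ℝ → ℂ} (h : ∀ n, Measurable (f n)) (j k l m : Fin 3) :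
    Measurable (rad₄ f j k l m) := by
  have hc := measurable_coord
  have := fun n => (h n).comp (measurable_norm (α := E3))
  have h2 : ∀ (a : ℂ) (i k : Fin 3), Measurable fun x : E3 => a * x i * x k := fun a i k =>
    ((hc i).const_mul a).mul (hc k)
  exact (((this 2).const_mul _).add (((((((h2 _ l m).add (h2 _ k m)).add (h2 _ j m)).add
    (h2 _ k l)).add (h2 _ j l)).add (h2 _ j k)).mul (this 3))).add
    (((((hc j).mul (hc k)).mul (hc l)).mul (hc m)).mul (this 4))

theorem norm_rad₁_le (f : ℕ → ℝ → ℂ) (j : Fin 3) (x : E3) :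
    ‖rad₁ f j x‖ ≤ ‖x‖ * ‖f 1 ‖x‖‖ := by
  rw [rad₁, norm_mul]; gcongr; exact norm_coord_le x j

theorem norm_rad₂_le (f : ℕ → ℝ → ℂ) (j k : Fin 3) (x : E3) :
    ‖rad₂ f j k x‖ ≤ ‖f 1 ‖x‖‖ + ‖x‖ ^ 2 * ‖f 2 ‖x‖‖ := by
  have hc := norm_coord_le x
  have hk := norm_kd_le
  refine (norm_add_le _ _).trans (add_le_add ?_ ?_)
  · rw [norm_mul]; exact mul_le_of_le_one_left (norm_nonneg _) (hk j k)
  · rw [norm_mul, norm_mul, sq]; gcongr <;> apply hc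

theorem norm_kd_mul_le (i j k : Fin 3) (x : E3) : ‖kd i j * x k‖ ≤ ‖x‖ := by
  rw [norm_mul]
  calc _ ≤ 1 * ‖x‖ := by gcongr; exacts [norm_kd_le i j, norm_coord_le x k]
    _ = _ := one_mul _

theorem norm_rad₃_le (f : ℕ → ℝ → ℂ) (j k l : Fin 3) (x : E3) :
    ‖rad₃ f j k l x‖ ≤ 3 * ‖x‖ * ‖f 2 ‖x‖‖ + ‖x‖ ^ 3 * ‖f 3 ‖x‖‖ := by
  have hc := norm_coord_le x
  refine (norm_add_le _ _).trans (add_le_add ?_ ?_)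
  · rw [norm_mul]
    gcongr
    refine (norm_add₃_le).trans ?_
    linarith [norm_kd_mul_le j k l x, norm_kd_mul_le j l k x, norm_kd_mul_le k l j x]
  · rw [norm_mul, norm_mul, norm_mul]
    calc _ ≤ ‖x‖ * ‖x‖ * ‖x‖ * ‖f 3 ‖x‖‖ := by gcongr <;> apply hc
      _ = _ := by ring

theorem norm_kd_mul_mul_le (i j k l : Fin 3) (x : E3) : ‖kd i j * x k * x l‖ ≤ ‖x‖ ^ 2 := by
  rw [norm_mul, sq]
  gcongr
  exacts [norm_kd_mul_le i j k x, norm_coord_le x l]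

theorem norm_kd_mul_kd_le (i j k l : Fin 3) : ‖kd i j * kd k l‖ ≤ 1 := by
  rw [norm_mul]; exact mul_le_one₀ (norm_kd_le _ _) (norm_nonneg _) (norm_kd_le _ _)

theorem norm_rad₄_le (f : ℕ → ℝ → ℂ) (j k l m : Fin 3) (x : E3) :
    ‖rad₄ f j k l m x‖ ≤
      3 * ‖f 2 ‖x‖‖ + 6 * ‖x‖ ^ 2 * ‖f 3 ‖x‖‖ + ‖x‖ ^ 4 * ‖f 4 ‖x‖‖ := by
  have hc := norm_coord_le x
  refine norm_add₃_le.trans (add_le_add (add_le_add ?_ ?_) ?_)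
  · rw [norm_mul]
    gcongr
    refine norm_add₃_le.trans ?_
    linarith [norm_kd_mul_kd_le j k l m, norm_kd_mul_kd_le j l k m, norm_kd_mul_kd_le k l j m]
  · rw [norm_mul]
    gcongr
    refine (norm_add_le _ _).trans ?_
    refine (add_le_add (norm_add_le _ _) le_rfl).trans ?_
    refine (add_le_add (add_le_add (norm_add_le _ _) le_rfl) le_rfl).trans ?_
    refine (add_le_add (add_le_add (add_le_add norm_add₃_le le_rfl) le_rfl) le_rfl).trans ?_
    linarith [norm_kd_mul_mul_le j k l m x, norm_kd_mul_mul_le j l k m x,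
      norm_kd_mul_mul_le k l j m x, norm_kd_mul_mul_le j m k l x, norm_kd_mul_mul_le k m j l x,
      norm_kd_mul_mul_le l m j k x]
  · rw [norm_mul, norm_mul, norm_mul, norm_mul]
    calc _ ≤ ‖x‖ * ‖x‖ * ‖x‖ * ‖x‖ * ‖f 4 ‖x‖‖ := by gcongr <;> apply hc
      _ = _ := by ring

/-! ### The remainder of the exponential series -/

/-- The `n`-th derivative of `s ↦ (1 - s + s²/2 - e^(-s)) / s³`. -/
def expRem (n : ℕ) (s : ℂ) : ℂ :=
  ∫ t in (0 : ℝ)..1, ((1 - t) ^ 2 / 2 * (-t) ^ n : ℂ) * Complex.exp (-(t * s))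

theorem norm_expRem_integrand_le (n : ℕ) {s : ℂ} (hs : 0 ≤ s.re) {t : ℝ} (ht : t ∈ Set.uIoc 0 1) :
    ‖((1 - t) ^ 2 / 2 * (-t) ^ n : ℂ) * Complex.exp (-(t * s))‖ ≤ 1 := by
  rw [Set.uIoc_of_le zero_le_one] at ht
  obtain ⟨h0, h1⟩ := ht
  rw [norm_mul, Complex.norm_exp]
  have e1 : ‖((1 - t) ^ 2 / 2 * (-t) ^ n : ℂ)‖ = (1 - t) ^ 2 / 2 * t ^ n := by
    rw [show ((1 - t) ^ 2 / 2 * (-t) ^ n : ℂ) = (((1 - t) ^ 2 / 2 * (-t) ^ n : ℝ) : ℂ) by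
      push_cast; ring, Complex.norm_real, norm_mul, norm_pow, norm_neg, Real.norm_of_nonneg h0.le,
      Real.norm_of_nonneg (by positivity)]
  have h2 : (-(t * s)).re ≤ 0 := by simp; positivity
  rw [e1]
  have h3 : (1 - t) ^ 2 / 2 ≤ 1 := by nlinarith
  have h4 : t ^ n ≤ 1 := pow_le_one₀ h0.le h1
  have h5 : Real.exp (-(t * s)).re ≤ 1 := Real.exp_le_one_iff.2 h2
  exact mul_le_one₀ (mul_le_one₀ h3 (by positivity) h4) (Real.exp_pos _).le h5

/-- The integral form involves no division by `s`, and `Re s ≥ 0` keeps the exponential bounded by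
one. The estimate is therefore uniform down to `s = 0`. -/
theorem norm_expRem_le (n : ℕ) {s : ℂ} (hs : 0 ≤ s.re) : ‖expRem n s‖ ≤ 1 := by
  have := intervalIntegral.norm_integral_le_of_norm_le_const (a := (0 : ℝ)) (b := 1) (C := 1)
    (fun t ht => norm_expRem_integrand_le n hs ht)
  simpa [expRem] using this

theorem hasDerivAt_expRem (n : ℕ) (s : ℂ) : HasDerivAt (expRem n) (expRem (n + 1) s) s := by
  have hc : ∀ (n : ℕ) (s : ℂ), Continuous fun t : ℝ =>
      ((1 - t) ^ 2 / 2 * (-t) ^ n : ℂ) * Complex.exp (-(t * s)) := fun n s => by fun_prop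
  refine (intervalIntegral.hasDerivAt_integral_of_dominated_loc_of_deriv_le (𝕜 := ℂ)
    (F := fun s (t : ℝ) => ((1 - t) ^ 2 / 2 * (-t) ^ n : ℂ) * Complex.exp (-(t * s)))
    (F' := fun s (t : ℝ) => ((1 - t) ^ 2 / 2 * (-t) ^ (n + 1) : ℂ) * Complex.exp (-(t * s)))
    (bound := fun _ => Real.exp (‖s‖ + 1)) (Metric.ball_mem_nhds s one_pos)
    (Eventually.of_forall fun s => (hc n s).aestronglyMeasurable)
    ((hc n s).intervalIntegrable _ _) (hc (n + 1) s).aestronglyMeasurable ?_ ?_ ?_).2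
  · refine Eventually.of_forall fun t ht z hz => ?_
    have hz' : ‖z‖ ≤ ‖s‖ + 1 := by
      have : ‖z - s‖ < 1 := by simpa [dist_eq_norm] using hz
      linarith [norm_sub_norm_le z s]
    have h0 := norm_expRem_integrand_le (n + 1) (s := 0) (by simp) ht
    rw [mul_zero, neg_zero, Complex.exp_zero, mul_one] at h0
    rw [norm_mul]
    refine (mul_le_of_le_one_left (norm_nonneg _) h0).trans ?_
    rw [Complex.norm_exp]
    gcongr
    rw [Set.uIoc_of_le zero_le_one] at ht
    calc (-(t * z)).re ≤ ‖-(t * z)‖ := Complex.re_le_norm _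
      _ = t * ‖z‖ := by rw [norm_neg, norm_mul, Complex.norm_real, Real.norm_of_nonneg ht.1.le]
      _ ≤ 1 * ‖z‖ := by gcongr; exact ht.2
      _ ≤ _ := by linarith
  · exact intervalIntegrable_const
  · refine Eventually.of_forall fun t _ z _ => ?_
    have h1 : HasDerivAt (fun z : ℂ => -(t * z)) (-t) z := by
      exact (((hasDerivAt_id z).const_mul (t : ℂ)).neg).congr_deriv (by simp)
    refine (h1.cexp.const_mul _).congr_deriv ?_
    rw [pow_succ]; ring

/-- Taylor's formula with integral remainder, checked with an explicit primitive of the integrand.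
-/
theorem exp_neg_eq_expRem {s : ℂ} (hs : s ≠ 0) :
    Complex.exp (-s) = 1 - s + s ^ 2 / 2 - s ^ 3 * expRem 0 s := by
  have h := intervalIntegral.integral_eq_sub_of_hasDerivAt (a := (0 : ℝ)) (b := 1)
    (f := fun t : ℝ => -(Complex.exp (-(t * s)) *
      ((1 - t) ^ 2 / (2 * s) - (1 - t) / s ^ 2 + 1 / s ^ 3)))
    (f' := fun t : ℝ => ((1 - t) ^ 2 / 2 * (-t) ^ 0 : ℂ) * Complex.exp (-(t * s)))
    (fun t _ => by
      have h0 : HasDerivAt (fun t : ℝ => (t : ℂ)) 1 t := Complex.ofRealCLM.hasDerivAt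
      have h1 : HasDerivAt (fun t : ℝ => -((t : ℂ) * s)) (-s) t := by
        exact (h0.mul_const s).neg.congr_deriv (by simp)
      have h2 : HasDerivAt (fun t : ℝ => (1 - (t : ℂ))) (-1) t := by simpa using h0.const_sub 1
      have h3 := (((h2.pow 2).div_const (2 * s)).sub (h2.div_const (s ^ 2))).add_const (1 / s ^ 3)
      refine (h1.cexp.mul h3).neg.congr_deriv ?_
      simp only [Pi.pow_apply, Pi.sub_apply]
      field_simp
      ring)
    (Continuous.intervalIntegrable (by fun_prop) _ _)
  rw [← expRem] at h
  rw [h]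
  simp
  field_simp
  ring

/-! ### The radial profiles of the resolvent kernels -/

/-- Profile of `1 / (4π|x|)`. -/
def newtonTower : ℕ → ℝ → ℂ
  | 0 => fun r => 1 / (4 * Real.pi * r)
  | 1 => fun r => -1 / (4 * Real.pi * r ^ 3)
  | _ => 0

/-- Profile of `-|x| / (8π)`. -/
def biTower : ℕ → ℝ → ℂ
  | 0 => fun r => -r / (8 * Real.pi)
  | 1 => fun r => -1 / (8 * Real.pi * r)
  | 2 => fun r => 1 / (8 * Real.pi * r ^ 3)
  | 3 => fun r => -3 / (8 * Real.pi * r ^ 5)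
  | _ => 0

/-- The combination `a h⁽ⁿ⁾(s) + s h⁽ⁿ⁺¹⁾(s)`. -/
def expComb (a : ℕ) (n : ℕ) (s : ℂ) : ℂ := a * expRem n s + s * expRem (n + 1) s

/-- Profile of `(1 - e^(-μ|x|)) / (4πμ²|x|) - 1 / (4πμ) + |x| / (8π)`. -/
def remTower (μ : ℂ) : ℕ → ℝ → ℂ
  | 0 => fun r => μ * r ^ 2 * expRem 0 (μ * r) / (4 * Real.pi)
  | 1 => fun r => μ * expComb 2 0 (μ * r) / (4 * Real.pi)
  | 2 => fun r => μ ^ 2 * (expComb 3 1 (μ * r) / r) / (4 * Real.pi)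
  | 3 => fun r => μ ^ 2 * (μ * expComb 4 2 (μ * r) / r ^ 2 - expComb 3 1 (μ * r) / r ^ 3) /
      (4 * Real.pi)
  | 4 => fun r => μ ^ 2 * (μ ^ 2 * expComb 5 3 (μ * r) / r ^ 3 - 3 * μ * expComb 4 2 (μ * r) / r ^ 4 +
      3 * expComb 3 1 (μ * r) / r ^ 5) / (4 * Real.pi)
  | _ => 0

/-- Profile of `(1 - e^(-μ|x|)) / (4πμ²|x|)`. -/
def fullTower (μ : ℂ) (n : ℕ) (r : ℝ) : ℂ :=
  (if n = 0 then 1 / (4 * Real.pi * μ) else 0) + biTower n r + remTower μ n r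

theorem measurable_expRem (n : ℕ) : Measurable (expRem n) :=
  (continuous_iff_continuousAt.2 fun s => (hasDerivAt_expRem n s).continuousAt).measurable

theorem hasDerivAt_expRem_mul (n : ℕ) (μ : ℂ) (r : ℝ) :
    HasDerivAt (fun r : ℝ => expRem n (μ * r)) (μ * expRem (n + 1) (μ * r)) r := by
  have h0 : HasDerivAt (fun r : ℝ => μ * (r : ℂ)) μ r :=
    ((Complex.ofRealCLM.hasDerivAt (x := r)).const_mul μ).congr_deriv (by simp)
  have := (hasDerivAt_expRem n (μ * r)).comp r h0
  exact this.congr_deriv (mul_comm _ _)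

/-- The combinations form a family closed under differentiation, which keeps every profile of the
remainder explicit. -/
theorem hasDerivAt_expComb_mul (a n : ℕ) (μ : ℂ) (r : ℝ) :
    HasDerivAt (fun r : ℝ => expComb a n (μ * r)) (μ * expComb (a + 1) (n + 1) (μ * r)) r := by
  have h0 : HasDerivAt (fun r : ℝ => μ * (r : ℂ)) μ r :=
    ((Complex.ofRealCLM.hasDerivAt (x := r)).const_mul μ).congr_deriv (by simp)
  refine (((hasDerivAt_expRem_mul n μ r).const_mul (a : ℂ)).add
    (h0.mul (hasDerivAt_expRem_mul (n + 1) μ r))).congr_deriv ?_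
  simp only [expComb]
  push_cast
  ring

theorem hasDerivAt_ofReal (r : ℝ) : HasDerivAt (fun r : ℝ => (r : ℂ)) 1 r :=
  Complex.ofRealCLM.hasDerivAt

theorem tower_newton : Tower newtonTower 1 := by
  constructor
  · intro n
    match n with
    | 0 => unfold newtonTower; fun_prop
    | 1 => unfold newtonTower; fun_prop
    | _ + 2 => exact measurable_const
  · intro n hn r hr
    have hr0 : (r : ℂ) ≠ 0 := by exact_mod_cast hr.ne'
    have hpi : (Real.pi : ℂ) ≠ 0 := by exact_mod_cast Real.pi_ne_zero
    have h0 := hasDerivAt_ofReal r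
    match n, hn with
    | 0, _ =>
      refine ((h0.const_mul (4 * Real.pi : ℂ)).fun_inv (by simp [hr0, hpi])).congr_of_eventuallyEq
        (Eventually.of_forall fun s => by simp [newtonTower]) |>.congr_deriv ?_
      simp only [newtonTower]
      field_simp

theorem tower_bi : Tower biTower 3 := by
  constructor
  · intro n
    match n with
    | 0 => unfold biTower; fun_prop
    | 1 => unfold biTower; fun_prop
    | 2 => unfold biTower; fun_prop
    | 3 => unfold biTower; fun_prop
    | _ + 4 => exact measurable_const
  · intro n hn r hr
    have hr0 : (r : ℂ) ≠ 0 := by exact_mod_cast hr.ne'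
    have hpi : (Real.pi : ℂ) ≠ 0 := by exact_mod_cast Real.pi_ne_zero
    have h0 := hasDerivAt_ofReal r
    match n, hn with
    | 0, _ =>
      refine (h0.neg.div_const (8 * Real.pi : ℂ)).congr_deriv ?_
      simp only [biTower]
      field_simp
    | 1, _ =>
      refine ((hasDerivAt_const r (-1 : ℂ)).div (h0.const_mul (8 * Real.pi : ℂ))
        (by simp [hr0, hpi])).congr_deriv ?_
      simp only [biTower]
      field_simp
      ring
    | 2, _ =>
      refine ((hasDerivAt_const r (1 : ℂ)).div ((h0.fun_pow 3).const_mul (8 * Real.pi : ℂ))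
        (by simp [hr0, hpi])).congr_deriv ?_
      simp only [biTower]
      field_simp
      ring

theorem tower_rem (μ : ℂ) : Tower (remTower μ) 4 := by
  have hE : ∀ n, Measurable fun r : ℝ => expRem n (μ * r) := fun n =>
    (measurable_expRem n).comp (by fun_prop)
  have hC : ∀ a n, Measurable fun r : ℝ => expComb a n (μ * r) := fun a n => by
    have h1 := hE n
    have h2 := hE (n + 1)
    unfold expComb; fun_prop
  constructor
  · intro n
    have h0 := hE 0
    have h1 := hC 2 0
    have h2 := hC 3 1
    have h3 := hC 4 2
    have h4 := hC 5 3
    match n with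
    | 0 => unfold remTower; fun_prop
    | 1 => unfold remTower; fun_prop
    | 2 => unfold remTower; fun_prop
    | 3 => unfold remTower; fun_prop
    | 4 => unfold remTower; fun_prop
    | _ + 5 => exact measurable_const
  · intro n hn r hr
    have hr0 : (r : ℂ) ≠ 0 := by exact_mod_cast hr.ne'
    have hpi : (Real.pi : ℂ) ≠ 0 := by exact_mod_cast Real.pi_ne_zero
    have h0 := hasDerivAt_ofReal r
    have e1 := hasDerivAt_expComb_mul 2 0 μ r
    have e2 := hasDerivAt_expComb_mul 3 1 μ r
    have e3 := hasDerivAt_expComb_mul 4 2 μ r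
    match n, hn with
    | 0, _ =>
      refine ((((h0.fun_pow 2).const_mul μ).mul (hasDerivAt_expRem_mul 0 μ r)).div_const
        (4 * Real.pi : ℂ)).congr_deriv ?_
      simp only [remTower, expComb]
      field_simp
      push_cast
      ring
    | 1, _ =>
      refine ((e1.const_mul μ).div_const (4 * Real.pi : ℂ)).congr_deriv ?_
      simp only [remTower]
      field_simp
    | 2, _ =>
      refine (((e2.div h0 hr0).const_mul (μ ^ 2)).div_const (4 * Real.pi : ℂ)).congr_deriv ?_
      simp only [remTower]
      field_simp
    | 3, _ =>
      refine (((((e3.const_mul μ).div (h0.fun_pow 2) (pow_ne_zero _ hr0)).sub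
        (e2.div (h0.fun_pow 3) (pow_ne_zero _ hr0))).const_mul (μ ^ 2)).div_const
          (4 * Real.pi : ℂ)).congr_deriv ?_
      simp only [remTower]
      field_simp
      ring

theorem tower_full (μ : ℂ) : Tower (fullTower μ) 3 := by
  constructor
  · intro n
    exact (measurable_const.add (tower_bi.1 n)).add ((tower_rem μ).1 n)
  · intro n hn r hr
    have h := ((tower_bi.2 n hn r hr).const_add (if n = 0 then 1 / (4 * Real.pi * μ) else 0)).add
      ((tower_rem μ).2 n (by omega) r hr)
    refine h.congr_deriv ?_
    simp only [fullTower]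
    rw [if_neg (Nat.succ_ne_zero n)]
    ring

/-! ### Bounds -/

theorem norm_expComb_le (a n : ℕ) {μ : ℂ} (hμ : 0 ≤ μ.re) (h1 : ‖μ‖ ≤ 1) {r : ℝ} (hr : 0 ≤ r) :
    ‖expComb a n (μ * r)‖ ≤ a + r := by
  have hs : 0 ≤ (μ * r).re := by simp; positivity
  refine (norm_add_le _ _).trans (add_le_add ?_ ?_)
  · rw [norm_mul, Complex.norm_natCast]
    exact mul_le_of_le_one_right (by positivity) (norm_expRem_le n hs)
  · rw [norm_mul, norm_mul, Complex.norm_real, Real.norm_of_nonneg hr]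
    calc _ ≤ 1 * r * 1 := by
          gcongr
          exact norm_expRem_le (n + 1) hs
      _ = r := by ring

theorem norm_div_four_pi_le (z : ℂ) : ‖z / (4 * Real.pi)‖ ≤ ‖z‖ := by
  rw [norm_div, show (4 * Real.pi : ℂ) = ((4 * Real.pi : ℝ) : ℂ) by push_cast; ring,
    Complex.norm_real, Real.norm_of_nonneg (by positivity)]
  exact div_le_self (norm_nonneg _) (by linarith [Real.pi_gt_three])

theorem norm_ofReal_pow {r : ℝ} (hr : 0 ≤ r) (n : ℕ) : ‖(r : ℂ) ^ n‖ = r ^ n := by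
  rw [norm_pow, Complex.norm_real, Real.norm_of_nonneg hr]

theorem norm_remTower_zero_le {μ : ℂ} (hμ : 0 ≤ μ.re) {r : ℝ} (hr : 0 < r) : ‖remTower μ 0 r‖ ≤ ‖μ‖ * r ^ 2 := by
  have hs : 0 ≤ (μ * r).re := by simp; positivity
  refine (norm_div_four_pi_le _).trans ?_
  rw [norm_mul, norm_mul, norm_ofReal_pow hr.le]
  exact mul_le_of_le_one_right (by positivity) (norm_expRem_le 0 hs)

theorem norm_remTower_one_le {μ : ℂ} (hμ : 0 ≤ μ.re) (h1 : ‖μ‖ ≤ 1) {r : ℝ} (hr : 0 < r) : ‖remTower μ 1 r‖ ≤ ‖μ‖ * (2 + r) := by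
  refine (norm_div_four_pi_le _).trans ?_
  rw [norm_mul]
  gcongr
  exact_mod_cast norm_expComb_le 2 0 hμ h1 hr.le

/-- Of the two factors `μ` one is retained and the other is bounded by one. A single power of `|μ|`
is all that the limit needs. -/
theorem norm_sq_mul_le {μ : ℂ} (h1 : ‖μ‖ ≤ 1) (z : ℂ) {b : ℝ} (hz : ‖z‖ ≤ b) : ‖μ ^ 2 * z / (4 * Real.pi)‖ ≤ ‖μ‖ * b := by
  refine (norm_div_four_pi_le _).trans ?_
  rw [norm_mul, norm_pow, sq, mul_assoc]
  gcongr
  exact (mul_le_of_le_one_left (norm_nonneg _) h1).trans hz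

theorem norm_remTower_two_le {μ : ℂ} (hμ : 0 ≤ μ.re) (h1 : ‖μ‖ ≤ 1) {r : ℝ} (hr : 0 < r) : ‖remTower μ 2 r‖ ≤ ‖μ‖ * ((3 + r) / r) := by
  refine norm_sq_mul_le h1 _ ?_
  rw [norm_div, Complex.norm_real, Real.norm_of_nonneg hr.le]
  gcongr
  exact_mod_cast norm_expComb_le 3 1 hμ h1 hr.le

theorem norm_remTower_three_le {μ : ℂ} (hμ : 0 ≤ μ.re) (h1 : ‖μ‖ ≤ 1) {r : ℝ} (hr : 0 < r) :
    ‖remTower μ 3 r‖ ≤ ‖μ‖ * ((4 + r) / r ^ 2 + (3 + r) / r ^ 3) := by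
  refine norm_sq_mul_le h1 _ ((norm_sub_le _ _).trans ?_)
  have a1 : ‖expComb 3 1 (μ * r)‖ ≤ 3 + r := by exact_mod_cast norm_expComb_le 3 1 hμ h1 hr.le
  have a2 : ‖expComb 4 2 (μ * r)‖ ≤ 4 + r := by exact_mod_cast norm_expComb_le 4 2 hμ h1 hr.le
  rw [norm_div, norm_div, norm_mul, norm_ofReal_pow hr.le, norm_ofReal_pow hr.le]
  gcongr
  exact (mul_le_of_le_one_left (norm_nonneg _) h1).trans a2

theorem norm_remTower_four_le {μ : ℂ} (hμ : 0 ≤ μ.re) (h1 : ‖μ‖ ≤ 1) {r : ℝ} (hr : 0 < r) : ‖remTower μ 4 r‖ ≤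
    ‖μ‖ * ((5 + r) / r ^ 3 + 3 * (4 + r) / r ^ 4 + 3 * (3 + r) / r ^ 5) := by
  refine norm_sq_mul_le h1 _ ((norm_add_le _ _).trans (add_le_add ((norm_sub_le _ _).trans ?_) ?_))
  · have a2 : ‖expComb 4 2 (μ * r)‖ ≤ 4 + r := by exact_mod_cast norm_expComb_le 4 2 hμ h1 hr.le
    have a3 : ‖expComb 5 3 (μ * r)‖ ≤ 5 + r := by exact_mod_cast norm_expComb_le 5 3 hμ h1 hr.le
    rw [norm_div, norm_div, norm_mul, norm_mul, norm_mul, norm_pow, norm_ofReal_pow hr.le,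
      norm_ofReal_pow hr.le, Complex.norm_ofNat]
    gcongr
    · exact (mul_le_of_le_one_left (norm_nonneg _) (pow_le_one₀ (norm_nonneg _) h1)).trans a3
    · linarith
  · have a1 : ‖expComb 3 1 (μ * r)‖ ≤ 3 + r := by exact_mod_cast norm_expComb_le 3 1 hμ h1 hr.le
    rw [norm_div, norm_mul, norm_ofReal_pow hr.le, Complex.norm_ofNat]
    gcongr

theorem pow_le_growth {i : ℕ} (hi : i ≤ 2) (x : E3) : ‖x‖ ^ i ≤ growth 2 x := by
  have h1 : ‖x‖ ^ i ≤ (1 + ‖x‖) ^ 2 := by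
    calc ‖x‖ ^ i ≤ (1 + ‖x‖) ^ i := by gcongr; linarith
      _ ≤ _ := pow_le_pow_right₀ (by linarith [norm_nonneg x]) hi
  unfold growth
  have h2 : (0 : ℝ) ≤ (‖x‖ ^ 2)⁻¹ := by positivity
  nlinarith [pow_nonneg (norm_nonneg x) i]

theorem poly_le_growth {a b c d : ℝ} (ha : 0 ≤ a) (hb : 0 ≤ b) (hc : 0 ≤ c) (hd : 0 ≤ d) (x : E3) :
    a * ‖x‖⁻¹ + b + c * ‖x‖ + d * ‖x‖ ^ 2 ≤ (a + b + c + d) * growth 2 x := by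
  have h1 := inv_le_growth 2 x
  have h2 := one_le_growth 2 x
  have h3 := pow_le_growth (i := 1) (by norm_num) x
  have h4 := pow_le_growth (i := 2) le_rfl x
  rw [pow_one] at h3
  nlinarith

/-- In the profile bounds all negative powers of `|x|` below `-1` cancel against the polynomial
factors. What is left lies between `|x|⁻¹` and `|x|²`, so one weight and one generous constant serve
the derivatives of order two, three and four. The factor `|μ|` drives the convergence. -/
theorem norm_rad₂_rem_le {μ : ℂ} (hμ : 0 ≤ μ.re) (h1 : ‖μ‖ ≤ 1) {x : E3} (hx : x ≠ 0)
    (j k : Fin 3) : ‖rad₂ (remTower μ) j k x‖ ≤ ‖μ‖ * (100 * growth 2 x) := by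
  have hr := norm_pos_iff.2 hx
  refine (norm_rad₂_le _ j k x).trans ?_
  have b1 := norm_remTower_one_le hμ h1 hr
  have b2 := norm_remTower_two_le hμ h1 hr
  calc _ ≤ ‖μ‖ * (2 + ‖x‖) + ‖x‖ ^ 2 * (‖μ‖ * ((3 + ‖x‖) / ‖x‖)) := by gcongr
    _ = ‖μ‖ * (0 * ‖x‖⁻¹ + 2 + 4 * ‖x‖ + 1 * ‖x‖ ^ 2) := by field_simp; ring
    _ ≤ ‖μ‖ * ((0 + 2 + 4 + 1) * growth 2 x) := by
        gcongr; exact poly_le_growth (by norm_num) (by norm_num) (by norm_num) (by norm_num) x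
    _ ≤ _ := by gcongr; exacts [(growth_pos 2 x).le, by norm_num]

theorem norm_rad₃_rem_le {μ : ℂ} (hμ : 0 ≤ μ.re) (h1 : ‖μ‖ ≤ 1) {x : E3} (hx : x ≠ 0)
    (j k l : Fin 3) : ‖rad₃ (remTower μ) j k l x‖ ≤ ‖μ‖ * (100 * growth 2 x) := by
  have hr := norm_pos_iff.2 hx
  refine (norm_rad₃_le _ j k l x).trans ?_
  have b2 := norm_remTower_two_le hμ h1 hr
  have b3 := norm_remTower_three_le hμ h1 hr
  calc _ ≤ 3 * ‖x‖ * (‖μ‖ * ((3 + ‖x‖) / ‖x‖)) +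
        ‖x‖ ^ 3 * (‖μ‖ * ((4 + ‖x‖) / ‖x‖ ^ 2 + (3 + ‖x‖) / ‖x‖ ^ 3)) := by gcongr
    _ = ‖μ‖ * (0 * ‖x‖⁻¹ + 12 + 8 * ‖x‖ + 1 * ‖x‖ ^ 2) := by field_simp; ring
    _ ≤ ‖μ‖ * ((0 + 12 + 8 + 1) * growth 2 x) := by
        gcongr; exact poly_le_growth (by norm_num) (by norm_num) (by norm_num) (by norm_num) x
    _ ≤ _ := by gcongr; exacts [(growth_pos 2 x).le, by norm_num]

theorem norm_rad₄_rem_le {μ : ℂ} (hμ : 0 ≤ μ.re) (h1 : ‖μ‖ ≤ 1) {x : E3} (hx : x ≠ 0)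
    (j k l m : Fin 3) : ‖rad₄ (remTower μ) j k l m x‖ ≤ ‖μ‖ * (100 * growth 2 x) := by
  have hr := norm_pos_iff.2 hx
  refine (norm_rad₄_le _ j k l m x).trans ?_
  have b2 := norm_remTower_two_le hμ h1 hr
  have b3 := norm_remTower_three_le hμ h1 hr
  have b4 := norm_remTower_four_le hμ h1 hr
  calc _ ≤ 3 * (‖μ‖ * ((3 + ‖x‖) / ‖x‖)) +
        6 * ‖x‖ ^ 2 * (‖μ‖ * ((4 + ‖x‖) / ‖x‖ ^ 2 + (3 + ‖x‖) / ‖x‖ ^ 3)) +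
        ‖x‖ ^ 4 * (‖μ‖ * ((5 + ‖x‖) / ‖x‖ ^ 3 + 3 * (4 + ‖x‖) / ‖x‖ ^ 4 +
          3 * (3 + ‖x‖) / ‖x‖ ^ 5)) := by gcongr
    _ = ‖μ‖ * (36 * ‖x‖⁻¹ + 48 + 14 * ‖x‖ + 1 * ‖x‖ ^ 2) := by field_simp; ring
    _ ≤ ‖μ‖ * ((36 + 48 + 14 + 1) * growth 2 x) := by
        gcongr; exact poly_le_growth (by norm_num) (by norm_num) (by norm_num) (by norm_num) x
    _ ≤ _ := by gcongr; exacts [(growth_pos 2 x).le, by norm_num]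

theorem norm_pi_const_le {a : ℝ} (ha : 0 ≤ a) {r : ℝ} (hr : 0 ≤ r) (n : ℕ) :
    ‖(a / (8 * Real.pi * r ^ n) : ℂ)‖ ≤ a * (r ^ n)⁻¹ := by
  rw [show (a / (8 * Real.pi * r ^ n) : ℂ) = ((a / (8 * Real.pi * r ^ n) : ℝ) : ℂ) by
    push_cast; ring, Complex.norm_real, Real.norm_of_nonneg (by positivity), div_eq_mul_inv, mul_inv]
  have : (8 * Real.pi)⁻¹ ≤ 1 := inv_le_one_of_one_le₀ (by linarith [Real.pi_gt_three])
  gcongr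
  exact mul_le_of_le_one_left (by positivity) this

theorem norm_biTower_one_le {r : ℝ} (hr : 0 ≤ r) : ‖biTower 1 r‖ ≤ r⁻¹ := by
  have := norm_pi_const_le (a := 1) zero_le_one hr 1
  simpa [biTower, neg_div] using this

theorem norm_biTower_two_le {r : ℝ} (hr : 0 ≤ r) : ‖biTower 2 r‖ ≤ (r ^ 3)⁻¹ := by
  have := norm_pi_const_le (a := 1) zero_le_one hr 3
  simpa [biTower, neg_div] using this

theorem norm_biTower_three_le {r : ℝ} (hr : 0 ≤ r) : ‖biTower 3 r‖ ≤ 3 * (r ^ 5)⁻¹ := by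
  have := norm_pi_const_le (a := 3) (by norm_num) hr 5
  simpa [biTower, neg_div] using this

theorem norm_newtonTower_one_le {r : ℝ} (hr : 0 ≤ r) : ‖newtonTower 1 r‖ ≤ (r ^ 3)⁻¹ := by
  rw [newtonTower, norm_div, norm_neg, norm_one,
    show (4 * Real.pi * r ^ 3 : ℂ) = ((4 * Real.pi * r ^ 3 : ℝ) : ℂ) by push_cast; ring,
    Complex.norm_real, Real.norm_of_nonneg (by positivity), one_div, mul_inv]
  have : (4 * Real.pi)⁻¹ ≤ 1 := inv_le_one_of_one_le₀ (by linarith [Real.pi_gt_three])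
  exact mul_le_of_le_one_left (by positivity) this

theorem norm_rad₁_newton_le (j : Fin 3) {x : E3} (hx : x ≠ 0) :
    ‖rad₁ newtonTower j x‖ ≤ 1 * (‖x‖ ^ 2)⁻¹ := by
  have hr := norm_pos_iff.2 hx
  refine (norm_rad₁_le _ j x).trans ?_
  calc _ ≤ ‖x‖ * (‖x‖ ^ 3)⁻¹ := by gcongr; exact norm_newtonTower_one_le hr.le
    _ = _ := by field_simp

theorem norm_rad₂_bi_le (j k : Fin 3) {x : E3} (hx : x ≠ 0) :
    ‖rad₂ biTower j k x‖ ≤ 2 * (‖x‖ ^ 1)⁻¹ := by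
  have hr := norm_pos_iff.2 hx
  refine (norm_rad₂_le _ j k x).trans ?_
  calc _ ≤ ‖x‖⁻¹ + ‖x‖ ^ 2 * (‖x‖ ^ 3)⁻¹ := by
        gcongr; exacts [norm_biTower_one_le hr.le, norm_biTower_two_le hr.le]
    _ = _ := by field_simp; norm_num

theorem norm_rad₃_bi_le (j k l : Fin 3) {x : E3} (hx : x ≠ 0) :
    ‖rad₃ biTower j k l x‖ ≤ 6 * (‖x‖ ^ 2)⁻¹ := by
  have hr := norm_pos_iff.2 hx
  refine (norm_rad₃_le _ j k l x).trans ?_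
  calc _ ≤ 3 * ‖x‖ * (‖x‖ ^ 3)⁻¹ + ‖x‖ ^ 3 * (3 * (‖x‖ ^ 5)⁻¹) := by
        gcongr; exacts [norm_biTower_two_le hr.le, norm_biTower_three_le hr.le]
    _ = _ := by field_simp; norm_num

theorem rad₂_full (μ : ℂ) (j k : Fin 3) (x : E3) :
    rad₂ (fullTower μ) j k x = rad₂ biTower j k x + rad₂ (remTower μ) j k x := by
  simp only [rad₂, fullTower]
  norm_num
  ring

theorem norm_rad₂_full_le {μ : ℂ} (hμ : 0 ≤ μ.re) (h1 : ‖μ‖ ≤ 1) {x : E3} (hx : x ≠ 0)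
    (j k : Fin 3) : ‖rad₂ (fullTower μ) j k x‖ ≤ 102 * growth 2 x := by
  rw [rad₂_full]
  refine (norm_add_le _ _).trans ?_
  have a1 := norm_rad₂_bi_le j k hx
  have a2 := norm_rad₂_rem_le hμ h1 hx j k
  have a3 := inv_le_growth 2 x
  rw [pow_one] at a1
  have a4 : ‖μ‖ * (100 * growth 2 x) ≤ 1 * (100 * growth 2 x) := by
    have := (growth_pos 2 x).le
    gcongr
  linarith

theorem norm_rad₁_full_le {μ : ℂ} (hμ : 0 ≤ μ.re) (h1 : ‖μ‖ ≤ 1) {x : E3} (hx : x ≠ 0)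
    (j : Fin 3) : ‖rad₁ (fullTower μ) j x‖ ≤ 102 * growth 2 x := by
  have hr := norm_pos_iff.2 hx
  refine (norm_rad₁_le _ j x).trans ?_
  have b1 := norm_remTower_one_le hμ h1 hr
  have b2 : ‖fullTower μ 1 ‖x‖‖ ≤ ‖x‖⁻¹ + 1 * (2 + ‖x‖) := by
    rw [fullTower, if_neg one_ne_zero, zero_add]
    refine (norm_add_le _ _).trans (add_le_add (norm_biTower_one_le hr.le) (b1.trans ?_))
    gcongr
  calc _ ≤ ‖x‖ * (‖x‖⁻¹ + 1 * (2 + ‖x‖)) := by gcongr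
    _ = 0 * ‖x‖⁻¹ + 1 + 2 * ‖x‖ + 1 * ‖x‖ ^ 2 := by field_simp; ring
    _ ≤ (0 + 1 + 2 + 1) * growth 2 x :=
        poly_le_growth (by norm_num) (by norm_num) (by norm_num) (by norm_num) x
    _ ≤ _ := by gcongr; exacts [(growth_pos 2 x).le, by norm_num]

/-- The additive constant `1/(4πμ)` in the undifferentiated kernel blows up as `μ → 0`.
Multiplication by `μ` makes it harmless, and derivatives do not see it. -/
theorem norm_mul_full_zero_le {μ : ℂ} (hμ : 0 ≤ μ.re) (h1 : ‖μ‖ ≤ 1) {x : E3} (hx : x ≠ 0) (h0 : μ ≠ 0) : ‖μ * fullTower μ 0 ‖x‖‖ ≤ 102 * growth 2 x := by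
  have hr := norm_pos_iff.2 hx
  have hpi : (Real.pi : ℂ) ≠ 0 := by exact_mod_cast Real.pi_ne_zero
  have e : μ * fullTower μ 0 ‖x‖ = 1 / (4 * Real.pi) + μ * (biTower 0 ‖x‖ + remTower μ 0 ‖x‖) := by
    rw [fullTower, if_pos rfl]; field_simp
    ring
  have b0 := norm_remTower_zero_le hμ hr
  have b1 : ‖biTower 0 ‖x‖‖ ≤ ‖x‖ := by
    have := norm_pi_const_le (a := ‖x‖) hr.le zero_le_one 1
    simpa [biTower, neg_div] using this
  have b2 : ‖(1 / (4 * Real.pi) : ℂ)‖ ≤ 1 := by simpa using norm_div_four_pi_le 1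
  rw [e]
  calc _ ≤ 1 + 1 * (‖x‖ + 1 * ‖x‖ ^ 2) := by
        refine (norm_add_le _ _).trans (add_le_add b2 ?_)
        rw [norm_mul]
        gcongr
        refine (norm_add_le _ _).trans (add_le_add b1 (b0.trans ?_))
        gcongr
    _ = 0 * ‖x‖⁻¹ + 1 + 1 * ‖x‖ + 1 * ‖x‖ ^ 2 := by ring
    _ ≤ (0 + 1 + 1 + 1) * growth 2 x :=
        poly_le_growth (by norm_num) (by norm_num) (by norm_num) (by norm_num) x
    _ ≤ _ := by gcongr; exacts [(growth_pos 2 x).le, by norm_num]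

/-! ### The symbols of the resolvent operators and their kernels -/

/-- `1 / |ξ|²`. -/
def symN (ξ : E3) : ℂ := (nsq ξ)⁻¹

/-- `ξ_j / |ξ|²`. -/
def symR (j : Fin 3) (ξ : E3) : ℂ := ξ j * (nsq ξ)⁻¹

/-- `ξ_j ξ_k / |ξ|⁴`. -/
def symQ (j k : Fin 3) (ξ : E3) : ℂ := ξ k * (ξ j * ((nsq ξ)⁻¹ * (nsq ξ)⁻¹))

/-- `1 / (|ξ|² (|ξ|² + μ²))`. -/
def symU (μ : ℂ) (ξ : E3) : ℂ := (nsq ξ)⁻¹ * (nsq ξ + μ ^ 2)⁻¹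

/-- `ξ_j ξ_k / (|ξ|² (|ξ|² + μ²)) - ξ_j ξ_k / |ξ|⁴`. -/
def symW (μ : ℂ) (j k : Fin 3) (ξ : E3) : ℂ := ξ k * (ξ j * symU μ ξ) + -1 * symQ j k ξ

/-- The scalar `a` is kept outside the kernel so that repeated differentiation only accumulates
powers of `-i`. -/
theorem HasKernel.partial {m K K' : E3 → ℂ} {a : ℂ} (h : HasKernel m fun x => a * K x)
    (hK' : Mild K') {j : Fin 3} (hd : IsPartial j K K') :
    HasKernel (fun ξ => ξ j * m ξ) fun x => -Complex.I * a * K' x := by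
  have h1 := (h.deriv (hK'.const_mul a) j fun x hx => (hd x hx).const_mul a).const_mul (-Complex.I)
  refine h1.congr (h.sym.coord_mul j) (hK'.const_mul _) (fun ξ _ => ?_) fun x _ => ?_
  · linear_combination (-(ξ j * m ξ)) * Complex.I_sq
  · ring

theorem HasKernel.one_mul {m K : E3 → ℂ} (h : HasKernel m K) : HasKernel m fun x => 1 * K x := by
  simpa using h

theorem measurable_symQ (j k : Fin 3) : Measurable (symQ j k) :=
  (measurable_coord k).mul ((measurable_coord j).mul (measurable_nsq.inv.mul measurable_nsq.inv))

theorem norm_symQ_le (j k : Fin 3) {ξ : E3} (hξ : ξ ≠ 0) : ‖symQ j k ξ‖ ≤ (‖ξ‖ ^ 2)⁻¹ := by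
  have hr := norm_pos_iff.2 hξ
  rw [symQ, norm_mul, norm_mul, norm_mul, norm_inv, norm_nsq]
  calc _ ≤ ‖ξ‖ * (‖ξ‖ * ((‖ξ‖ ^ 2)⁻¹ * (‖ξ‖ ^ 2)⁻¹)) := by gcongr <;> apply norm_coord_le
    _ = _ := by field_simp

theorem mild_symQ (j k : Fin 3) : Mild (symQ j k) :=
  Mild.of_bound (measurable_symQ j k) zero_le_one (N := 0) fun ξ hξ => by
    rw [one_mul]; exact (norm_symQ_le j k hξ).trans (inv_sq_le_growth 0 ξ)

theorem mild_symN : Mild symN := mild_inv_nsq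

theorem mild_symR (j : Fin 3) : Mild (symR j) := mild_symN.coord_mul j

theorem mild_symU {μ : ℂ} (hμ : 0 < μ.re) : Mild (symU μ) := by
  obtain ⟨h, M, hM⟩ := norm_fhat_yukawa_bound hμ
  have := mild_inv_nsq.mul_bdd h hM
  simp only [mul_comm] at this
  exact this

theorem mild_symW {μ : ℂ} (hμ : 0 < μ.re) (j k : Fin 3) : Mild (symW μ j k) :=
  (((mild_symU hμ).coord_mul j).coord_mul k).add ((mild_symQ j k).const_mul _)

theorem mild_rad₁_newton (j : Fin 3) : Mild (rad₁ newtonTower j) :=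
  Mild.of_bound (measurable_rad₁ tower_newton.1 j) zero_le_one (N := 0) fun x hx =>
    (norm_rad₁_newton_le j hx).trans (by gcongr; exact inv_sq_le_growth 0 x)

theorem hasKernel_symN : HasKernel symN fun x => newtonTower 0 ‖x‖ := by
  refine hasKernel_newton.congr mild_symN ?_ (fun _ _ => rfl) fun x _ => ?_
  · have e : (fun x : E3 => newtonTower 0 ‖x‖) = yukawa 0 := by
      funext x; simp [newtonTower, yukawa]
    rw [e]; exact mild_yukawa (by simp)
  · simp [newtonTower, yukawa]

theorem hasKernel_symR (j : Fin 3) :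
    HasKernel (symR j) fun x => -Complex.I * 1 * rad₁ newtonTower j x :=
  hasKernel_symN.one_mul.partial (mild_rad₁_newton j) (tower_newton.isPartial₁ j)

section

variable {μ : ℂ}

theorem mild_full_zero (hμ : 0 < μ.re) (h1 : ‖μ‖ ≤ 1) : Mild fun x : E3 => fullTower μ 0 ‖x‖ := by
  have h0 : μ ≠ 0 := fun h => by simp [h] at hμ
  have hm : Mild fun x : E3 => μ * fullTower μ 0 ‖x‖ :=
    Mild.of_bound ((((tower_full μ).1 0).comp measurable_norm).const_mul μ) (by norm_num)
      fun x hx => norm_mul_full_zero_le hμ.le h1 hx h0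
  have := hm.const_mul μ⁻¹
  simpa [h0] using this

/-- Partial fractions: the symbol is `μ⁻²` times the difference of the Newtonian and Yukawa symbols.
Expanding the exponential to second order isolates the constant, the biharmonic term `-|x|/(8π)` and
the remainder. -/
theorem hasKernel_symU (hμ : 0 < μ.re) (h1 : ‖μ‖ ≤ 1) :
    HasKernel (symU μ) fun x => fullTower μ 0 ‖x‖ := by
  have h0 : μ ≠ 0 := fun h => by simp [h] at hμ
  have hpi : (Real.pi : ℂ) ≠ 0 := by exact_mod_cast Real.pi_ne_zero
  have h := (hasKernel_newton.add ((hasKernel_yukawa hμ).const_mul (-1))).const_mul ((μ ^ 2)⁻¹)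
  refine h.congr (mild_symU hμ) (mild_full_zero hμ h1) (fun ξ hξ => ?_) fun x hx => ?_
  · have a1 := nsq_ne_zero hξ
    have a2 := nsq_add_sq_ne_zero hμ ξ
    unfold symU
    field_simp
    ring
  · have hr : (‖x‖ : ℂ) ≠ 0 := by exact_mod_cast norm_ne_zero_iff.2 hx
    simp only [yukawa, fullTower, biTower, remTower]
    rw [neg_mul μ, exp_neg_eq_expRem (mul_ne_zero h0 hr)]
    simp only [if_true, neg_zero, zero_mul, Complex.exp_zero]
    field_simp
    ring

theorem mild_rad₁_full (hμ : 0 ≤ μ.re) (h1 : ‖μ‖ ≤ 1) (j : Fin 3) : Mild (rad₁ (fullTower μ) j) :=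
  Mild.of_bound (measurable_rad₁ (tower_full μ).1 j) (by norm_num)
    fun _ hx => norm_rad₁_full_le hμ h1 hx j

theorem mild_rad₂_full (hμ : 0 ≤ μ.re) (h1 : ‖μ‖ ≤ 1) (j k : Fin 3) :
    Mild (rad₂ (fullTower μ) j k) :=
  Mild.of_bound (measurable_rad₂ (tower_full μ).1 j k) (by norm_num)
    fun _ hx => norm_rad₂_full_le hμ h1 hx j k

theorem mild_rad₂_bi (j k : Fin 3) : Mild (rad₂ biTower j k) :=
  Mild.of_bound (measurable_rad₂ tower_bi.1 j k) zero_le_two (N := 0) fun x hx =>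
    (norm_rad₂_bi_le j k hx).trans (by gcongr; rw [pow_one]; exact inv_le_growth 0 x)

theorem mild_rad₃_bi (j k l : Fin 3) : Mild (rad₃ biTower j k l) :=
  Mild.of_bound (measurable_rad₃ tower_bi.1 j k l) (C := 6) (by norm_num) (N := 0) fun x hx =>
    (norm_rad₃_bi_le j k l hx).trans (by gcongr; exact inv_sq_le_growth 0 x)

theorem mild_of_rem_bound {K : E3 → ℂ} (hK : Measurable K)
    (hb : ∀ x, x ≠ 0 → ‖K x‖ ≤ ‖μ‖ * (100 * growth 2 x)) : Mild K :=
  Mild.of_bound hK (C := ‖μ‖ * 100) (by positivity) fun x hx => by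
    rw [mul_assoc]; exact hb x hx

theorem mild_rad₂_rem (hμ : 0 ≤ μ.re) (h1 : ‖μ‖ ≤ 1) (j k : Fin 3) :
    Mild (rad₂ (remTower μ) j k) :=
  mild_of_rem_bound (measurable_rad₂ (tower_rem μ).1 j k)
    fun _ hx => norm_rad₂_rem_le hμ h1 hx j k

theorem mild_rad₃_rem (hμ : 0 ≤ μ.re) (h1 : ‖μ‖ ≤ 1) (j k l : Fin 3) :
    Mild (rad₃ (remTower μ) j k l) :=
  mild_of_rem_bound (measurable_rad₃ (tower_rem μ).1 j k l)
    fun _ hx => norm_rad₃_rem_le hμ h1 hx j k l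

theorem mild_rad₄_rem (hμ : 0 ≤ μ.re) (h1 : ‖μ‖ ≤ 1) (j k l m : Fin 3) :
    Mild (rad₄ (remTower μ) j k l m) :=
  mild_of_rem_bound (measurable_rad₄ (tower_rem μ).1 j k l m)
    fun _ hx => norm_rad₄_rem_le hμ h1 hx j k l m

theorem hasKernel_symU₁ (hμ : 0 < μ.re) (h1 : ‖μ‖ ≤ 1) (j : Fin 3) :
    HasKernel (fun ξ => ξ j * symU μ ξ) fun x => -Complex.I * 1 * rad₁ (fullTower μ) j x :=
  (hasKernel_symU hμ h1).one_mul.partial (mild_rad₁_full hμ.le h1 j)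
    (Tower.isPartial₁ ⟨(tower_full μ).1, fun n hn => (tower_full μ).2 n (by omega)⟩ j)

theorem hasKernel_symU₂ (hμ : 0 < μ.re) (h1 : ‖μ‖ ≤ 1) (j k : Fin 3) :
    HasKernel (fun ξ => ξ k * (ξ j * symU μ ξ))
      fun x => -Complex.I * (-Complex.I * 1) * rad₂ (fullTower μ) j k x :=
  (hasKernel_symU₁ hμ h1 j).partial (mild_rad₂_full hμ.le h1 j k)
    (Tower.isPartial₂ ⟨(tower_full μ).1, fun n hn => (tower_full μ).2 n (by omega)⟩ j k)

/-- The symbol `|ξ|⁻⁴` is not locally integrable in three dimensions, so it cannot be used directly.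
Instead the kernel of `symU μ` is differentiated twice, which removes the divergent constant, and `μ
= 1/(n+1)` tends to zero. -/
theorem hasKernel_symQ (j k : Fin 3) :
    HasKernel (symQ j k) fun x => -Complex.I * (-Complex.I * 1) * rad₂ biTower j k x := by
  set μ : ℕ → ℂ := fun n => ((1 / ((n : ℝ) + 1) : ℝ) : ℂ) with hμd
  have hpos : ∀ n, 0 < (μ n).re := fun n => by
    simp only [hμd]; rw [Complex.ofReal_re]; positivity
  have hle : ∀ n, ‖μ n‖ ≤ 1 := fun n => by
    simp only [hμd]
    rw [Complex.norm_real, Real.norm_of_nonneg (by positivity), div_le_one (by positivity)]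
    have : (0 : ℝ) ≤ n := n.cast_nonneg
    linarith
  have ht : Tendsto μ atTop (𝓝 0) := by
    have := (Complex.continuous_ofReal.tendsto 0).comp tendsto_one_div_add_atTop_nhds_zero_nat
    simpa [Function.comp_def, hμd] using this
  have hI : ∀ z : ℂ, ‖-Complex.I * (-Complex.I * 1) * z‖ = ‖z‖ := fun z => by simp
  refine HasKernel.of_tendsto (fun n => hasKernel_symU₂ (hpos n) (hle n) j k) (mild_symQ j k)
    ((mild_rad₂_bi j k).const_mul _) (C := 1) (N := 0) (D := 102) (M := 2) (fun n x hx => ?_)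
    (fun n x hx => ?_) (fun x hx => ?_) (fun x hx => ?_)
  · have hr := norm_pos_iff.2 hx
    rw [_root_.one_mul]
    refine le_trans ?_ (inv_sq_le_growth 0 x)
    rw [norm_mul, norm_mul, symU, norm_mul, norm_inv, norm_nsq, norm_inv]
    have e : ‖x‖ ^ 2 ≤ ‖nsq x + μ n ^ 2‖ := by
      simp only [hμd]
      rw [nsq, ← Complex.ofReal_pow, ← Complex.ofReal_add, Complex.norm_real,
        Real.norm_of_nonneg (by positivity)]
      have : 0 ≤ (1 / ((n : ℝ) + 1)) ^ 2 := by positivity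
      linarith
    calc _ ≤ ‖x‖ * (‖x‖ * ((‖x‖ ^ 2)⁻¹ * (‖x‖ ^ 2)⁻¹)) := by gcongr <;> apply norm_coord_le
      _ = _ := by field_simp
  · rw [hI]; exact norm_rad₂_full_le (hpos n).le (hle n) hx j k
  · have h1 : Tendsto (fun n => (nsq x + μ n ^ 2)⁻¹) atTop (𝓝 (nsq x)⁻¹) := by
      refine Tendsto.inv₀ ?_ (nsq_ne_zero hx)
      simpa using (ht.pow 2).const_add (nsq x)
    exact ((h1.const_mul _).const_mul _).const_mul _
  · refine Tendsto.const_mul _ ?_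
    simp_rw [rad₂_full]
    have h1 : Tendsto (fun n => rad₂ (remTower (μ n)) j k x) atTop (𝓝 0) := by
      refine squeeze_zero_norm (fun n => norm_rad₂_rem_le (hpos n).le (hle n) hx j k) ?_
      simpa using ht.norm.mul_const (100 * growth 2 x)
    simpa using h1.const_add (rad₂ biTower j k x)

theorem hasKernel_symT (j k l : Fin 3) : HasKernel (fun ξ => ξ l * symQ j k ξ)
    fun x => -Complex.I * (-Complex.I * (-Complex.I * 1)) * rad₃ biTower j k l x :=
  (hasKernel_symQ j k).partial (mild_rad₃_bi j k l) (tower_bi.isPartial₃ j k l)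

/-- Subtracting the limit symbol cancels the biharmonic part of the kernel and leaves the remainder,
which is of size `|μ|`. -/
theorem hasKernel_symW (hμ : 0 < μ.re) (h1 : ‖μ‖ ≤ 1) (j k : Fin 3) : HasKernel (symW μ j k)
    fun x => -Complex.I * (-Complex.I * 1) * rad₂ (remTower μ) j k x := by
  refine ((hasKernel_symU₂ hμ h1 j k).add ((hasKernel_symQ j k).const_mul (-1))).congr
    (mild_symW hμ j k) ((mild_rad₂_rem hμ.le h1 j k).const_mul _) (fun _ _ => rfl) fun x _ => ?_
  rw [rad₂_full]
  ring

theorem hasKernel_symW₁ (hμ : 0 < μ.re) (h1 : ‖μ‖ ≤ 1) (j k l : Fin 3) :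
    HasKernel (fun ξ => ξ l * symW μ j k ξ)
      fun x => -Complex.I * (-Complex.I * (-Complex.I * 1)) * rad₃ (remTower μ) j k l x :=
  (hasKernel_symW hμ h1 j k).partial (mild_rad₃_rem hμ.le h1 j k l)
    (Tower.isPartial₃ ⟨(tower_rem μ).1, fun n hn => (tower_rem μ).2 n (by omega)⟩ j k l)

theorem hasKernel_symW₂ (hμ : 0 < μ.re) (h1 : ‖μ‖ ≤ 1) (j k l m : Fin 3) :
    HasKernel (fun ξ => ξ m * (ξ l * symW μ j k ξ))
      fun x => -Complex.I * (-Complex.I * (-Complex.I * (-Complex.I * 1))) *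
        rad₄ (remTower μ) j k l m x :=
  (hasKernel_symW₁ hμ h1 j k l).partial (mild_rad₄_rem hμ.le h1 j k l m)
    ((tower_rem μ).isPartial₄ j k l m)

end

/-! ### Families of multipliers that are locally uniformly bounded -/

/-- The multipliers `m i` are bounded, uniformly in `i`, from `L^p` functions supported in `B_R`
to `L^p(B_{R'})`, for every `R'`. -/
def UBdd {ι : Type*} (p R : ℝ) (m : ι → E3 → ℂ) : Prop :=
  (∀ i, Mild (m i)) ∧ ∀ R' : ℝ, ∃ C : ℝ≥0, ∀ i g, SuppIn R g → MemLp g (ENNReal.ofReal p) →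
    lpNorm (ENNReal.ofReal p) (B R') (op (m i) g) ≤ C * eLpNorm g (ENNReal.ofReal p) volume

theorem UBdd.of_kernel {ι : Type*} {p R : ℝ} (hp : 1 < p) (hR : 0 < R) {m K : ι → E3 → ℂ}
    (h : ∀ i, HasKernel (m i) (K i)) {A : ℝ} {N : ℕ} (hA : 0 ≤ A)
    (hb : ∀ i x, x ≠ 0 → ‖K i x‖ ≤ A * growth N x) : UBdd p R m := by
  refine ⟨fun i => (h i).sym, fun R' =>
    ⟨(ENNReal.ofReal A * growthMass N (R + R')).toNNReal, fun i g hg _ => ?_⟩⟩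
  rw [ENNReal.coe_toNNReal (ENNReal.mul_ne_top ENNReal.ofReal_ne_top (growthMass_lt_top _ _).ne)]
  exact (h i).lpNorm_op_le hA (hb i) hR hp.le R' hg

theorem LpMult.exists_lpNorm_le {m : E3 → ℂ} (hm : LpMult m) {p : ℝ} (hp : 1 < p) :
    ∃ C : ℝ≥0, ∀ g : E3 → ℂ, Integrable g → MemLp g (ENNReal.ofReal p) →
      lpNorm (ENNReal.ofReal p) Set.univ (op m g) ≤ C * eLpNorm g (ENNReal.ofReal p) volume := by
  obtain ⟨C, hC⟩ := hm.exists_finv hp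
  refine ⟨C, fun g hg hgp => ?_⟩
  obtain ⟨h, hh, hle, he⟩ := hC g hg hgp
  refine (lpNorm_le (g := h) ⟨?_, fun φ _ _ => he φ⟩ _).trans (by simpa using hle)
  exact (hh.locallyIntegrable (one_le_ofReal hp)).locallyIntegrableOn _

theorem LpMult.uBdd {ι : Type*} {p R : ℝ} (hp : 1 < p) {m : E3 → ℂ} (hm : LpMult m) :
    UBdd p R fun _ : ι => m := by
  obtain ⟨C, hC⟩ := hm.exists_lpNorm_le hp
  exact ⟨fun _ => hm.bdd.mild, fun R' => ⟨C, fun _ g hg hgp =>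
    (lpNorm_mono isOpen_univ (Set.subset_univ _) _).trans (hC g hg.int hgp)⟩⟩

theorem UBdd.congr {ι : Type*} {p R : ℝ} {m n : ι → E3 → ℂ} (h : UBdd p R m)
    (hn : ∀ i, Mild (n i)) (e : ∀ i ξ, ξ ≠ 0 → m i ξ = n i ξ) : UBdd p R n := by
  refine ⟨hn, fun R' => ?_⟩
  obtain ⟨C, hC⟩ := h.2 R'
  refine ⟨C, fun i g hg hgp => ?_⟩
  rw [← op_congr (h.1 i) (hn i) hg.int (e i)]
  exact hC i g hg hgp

theorem UBdd.const_mul {ι : Type*} {p R : ℝ} {m : ι → E3 → ℂ} (h : UBdd p R m) {a : ι → ℂ} {A : ℝ}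
    (ha : ∀ i, ‖a i‖ ≤ A) : UBdd p R fun i ξ => a i * m i ξ := by
  refine ⟨fun i => (h.1 i).const_mul _, fun R' => ?_⟩
  obtain ⟨C, hC⟩ := h.2 R'
  refine ⟨A.toNNReal * C, fun i g hg hgp => ?_⟩
  rw [op_const_mul (h.1 i) hg.int]
  refine (lpNorm_smul_le (isOpen_B R') _ _).trans ?_
  rw [ENNReal.coe_mul, mul_assoc]
  refine mul_le_mul' ?_ (hC i g hg hgp)
  rw [← ofReal_norm]
  exact ENNReal.ofReal_le_ofReal (ha i)

/-- `g` vanishes outside `B_R` and has the weak gradient `d`, both in `L^p`. -/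
structure HasGrad (p R : ℝ) (g : E3 → ℂ) (d : Fin 3 → E3 → ℂ) : Prop where
  supp : SuppIn R g
  mem : MemLp g (ENNReal.ofReal p)
  suppd : ∀ k, SuppIn R (d k)
  memd : ∀ k, MemLp (d k) (ENNReal.ofReal p)
  fhat_eq : ∀ k ξ, fhat (d k) ξ = Complex.I * ξ k * fhat g ξ

theorem lpNorm_I_smul_le {p : ℝ≥0∞} {D : Set E3} (hD : IsOpen D) (T : 𝓢'(E3, ℂ)) :
    lpNorm p D (Complex.I • T) ≤ lpNorm p D T := by
  have := lpNorm_smul_le (p := p) hD Complex.I T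
  simpa [← ofReal_norm] using this

theorem HasGrad.pd_op {p R : ℝ} {g : E3 → ℂ} {d : Fin 3 → E3 → ℂ} (h : HasGrad p R g d)
    {m : E3 → ℂ} (hm : Mild m) (k : Fin 3) : pd k (op m g) = op m (d k) := by
  rw [Viscoelastic.pd_op hm h.supp.int, op_coord_mul k (h.fhat_eq k) hm (h.suppd k).int, smul_smul]
  simp

theorem UBdd.exists_sobNorm_one_le {ι : Type*} {p R : ℝ} {m : ι → E3 → ℂ} (h0 : UBdd p R m)
    (h1 : ∀ k, UBdd p R fun i ξ => (ξ k : ℂ) * m i ξ) (R' : ℝ) :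
    ∃ C : ℝ≥0, ∀ i g, SuppIn R g → MemLp g (ENNReal.ofReal p) →
      sobNorm 1 (ENNReal.ofReal p) (B R') (op (m i) g) ≤
        C * eLpNorm g (ENNReal.ofReal p) volume := by
  obtain ⟨C, hC⟩ := h0.2 R'
  choose D hD using fun k => (h1 k).2 R'
  refine ⟨C + ∑ k, D k, fun i g hg hgp => ?_⟩
  rw [sobNorm_one, ENNReal.coe_add, add_mul, ENNReal.ofNNReal_finsetSum, Finset.sum_mul]
  refine add_le_add (hC i g hg hgp) (Finset.sum_le_sum fun k _ => ?_)
  rw [pd_op (h0.1 i) hg.int]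
  exact (lpNorm_I_smul_le (isOpen_B R') _).trans (hD k i g hg hgp)

theorem UBdd.exists_sobSum_le {ι : Type*} {p R : ℝ} {m : ι → E3 → ℂ} (h0 : UBdd p R m)
    (h1 : ∀ k, UBdd p R fun i ξ => (ξ k : ℂ) * m i ξ)
    (h2 : ∀ k l, UBdd p R fun i ξ => (ξ l : ℂ) * (ξ k * m i ξ)) (R' : ℝ) :
    ∃ C : ℝ≥0, ∀ i g, SuppIn R g → MemLp g (ENNReal.ofReal p) →
      sobSum (ENNReal.ofReal p) (B R') (op (m i) g) ≤
        C * eLpNorm g (ENNReal.ofReal p) volume := by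
  obtain ⟨C, hC⟩ := h0.exists_sobNorm_one_le h1 R'
  choose D hD using fun k l => (h2 k l).2 R'
  refine ⟨C + ∑ l, ∑ k, D k l, fun i g hg hgp => ?_⟩
  rw [sobSum, ← sobNorm_one, ENNReal.coe_add, add_mul, ENNReal.ofNNReal_finsetSum, Finset.sum_mul]
  refine add_le_add (hC i g hg hgp) (Finset.sum_le_sum fun l _ => ?_)
  rw [ENNReal.ofNNReal_finsetSum, Finset.sum_mul]
  refine Finset.sum_le_sum fun k _ => ?_
  rw [pd_op (h0.1 i) hg.int, pd_smul, pd_op ((h0.1 i).coord_mul k) hg.int]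
  exact (lpNorm_I_smul_le (isOpen_B R') _).trans
    ((lpNorm_I_smul_le (isOpen_B R') _).trans (hD k l i g hg hgp))

/-- For data in `W^{1,p}` one derivative falls on the datum, so second order control of the result
needs only one factor `ξ_k` on the symbol. -/
theorem UBdd.exists_sobSum_le_grad {ι : Type*} {p R : ℝ} {m : ι → E3 → ℂ} (h0 : UBdd p R m)
    (h1 : ∀ k, UBdd p R fun i ξ => (ξ k : ℂ) * m i ξ) (R' : ℝ) :
    ∃ C : ℝ≥0, ∀ i g d, HasGrad p R g d →
      sobSum (ENNReal.ofReal p) (B R') (op (m i) g) ≤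
        C * (eLpNorm g (ENNReal.ofReal p) volume +
          ∑ k, eLpNorm (d k) (ENNReal.ofReal p) volume) := by
  obtain ⟨C, hC⟩ := h0.exists_sobNorm_one_le h1 R'
  refine ⟨C + C, fun i g d hg => ?_⟩
  rw [sobSum, ← sobNorm_one]
  have e1 := hC i g hg.supp hg.mem
  have e2 : ∑ j, ∑ k, lpNorm (ENNReal.ofReal p) (B R') (pd j (pd k (op (m i) g))) ≤
      C * ∑ k, eLpNorm (d k) (ENNReal.ofReal p) volume := by
    rw [Finset.sum_comm, Finset.mul_sum]
    refine Finset.sum_le_sum fun k _ => ?_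
    rw [hg.pd_op (h0.1 i)]
    refine le_trans ?_ (hC i (d k) (hg.suppd k) (hg.memd k))
    rw [sobNorm_one]
    exact le_add_self
  refine (add_le_add e1 e2).trans ?_
  rw [← mul_add, ENNReal.coe_add]
  gcongr
  exact le_self_add

/-! ### Uniform bounds for the symbols of the resolvent operators -/

/-- The range of the parameter `μ`. -/
abbrev Par : Type := {μ : ℂ // 0 < μ.re ∧ ‖μ‖ ≤ 1}

theorem Par.ne_zero (μ : Par) : (μ : ℂ) ≠ 0 := fun h => by
  have := μ.2.1
  simp [h] at this

theorem norm_negI_pow₁ (z : ℂ) : ‖-Complex.I * 1 * z‖ = ‖z‖ := by simp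

theorem norm_negI_pow₂ (z : ℂ) : ‖-Complex.I * (-Complex.I * 1) * z‖ = ‖z‖ := by simp

theorem norm_negI_pow₃ (z : ℂ) : ‖-Complex.I * (-Complex.I * (-Complex.I * 1)) * z‖ = ‖z‖ := by
  simp

theorem norm_negI_pow₄ (z : ℂ) :
    ‖-Complex.I * (-Complex.I * (-Complex.I * (-Complex.I * 1))) * z‖ = ‖z‖ := by
  simp

theorem norm_newtonTower_zero_le {r : ℝ} (hr : 0 ≤ r) : ‖newtonTower 0 r‖ ≤ 1 * (r ^ 1)⁻¹ := by
  rw [newtonTower, norm_div, norm_one,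
    show (4 * Real.pi * r : ℂ) = ((4 * Real.pi * r : ℝ) : ℂ) by push_cast; ring,
    Complex.norm_real, Real.norm_of_nonneg (by positivity), one_div, mul_inv, pow_one]
  have : (4 * Real.pi)⁻¹ ≤ 1 := inv_le_one_of_one_le₀ (by linarith [Real.pi_gt_three])
  gcongr

theorem rr_eq {ξ : E3} (i j : Fin 3) : rr i j ξ = ξ i * (ξ j * (nsq ξ)⁻¹) := by
  by_cases h : ξ = 0
  · simp [rr, riesz, h]
  have : (‖ξ‖ : ℂ) ≠ 0 := by exact_mod_cast norm_ne_zero_iff.2 h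
  simp only [rr, riesz, nsq]
  push_cast
  field_simp

section

variable {p R : ℝ} (ι : Type)

theorem uBdd_symN (hp : 1 < p) (hR : 0 < R) : UBdd p R fun _ : ι => symN :=
  UBdd.of_kernel hp hR (fun _ => hasKernel_symN) (A := 1) (N := 0) zero_le_one fun _ x _ =>
    (norm_newtonTower_zero_le (norm_nonneg x)).trans
      (by rw [pow_one]; gcongr; exact inv_le_growth 0 x)

theorem uBdd_symR (hp : 1 < p) (hR : 0 < R) (j : Fin 3) : UBdd p R fun _ : ι => symR j :=
  UBdd.of_kernel hp hR (fun _ => hasKernel_symR j) (A := 1) (N := 0) zero_le_one fun _ x hx => by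
    rw [norm_negI_pow₁]
    exact (norm_rad₁_newton_le j hx).trans (by gcongr; exact inv_sq_le_growth 0 x)

theorem uBdd_symQ (hp : 1 < p) (hR : 0 < R) (j k : Fin 3) : UBdd p R fun _ : ι => symQ j k :=
  UBdd.of_kernel hp hR (fun _ => hasKernel_symQ j k) (A := 2) (N := 0) zero_le_two fun _ x hx => by
    rw [norm_negI_pow₂]
    exact (norm_rad₂_bi_le j k hx).trans (by rw [pow_one]; gcongr; exact inv_le_growth 0 x)

theorem uBdd_symT (hp : 1 < p) (hR : 0 < R) (j k l : Fin 3) :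
    UBdd p R fun (_ : ι) ξ => (ξ l : ℂ) * symQ j k ξ :=
  UBdd.of_kernel hp hR (fun _ => hasKernel_symT j k l) (A := 6) (N := 0) (by norm_num)
    fun _ x hx => by
      rw [norm_negI_pow₃]
      exact (norm_rad₃_bi_le j k l hx).trans (by gcongr; exact inv_sq_le_growth 0 x)

/-- The symbol has order zero and its kernel is not locally integrable, so the bound rests on
products of Riesz symbols instead of kernels. -/
theorem uBdd_coord_symR (hp : 1 < p) (j k : Fin 3) :
    UBdd p R fun (_ : ι) ξ => (ξ k : ℂ) * symR j ξ :=
  ((lpMult_rr k j).uBdd hp).congr (fun _ => (mild_symR j).coord_mul k) fun _ _ _ => rr_eq k j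

theorem coord_mul_coord_mul_symQ (j k l m : Fin 3) {ξ : E3} :
    (ξ m : ℂ) * (ξ l * symQ j k ξ) = rr m l ξ * rr j k ξ := by
  rw [rr_eq, rr_eq, symQ]; ring

theorem uBdd_coord_symT (hp : 1 < p) (j k l m : Fin 3) :
    UBdd p R fun (_ : ι) ξ => (ξ m : ℂ) * (ξ l * symQ j k ξ) :=
  ((lpMult_rr_mul_rr m l j k).uBdd hp).congr (fun _ => ((mild_symQ j k).coord_mul l).coord_mul m)
    fun _ _ _ => (coord_mul_coord_mul_symQ j k l m).symm

theorem uBdd_symU₁ (hp : 1 < p) (hR : 0 < R) (j : Fin 3) :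
    UBdd p R fun (μ : Par) ξ => (ξ j : ℂ) * symU μ ξ :=
  UBdd.of_kernel hp hR (fun μ => hasKernel_symU₁ μ.2.1 μ.2.2 j) (A := 102) (N := 2) (by norm_num)
    fun μ x hx => by
      rw [norm_negI_pow₁]
      exact norm_rad₁_full_le μ.2.1.le μ.2.2 hx j

theorem uBdd_symU₂ (hp : 1 < p) (hR : 0 < R) (j k : Fin 3) :
    UBdd p R fun (μ : Par) ξ => (ξ k : ℂ) * (ξ j * symU μ ξ) :=
  UBdd.of_kernel hp hR (fun μ => hasKernel_symU₂ μ.2.1 μ.2.2 j k) (A := 102) (N := 2)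
    (by norm_num) fun μ x hx => by
      rw [norm_negI_pow₂]
      exact norm_rad₂_full_le μ.2.1.le μ.2.2 hx j k

theorem uBdd_mul_symU (hp : 1 < p) (hR : 0 < R) : UBdd p R fun (μ : Par) ξ => (μ : ℂ) * symU μ ξ :=
  UBdd.of_kernel hp hR (fun μ => (hasKernel_symU μ.2.1 μ.2.2).const_mul (μ : ℂ)) (A := 102) (N := 2)
    (by norm_num) fun μ _ hx => norm_mul_full_zero_le μ.2.1.le μ.2.2 hx μ.ne_zero

/-- The kernels are of size `|μ|`, so division by `μ` preserves a uniform bound. -/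
theorem uBdd_of_rem {m : Par → E3 → ℂ} {K : Par → E3 → ℂ} (hp : 1 < p) (hR : 0 < R)
    (h : ∀ μ, HasKernel (m μ) (K μ))
    (hb : ∀ μ x, x ≠ 0 → ‖K μ x‖ ≤ ‖(μ : ℂ)‖ * (100 * growth 2 x)) :
    UBdd p R fun (μ : Par) ξ => (μ : ℂ)⁻¹ * m μ ξ :=
  UBdd.of_kernel hp hR (fun μ => (h μ).const_mul _) (A := 100) (N := 2) (by norm_num)
    fun μ x hx => by
      have := norm_pos_iff.2 μ.ne_zero
      rw [norm_mul, norm_inv, inv_mul_le_iff₀ this]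
      exact hb μ x hx

theorem uBdd_symW (hp : 1 < p) (hR : 0 < R) (j k : Fin 3) :
    UBdd p R fun (μ : Par) ξ => (μ : ℂ)⁻¹ * symW μ j k ξ :=
  uBdd_of_rem hp hR (fun μ => hasKernel_symW μ.2.1 μ.2.2 j k) fun μ x hx => by
    rw [norm_negI_pow₂]; exact norm_rad₂_rem_le μ.2.1.le μ.2.2 hx j k

theorem uBdd_coord_symW (hp : 1 < p) (hR : 0 < R) (j k l : Fin 3) :
    UBdd p R fun (μ : Par) ξ => (ξ l : ℂ) * ((μ : ℂ)⁻¹ * symW μ j k ξ) := by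
  have := uBdd_of_rem hp hR (fun μ => hasKernel_symW₁ μ.2.1 μ.2.2 j k l) fun μ x hx => by
    rw [norm_negI_pow₃]; exact norm_rad₃_rem_le μ.2.1.le μ.2.2 hx j k l
  refine this.congr (fun μ => ((mild_symW μ.2.1 j k).const_mul _).coord_mul l) fun μ ξ _ => by ring

theorem uBdd_coord_coord_symW (hp : 1 < p) (hR : 0 < R) (j k l m : Fin 3) :
    UBdd p R fun (μ : Par) ξ => (ξ m : ℂ) * (ξ l * ((μ : ℂ)⁻¹ * symW μ j k ξ)) := by
  have := uBdd_of_rem hp hR (fun μ => hasKernel_symW₂ μ.2.1 μ.2.2 j k l m) fun μ x hx => by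
    rw [norm_negI_pow₄]; exact norm_rad₄_rem_le μ.2.1.le μ.2.2 hx j k l m
  refine this.congr (fun μ => (((mild_symW μ.2.1 j k).const_mul _).coord_mul l).coord_mul m)
    fun μ ξ _ => by ring

theorem UBdd.mul_par {m : Par → E3 → ℂ} (h : UBdd p R m) :
    UBdd p R fun (μ : Par) ξ => (μ : ℂ) * m μ ξ := h.const_mul fun μ => μ.2.2

end

/-! ### Sobolev bounds on balls for the scalar multiplier operators. -/

section

variable {p R : ℝ}

theorem exists_sobSum_symN_le (hp : 1 < p) (hR : 0 < R) (R' : ℝ) : ∃ C : ℝ≥0, ∀ g, SuppIn R g →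
    MemLp g (ENNReal.ofReal p) → sobSum (ENNReal.ofReal p) (B R') (op symN g) ≤
      C * eLpNorm g (ENNReal.ofReal p) volume := by
  obtain ⟨C, hC⟩ := (uBdd_symN (R := R) Unit hp hR).exists_sobSum_le
    (fun k => uBdd_symR Unit hp hR k) (fun k l => uBdd_coord_symR Unit hp k l) R'
  exact ⟨C, hC ()⟩

theorem exists_sobSum_symQ_le (hp : 1 < p) (hR : 0 < R) (R' : ℝ) (j k : Fin 3) :
    ∃ C : ℝ≥0, ∀ g, SuppIn R g →
    MemLp g (ENNReal.ofReal p) → sobSum (ENNReal.ofReal p) (B R') (op (symQ j k) g) ≤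
      C * eLpNorm g (ENNReal.ofReal p) volume := by
  obtain ⟨C, hC⟩ := (uBdd_symQ (R := R) Unit hp hR j k).exists_sobSum_le
    (fun l => uBdd_symT Unit hp hR j k l) (fun l m => uBdd_coord_symT Unit hp j k l m) R'
  exact ⟨C, hC ()⟩

theorem exists_sobNorm_symR_le (hp : 1 < p) (hR : 0 < R) (R' : ℝ) (j : Fin 3) :
    ∃ C : ℝ≥0, ∀ g, SuppIn R g →
    MemLp g (ENNReal.ofReal p) → sobNorm 1 (ENNReal.ofReal p) (B R') (op (symR j) g) ≤
      C * eLpNorm g (ENNReal.ofReal p) volume := by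
  obtain ⟨C, hC⟩ := (uBdd_symR (R := R) Unit hp hR j).exists_sobNorm_one_le
    (fun l => uBdd_coord_symR Unit hp j l) R'
  exact ⟨C, hC ()⟩

theorem exists_sobSum_symR_le (hp : 1 < p) (hR : 0 < R) (R' : ℝ) (j : Fin 3) :
    ∃ C : ℝ≥0, ∀ g d, HasGrad p R g d →
      sobSum (ENNReal.ofReal p) (B R') (op (symR j) g) ≤
      C * (eLpNorm g (ENNReal.ofReal p) volume + ∑ k, eLpNorm (d k) (ENNReal.ofReal p) volume) := by
  obtain ⟨C, hC⟩ := (uBdd_symR (R := R) Unit hp hR j).exists_sobSum_le_grad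
    (fun l => uBdd_coord_symR Unit hp j l) R'
  exact ⟨C, hC ()⟩

/-- The weight `μ` is needed only for the undifferentiated operator, whose kernel contains a
constant of size `|μ|⁻¹`. The derivatives are uniformly bounded even without it. -/
theorem exists_sobSum_symU_le (hp : 1 < p) (hR : 0 < R) (R' : ℝ) : ∃ C : ℝ≥0, ∀ (μ : Par) g,
    SuppIn R g → MemLp g (ENNReal.ofReal p) →
      sobSum (ENNReal.ofReal p) (B R') (op (fun ξ => (μ : ℂ) * symU μ ξ) g) ≤
      C * eLpNorm g (ENNReal.ofReal p) volume :=
  (uBdd_mul_symU hp hR).exists_sobSum_le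
    (fun k => (uBdd_symU₁ hp hR k).mul_par.congr
      (fun μ => ((mild_symU μ.2.1).const_mul _).coord_mul k) fun μ ξ _ => by ring)
    (fun k l => (uBdd_symU₂ hp hR k l).mul_par.congr
      (fun μ => (((mild_symU μ.2.1).const_mul _).coord_mul k).coord_mul l) fun μ ξ _ => by ring) R'

theorem exists_sobNorm_symU₁_le (hp : 1 < p) (hR : 0 < R) (R' : ℝ) (j : Fin 3) :
    ∃ C : ℝ≥0, ∀ (μ : Par) g, SuppIn R g → MemLp g (ENNReal.ofReal p) →
      sobNorm 1 (ENNReal.ofReal p) (B R') (op (fun ξ => ξ j * symU μ ξ) g) ≤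
      C * eLpNorm g (ENNReal.ofReal p) volume :=
  (uBdd_symU₁ hp hR j).exists_sobNorm_one_le (fun k => uBdd_symU₂ hp hR j k) R'

theorem exists_sobSum_symU₁_le (hp : 1 < p) (hR : 0 < R) (R' : ℝ) (j : Fin 3) :
    ∃ C : ℝ≥0, ∀ (μ : Par) g d, HasGrad p R g d →
      sobSum (ENNReal.ofReal p) (B R') (op (fun ξ => ξ j * symU μ ξ) g) ≤
      C * (eLpNorm g (ENNReal.ofReal p) volume + ∑ k, eLpNorm (d k) (ENNReal.ofReal p) volume) :=
  (uBdd_symU₁ hp hR j).exists_sobSum_le_grad (fun k => uBdd_symU₂ hp hR j k) R'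

theorem exists_sobSum_symW_le (hp : 1 < p) (hR : 0 < R) (R' : ℝ) (j k : Fin 3) :
    ∃ C : ℝ≥0, ∀ (μ : Par) g, SuppIn R g → MemLp g (ENNReal.ofReal p) →
      sobSum (ENNReal.ofReal p) (B R') (op (fun ξ => (μ : ℂ)⁻¹ * symW μ j k ξ) g) ≤
      C * eLpNorm g (ENNReal.ofReal p) volume :=
  (uBdd_symW hp hR j k).exists_sobSum_le (fun l => uBdd_coord_symW hp hR j k l)
    (fun l m => uBdd_coord_coord_symW hp hR j k l m) R'

end

/-! ### The data of the resolvent problem -/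

theorem suppIn_of_memLp {p : ℝ} (hp : 1 < p) {R : ℝ} {g : E3 → ℂ}
    (hg : MemLp g (ENNReal.ofReal p)) (hs : ∀ᵐ x, R ≤ ‖x‖ → g x = 0) : SuppIn R g := by
  refine ⟨?_, hs⟩
  have hfin : IsFiniteMeasure (volume.restrict (B R)) :=
    ⟨by rw [Measure.restrict_apply_univ]; exact measure_ball_lt_top⟩
  have h1 : IntegrableOn g (B R) := (hg.restrict (B R)).integrable (one_le_ofReal hp)
  refine ((integrable_indicator_iff (isOpen_B R).measurableSet).2 h1).congr ?_
  filter_upwards [hs] with x hx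
  by_cases hxR : x ∈ B R
  · rw [Set.indicator_of_mem hxR]
  · rw [Set.indicator_of_notMem hxR, hx (by simpa [B] using hxR)]

/-- On the Fourier side both sides are multiplication by the same product of coordinates, and the
inverse transform is injective. -/
theorem lineDerivOp_comm (a b : Fin 3) (φ : 𝓢(E3, ℂ)) :
    ∂_{(EuclideanSpace.single a 1 : E3)} (∂_{(EuclideanSpace.single b 1 : E3)} φ) =
      ∂_{(EuclideanSpace.single b 1 : E3)} (∂_{(EuclideanSpace.single a 1 : E3)} φ) := by
  have h : ivS (∂_{(EuclideanSpace.single a 1 : E3)} (∂_{(EuclideanSpace.single b 1 : E3)} φ)) =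
      ivS (∂_{(EuclideanSpace.single b 1 : E3)} (∂_{(EuclideanSpace.single a 1 : E3)} φ)) := by
    ext ξ
    simp only [ivS_lineDeriv]
    ring
  ext x
  rw [← fhat_ivS, h, fhat_ivS]

theorem pd_comm (a b : Fin 3) (T : 𝓢'(E3, ℂ)) : pd a (pd b T) = pd b (pd a T) := by
  ext φ
  simp only [pd_apply]
  rw [lineDerivOp_comm]

/-- There is a compactly supported Schwartz function equal to `e^(-iξ·x)` near the closed ball. -/
theorem exists_phase_schwartz (R : ℝ) (hR : 0 < R) (ξ : E3) : ∃ φ : 𝓢(E3, ℂ),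
    HasCompactSupport φ ∧
    (∀ x, ‖x‖ < R + 1 → φ x = Complex.exp (-(Complex.I * ((inner ℝ ξ x : ℝ) : ℂ)))) ∧
    ∀ (k : Fin 3) (x), ‖x‖ < R + 1 → (∂_{(EuclideanSpace.single k 1 : E3)} φ) x =
      -Complex.I * ξ k * Complex.exp (-(Complex.I * ((inner ℝ ξ x : ℝ) : ℂ))) := by
  let b : ContDiffBump (0 : E3) := ⟨R + 1, R + 2, by linarith, by linarith⟩
  have hb : HasCompactSupport fun x => ((b x : ℝ) : ℂ) := b.hasCompactSupport.comp_left
    (g := Complex.ofReal) rfl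
  have hb' : ContDiff ℝ ((⊤ : ℕ∞) : WithTop ℕ∞) fun x => ((b x : ℝ) : ℂ) :=
    Complex.ofRealCLM.contDiff.comp b.contDiff
  have he : ContDiff ℝ ((⊤ : ℕ∞) : WithTop ℕ∞)
      fun x : E3 => Complex.exp (-(Complex.I * ((inner ℝ ξ x : ℝ) : ℂ))) := by
    refine ContDiff.cexp (ContDiff.neg (contDiff_const.mul ?_))
    exact Complex.ofRealCLM.contDiff.comp (contDiff_const.inner ℝ contDiff_id)
  set φ : 𝓢(E3, ℂ) := (hb.mul_right (f' := fun x : E3 =>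
    Complex.exp (-(Complex.I * ((inner ℝ ξ x : ℝ) : ℂ))))).toSchwartzMap (hb'.mul he) with hφ
  have hv : ∀ x, ‖x‖ < R + 1 → φ x = Complex.exp (-(Complex.I * ((inner ℝ ξ x : ℝ) : ℂ))) := by
    intro x hx
    have h1 : b x = 1 := b.one_of_mem_closedBall (by simpa using hx.le)
    change ((b x : ℝ) : ℂ) * _ = _
    rw [h1]; simp
  refine ⟨φ, hb.mul_right, hv, fun k x hx => ?_⟩
  have hn : φ =ᶠ[𝓝 x] fun x => Complex.exp (-(Complex.I * ((inner ℝ ξ x : ℝ) : ℂ))) := by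
    filter_upwards [Metric.isOpen_ball.mem_nhds (show x ∈ Metric.ball (0 : E3) (R + 1) by
      simpa using hx)] with y hy
    exact hv y (by simpa using hy)
  rw [SchwartzMap.lineDerivOp_apply, Filter.EventuallyEq.lineDeriv_eq hn]
  refine HasLineDerivAt.lineDeriv ?_
  have h1 : HasDerivAt (fun t : ℝ => (inner ℝ ξ (x + t • EuclideanSpace.single k (1 : ℝ)) : ℝ))
      (ξ k) 0 := by
    simp only [inner_add_right, inner_smul_right, EuclideanSpace.inner_single_right]
    simpa using ((hasDerivAt_id (0 : ℝ)).mul_const (ξ k)).const_add (inner ℝ ξ x)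
  have h2 := ((h1.ofReal_comp.const_mul Complex.I).neg).cexp
  unfold HasLineDerivAt
  refine h2.congr_deriv ?_
  simp only [Pi.neg_apply, zero_smul, add_zero]
  ring

section

variable {R : ℝ} {g : E3 → ℂ}

/-- Testing against a Schwartz function that equals a plane wave near the support evaluates the
Fourier transform. Identities between compactly supported distributions thereby become pointwise
identities of transforms. -/
theorem SuppIn.ofFun_apply_of_eq (hg : SuppIn R g) {φ : 𝓢(E3, ℂ)} {ξ : E3} {a : ℂ}
    (h : ∀ x, ‖x‖ < R + 1 → φ x = a * Complex.exp (-(Complex.I * ((inner ℝ ξ x : ℝ) : ℂ)))) :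
    C0 * ofFun g φ = a * fhat g ξ := by
  rw [ofFun_apply (isTempered_of_integrable hg.int), fhat_eq, mul_left_comm, ← integral_const_mul a]
  congr 1
  refine integral_congr_ae ?_
  filter_upwards [hg.supp] with x hx
  rcases lt_or_ge ‖x‖ R with h1 | h1
  · rw [h x (by linarith)]; ring
  · rw [hx h1]; ring

theorem ae_norm_ne (R : ℝ) : ∀ᵐ x : E3, ‖x‖ ≠ R := by
  have h := Measure.addHaar_sphere (volume : Measure E3) 0 R
  have := measure_eq_zero_iff_ae_notMem.1 h
  filter_upwards [this] with x hx hxR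
  exact hx (by simpa using hxR)

theorem isOpen_norm_gt (R : ℝ) : IsOpen {x : E3 | R < ‖x‖} :=
  isOpen_lt continuous_const continuous_norm

/-- Test functions supported in `|x| > R` do not see `g`, so the derivative vanishes on that open
set. The sphere `|x| = R` is a null set. -/
theorem SuppIn.ae_eq_zero_of_pd (hg : SuppIn R g) {k : Fin 3} {d : E3 → ℂ}
    (hd : RepresentedOn (pd k (ofFun g)) Set.univ d) : ∀ᵐ x, R ≤ ‖x‖ → d x = 0 := by
  have h0 : RepresentedOn (pd k (ofFun g)) {x : E3 | R < ‖x‖} 0 := by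
    refine ⟨(RepresentedOn.zero _).1, fun φ hc hs => ?_⟩
    rw [pd_apply, ofFun_apply (isTempered_of_integrable hg.int)]
    have : ∀ᵐ x, g x * (∂_{(EuclideanSpace.single k 1 : E3)} φ) x = 0 := by
      filter_upwards [hg.supp] with x hx
      rcases lt_or_ge ‖x‖ R with h1 | h1
      · have hx' : x ∉ tsupport (∂_{(EuclideanSpace.single k 1 : E3)} φ : 𝓢(E3, ℂ)) := fun h' =>
          lt_asymm h1 (hs (SchwartzMap.tsupport_lineDerivOp_subset _ _ h'))
        rw [image_eq_zero_of_notMem_tsupport hx', mul_zero]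
      · rw [hx h1, zero_mul]
    rw [integral_eq_zero_of_ae this]
    simp
  have h1 := (hd.mono (Set.subset_univ _)).unique (isOpen_norm_gt R) h0
  rw [Filter.EventuallyEq, ae_restrict_iff' (isOpen_norm_gt R).measurableSet] at h1
  filter_upwards [h1, ae_norm_ne R] with x hx hx' hxR
  exact hx (lt_of_le_of_ne hxR hx'.symm)

/-- The representatives of the distributional derivatives are again supported in the ball, hence
integrable, and testing with plane waves identifies their transforms. -/
theorem SuppIn.exists_grad (hR : 0 < R) {p : ℝ} (hp : 1 < p) (hg : SuppIn R g)
    (hgp : MemLp g (ENNReal.ofReal p))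
    (hs : sobNorm 1 (ENNReal.ofReal p) Set.univ (ofFun g) < ⊤) :
    ∃ d, HasGrad p R g d ∧
      eLpNorm g (ENNReal.ofReal p) volume + ∑ k, eLpNorm (d k) (ENNReal.ofReal p) volume ≤
        sobNorm 1 (ENNReal.ofReal p) Set.univ (ofFun g) := by
  rw [sobNorm_one] at hs ⊢
  have hk : ∀ k, lpNorm (ENNReal.ofReal p) Set.univ (pd k (ofFun g)) < ⊤ := fun k =>
    lt_of_le_of_lt (Finset.single_le_sum
      (f := fun k => lpNorm (ENNReal.ofReal p) Set.univ (pd k (ofFun g)))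
      (fun _ _ => zero_le) (Finset.mem_univ k)) (lt_of_le_of_lt le_add_self hs)
  choose d hd he using fun k => exists_represented isOpen_univ (hk k)
  simp only [Measure.restrict_univ] at he
  have hmem : ∀ k, MemLp (d k) (ENNReal.ofReal p) := fun k =>
    ⟨(locallyIntegrableOn_univ.1 (hd k).1).aestronglyMeasurable, by rw [he k]; exact hk k⟩
  have hsupp : ∀ k, SuppIn R (d k) := fun k =>
    suppIn_of_memLp hp (hmem k) (hg.ae_eq_zero_of_pd (hd k))
  have hrep : RepresentedOn (ofFun g) Set.univ g :=
    ⟨hg.int.locallyIntegrable.locallyIntegrableOn _, fun φ _ _ =>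
      ofFun_apply (isTempered_of_integrable hg.int) φ⟩
  refine ⟨d, ⟨hg, hgp, hsupp, hmem, fun k ξ => ?_⟩, ?_⟩
  · obtain ⟨φ, hc, h1, h2⟩ := exists_phase_schwartz R hR ξ
    have e1 := (hsupp k).ofFun_apply_of_eq (φ := φ) (ξ := ξ) (a := 1) fun x hx => by
      rw [h1 x hx, one_mul]
    have e2 := hg.ofFun_apply_of_eq (h2 k)
    have e3 := (hd k).2 φ hc (Set.subset_univ _)
    rw [pd_apply, ← ofFun_apply (isTempered_of_integrable (hsupp k).int)] at e3
    rw [← e3] at e1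
    linear_combination -e1 - e2
  · rw [lpNorm_eq isOpen_univ hrep, Measure.restrict_univ]
    simp only [he]
    exact le_rfl

end

/-- Integrable data that satisfy the constraints of the space `X_R^p`, in Fourier variables. -/
structure Constrained (f : Data) : Prop where
  int₁ : Integrable f.1
  int₂ : ∀ j, Integrable (f.2.1 j)
  int₃ : ∀ j k, Integrable (f.2.2 j k)
  div : ∀ ξ j, ξ j * fhat f.1 ξ + ∑ k, ξ k * fhat (f.2.2 k j) ξ = 0
  curl : ∀ ξ j k l, ξ l * fhat (f.2.2 j k) ξ = ξ k * fhat (f.2.2 j l) ξ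

/-- Data in the space `X_R^p` with their weak gradients. -/
structure Datum (p R : ℝ) (f : Data) (d₁ : Fin 3 → E3 → ℂ)
    (d₃ : Fin 3 → Fin 3 → Fin 3 → E3 → ℂ) : Prop extends Constrained f where
  grad₁ : HasGrad p R f.1 d₁
  supp₂ : ∀ j, SuppIn R (f.2.1 j)
  mem₂ : ∀ j, MemLp (f.2.1 j) (ENNReal.ofReal p)
  grad₃ : ∀ j k, HasGrad p R (f.2.2 j k) (d₃ j k)
  le₁ : eLpNorm f.1 (ENNReal.ofReal p) volume + ∑ k, eLpNorm (d₁ k) (ENNReal.ofReal p) volume ≤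
    xNorm (ENNReal.ofReal p) f
  le₂ : ∀ j, eLpNorm (f.2.1 j) (ENNReal.ofReal p) volume ≤ xNorm (ENNReal.ofReal p) f
  le₃ : ∀ j k, eLpNorm (f.2.2 j k) (ENNReal.ofReal p) volume +
    ∑ l, eLpNorm (d₃ j k l) (ENNReal.ofReal p) volume ≤ xNorm (ENNReal.ofReal p) f

/-- Both constraints are tested against plane waves cut off outside the support. The divergence
constraint becomes a linear relation between `f̂₁` and the columns of `f̂₃`. Being a gradient
becomes the vanishing of the curl, in which the potential itself no longer appears. -/
theorem exists_datum {p R : ℝ} (hp : 1 < p) (hR : 0 < R) {f : Data}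
    (hf : f ∈ XR (ENNReal.ofReal p) R) : ∃ d₁ d₃, Datum p R f d₁ d₃ := by
  obtain ⟨⟨m1, s1⟩, m2, ms3, hdiv, hgrad, hz⟩ := hf
  have hz' : ∀ᵐ x : E3, R ≤ ‖x‖ →
      f.1 x = 0 ∧ (∀ j, f.2.1 j x = 0) ∧ ∀ j k, f.2.2 j k x = 0 := by
    filter_upwards [hz] with x hx h
    exact hx (by simpa [B] using h)
  have g1 : SuppIn R f.1 := suppIn_of_memLp hp m1 (hz'.mono fun x hx h => (hx h).1)
  have g2 : ∀ j, SuppIn R (f.2.1 j) := fun j =>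
    suppIn_of_memLp hp (m2 j) (hz'.mono fun x hx h => (hx h).2.1 j)
  have g3 : ∀ j k, SuppIn R (f.2.2 j k) := fun j k =>
    suppIn_of_memLp hp (ms3 j k).1 (hz'.mono fun x hx h => (hx h).2.2 j k)
  obtain ⟨d₁, hd1, hl1⟩ := g1.exists_grad hR hp m1 s1
  choose d₃ hd3 hl3 using fun j k => (g3 j k).exists_grad hR hp (ms3 j k).1 (ms3 j k).2
  have hC0 : (C0 : ℂ) ≠ 0 := by
    have : 0 < C0 := by unfold C0; positivity
    exact_mod_cast this.ne'
  refine ⟨d₁, d₃, ⟨g1.int, fun j => (g2 j).int, fun j k => (g3 j k).int, fun ξ j => ?_,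
    fun ξ j k l => ?_⟩, hd1, g2, m2, hd3, ?_, fun j => ?_, fun j k => ?_⟩
  · obtain ⟨φ, hc, -, h2⟩ := exists_phase_schwartz R hR ξ
    have h := hdiv j φ hc (Set.subset_univ _)
    have e1 := g1.ofFun_apply_of_eq (h2 j)
    have e3 := fun k => (g3 k j).ofFun_apply_of_eq (h2 k)
    simp only [Fin.sum_univ_three, _root_.add_apply, pd_apply, _root_.zero_apply] at h ⊢
    have : Complex.I * (ξ j * fhat f.1 ξ + (ξ 0 * fhat (f.2.2 0 j) ξ + ξ 1 * fhat (f.2.2 1 j) ξ +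
        ξ 2 * fhat (f.2.2 2 j) ξ)) = 0 := by
      linear_combination C0 * h + e1 + e3 0 + e3 1 + e3 2
    exact (mul_eq_zero.1 this).resolve_left Complex.I_ne_zero
  · obtain ⟨φ, hc, -, h2⟩ := exists_phase_schwartz R hR ξ
    obtain ⟨ψ, -, hψ⟩ := hgrad
    have hcl : ∀ l, HasCompactSupport (∂_{(EuclideanSpace.single l 1 : E3)} φ : 𝓢(E3, ℂ)) :=
      fun l => hc.mono' ((subset_tsupport _).trans (SchwartzMap.tsupport_lineDerivOp_subset _ _))
    have a1 := hψ j k _ (hcl l) (Set.subset_univ _)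
    have a2 := hψ j l _ (hcl k) (Set.subset_univ _)
    have e1 := (g3 j k).ofFun_apply_of_eq (h2 l)
    have e2 := (g3 j l).ofFun_apply_of_eq (h2 k)
    rw [pd_apply] at a1 a2
    -- Equality of mixed derivatives makes the two expressions in the potential coincide, so that it
    -- drops out of the difference.
    rw [lineDerivOp_comm] at a2
    have : Complex.I * (ξ l * fhat (f.2.2 j k) ξ - ξ k * fhat (f.2.2 j l) ξ) = 0 := by
      simp only [] at a1 a2
      linear_combination e1 - e2 - C0 * (a1 - a2)
    have := (mul_eq_zero.1 this).resolve_left Complex.I_ne_zero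
    linear_combination this
  · refine hl1.trans ?_
    rw [xNorm, add_assoc]
    exact le_self_add
  · refine (Finset.single_le_sum (f := fun j => eLpNorm (f.2.1 j) (ENNReal.ofReal p) volume)
      (fun _ _ => zero_le) (Finset.mem_univ j)).trans ?_
    rw [xNorm]
    exact le_add_self.trans le_self_add
  · refine (hl3 j k).trans ?_
    rw [xNorm]
    refine le_trans ?_ le_add_self
    refine (Finset.single_le_sum (f := fun k => sobNorm 1 (ENNReal.ofReal p) Set.univ
      (ofFun (f.2.2 j k))) (fun _ _ => zero_le) (Finset.mem_univ k)).trans ?_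
    exact Finset.single_le_sum (f := fun j => ∑ k, sobNorm 1 (ENNReal.ofReal p) Set.univ
      (ofFun (f.2.2 j k))) (fun _ _ => zero_le) (Finset.mem_univ j)

/-! ### Inverse Fourier transforms of functions given off the origin -/

/-- No temperedness is assumed: equality almost everywhere preserves it in both directions, and
symbols that are not tempered yield `0` on both sides. Identities need therefore only be checked for
`ξ ≠ 0`. -/
theorem finv_congr_of_ne {F G : E3 → ℂ} (h : ∀ ξ, ξ ≠ 0 → F ξ = G ξ) : finv F = finv G := by
  have e : (fun η : E3 => F ((2 * Real.pi) • η)) =ᵐ[volume] fun η => G ((2 * Real.pi) • η) := by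
    filter_upwards [ae_ne_zero] with η hη
    exact h _ (smul_ne_zero (by positivity) hη)
  have ht : ∀ {u v : E3 → ℂ}, u =ᵐ[volume] v → IsTempered u → IsTempered v := by
    rintro u v huv ⟨N, hN⟩
    exact ⟨N, hN.congr (huv.mono fun x hx => by simp only [hx])⟩
  have : ofFun (fun η : E3 => F ((2 * Real.pi) • η)) = ofFun fun η => G ((2 * Real.pi) • η) := by
    by_cases h1 : IsTempered fun η : E3 => F ((2 * Real.pi) • η)
    · ext φ
      rw [ofFun_apply h1, ofFun_apply (ht e h1)]
      exact integral_congr_ae (e.mono fun x hx => by simp only [hx])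
    · have h2 : ¬ IsTempered fun η : E3 => G ((2 * Real.pi) • η) := fun h2 => h1 (ht e.symm h2)
      rw [ofFun, ofFun, dif_neg h1, dif_neg h2]
  rw [finv, finv, this]

/-- `T` is the inverse Fourier transform of a mild function that agrees with `F` off the origin. -/
def Rep (T : 𝓢'(E3, ℂ)) (F : E3 → ℂ) : Prop :=
  ∃ G, Mild G ∧ T = finv G ∧ ∀ ξ, ξ ≠ 0 → F ξ = G ξ

theorem Rep.finv_eq {T : 𝓢'(E3, ℂ)} {F : E3 → ℂ} (h : Rep T F) : finv F = T := by
  obtain ⟨G, -, rfl, e⟩ := h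
  exact finv_congr_of_ne e

theorem Rep.congr {T : 𝓢'(E3, ℂ)} {F F' : E3 → ℂ} (h : Rep T F) (e : ∀ ξ, ξ ≠ 0 → F' ξ = F ξ) :
    Rep T F' := by
  obtain ⟨G, hG, hT, e'⟩ := h
  exact ⟨G, hG, hT, fun ξ hξ => (e ξ hξ).trans (e' ξ hξ)⟩

theorem distrib_zero_smul (T : 𝓢'(E3, ℂ)) : (0 : ℂ) • T = 0 := by
  ext φ; rw [_root_.smul_apply, zero_smul]; rfl

theorem distrib_smul_zero (a : ℂ) : a • (0 : 𝓢'(E3, ℂ)) = 0 := by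
  ext φ; rw [_root_.smul_apply]; simp

theorem distrib_neg_one_smul (T : 𝓢'(E3, ℂ)) : (-1 : ℂ) • T = -T := by
  ext φ; rw [_root_.smul_apply, neg_one_smul]; rfl

theorem Rep.add {S T : 𝓢'(E3, ℂ)} {F G : E3 → ℂ} (hS : Rep S F) (hT : Rep T G) :
    Rep (S + T) fun ξ => F ξ + G ξ := by
  obtain ⟨F', hF, rfl, eF⟩ := hS
  obtain ⟨G', hG, rfl, eG⟩ := hT
  exact ⟨_, hF.add hG, (finv_add hF hG).symm, fun ξ hξ => by simp only [eF ξ hξ, eG ξ hξ]⟩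

theorem Rep.smul {T : 𝓢'(E3, ℂ)} {F : E3 → ℂ} (hT : Rep T F) (a : ℂ) :
    Rep (a • T) fun ξ => a * F ξ := by
  obtain ⟨F', hF, rfl, eF⟩ := hT
  exact ⟨_, hF.const_mul a, (finv_smul hF a).symm, fun ξ hξ => by simp only [eF ξ hξ]⟩

theorem Rep.neg {T : 𝓢'(E3, ℂ)} {F : E3 → ℂ} (hT : Rep T F) : Rep (-T) fun ξ => -F ξ := by
  have := hT.smul (-1)
  rw [distrib_neg_one_smul] at this
  simpa using this

theorem Rep.sub {S T : 𝓢'(E3, ℂ)} {F G : E3 → ℂ} (hS : Rep S F) (hT : Rep T G) :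
    Rep (S - T) fun ξ => F ξ - G ξ := by
  simpa [sub_eq_add_neg] using hS.add hT.neg

theorem Rep.sum {ι : Type*} [Fintype ι] {T : ι → 𝓢'(E3, ℂ)} {F : ι → E3 → ℂ}
    (h : ∀ i, Rep (T i) (F i)) : Rep (∑ i, T i) fun ξ => ∑ i, F i ξ := by
  choose G hG hT e using h
  refine ⟨_, Mild.sum Finset.univ fun i _ => hG i, ?_, fun ξ hξ =>
    Finset.sum_congr rfl fun i _ => e i ξ hξ⟩
  rw [finv_sum Finset.univ fun i _ => hG i]
  exact Finset.sum_congr rfl fun i _ => hT i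

theorem Rep.pd {T : 𝓢'(E3, ℂ)} {F : E3 → ℂ} (hT : Rep T F) (k : Fin 3) :
    Rep (pd k T) fun ξ => Complex.I * (ξ k * F ξ) := by
  obtain ⟨F', hF, rfl, eF⟩ := hT
  exact ⟨_, (hF.coord_mul k).const_mul _, pd_finv hF k, fun ξ hξ => by simp only [eF ξ hξ]⟩

theorem rep_op {m g : E3 → ℂ} (hm : Mild m) (hg : Integrable g) :
    Rep (op m g) fun ξ => m ξ * fhat g ξ :=
  ⟨_, hm.mul_fhat hg, rfl, fun _ _ => rfl⟩

/-! ### Solenoidal and compressible modes -/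

/-- The parameters of one of the two modes: the viscosity `a`, the elastic modulus `κ`, the
decay rate `μ`, and the spectral parameter `z`. -/
structure Mode where
  a : ℂ
  κ : ℂ
  μ : ℂ
  z : ℂ

namespace Mode

/-- The relations satisfied by the parameters of a mode. -/
structure Ok (M : Mode) : Prop where
  κ_ne : M.κ ≠ 0
  sq_eq : M.κ * M.μ ^ 2 = M.z ^ 2
  cases : M.μ = 0 ∨ 0 < M.μ.re ∧ ‖M.μ‖ ≤ 1

variable (M : Mode)

/-- The denominator `z² + κ|ξ|²`. -/
def d (ξ : E3) : ℂ := M.z ^ 2 + M.κ * nsq ξ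

/-- The operator with symbol `1 / d`. -/
def opD (g : E3 → ℂ) : 𝓢'(E3, ℂ) :=
  M.κ⁻¹ • op symN g - (M.κ⁻¹ * M.μ) • op (fun ξ => M.μ * symU M.μ ξ) g

/-- The operator with symbol `ξ_k / d`. -/
def opE (k : Fin 3) (g : E3 → ℂ) : 𝓢'(E3, ℂ) :=
  M.κ⁻¹ • op (symR k) g - (M.κ⁻¹ * M.μ ^ 2) • op (fun ξ => ξ k * symU M.μ ξ) g

/-- The operator with symbol `ξ_j ξ_k / (|ξ|² d)`. -/
def opF (j k : Fin 3) (g : E3 → ℂ) : 𝓢'(E3, ℂ) :=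
  M.κ⁻¹ • op (symQ j k) g + (M.κ⁻¹ * M.μ) • op (fun ξ => M.μ⁻¹ * symW M.μ j k ξ) g

/-- The operator with symbol `(z + a|ξ|²) ξ_k / (|ξ|² d)`. -/
def opH (k : Fin 3) (g : E3 → ℂ) : 𝓢'(E3, ℂ) :=
  (M.a * M.κ⁻¹) • op (symR k) g +
    ((M.z - M.a * M.μ ^ 2) * M.κ⁻¹) • op (fun ξ => ξ k * symU M.μ ξ) g

/-- The operator with symbol `(z + a|ξ|²) / d`. -/
def opK (g : E3 → ℂ) : 𝓢'(E3, ℂ) :=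
  (M.a * M.κ⁻¹) • ofFun g + (M.z - M.a * M.μ ^ 2) • M.opD g

variable {M} {g : E3 → ℂ}

theorem Ok.z_eq_zero (hM : M.Ok) (h : M.μ = 0) : M.z = 0 := by
  have := hM.sq_eq
  rw [h] at this
  simpa using this.symm

theorem Ok.d_eq (hM : M.Ok) (ξ : E3) : M.d ξ = M.κ * (nsq ξ + M.μ ^ 2) := by
  rw [d, ← hM.sq_eq]; ring

theorem Ok.d_ne (hM : M.Ok) {ξ : E3} (hξ : ξ ≠ 0) : M.d ξ ≠ 0 := by
  rw [hM.d_eq]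
  refine mul_ne_zero hM.κ_ne ?_
  rcases hM.cases with h | h
  · rw [h]; simpa using nsq_ne_zero hξ
  · exact nsq_add_sq_ne_zero h.1 ξ

theorem Ok.rep_D (hM : M.Ok) (hg : Integrable g) :
    Rep (M.opD g) fun ξ => (M.d ξ)⁻¹ * fhat g ξ := by
  rcases hM.cases with h | h
  · have : M.opD g = M.κ⁻¹ • op symN g := by
      simp [opD, h, distrib_zero_smul]
    rw [this]
    refine ((rep_op mild_symN hg).smul _).congr fun ξ hξ => ?_
    rw [hM.d_eq, h, symN, mul_inv]; simp [mul_assoc]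
  · refine (((rep_op mild_symN hg).smul _).sub
      ((rep_op ((mild_symU h.1).const_mul _) hg).smul _)).congr fun ξ hξ => ?_
    have h1 := nsq_ne_zero hξ
    have h2 := nsq_add_sq_ne_zero h.1 ξ
    have h3 := hM.κ_ne
    rw [hM.d_eq, symN, symU]
    field_simp
    ring

theorem Ok.rep_E (hM : M.Ok) (hg : Integrable g) (k : Fin 3) :
    Rep (M.opE k g) fun ξ => ξ k * (M.d ξ)⁻¹ * fhat g ξ := by
  rcases hM.cases with h | h
  · have : M.opE k g = M.κ⁻¹ • op (symR k) g := by
      simp [opE, h, distrib_zero_smul]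
    rw [this]
    refine ((rep_op (mild_symR k) hg).smul _).congr fun ξ hξ => ?_
    rw [hM.d_eq, h, symR, mul_inv]; simp only [ne_eq, OfNat.ofNat_ne_zero, not_false_eq_true,
      zero_pow, add_zero]; ring
  · refine (((rep_op (mild_symR k) hg).smul _).sub
      ((rep_op ((mild_symU h.1).coord_mul k) hg).smul _)).congr fun ξ hξ => ?_
    have h1 := nsq_ne_zero hξ
    have h2 := nsq_add_sq_ne_zero h.1 ξ
    have h3 := hM.κ_ne
    rw [hM.d_eq, symR, symU]
    field_simp
    ring

theorem Ok.rep_F (hM : M.Ok) (hg : Integrable g) (j k : Fin 3) :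
    Rep (M.opF j k g) fun ξ => ξ j * ξ k * (nsq ξ)⁻¹ * (M.d ξ)⁻¹ * fhat g ξ := by
  rcases hM.cases with h | h
  · have : M.opF j k g = M.κ⁻¹ • op (symQ j k) g := by
      simp [opF, h, distrib_zero_smul]
    rw [this]
    refine ((rep_op (mild_symQ j k) hg).smul _).congr fun ξ hξ => ?_
    rw [hM.d_eq, h, symQ, mul_inv]; simp only [ne_eq, OfNat.ofNat_ne_zero, not_false_eq_true,
      zero_pow, add_zero]; ring
  · refine (((rep_op (mild_symQ j k) hg).smul _).add
      ((rep_op ((mild_symW h.1 j k).const_mul _) hg).smul _)).congr fun ξ hξ => ?_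
    have h0 : M.μ ≠ 0 := fun h0 => by simp [h0] at h
    have h1 := nsq_ne_zero hξ
    have h2 := nsq_add_sq_ne_zero h.1 ξ
    have h3 := hM.κ_ne
    rw [hM.d_eq, symW, symQ, symU]
    field_simp
    ring

theorem Ok.rep_H (hM : M.Ok) (hg : Integrable g) (k : Fin 3) :
    Rep (M.opH k g) fun ξ =>
      ξ k * (nsq ξ)⁻¹ * ((M.z + M.a * nsq ξ) * (M.d ξ)⁻¹) * fhat g ξ := by
  rcases hM.cases with h | h
  · have : M.opH k g = (M.a * M.κ⁻¹) • op (symR k) g := by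
      simp [opH, h, hM.z_eq_zero h, distrib_zero_smul]
    rw [this]
    refine ((rep_op (mild_symR k) hg).smul _).congr fun ξ hξ => ?_
    have h1 := nsq_ne_zero hξ
    have h3 := hM.κ_ne
    rw [hM.d_eq, h, hM.z_eq_zero h, symR, zero_pow two_ne_zero, add_zero]
    field_simp
    ring
  · refine (((rep_op (mild_symR k) hg).smul _).add
      ((rep_op ((mild_symU h.1).coord_mul k) hg).smul _)).congr fun ξ hξ => ?_
    have h1 := nsq_ne_zero hξ
    have h2 := nsq_add_sq_ne_zero h.1 ξ
    have h3 := hM.κ_ne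
    rw [hM.d_eq, symR, symU]
    field_simp
    ring

theorem rep_ofFun (hg : Integrable g) : Rep (ofFun g) fun ξ => fhat g ξ := by
  rw [← op_one hg]
  have : Mild fun _ => (1 : ℂ) := BddSym.mild ⟨measurable_const, 1, fun _ => by simp⟩
  exact (rep_op this hg).congr fun ξ _ => by rw [one_mul]

theorem Ok.rep_K (hM : M.Ok) (hg : Integrable g) :
    Rep (M.opK g) fun ξ => (M.z + M.a * nsq ξ) * (M.d ξ)⁻¹ * fhat g ξ := by
  refine (((rep_ofFun hg).smul _).add ((hM.rep_D hg).smul _)).congr fun ξ hξ => ?_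
  have h1 := hM.d_ne hξ
  have h3 := hM.κ_ne
  field_simp
  rw [d, ← hM.sq_eq]
  ring

end Mode

/-! ### Algebra of the projections -/

theorem nsq_eq (ξ : E3) : nsq ξ = ∑ k, (ξ k : ℂ) * ξ k := by
  rw [nsq, EuclideanSpace.norm_sq_eq]
  push_cast
  exact Finset.sum_congr rfl fun k _ => by
    rw [Real.norm_eq_abs, ← Complex.ofReal_pow, sq_abs]; push_cast; ring

theorem Pc_mulVec (ξ : E3) (v : Fin 3 → ℂ) (j : Fin 3) :
    Matrix.mulVec (Pc ξ) v j = (nsq ξ)⁻¹ * (ξ j * ∑ k, ξ k * v k) := by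
  simp only [Matrix.mulVec, dotProduct, Pc, outer, Matrix.smul_apply, Matrix.vecMulVec_apply, vec,
    smul_eq_mul, Finset.mul_sum]
  exact Finset.sum_congr rfl fun k _ => by ring

theorem Ps_mulVec (ξ : E3) (v : Fin 3 → ℂ) (j : Fin 3) :
    Matrix.mulVec (Ps ξ) v j = v j - (nsq ξ)⁻¹ * (ξ j * ∑ k, ξ k * v k) := by
  rw [Ps, Matrix.sub_mulVec, Matrix.one_mulVec, Pi.sub_apply, Pc_mulVec]

section

variable {f : Data}

/-- The divergence constraint replaces the compressible part of `f̂₃` by `f̂₁`. Projections applied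
to `f̂₃` then produce only symbols already present for the other data. -/
theorem Constrained.Pc_hat3 (h : Constrained f) (ξ : E3) (j k : Fin 3) :
    (Pc ξ * hat3 f ξ) j k = -((nsq ξ)⁻¹ * (ξ j * ξ k) * hat1 f ξ) := by
  have hd := h.div ξ k
  simp only [Matrix.mul_apply, Pc, outer, Matrix.smul_apply, Matrix.vecMulVec_apply, vec,
    smul_eq_mul, hat3, hat1]
  have : ∑ x, (nsq ξ)⁻¹ * ((ξ j : ℂ) * ξ x) * fhat (f.2.2 x k) ξ =
      (nsq ξ)⁻¹ * ξ j * ∑ x, ξ x * fhat (f.2.2 x k) ξ := by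
    rw [Finset.mul_sum]; exact Finset.sum_congr rfl fun x _ => by ring
  rw [this]
  linear_combination (nsq ξ)⁻¹ * ξ j * hd

theorem Constrained.Ps_hat3 (h : Constrained f) (ξ : E3) (j k : Fin 3) :
    (Ps ξ * hat3 f ξ) j k = fhat (f.2.2 j k) ξ + (nsq ξ)⁻¹ * (ξ j * ξ k) * hat1 f ξ := by
  rw [Ps, sub_mul, one_mul, Matrix.sub_apply, h.Pc_hat3, sub_neg_eq_add]; rfl

end

/-! ### The resolvent operators in terms of scalar multipliers -/

/-- The solenoidal mode. -/
def Coeffs.mode₁ (c : Coeffs) (z : ℂ) : Mode := ⟨c.ν, c.κ₁ z, z / c.κ₁ z ^ (2⁻¹ : ℂ), z⟩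

/-- The compressible mode. -/
def Coeffs.mode₂ (c : Coeffs) (z : ℂ) : Mode := ⟨c.ν + c.νt, c.κ₂ z, z / c.κ₂ z ^ (2⁻¹ : ℂ), z⟩

/-- The part of the potential that depends on `f₂`. -/
def forceForm (M₁ M₂ : Mode) (f : Data) (j : Fin 3) : 𝓢'(E3, ℂ) :=
  M₁.opD (f.2.1 j) + (∑ k, M₂.opF j k (f.2.1 k) - ∑ k, M₁.opF j k (f.2.1 k))

/-- The potential in terms of scalar multipliers. -/
def psiForm (M₁ M₂ : Mode) (f : Data) (j : Fin 3) : 𝓢'(E3, ℂ) :=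
  forceForm M₁ M₂ f j -
    Complex.I • (∑ k, M₁.opH k (f.2.2 j k) + M₁.opH j f.1 - M₂.opH j f.1)

/-- The velocity in terms of scalar multipliers. -/
def velForm (c : Coeffs) (M₁ M₂ : Mode) (f : Data) (j : Fin 3) : 𝓢'(E3, ℂ) :=
  -((Complex.I * (c.γ : ℂ) ^ 2) • M₂.opE j f.1) + M₁.z • forceForm M₁ M₂ f j +
    (Complex.I * (c.β : ℂ) ^ 2) •
      (∑ k, M₁.opE k (f.2.2 j k) + M₁.opE j f.1 - M₂.opE j f.1)

/-- The density in terms of scalar multipliers. -/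
def phiForm (M₂ : Mode) (f : Data) : 𝓢'(E3, ℂ) :=
  M₂.opK f.1 - Complex.I • ∑ k, M₂.opE k (f.2.1 k)

theorem inv_nsq_mul_sum {ξ : E3} (hξ : ξ ≠ 0) :
    (nsq ξ)⁻¹ * ((ξ 0 : ℂ) * ξ 0 + ξ 1 * ξ 1 + ξ 2 * ξ 2) = 1 := by
  rw [← Fin.sum_univ_three (f := fun k => (ξ k : ℂ) * ξ k), ← nsq_eq]
  exact inv_mul_cancel₀ (nsq_ne_zero hξ)

section

variable {f : Data}
  {c : Coeffs} {z : ℂ}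

theorem symL_mulVec (c : Coeffs) (z : ℂ) (ξ : E3) (v : Fin 3 → ℂ) (j : Fin 3) :
    Matrix.mulVec (symL c z ξ) v j =
      (den₁ c z ξ)⁻¹ * (v j - (nsq ξ)⁻¹ * (ξ j * ∑ k, ξ k * v k)) +
        (den₂ c z ξ)⁻¹ * ((nsq ξ)⁻¹ * (ξ j * ∑ k, ξ k * v k)) := by
  rw [symL, Matrix.add_mulVec, Matrix.smul_mulVec, Matrix.smul_mulVec, Pi.add_apply,
    Pi.smul_apply, Pi.smul_apply, Ps_mulVec, Pc_mulVec, smul_eq_mul, smul_eq_mul]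

theorem Constrained.symL_hat3 (h : Constrained f) (c : Coeffs) (z : ℂ) (ξ : E3) (j k : Fin 3) :
    (symL c z ξ * hat3 f ξ) j k =
      (den₁ c z ξ)⁻¹ * (fhat (f.2.2 j k) ξ + (nsq ξ)⁻¹ * (ξ j * ξ k) * fhat f.1 ξ) -
        (den₂ c z ξ)⁻¹ * ((nsq ξ)⁻¹ * (ξ j * ξ k) * fhat f.1 ξ) := by
  rw [symL, add_mul, Matrix.add_apply, smul_mul_assoc, smul_mul_assoc, Matrix.smul_apply,
    Matrix.smul_apply, h.Ps_hat3, h.Pc_hat3, smul_eq_mul, smul_eq_mul, hat1]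
  ring

theorem Constrained.symH_hat3 (h : Constrained f) (c : Coeffs) (z : ℂ) (ξ : E3) (j k : Fin 3) :
    (symH c z ξ * hat3 f ξ) j k =
      (z + c.ν * nsq ξ) * (den₁ c z ξ)⁻¹ *
          (fhat (f.2.2 j k) ξ + (nsq ξ)⁻¹ * (ξ j * ξ k) * fhat f.1 ξ) -
        (z + (c.ν + c.νt) * nsq ξ) * (den₂ c z ξ)⁻¹ *
          ((nsq ξ)⁻¹ * (ξ j * ξ k) * fhat f.1 ξ) := by
  rw [symH, add_mul, Matrix.add_apply, smul_mul_assoc, smul_mul_assoc, Matrix.smul_apply,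
    Matrix.smul_apply, h.Ps_hat3, h.Pc_hat3, smul_eq_mul, smul_eq_mul, hat1]
  ring

theorem Constrained.rep_force (h : Constrained f) (h₁ : (c.mode₁ z).Ok) (h₂ : (c.mode₂ z).Ok)
    (j : Fin 3) : Rep (forceForm (c.mode₁ z) (c.mode₂ z) f j)
      fun ξ => Matrix.mulVec (symL c z ξ) (hat2 f ξ) j := by
  refine ((h₁.rep_D (h.int₂ j)).add ((Rep.sum fun k => h₂.rep_F (h.int₂ k) j k).sub
    (Rep.sum fun k => h₁.rep_F (h.int₂ k) j k))).congr fun ξ _ => ?_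
  rw [symL_mulVec]
  simp only [Fin.sum_univ_three, hat2]
  change _ = (den₁ c z ξ)⁻¹ * _ + (_ * (den₂ c z ξ)⁻¹ * _ + _ * (den₂ c z ξ)⁻¹ * _ +
    _ * (den₂ c z ξ)⁻¹ * _ - (_ * (den₁ c z ξ)⁻¹ * _ + _ * (den₁ c z ξ)⁻¹ * _ +
    _ * (den₁ c z ξ)⁻¹ * _))
  ring

theorem Constrained.rep_H (h : Constrained f) (h₁ : (c.mode₁ z).Ok) (h₂ : (c.mode₂ z).Ok)
    (j : Fin 3) : Rep (∑ k, (c.mode₁ z).opH k (f.2.2 j k) + (c.mode₁ z).opH j f.1 -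
      (c.mode₂ z).opH j f.1)
      fun ξ => Matrix.mulVec (symH c z ξ * hat3 f ξ) ((nsq ξ)⁻¹ • vec ξ) j := by
  refine (((Rep.sum fun k => h₁.rep_H (h.int₃ j k) k).add
    (h₁.rep_H h.int₁ j)).sub (h₂.rep_H h.int₁ j)).congr fun ξ hξ => ?_
  have hn := inv_nsq_mul_sum hξ
  simp only [Matrix.mulVec, dotProduct, h.symH_hat3, Pi.smul_apply, vec, smul_eq_mul,
    Fin.sum_univ_three]
  have e1 : (c.mode₁ z).d ξ = den₁ c z ξ := rfl
  have e2 : (c.mode₂ z).d ξ = den₂ c z ξ := rfl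
  rw [e1, e2]
  simp only [Coeffs.mode₁, Coeffs.mode₂]
  linear_combination ((z + c.ν * nsq ξ) * (den₁ c z ξ)⁻¹ -
    (z + (c.ν + c.νt) * nsq ξ) * (den₂ c z ξ)⁻¹) * ((nsq ξ)⁻¹ * ξ j * fhat f.1 ξ) * hn

theorem Constrained.rep_E (h : Constrained f) (h₁ : (c.mode₁ z).Ok) (h₂ : (c.mode₂ z).Ok)
    (j : Fin 3) : Rep (∑ k, (c.mode₁ z).opE k (f.2.2 j k) + (c.mode₁ z).opE j f.1 -
      (c.mode₂ z).opE j f.1)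
      fun ξ => Matrix.mulVec (symL c z ξ * hat3 f ξ) (vec ξ) j := by
  refine (((Rep.sum fun k => h₁.rep_E (h.int₃ j k) k).add
    (h₁.rep_E h.int₁ j)).sub (h₂.rep_E h.int₁ j)).congr fun ξ hξ => ?_
  have hn := inv_nsq_mul_sum hξ
  simp only [Matrix.mulVec, dotProduct, h.symL_hat3, vec, Fin.sum_univ_three]
  have e1 : (c.mode₁ z).d ξ = den₁ c z ξ := rfl
  have e2 : (c.mode₂ z).d ξ = den₂ c z ξ := rfl
  rw [e1, e2]
  linear_combination ((den₁ c z ξ)⁻¹ - (den₂ c z ξ)⁻¹) * (ξ j * fhat f.1 ξ) * hn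

theorem Constrained.Psi_eq (h : Constrained f) (h₁ : (c.mode₁ z).Ok) (h₂ : (c.mode₂ z).Ok)
    (j : Fin 3) : Psi c z f j = psiForm (c.mode₁ z) (c.mode₂ z) f j := by
  rw [Psi, (h.rep_force h₁ h₂ j).finv_eq, (h.rep_H h₁ h₂ j).finv_eq, psiForm]

theorem finv_zero_fun : finv (fun _ => 0) = 0 := finv_zero

theorem Constrained.sum_coord_hat3 (h : Constrained f) (ξ : E3) (k : Fin 3) :
    (ξ 0 : ℂ) * fhat (f.2.2 0 k) ξ + ξ 1 * fhat (f.2.2 1 k) ξ + ξ 2 * fhat (f.2.2 2 k) ξ =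
      -(ξ k * fhat f.1 ξ) := by
  have := h.div ξ k
  rw [Fin.sum_univ_three] at this
  linear_combination this

/-- The term with the factor `1/z` disappears because contracting the divergence constraint with `ξ`
gives `|ξ|² f̂₁ + ξᵀ f̂₃ ξ = 0`. -/
theorem Constrained.Phi_eq (h : Constrained f) (h₂ : (c.mode₂ z).Ok) :
    Phi c z f = phiForm (c.mode₂ z) f := by
  have e0 : Rbar₁ c z f = 0 := by
    rw [Rbar₁, finv_congr_of_ne (G := fun _ => 0), finv_zero_fun, distrib_smul_zero, neg_zero]
    intro ξ _
    have : hat1 f ξ * nsq ξ + vec ξ ⬝ᵥ Matrix.mulVec (hat3 f ξ) (vec ξ) = 0 := by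
      rw [nsq_eq]
      simp only [Matrix.mulVec, dotProduct, vec, hat1, hat3, Fin.sum_univ_three]
      linear_combination ξ 0 * h.sum_coord_hat3 ξ 0 + ξ 1 * h.sum_coord_hat3 ξ 1 +
        ξ 2 * h.sum_coord_hat3 ξ 2
    rw [this, zero_div]
  have e1 : Rep (∑ k, (c.mode₂ z).opE k (f.2.1 k))
      fun ξ => (vec ξ ⬝ᵥ hat2 f ξ) / den₂ c z ξ := by
    refine (Rep.sum fun k => h₂.rep_E (h.int₂ k) k).congr fun ξ _ => ?_
    have e2 : (c.mode₂ z).d ξ = den₂ c z ξ := rfl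
    simp only [dotProduct, vec, hat2, e2, Fin.sum_univ_three]
    ring
  have e2 : Rep ((c.mode₂ z).opK f.1)
      fun ξ => (z + (c.ν + c.νt) * nsq ξ) / den₂ c z ξ * hat1 f ξ :=
    (h₂.rep_K h.int₁).congr fun ξ _ => rfl
  rw [Phi, e0, add_zero, e1.finv_eq, e2.finv_eq, phiForm]

theorem Constrained.Wvel_eq (h : Constrained f) (h₁ : (c.mode₁ z).Ok) (h₂ : (c.mode₂ z).Ok)
    (j : Fin 3) : Wvel c z f j = velForm c (c.mode₁ z) (c.mode₂ z) f j := by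
  have e1 : Rep ((c.mode₂ z).opE j f.1) fun ξ => hat1 f ξ / den₂ c z ξ * vec ξ j := by
    refine (h₂.rep_E h.int₁ j).congr fun ξ _ => ?_
    have e2 : (c.mode₂ z).d ξ = den₂ c z ξ := rfl
    rw [e2, hat1, vec]; ring
  have e2 : Rep (z • forceForm (c.mode₁ z) (c.mode₂ z) f j)
      fun ξ => Matrix.mulVec (z • symL c z ξ) (hat2 f ξ) j :=
    ((h.rep_force h₁ h₂ j).smul z).congr fun ξ _ => by
      rw [Matrix.smul_mulVec, Pi.smul_apply, smul_eq_mul]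
  rw [Wvel, e1.finv_eq, e2.finv_eq, (h.rep_E h₁ h₂ j).finv_eq, velForm]
  rfl

/-- Both singular terms vanish before any limit is taken. The divergence constraint gives `ξ ξᵀ (f̂₁
I + f̂₃) = 0`, and the curl constraint makes each row of `f̂₃` a multiple of `ξᵀ`, hence `f̂₃ P̂_s =
0`. -/
theorem Constrained.Rbar₃_eq_zero (h : Constrained f) (j k : Fin 3) : Rbar₃ c z f j k = 0 := by
  rw [Rbar₃, finv_congr_of_ne (G := fun _ => 0), finv_zero_fun, distrib_smul_zero,
    finv_congr_of_ne (G := fun _ => 0), finv_zero_fun, distrib_smul_zero, add_zero]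
  · intro ξ hξ
    have hn := inv_nsq_mul_sum hξ
    have c0 := h.curl ξ j 0 k
    have c1 := h.curl ξ j 1 k
    have c2 := h.curl ξ j 2 k
    have e : (symL c z ξ * hat3 f ξ * Ps ξ) j k = 0 := by
      rw [Ps, mul_sub, mul_one, Matrix.sub_apply, Matrix.mul_apply (N := Pc ξ), Fin.sum_univ_three]
      simp only [h.symL_hat3, Pc, outer, Matrix.smul_apply, Matrix.vecMulVec_apply, vec,
        smul_eq_mul]
      linear_combination -((den₁ c z ξ)⁻¹ * (fhat (f.2.2 j k) ξ + (nsq ξ)⁻¹ * (ξ j * ξ k) *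
        fhat f.1 ξ) - (den₂ c z ξ)⁻¹ * ((nsq ξ)⁻¹ * (ξ j * ξ k) * fhat f.1 ξ)) * hn -
        (den₁ c z ξ)⁻¹ * (nsq ξ)⁻¹ * (ξ 0 * c0 + ξ 1 * c1 + ξ 2 * c2)
    rw [Matrix.smul_apply, e, smul_zero]
  · intro ξ _
    have e : (outer ξ * (hat1 f ξ • (1 : Matrix (Fin 3) (Fin 3) ℂ) + hat3 f ξ)) j k = 0 := by
      rw [mul_add, Matrix.add_apply, mul_smul_comm, mul_one, Matrix.smul_apply, Matrix.mul_apply,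
        Fin.sum_univ_three]
      simp only [outer, Matrix.vecMulVec_apply, vec, smul_eq_mul, hat1, hat3]
      linear_combination ξ j * h.sum_coord_hat3 ξ k
    rw [Matrix.smul_apply, e, smul_zero]

/-- The curl constraint says `f̂₃ = (f̂₃ ξ/|ξ|²) ξᵀ`. So the strain part of the tensor also has the
factor `ξᵀ` on the right, that is, it is a gradient. -/
theorem Constrained.Gdef_eq (h : Constrained f) (h₁ : (c.mode₁ z).Ok) (h₂ : (c.mode₂ z).Ok)
    (j k : Fin 3) : Gdef c z f j k = pd k (psiForm (c.mode₁ z) (c.mode₂ z) f j) := by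
  have e1 : Rep (-Complex.I • pd k (forceForm (c.mode₁ z) (c.mode₂ z) f j)) fun ξ =>
      Matrix.vecMulVec (Matrix.mulVec (symL c z ξ) (hat2 f ξ)) (vec ξ) j k := by
    refine (((h.rep_force h₁ h₂ j).pd k).smul (-Complex.I)).congr fun ξ _ => ?_
    rw [Matrix.vecMulVec_apply, vec]
    linear_combination (ξ k * Matrix.mulVec (symL c z ξ) (hat2 f ξ) j) * Complex.I_sq
  have e2 := (((h.rep_H h₁ h₂ j).pd k).smul (-Complex.I)).congr
    (F' := fun ξ => (symH c z ξ * hat3 f ξ) j k) fun ξ hξ => by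
    have hn := inv_nsq_mul_sum hξ
    have c0 := h.curl ξ j 0 k
    have c1 := h.curl ξ j 1 k
    have c2 := h.curl ξ j 2 k
    simp only [Matrix.mulVec, dotProduct, h.symH_hat3, Pi.smul_apply, vec, smul_eq_mul,
      Fin.sum_univ_three]
    generalize (z + c.ν * nsq ξ) * (den₁ c z ξ)⁻¹ = H1
    generalize (z + (c.ν + c.νt) * nsq ξ) * (den₂ c z ξ)⁻¹ = H2
    have hI : ∀ X : ℂ, -Complex.I * (Complex.I * X) = X := fun X => by
      linear_combination (-X) * Complex.I_sq
    rw [hI]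
    linear_combination -(H1 * (fhat (f.2.2 j k) ξ + (nsq ξ)⁻¹ * (ξ j * ξ k) *
        fhat f.1 ξ) - H2 * ((nsq ξ)⁻¹ * (ξ j * ξ k) * fhat f.1 ξ)) * hn -
        H1 * (nsq ξ)⁻¹ * (ξ 0 * c0 + ξ 1 * c1 + ξ 2 * c2)
  rw [Gdef, h.Rbar₃_eq_zero, add_zero, e1.finv_eq, e2.finv_eq, psiForm]
  have hI : ∀ T : 𝓢'(E3, ℂ), Complex.I • -Complex.I • T = T := fun T => by
    ext φ
    simp only [_root_.smul_apply, smul_eq_mul]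
    linear_combination (-(T φ)) * Complex.I_sq
  rw [hI]
  simp only [pd_sub, pd_smul]
  module

end

/-! ### The zero resolvent operator -/

section

variable (c : Coeffs)

theorem Coeffs.kappa₁_zero : c.κ₁ 0 = (c.β : ℂ) ^ 2 := by simp [Coeffs.κ₁]

theorem Coeffs.kappa₂_zero : c.κ₂ 0 = (c.β : ℂ) ^ 2 + (c.γ : ℂ) ^ 2 := by simp [Coeffs.κ₂]

theorem Coeffs.beta_sq_ne : (c.β : ℂ) ^ 2 ≠ 0 := by
  have := c.β_pos
  exact_mod_cast (by positivity : c.β ^ 2 ≠ 0)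

theorem Coeffs.beta_sq_add_ne : (c.β : ℂ) ^ 2 + (c.γ : ℂ) ^ 2 ≠ 0 := by
  have := c.β_pos
  exact_mod_cast (by positivity : c.β ^ 2 + c.γ ^ 2 ≠ 0)

theorem Coeffs.ok₁_zero : (c.mode₁ 0).Ok :=
  ⟨by simpa [Coeffs.mode₁, Coeffs.κ₁] using c.β_pos.ne', by simp [Coeffs.mode₁],
    Or.inl (by simp [Coeffs.mode₁])⟩

theorem Coeffs.ok₂_zero : (c.mode₂ 0).Ok :=
  ⟨by simpa [Coeffs.mode₂, c.kappa₂_zero] using c.beta_sq_add_ne, by simp [Coeffs.mode₂],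
    Or.inl (by simp [Coeffs.mode₂])⟩

end

theorem Mode.opH_of_zero {M : Mode} (hμ : M.μ = 0) (hz : M.z = 0) (k : Fin 3) (g : E3 → ℂ) :
    M.opH k g = M.a • M.opE k g := by
  simp only [opH, opE, hμ, hz]
  ext φ
  simp
  ring

section

variable {f : Data}
  {c : Coeffs}

theorem Coeffs.d₁_zero (c : Coeffs) (ξ : E3) : ((c.mode₁ 0).d ξ)⁻¹ =
    ((c.β : ℂ) ^ 2)⁻¹ * (nsq ξ)⁻¹ := by
  simp [Mode.d, Coeffs.mode₁, c.kappa₁_zero, mul_comm]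

theorem Coeffs.d₂_zero (c : Coeffs) (ξ : E3) : ((c.mode₂ 0).d ξ)⁻¹ =
    ((c.β : ℂ) ^ 2 + (c.γ : ℂ) ^ 2)⁻¹ * (nsq ξ)⁻¹ := by
  simp [Mode.d, Coeffs.mode₂, c.kappa₂_zero, mul_comm]

/-- The part of the potential `Ψ(0)f` with the solenoidal component of `f₂`. -/
def zeroForce₁ (c : Coeffs) (f : Data) (j : Fin 3) : 𝓢'(E3, ℂ) :=
  (c.β : ℂ) ^ 2 • ((c.mode₁ 0).opD (f.2.1 j) - ∑ k, (c.mode₁ 0).opF j k (f.2.1 k))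

/-- The part of the potential `Ψ(0)f` with the compressible component of `f₂`. -/
def zeroForce₂ (c : Coeffs) (f : Data) (j : Fin 3) : 𝓢'(E3, ℂ) :=
  ((c.β : ℂ) ^ 2 + (c.γ : ℂ) ^ 2) • ∑ k, (c.mode₂ 0).opF j k (f.2.1 k)

/-- The part of the potential `Ψ(0)f` with the solenoidal component of `f₃`. -/
def zeroStrain₁ (c : Coeffs) (f : Data) (j : Fin 3) : 𝓢'(E3, ℂ) :=
  (c.β : ℂ) ^ 2 • (∑ k, (c.mode₁ 0).opE k (f.2.2 j k) + (c.mode₁ 0).opE j f.1)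

/-- The part of the potential `Ψ(0)f` with the compressible component of `f₃`. -/
def zeroStrain₂ (c : Coeffs) (f : Data) (j : Fin 3) : 𝓢'(E3, ℂ) :=
  -(((c.β : ℂ) ^ 2 + (c.γ : ℂ) ^ 2) • (c.mode₂ 0).opE j f.1)

theorem Constrained.rep_zeroForce₁ (h : Constrained f) (j : Fin 3) :
    Rep (zeroForce₁ c f j) fun ξ => (nsq ξ)⁻¹ * Matrix.mulVec (Ps ξ) (hat2 f ξ) j := by
  refine (((c.ok₁_zero.rep_D (h.int₂ j)).sub
    (Rep.sum fun k => c.ok₁_zero.rep_F (h.int₂ k) j k)).smul _).congr fun ξ _ => ?_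
  have hb := mul_inv_cancel₀ c.beta_sq_ne
  simp only [Ps_mulVec, c.d₁_zero, hat2, Fin.sum_univ_three]
  generalize ((c.β : ℂ) ^ 2)⁻¹ = b at *
  generalize (c.β : ℂ) ^ 2 = a at *
  linear_combination -((nsq ξ)⁻¹ * (fhat (f.2.1 j) ξ - (nsq ξ)⁻¹ * (ξ j * (ξ 0 * fhat (f.2.1 0) ξ +
    ξ 1 * fhat (f.2.1 1) ξ + ξ 2 * fhat (f.2.1 2) ξ)))) * hb

theorem Constrained.rep_zeroForce₂ (h : Constrained f) (j : Fin 3) :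
    Rep (zeroForce₂ c f j) fun ξ => (nsq ξ)⁻¹ * Matrix.mulVec (Pc ξ) (hat2 f ξ) j := by
  refine ((Rep.sum fun k => c.ok₂_zero.rep_F (h.int₂ k) j k).smul _).congr fun ξ _ => ?_
  have hb := mul_inv_cancel₀ c.beta_sq_add_ne
  simp only [Pc_mulVec, c.d₂_zero, hat2, Fin.sum_univ_three]
  generalize ((c.β : ℂ) ^ 2 + (c.γ : ℂ) ^ 2)⁻¹ = b at *
  generalize (c.β : ℂ) ^ 2 + (c.γ : ℂ) ^ 2 = a at *
  linear_combination -((nsq ξ)⁻¹ * ((nsq ξ)⁻¹ * (ξ j * (ξ 0 * fhat (f.2.1 0) ξ +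
    ξ 1 * fhat (f.2.1 1) ξ + ξ 2 * fhat (f.2.1 2) ξ)))) * hb

theorem Constrained.rep_zeroStrain₁ (h : Constrained f) (j : Fin 3) :
    Rep (zeroStrain₁ c f j)
      fun ξ => Matrix.mulVec (Ps ξ * hat3 f ξ) ((nsq ξ)⁻¹ • vec ξ) j := by
  refine (((Rep.sum fun k => c.ok₁_zero.rep_E (h.int₃ j k) k).add
    (c.ok₁_zero.rep_E h.int₁ j)).smul _).congr fun ξ hξ => ?_
  have hb := mul_inv_cancel₀ c.beta_sq_ne
  have hn := inv_nsq_mul_sum hξ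
  simp only [Matrix.mulVec, dotProduct, h.Ps_hat3, Pi.smul_apply, vec, smul_eq_mul, hat1,
    Fin.sum_univ_three, c.d₁_zero]
  generalize ((c.β : ℂ) ^ 2)⁻¹ = b at *
  generalize (c.β : ℂ) ^ 2 = a at *
  linear_combination -((nsq ξ)⁻¹ * (ξ 0 * fhat (f.2.2 j 0) ξ + ξ 1 * fhat (f.2.2 j 1) ξ +
    ξ 2 * fhat (f.2.2 j 2) ξ + ξ j * fhat f.1 ξ)) * hb + (nsq ξ)⁻¹ * ξ j * fhat f.1 ξ * hn

theorem Constrained.rep_zeroStrain₂ (h : Constrained f) (j : Fin 3) :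
    Rep (zeroStrain₂ c f j)
      fun ξ => Matrix.mulVec (Pc ξ * hat3 f ξ) ((nsq ξ)⁻¹ • vec ξ) j := by
  refine (((c.ok₂_zero.rep_E h.int₁ j).smul _).neg).congr fun ξ hξ => ?_
  have hb := mul_inv_cancel₀ c.beta_sq_add_ne
  have hn := inv_nsq_mul_sum hξ
  simp only [Matrix.mulVec, dotProduct, h.Pc_hat3, Pi.smul_apply, vec, smul_eq_mul, hat1,
    Fin.sum_univ_three, c.d₂_zero]
  generalize ((c.β : ℂ) ^ 2 + (c.γ : ℂ) ^ 2)⁻¹ = b at *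
  generalize (c.β : ℂ) ^ 2 + (c.γ : ℂ) ^ 2 = a at *
  linear_combination ((nsq ξ)⁻¹ * (ξ j * fhat f.1 ξ)) * hb - (nsq ξ)⁻¹ * ξ j * fhat f.1 ξ * hn

theorem Constrained.Psi0_eq_parts (h : Constrained f) (j : Fin 3) : Psi0 c f j =
    ((1 / c.β ^ 2 : ℝ) : ℂ) • zeroForce₁ c f j +
    ((1 / (c.β ^ 2 + c.γ ^ 2) : ℝ) : ℂ) • zeroForce₂ c f j -
    (Complex.I * ((c.ν / c.β ^ 2 : ℝ) : ℂ)) • zeroStrain₁ c f j -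
    (Complex.I * (((c.ν + c.νt) / (c.β ^ 2 + c.γ ^ 2) : ℝ) : ℂ)) • zeroStrain₂ c f j := by
  rw [Psi0, (h.rep_zeroForce₁ j).finv_eq, (h.rep_zeroForce₂ j).finv_eq,
    (h.rep_zeroStrain₁ j).finv_eq, (h.rep_zeroStrain₂ j).finv_eq]

/-- At `z = 0` the operators `opH` reduce to multiples of `opE`, and the moduli cancel against the
prefactors. The zero operator is thus the member `z = 0` of the family used for `z ≠ 0`, which makes
the difference of the two accessible term by term. -/
theorem Constrained.Psi0_eq (h : Constrained f) (j : Fin 3) :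
    Psi0 c f j = psiForm (c.mode₁ 0) (c.mode₂ 0) f j := by
  have hb : (c.β : ℂ) ≠ 0 := by exact_mod_cast c.β_pos.ne'
  have hb' := c.beta_sq_add_ne
  have hE₁ : ∀ k g, (c.mode₁ 0).opH k g = (c.ν : ℂ) • (c.mode₁ 0).opE k g := fun k g =>
    Mode.opH_of_zero (by simp [Coeffs.mode₁]) rfl k g
  have hE₂ : ∀ k g, (c.mode₂ 0).opH k g = ((c.ν : ℂ) + c.νt) • (c.mode₂ 0).opE k g := fun k g =>
    Mode.opH_of_zero (by simp [Coeffs.mode₂]) rfl k g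
  rw [h.Psi0_eq_parts, psiForm, forceForm, zeroForce₁, zeroForce₂, zeroStrain₁, zeroStrain₂]
  simp only [hE₁, hE₂, ← Finset.smul_sum]
  push_cast
  match_scalars <;> field_simp

theorem Constrained.Gdef0_eq (h : Constrained f) (j k : Fin 3) :
    Gdef0 c f j k = pd k (Psi0 c f j) := by
  have hI : ∀ X : ℂ, -Complex.I * (Complex.I * X) = X := fun X => by
    linear_combination (-X) * Complex.I_sq
  have e1 := (((h.rep_zeroForce₁ (c := c) j).pd k).smul (-Complex.I)).congr
    (F' := fun ξ => Matrix.vecMulVec (Matrix.mulVec (Ps ξ) (hat2 f ξ)) ((nsq ξ)⁻¹ • vec ξ) j k)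
    fun ξ _ => by
      rw [hI, Matrix.vecMulVec_apply, Pi.smul_apply, vec, smul_eq_mul]; ring
  have e2 := (((h.rep_zeroForce₂ (c := c) j).pd k).smul (-Complex.I)).congr
    (F' := fun ξ => Matrix.vecMulVec (Matrix.mulVec (Pc ξ) (hat2 f ξ)) ((nsq ξ)⁻¹ • vec ξ) j k)
    fun ξ _ => by
      rw [hI, Matrix.vecMulVec_apply, Pi.smul_apply, vec, smul_eq_mul]; ring
  have e3 := (((h.rep_zeroStrain₁ (c := c) j).pd k).smul (-Complex.I)).congr
    (F' := fun ξ => (Ps ξ * hat3 f ξ) j k) fun ξ hξ => by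
      have hn := inv_nsq_mul_sum hξ
      have c0 := h.curl ξ j 0 k
      have c1 := h.curl ξ j 1 k
      have c2 := h.curl ξ j 2 k
      rw [hI]
      simp only [Matrix.mulVec, dotProduct, h.Ps_hat3, Pi.smul_apply, vec, smul_eq_mul,
        Fin.sum_univ_three]
      linear_combination -(fhat (f.2.2 j k) ξ + (nsq ξ)⁻¹ * (ξ j * ξ k) * hat1 f ξ) * hn -
        (nsq ξ)⁻¹ * (ξ 0 * c0 + ξ 1 * c1 + ξ 2 * c2)
  have e4 := (((h.rep_zeroStrain₂ (c := c) j).pd k).smul (-Complex.I)).congr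
    (F' := fun ξ => (Pc ξ * hat3 f ξ) j k) fun ξ hξ => by
      have hn := inv_nsq_mul_sum hξ
      rw [hI]
      simp only [Matrix.mulVec, dotProduct, h.Pc_hat3, Pi.smul_apply, vec, smul_eq_mul,
        Fin.sum_univ_three]
      linear_combination ((nsq ξ)⁻¹ * (ξ j * ξ k) * hat1 f ξ) * hn
  rw [Gdef0, e1.finv_eq, e2.finv_eq, e3.finv_eq, e4.finv_eq, h.Psi0_eq_parts]
  simp only [pd_sub, pd_add, pd_smul]
  push_cast
  ext φ
  simp only [_root_.add_apply, _root_.sub_apply, _root_.smul_apply, smul_eq_mul]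
  generalize pd k (zeroForce₁ c f j) φ = A1
  generalize pd k (zeroForce₂ c f j) φ = A2
  linear_combination (-(A1 / (c.β : ℂ) ^ 2) - A2 / ((c.β : ℂ) ^ 2 + (c.γ : ℂ) ^ 2)) * Complex.I_sq

theorem Constrained.Wvel0_eq (h : Constrained f) (j : Fin 3) :
    Wvel0 c f j = velForm c (c.mode₁ 0) (c.mode₂ 0) f j := by
  have hb := c.beta_sq_ne
  have hb' := c.beta_sq_add_ne
  have e1 : Rep (((c.β : ℂ) ^ 2 + (c.γ : ℂ) ^ 2) • (c.mode₂ 0).opE j f.1)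
      fun ξ => hat1 f ξ / nsq ξ * vec ξ j := by
    refine ((c.ok₂_zero.rep_E h.int₁ j).smul _).congr fun ξ _ => ?_
    rw [c.d₂_zero, hat1, vec]; field_simp
  have hz : (c.mode₁ 0).z = 0 := rfl
  rw [Wvel0, e1.finv_eq, (h.rep_zeroStrain₁ j).finv_eq, (h.rep_zeroStrain₂ j).finv_eq, velForm,
    zeroStrain₁, zeroStrain₂, hz, distrib_zero_smul, add_zero]
  push_cast
  match_scalars <;> field_simp

theorem Constrained.Phi0_eq (h : Constrained f) : Phi0 c f = phiForm (c.mode₂ 0) f := by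
  have hb' := c.beta_sq_add_ne
  have e1 : Rep (((c.β : ℂ) ^ 2 + (c.γ : ℂ) ^ 2) • ∑ k, (c.mode₂ 0).opE k (f.2.1 k))
      fun ξ => (vec ξ ⬝ᵥ hat2 f ξ) / nsq ξ := by
    refine ((Rep.sum fun k => c.ok₂_zero.rep_E (h.int₂ k) k).smul _).congr fun ξ _ => ?_
    simp only [dotProduct, vec, hat2, c.d₂_zero, Fin.sum_univ_three]
    field_simp
  have hK : (c.mode₂ 0).opK f.1 =
      (((c.ν : ℂ) + c.νt) * ((c.β : ℂ) ^ 2 + (c.γ : ℂ) ^ 2)⁻¹) • ofFun f.1 := by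
    simp [Mode.opK, Coeffs.mode₂, c.kappa₂_zero, distrib_zero_smul]
  rw [Phi0, e1.finv_eq, phiForm, hK]
  push_cast
  match_scalars <;> field_simp

end

section

/-! ### Bounds for the zero resolvent operator -/

/-- `N T a`, read as `T` has size at most `a`, behaves like a norm bound. -/
structure BoundRel (N : 𝓢'(E3, ℂ) → ℝ≥0∞ → Prop) : Prop where
  zero : N 0 0
  add : ∀ {S T a b}, N S a → N T b → N (S + T) (a + b)
  smul : ∀ (c : ℂ) {T a}, N T a → N (c • T) (‖c‖ₑ * a)
  mono : ∀ {T a b}, N T a → a ≤ b → N T b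

variable {p R : ℝ} {N : 𝓢'(E3, ℂ) → ℝ≥0∞ → Prop}

/-- `A` is bounded on `L^p` functions supported in `B_R`. -/
def SuppBdd (p R : ℝ) (N : 𝓢'(E3, ℂ) → ℝ≥0∞ → Prop) (A : (E3 → ℂ) → 𝓢'(E3, ℂ)) : Prop :=
  ∃ C : ℝ≥0, ∀ g, SuppIn R g → MemLp g (ENNReal.ofReal p) →
    N (A g) (C * eLpNorm g (ENNReal.ofReal p) volume)

/-- `A` is bounded on `W^{1,p}` functions supported in `B_R`. -/
def GradBdd (p R : ℝ) (N : 𝓢'(E3, ℂ) → ℝ≥0∞ → Prop) (A : (E3 → ℂ) → 𝓢'(E3, ℂ)) : Prop :=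
  ∃ C : ℝ≥0, ∀ g d, HasGrad p R g d → N (A g)
    (C * (eLpNorm g (ENNReal.ofReal p) volume + ∑ k, eLpNorm (d k) (ENNReal.ofReal p) volume))

/-- `T` is bounded on the space `X_R^p`. -/
def Controlled (p R : ℝ) (N : 𝓢'(E3, ℂ) → ℝ≥0∞ → Prop) (T : Data → 𝓢'(E3, ℂ)) : Prop :=
  ∃ C : ℝ≥0, ∀ f d₁ d₃, Datum p R f d₁ d₃ → N (T f) (C * xNorm (ENNReal.ofReal p) f)

theorem SuppBdd.grad (hN : BoundRel N) {A : (E3 → ℂ) → 𝓢'(E3, ℂ)} (h : SuppBdd p R N A) :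
    GradBdd p R N A := by
  obtain ⟨C, hC⟩ := h
  exact ⟨C, fun g d hg => hN.mono (hC g hg.supp hg.mem) (by gcongr; exact le_self_add)⟩

theorem SuppBdd.controlled (hN : BoundRel N) {A : (E3 → ℂ) → 𝓢'(E3, ℂ)} (h : SuppBdd p R N A)
    (j : Fin 3) : Controlled p R N fun f => A (f.2.1 j) := by
  obtain ⟨C, hC⟩ := h
  exact ⟨C, fun f d₁ d₃ hf => hN.mono (hC _ (hf.supp₂ j) (hf.mem₂ j)) (by gcongr; exact hf.le₂ j)⟩

theorem GradBdd.controlled₁ (hN : BoundRel N) {A : (E3 → ℂ) → 𝓢'(E3, ℂ)} (h : GradBdd p R N A) :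
    Controlled p R N fun f => A f.1 := by
  obtain ⟨C, hC⟩ := h
  exact ⟨C, fun f d₁ d₃ hf => hN.mono (hC _ _ hf.grad₁) (by gcongr; exact hf.le₁)⟩

theorem GradBdd.controlled₃ (hN : BoundRel N) {A : (E3 → ℂ) → 𝓢'(E3, ℂ)} (h : GradBdd p R N A)
    (j k : Fin 3) : Controlled p R N fun f => A (f.2.2 j k) := by
  obtain ⟨C, hC⟩ := h
  exact ⟨C, fun f d₁ d₃ hf => hN.mono (hC _ _ (hf.grad₃ j k)) (by gcongr; exact hf.le₃ j k)⟩

theorem Controlled.congr {S T : Data → 𝓢'(E3, ℂ)} (h : Controlled p R N S)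
    (e : ∀ f d₁ d₃, Datum p R f d₁ d₃ → T f = S f) : Controlled p R N T := by
  obtain ⟨C, hC⟩ := h
  exact ⟨C, fun f d₁ d₃ hf => by rw [e f d₁ d₃ hf]; exact hC f d₁ d₃ hf⟩

theorem Controlled.add (hN : BoundRel N) {S T : Data → 𝓢'(E3, ℂ)} (hS : Controlled p R N S)
    (hT : Controlled p R N T) : Controlled p R N fun f => S f + T f := by
  obtain ⟨C, hC⟩ := hS
  obtain ⟨D, hD⟩ := hT
  refine ⟨C + D, fun f d₁ d₃ hf => ?_⟩
  rw [ENNReal.coe_add, add_mul]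
  exact hN.add (hC f d₁ d₃ hf) (hD f d₁ d₃ hf)

theorem Controlled.smul (hN : BoundRel N) {T : Data → 𝓢'(E3, ℂ)} (hT : Controlled p R N T)
    (a : ℂ) : Controlled p R N fun f => a • T f := by
  obtain ⟨C, hC⟩ := hT
  refine ⟨‖a‖₊ * C, fun f d₁ d₃ hf => ?_⟩
  rw [ENNReal.coe_mul, mul_assoc]
  exact hN.smul a (hC f d₁ d₃ hf)

theorem Controlled.neg (hN : BoundRel N) {T : Data → 𝓢'(E3, ℂ)} (hT : Controlled p R N T) :
    Controlled p R N fun f => -T f := by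
  simpa only [distrib_neg_one_smul] using hT.smul hN (-1)

theorem Controlled.sub (hN : BoundRel N) {S T : Data → 𝓢'(E3, ℂ)} (hS : Controlled p R N S)
    (hT : Controlled p R N T) : Controlled p R N fun f => S f - T f := by
  simpa only [sub_eq_add_neg] using hS.add hN (hT.neg hN)

theorem Controlled.sum (hN : BoundRel N) {T : Fin 3 → Data → 𝓢'(E3, ℂ)}
    (hT : ∀ k, Controlled p R N (T k)) : Controlled p R N fun f => ∑ k, T k f := by
  simp only [Fin.sum_univ_three]
  exact ((hT 0).add hN (hT 1)).add hN (hT 2)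

theorem Mode.opD_of_zero {M : Mode} (hμ : M.μ = 0) (g : E3 → ℂ) :
    M.opD g = M.κ⁻¹ • op symN g := by
  simp [opD, hμ, distrib_zero_smul]

theorem Mode.opE_of_zero {M : Mode} (hμ : M.μ = 0) (k : Fin 3) (g : E3 → ℂ) :
    M.opE k g = M.κ⁻¹ • op (symR k) g := by
  simp [opE, hμ, distrib_zero_smul]

theorem Mode.opF_of_zero {M : Mode} (hμ : M.μ = 0) (j k : Fin 3) (g : E3 → ℂ) :
    M.opF j k g = M.κ⁻¹ • op (symQ j k) g := by
  simp [opF, hμ, distrib_zero_smul]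

theorem Mode.opK_of_zero {M : Mode} (hμ : M.μ = 0) (hz : M.z = 0) (g : E3 → ℂ) :
    M.opK g = (M.a * M.κ⁻¹) • ofFun g := by
  simp [opK, hμ, hz, distrib_zero_smul]

theorem Coeffs.mode₁_zero_mu (c : Coeffs) : (c.mode₁ 0).μ = 0 := by simp [Coeffs.mode₁]

theorem Coeffs.mode₂_zero_mu (c : Coeffs) : (c.mode₂ 0).μ = 0 := by simp [Coeffs.mode₂]

theorem controlled_forceForm (hN : BoundRel N) (hn : SuppBdd p R N (op symN))
    (hq : ∀ j k, SuppBdd p R N (op (symQ j k))) (c : Coeffs) (j : Fin 3) :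
    Controlled p R N fun f => forceForm (c.mode₁ 0) (c.mode₂ 0) f j := by
  have h1 := c.mode₁_zero_mu
  have h2 := c.mode₂_zero_mu
  simp only [forceForm, Mode.opD_of_zero h1, Mode.opF_of_zero h1, Mode.opF_of_zero h2]
  exact ((hn.controlled hN j).smul hN _).add hN
    ((Controlled.sum hN fun k => ((hq j k).controlled hN k).smul hN _).sub hN
      (Controlled.sum hN fun k => ((hq j k).controlled hN k).smul hN _))

/-- The notion of size is left abstract so that one decomposition yields local Sobolev bounds,
second derivatives in the whole space and pointwise decay. Only the scalar operators with symbols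
`symN`, `symQ` and `symR` have to be estimated in each case. -/
theorem controlled_Psi0 (hN : BoundRel N) (hn : SuppBdd p R N (op symN))
    (hq : ∀ j k, SuppBdd p R N (op (symQ j k))) (hr : ∀ k, GradBdd p R N (op (symR k)))
    (c : Coeffs) (j : Fin 3) : Controlled p R N fun f => Psi0 c f j := by
  have h1 := c.mode₁_zero_mu
  have h2 := c.mode₂_zero_mu
  refine Controlled.congr ?_ fun f d₁ d₃ hf => hf.Psi0_eq j
  simp only [psiForm, Mode.opH_of_zero h1 rfl, Mode.opH_of_zero h2 rfl, Mode.opE_of_zero h1,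
    Mode.opE_of_zero h2]
  have r1 := (hr j).controlled₁ (p := p) (R := R) hN
  exact (controlled_forceForm hN hn hq c j).sub hN
    ((((Controlled.sum hN fun k => (((hr k).controlled₃ hN j k).smul hN _).smul hN _).add hN
      ((r1.smul hN _).smul hN _)).sub hN ((r1.smul hN _).smul hN _)).smul hN _)

theorem controlled_Wvel0 (hN : BoundRel N) (hr : ∀ k, GradBdd p R N (op (symR k)))
    (c : Coeffs) (j : Fin 3) : Controlled p R N fun f => Wvel0 c f j := by
  have h1 := c.mode₁_zero_mu
  have h2 := c.mode₂_zero_mu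
  have hz : (c.mode₁ 0).z = 0 := rfl
  refine Controlled.congr ?_ fun f d₁ d₃ hf => hf.Wvel0_eq j
  simp only [velForm, hz, Mode.opE_of_zero h1, Mode.opE_of_zero h2, distrib_zero_smul, add_zero]
  have r1 := (hr j).controlled₁ (p := p) (R := R) hN
  exact (((r1.smul hN _).smul hN _).neg hN).add hN
    ((((Controlled.sum hN fun k => ((hr k).controlled₃ hN j k).smul hN _).add hN
      (r1.smul hN _)).sub hN (r1.smul hN _)).smul hN _)

theorem controlled_Phi0 (hN : BoundRel N) (h0 : GradBdd p R N ofFun)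
    (hr : ∀ k, SuppBdd p R N (op (symR k))) (c : Coeffs) :
    Controlled p R N fun f => Phi0 c f := by
  have h2 := c.mode₂_zero_mu
  refine Controlled.congr (S := fun f => phiForm (c.mode₂ 0) f) ?_ fun f d₁ d₃ hf => hf.Phi0_eq
  simp only [phiForm, Mode.opE_of_zero h2, Mode.opK_of_zero h2 rfl]
  exact ((h0.controlled₁ hN).smul hN _).sub hN
    ((Controlled.sum hN fun k => ((hr k).controlled hN k).smul hN _).smul hN _)

/-! ### The norms in use -/

/-- The bound given by a norm. -/
def leRel (n : 𝓢'(E3, ℂ) → ℝ≥0∞) (T : 𝓢'(E3, ℂ)) (a : ℝ≥0∞) : Prop := n T ≤ a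

theorem BoundRel.of_norm {n : 𝓢'(E3, ℂ) → ℝ≥0∞} (h0 : n 0 = 0)
    (hadd : ∀ S T, n (S + T) ≤ n S + n T) (hsmul : ∀ (c : ℂ) T, n (c • T) ≤ ‖c‖ₑ * n T) :
    BoundRel (leRel n) where
  zero := h0.le
  add := fun h1 h2 => (hadd _ _).trans (add_le_add h1 h2)
  smul := fun c _ _ h => (hsmul c _).trans (mul_le_mul' le_rfl h)
  mono := fun h1 h2 => le_trans (α := ℝ≥0∞) h1 h2

theorem BoundRel.pd (h : BoundRel N) (k : Fin 3) : BoundRel fun T => N (pd k T) where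
  zero := by rw [pd_zero]; exact h.zero
  add := fun h1 h2 => by rw [pd_add]; exact h.add h1 h2
  smul := fun c _ _ h1 => by rw [pd_smul]; exact h.smul c h1
  mono := h.mono

theorem boundRel_lpNorm {p : ℝ≥0∞} (hp : 1 ≤ p) {D : Set E3} (hD : IsOpen D) :
    BoundRel (leRel (lpNorm p D)) :=
  BoundRel.of_norm (lpNorm_zero p D) (lpNorm_add_le hp hD) (lpNorm_smul_le hD)

theorem boundRel_sobNorm_one {p : ℝ≥0∞} (hp : 1 ≤ p) {D : Set E3} (hD : IsOpen D) :
    BoundRel (leRel (sobNorm 1 p D)) :=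
  BoundRel.of_norm (by simp [sobNorm_one, pd_zero, lpNorm_zero]) (sobNorm_one_add_le hp hD)
    (sobNorm_one_smul_le hD)

theorem boundRel_sobSum {p : ℝ≥0∞} (hp : 1 ≤ p) {D : Set E3} (hD : IsOpen D) :
    BoundRel (leRel (sobSum p D)) :=
  BoundRel.of_norm (by simp [sobSum, pd_zero, lpNorm_zero]) (sobSum_add_le hp hD)
    (sobSum_smul_le hD)

theorem HasGrad.pd_ofFun {g : E3 → ℂ} {d : Fin 3 → E3 → ℂ} (h : HasGrad p R g d) (k : Fin 3) :
    pd k (ofFun g) = ofFun (d k) := by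
  have h1 : Mild fun _ => (1 : ℂ) := BddSym.mild ⟨measurable_const, 1, fun _ => by simp⟩
  rw [← op_one h.supp.int, h.pd_op h1, op_one (h.suppd k).int]

theorem lpNorm_ofFun_le {q : ℝ≥0∞} {g : E3 → ℂ} (hg : Integrable g) (D : Set E3) :
    lpNorm q D (ofFun g) ≤ eLpNorm g q volume :=
  (lpNorm_le (g := g) ⟨hg.locallyIntegrable.locallyIntegrableOn _, fun φ _ _ =>
    ofFun_apply (isTempered_of_integrable hg) φ⟩ q).trans
    (eLpNorm_mono_measure _ Measure.restrict_le_self)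

theorem gradBdd_sobNorm_ofFun (R' : ℝ) :
    GradBdd p R (leRel (sobNorm 1 (ENNReal.ofReal p) (B R'))) ofFun := by
  refine ⟨1, fun g d h => ?_⟩
  rw [leRel, sobNorm_one, ENNReal.coe_one, one_mul]
  refine add_le_add (lpNorm_ofFun_le h.supp.int _) (Finset.sum_le_sum fun k _ => ?_)
  rw [h.pd_ofFun]
  exact lpNorm_ofFun_le (h.suppd k).int _

theorem gradBdd_pd_ofFun (k : Fin 3) :
    GradBdd p R (leRel fun T => lpNorm (ENNReal.ofReal p) Set.univ (pd k T)) ofFun := by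
  refine ⟨1, fun g d h => ?_⟩
  rw [leRel, h.pd_ofFun, ENNReal.coe_one, one_mul]
  refine (lpNorm_ofFun_le (h.suppd k).int _).trans ?_
  exact (Finset.single_le_sum (f := fun k => eLpNorm (d k) (ENNReal.ofReal p) volume)
    (fun _ _ => zero_le) (Finset.mem_univ k)).trans le_add_self

theorem suppBdd_pd_symR (hp : 1 < p) (j l : Fin 3) :
    SuppBdd p R (leRel fun T => lpNorm (ENNReal.ofReal p) Set.univ (pd l T)) (op (symR j)) := by
  obtain ⟨C, hC⟩ := (lpMult_rr l j).exists_lpNorm_le hp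
  refine ⟨C, fun g hg hgp => ?_⟩
  rw [leRel, pd_op (mild_symR j) hg.int]
  refine (lpNorm_I_smul_le isOpen_univ _).trans ?_
  rw [op_congr ((mild_symR j).coord_mul l) (lpMult_rr l j).bdd.mild hg.int
    fun ξ _ => (rr_eq l j).symm]
  exact hC g hg.int hgp

theorem gradBdd_pd_pd_symR (hp : 1 < p) (j l m : Fin 3) :
    GradBdd p R (leRel fun T => lpNorm (ENNReal.ofReal p) Set.univ (pd m (pd l T)))
      (op (symR j)) := by
  obtain ⟨C, hC⟩ := suppBdd_pd_symR (R := R) hp j m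
  refine ⟨C, fun g d h => ?_⟩
  rw [leRel, h.pd_op (mild_symR j)]
  refine (hC (d l) (h.suppd l) (h.memd l)).trans ?_
  gcongr
  exact (Finset.single_le_sum (f := fun k => eLpNorm (d k) (ENNReal.ofReal p) volume)
    (fun _ _ => zero_le) (Finset.mem_univ l)).trans le_add_self

theorem suppBdd_pd_pd_symN (hp : 1 < p) (l m : Fin 3) :
    SuppBdd p R (leRel fun T => lpNorm (ENNReal.ofReal p) Set.univ (pd m (pd l T)))
      (op symN) := by
  obtain ⟨C, hC⟩ := suppBdd_pd_symR (R := R) hp l m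
  refine ⟨C, fun g hg hgp => ?_⟩
  rw [leRel, pd_op mild_symN hg.int, pd_smul]
  exact (lpNorm_I_smul_le isOpen_univ _).trans (hC g hg hgp)

theorem suppBdd_pd_pd_symQ (hp : 1 < p) (j k l m : Fin 3) :
    SuppBdd p R (leRel fun T => lpNorm (ENNReal.ofReal p) Set.univ (pd m (pd l T)))
      (op (symQ j k)) := by
  obtain ⟨C, hC⟩ := (lpMult_rr_mul_rr m l j k).exists_lpNorm_le hp
  refine ⟨C, fun g hg hgp => ?_⟩
  rw [leRel, pd_op (mild_symQ j k) hg.int, pd_smul, pd_op ((mild_symQ j k).coord_mul l) hg.int]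
  refine (lpNorm_I_smul_le isOpen_univ _).trans ((lpNorm_I_smul_le isOpen_univ _).trans ?_)
  rw [op_congr (((mild_symQ j k).coord_mul l).coord_mul m) (lpMult_rr_mul_rr m l j k).bdd.mild
    hg.int fun ξ _ => coord_mul_coord_mul_symQ j k l m]
  exact hC g hg.int hgp

end

section

/-! ### Pointwise decay -/

/-- Outside `B_R` the distribution `T` is a continuous function `φ` with `|x|^s |φ(x)| ≤ a` for
`|x| ≥ 2R`. -/
def decayRel (R : ℝ) (s : ℕ) (T : 𝓢'(E3, ℂ)) (a : ℝ≥0∞) : Prop :=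
  ∃ φ : E3 → ℂ, (ContinuousOn φ {x | R < ‖x‖} ∧ RepresentedOn T {x | R < ‖x‖} φ) ∧
    ∀ x : E3, 2 * R ≤ ‖x‖ → ENNReal.ofReal (‖x‖ ^ s * ‖φ x‖) ≤ a

theorem boundRel_decayRel (R : ℝ) (s : ℕ) : BoundRel (decayRel R s) where
  zero := ⟨0, ⟨continuousOn_const, RepresentedOn.zero _⟩, fun x _ => by simp⟩
  add := by
    rintro S T a b ⟨φ, ⟨c1, r1⟩, b1⟩ ⟨ψ, ⟨c2, r2⟩, b2⟩
    refine ⟨φ + ψ, ⟨c1.add c2, r1.add r2⟩, fun x hx => ?_⟩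
    refine le_trans ?_ (add_le_add (b1 x hx) (b2 x hx))
    rw [← ENNReal.ofReal_add (by positivity) (by positivity), ← mul_add]
    exact ENNReal.ofReal_le_ofReal (by gcongr; exact norm_add_le _ _)
  smul := by
    rintro c T a ⟨φ, ⟨c1, r1⟩, b1⟩
    refine ⟨c • φ, ⟨c1.const_smul c, r1.smul c⟩, fun x hx => ?_⟩
    rw [Pi.smul_apply, norm_smul, mul_left_comm, ENNReal.ofReal_mul (norm_nonneg c), ofReal_norm]
    exact mul_le_mul' le_rfl (b1 x hx)
  mono := by
    rintro T a b ⟨φ, h, b1⟩ hab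
    exact ⟨φ, h, fun x hx => (b1 x hx).trans hab⟩

variable {p R : ℝ}

theorem HasKernel.suppBdd_decayRel (hp : 1 < p) (hR : 0 < R) {m K : E3 → ℂ} (h : HasKernel m K)
    (hc : ContinuousOn K {0}ᶜ) {A : ℝ} {s : ℕ} (hA : 0 ≤ A)
    (hb : ∀ x, x ≠ 0 → ‖K x‖ ≤ A * (‖x‖ ^ s)⁻¹) : SuppBdd p R (decayRel R s) (op m) := by
  have hv : volume (B R) ^ (1 - 1 / p) ≠ ⊤ := by
    refine ENNReal.rpow_ne_top_of_nonneg ?_ measure_ball_lt_top.ne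
    rw [sub_nonneg, div_le_one (by linarith)]
    exact hp.le
  refine ⟨(ENNReal.ofReal (2 ^ s * A) * volume (B R) ^ (1 - 1 / p)).toNNReal, fun g hg hgp =>
    ⟨conv K g, ⟨continuousOn_conv h.ker.1 hc hA hb hg,
      (h.represented hR hg).mono (Set.subset_univ _)⟩, fun x hx => ?_⟩⟩
  rw [ENNReal.coe_toNNReal (ENNReal.mul_ne_top ENNReal.ofReal_ne_top hv), mul_assoc]
  refine (ENNReal.ofReal_le_ofReal (norm_conv_le hA hb hR hg hx)).trans ?_
  rw [ENNReal.ofReal_mul (by positivity)]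
  exact mul_le_mul' le_rfl (integral_norm_le_eLpNorm hp hg)

theorem continuousOn_radial {u : ℝ → ℂ} (h : ContinuousOn u (Set.Ioi 0)) :
    ContinuousOn (fun x : E3 => u ‖x‖) {0}ᶜ :=
  h.comp continuous_norm.continuousOn fun _ hx => norm_pos_iff.2 hx

theorem continuousOn_coord (j : Fin 3) : ContinuousOn (fun x : E3 => ((x j : ℝ) : ℂ)) {0}ᶜ := by
  have : Continuous fun x : E3 => ((x j : ℝ) : ℂ) := by fun_prop
  exact this.continuousOn

theorem continuousOn_div_pow (a b : ℂ) (hb : b ≠ 0) (n : ℕ) :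
    ContinuousOn (fun r : ℝ => a / (b * (r : ℂ) ^ n)) (Set.Ioi 0) := by
  refine ContinuousOn.div continuousOn_const (by fun_prop) fun r hr => ?_
  have : (r : ℂ) ≠ 0 := by exact_mod_cast (ne_of_gt hr : r ≠ 0)
  positivity

theorem four_pi_ne : (4 * Real.pi : ℂ) ≠ 0 := by
  exact_mod_cast (by positivity : (4 * Real.pi : ℝ) ≠ 0)

theorem eight_pi_ne : (8 * Real.pi : ℂ) ≠ 0 := by
  exact_mod_cast (by positivity : (8 * Real.pi : ℝ) ≠ 0)

theorem suppBdd_decay_symN (hp : 1 < p) (hR : 0 < R) :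
    SuppBdd p R (decayRel R 1) (op symN) := by
  refine hasKernel_symN.suppBdd_decayRel hp hR (continuousOn_radial ?_) zero_le_one
    fun x _ => norm_newtonTower_zero_le (norm_nonneg x)
  have h := continuousOn_div_pow 1 _ four_pi_ne 1
  simp only [pow_one] at h
  exact h

theorem suppBdd_decay_symR (hp : 1 < p) (hR : 0 < R) (j : Fin 3) :
    SuppBdd p R (decayRel R 2) (op (symR j)) := by
  refine (hasKernel_symR j).suppBdd_decayRel hp hR (continuousOn_const.mul
    ((continuousOn_coord j).mul (continuousOn_radial ?_))) zero_le_one fun x hx => ?_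
  · exact continuousOn_div_pow (-1) _ four_pi_ne 3
  · rw [norm_negI_pow₁]; exact norm_rad₁_newton_le j hx

theorem continuousOn_biTower_one : ContinuousOn (biTower 1) (Set.Ioi 0) := by
  have h := continuousOn_div_pow (-1) _ eight_pi_ne 1
  simp only [pow_one] at h
  exact h

theorem continuousOn_biTower_two : ContinuousOn (biTower 2) (Set.Ioi 0) :=
  continuousOn_div_pow 1 _ eight_pi_ne 3

theorem continuousOn_biTower_three : ContinuousOn (biTower 3) (Set.Ioi 0) :=
  continuousOn_div_pow (-3) _ eight_pi_ne 5

theorem suppBdd_decay_symQ (hp : 1 < p) (hR : 0 < R) (j k : Fin 3) :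
    SuppBdd p R (decayRel R 1) (op (symQ j k)) := by
  refine (hasKernel_symQ j k).suppBdd_decayRel hp hR (continuousOn_const.mul
    ((continuousOn_const.mul (continuousOn_radial continuousOn_biTower_one)).add
      (((continuousOn_coord j).mul (continuousOn_coord k)).mul
        (continuousOn_radial continuousOn_biTower_two)))) zero_le_two fun x hx => ?_
  rw [norm_negI_pow₂]; exact norm_rad₂_bi_le j k hx

theorem suppBdd_decay_symT (hp : 1 < p) (hR : 0 < R) (j k l : Fin 3) :
    SuppBdd p R (decayRel R 2) (op fun ξ => ξ l * symQ j k ξ) := by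
  refine (hasKernel_symT j k l).suppBdd_decayRel hp hR (continuousOn_const.mul
    ((((continuousOn_const.mul (continuousOn_coord l)).add
      (continuousOn_const.mul (continuousOn_coord k))).add
      (continuousOn_const.mul (continuousOn_coord j))).mul
        (continuousOn_radial continuousOn_biTower_two) |>.add
      ((((continuousOn_coord j).mul (continuousOn_coord k)).mul (continuousOn_coord l)).mul
        (continuousOn_radial continuousOn_biTower_three)))) (A := 6) (by norm_num) fun x hx => ?_
  rw [norm_negI_pow₃]; exact norm_rad₃_bi_le j k l hx

/-- For `|x| ≥ 2R` one has `|x| ≤ (2R)⁻¹ |x|²`. -/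
theorem decayRel.of_two (hR : 0 < R) {T : 𝓢'(E3, ℂ)} {a : ℝ≥0∞} (h : decayRel R 2 T a) :
    decayRel R 1 T (((2 * R)⁻¹.toNNReal : ℝ≥0∞) * a) := by
  obtain ⟨φ, h1, h2⟩ := h
  refine ⟨φ, h1, fun x hx => le_trans ?_ (mul_le_mul' le_rfl (h2 x hx))⟩
  change _ ≤ ENNReal.ofReal _ * _
  rw [← ENNReal.ofReal_mul (by positivity)]
  refine ENNReal.ofReal_le_ofReal ?_
  rw [← mul_assoc, inv_mul_eq_div]
  gcongr
  rw [le_div_iff₀ (by positivity), pow_one]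
  nlinarith [norm_nonneg x]

theorem SuppBdd.decay_one (hR : 0 < R) {A : (E3 → ℂ) → 𝓢'(E3, ℂ)}
    (h : SuppBdd p R (decayRel R 2) A) : SuppBdd p R (decayRel R 1) A := by
  obtain ⟨C, hC⟩ := h
  refine ⟨(2 * R)⁻¹.toNNReal * C, fun g hg hgp => ?_⟩
  rw [ENNReal.coe_mul, mul_assoc]
  exact (hC g hg hgp).of_two hR

/-- The datum vanishes outside `B_R`, so there it is represented by `0` and the constant may be
taken to be `0`. -/
theorem gradBdd_decay_ofFun (s : ℕ) : GradBdd p R (decayRel R s) ofFun := by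
  refine ⟨0, fun g d h => ⟨0, ⟨continuousOn_const, ?_⟩, fun x _ => by simp⟩⟩
  have h1 : RepresentedOn (ofFun g) {x : E3 | R < ‖x‖} g :=
    ⟨h.supp.int.locallyIntegrable.locallyIntegrableOn _, fun φ _ _ =>
      ofFun_apply (isTempered_of_integrable h.supp.int) φ⟩
  refine h1.congr_ae (isOpen_norm_gt R) ?_
  filter_upwards [h.supp.supp] with x hx hxR
  exact hx (le_of_lt hxR)

theorem SuppBdd.pd_grad {N : 𝓢'(E3, ℂ) → ℝ≥0∞ → Prop} (hN : BoundRel N) {m : E3 → ℂ}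
    (hm : Mild m) (h : SuppBdd p R N (op m)) (k : Fin 3) :
    GradBdd p R (fun T => N (pd k T)) (op m) := by
  obtain ⟨C, hC⟩ := h
  refine ⟨C, fun g d hg => ?_⟩
  simp only [hg.pd_op hm]
  refine hN.mono (hC (d k) (hg.suppd k) (hg.memd k)) ?_
  gcongr
  exact (Finset.single_le_sum (f := fun k => eLpNorm (d k) (ENNReal.ofReal p) volume)
    (fun _ _ => zero_le) (Finset.mem_univ k)).trans le_add_self

theorem SuppBdd.pd {N : 𝓢'(E3, ℂ) → ℝ≥0∞ → Prop} (hN : BoundRel N) {m : E3 → ℂ}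
    (hm : Mild m) {k : Fin 3} (h : SuppBdd p R N (op fun ξ => ξ k * m ξ)) :
    SuppBdd p R (fun T => N (pd k T)) (op m) := by
  obtain ⟨C, hC⟩ := h
  refine ⟨C, fun g hg hgp => ?_⟩
  change N (Viscoelastic.pd k (op m g)) _
  rw [pd_op hm hg.int]
  simpa [← ofReal_norm] using hN.smul Complex.I (hC g hg hgp)

theorem controlled_decay_Phi0 (hp : 1 < p) (hR : 0 < R) (c : Coeffs) :
    Controlled p R (decayRel R 2) fun f => Phi0 c f :=
  controlled_Phi0 (boundRel_decayRel R 2) (gradBdd_decay_ofFun 2)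
    (fun k => suppBdd_decay_symR hp hR k) c

theorem controlled_decay_Wvel0 (hp : 1 < p) (hR : 0 < R) (c : Coeffs) (j : Fin 3) :
    Controlled p R (decayRel R 2) fun f => Wvel0 c f j :=
  controlled_Wvel0 (boundRel_decayRel R 2)
    (fun k => (suppBdd_decay_symR hp hR k).grad (boundRel_decayRel R 2)) c j

theorem controlled_decay_Psi0 (hp : 1 < p) (hR : 0 < R) (c : Coeffs) (j : Fin 3) :
    Controlled p R (decayRel R 1) fun f => Psi0 c f j :=
  controlled_Psi0 (boundRel_decayRel R 1) (suppBdd_decay_symN hp hR)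
    (fun j k => suppBdd_decay_symQ hp hR j k)
    (fun k => ((suppBdd_decay_symR hp hR k).decay_one hR).grad (boundRel_decayRel R 1)) c j

/-- As the gradient of the potential, the tensor is estimated by measuring `pd k`. For the force the
derivative acts on the kernel and improves its decay from `|x|⁻¹` to `|x|⁻²`. For the density and
strain data it falls on the datum, and the kernel already decays like `|x|⁻²`. -/
theorem controlled_decay_Gdef0 (hp : 1 < p) (hR : 0 < R) (c : Coeffs) (j k : Fin 3) :
    Controlled p R (decayRel R 2) fun f => Gdef0 c f j k := by
  have hN := boundRel_decayRel R 2
  obtain ⟨C, hC⟩ := controlled_Psi0 (p := p) (hN.pd k)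
    (SuppBdd.pd hN mild_symN (suppBdd_decay_symR hp hR k))
    (fun j l => SuppBdd.pd hN (mild_symQ j l) (suppBdd_decay_symT hp hR j l k))
    (fun l => SuppBdd.pd_grad hN (mild_symR l) (suppBdd_decay_symR hp hR l) k) c j
  refine ⟨C, fun f d₁ d₃ hf => ?_⟩
  simp only [hf.Gdef0_eq]
  exact hC f d₁ d₃ hf

/-- Continuity and decay of `R(0)f` and `Ψ(0)f` away from the support of `f`. -/
theorem exists_decay_zero_resolvent (hp : 1 < p) (hR : 0 < R) (c : Coeffs) :
    ∃ C : ℝ≥0, ∀ f ∈ XR (ENNReal.ofReal p) R,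
      ∃ (φ : E3 → ℂ) (w : Fin 3 → E3 → ℂ) (G : Fin 3 → Fin 3 → E3 → ℂ) (ψ : Fin 3 → E3 → ℂ),
        (ContinuousOn φ {x | R < ‖x‖} ∧ RepresentedOn (Phi0 c f) {x | R < ‖x‖} φ) ∧
        (∀ j, ContinuousOn (w j) {x | R < ‖x‖} ∧
          RepresentedOn (Wvel0 c f j) {x | R < ‖x‖} (w j)) ∧
        (∀ j k, ContinuousOn (G j k) {x | R < ‖x‖} ∧
          RepresentedOn (Gdef0 c f j k) {x | R < ‖x‖} (G j k)) ∧
        (∀ j, ContinuousOn (ψ j) {x | R < ‖x‖} ∧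
          RepresentedOn (Psi0 c f j) {x | R < ‖x‖} (ψ j)) ∧
        ∀ x : E3, 2 * R ≤ ‖x‖ →
          ENNReal.ofReal
            (‖x‖ ^ 2 * (‖φ x‖ + ∑ j, ‖w j x‖ + ∑ j, ∑ k, ‖G j k x‖) + ‖x‖ * ∑ j, ‖ψ j x‖) ≤
              C * xNorm (ENNReal.ofReal p) f := by
  obtain ⟨C₁, h1⟩ := controlled_decay_Phi0 hp hR c
  choose C₂ h2 using controlled_decay_Wvel0 hp hR c
  choose C₃ h3 using controlled_decay_Gdef0 hp hR c
  choose C₄ h4 using controlled_decay_Psi0 hp hR c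
  refine ⟨C₁ + ∑ j, C₂ j + ∑ j, ∑ k, C₃ j k + ∑ j, C₄ j, fun f hf => ?_⟩
  obtain ⟨d₁, d₃, hd⟩ := exists_datum hp hR hf
  obtain ⟨φ, hφ, bφ⟩ := h1 f d₁ d₃ hd
  choose w hw bw using fun j => h2 j f d₁ d₃ hd
  choose G hG bG using fun j k => h3 j k f d₁ d₃ hd
  choose ψ hψ bψ using fun j => h4 j f d₁ d₃ hd
  refine ⟨φ, w, G, ψ, hφ, hw, hG, hψ, fun x hx => ?_⟩
  simp only [pow_one] at bψ
  simp only [mul_add, Finset.mul_sum, ENNReal.coe_add, add_mul, ENNReal.ofNNReal_finsetSum,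
    Finset.sum_mul]
  rw [ENNReal.ofReal_add (by positivity) (by positivity),
    ENNReal.ofReal_add (by positivity) (by positivity),
    ENNReal.ofReal_add (by positivity) (by positivity),
    ENNReal.ofReal_sum_of_nonneg fun _ _ => by positivity,
    ENNReal.ofReal_sum_of_nonneg fun _ _ => by positivity,
    ENNReal.ofReal_sum_of_nonneg fun _ _ => by positivity]
  refine add_le_add (add_le_add (add_le_add (bφ x hx) (Finset.sum_le_sum fun j _ => bw j x hx))
    (Finset.sum_le_sum fun j _ => ?_)) (Finset.sum_le_sum fun j _ => bψ j x hx)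
  rw [ENNReal.ofReal_sum_of_nonneg fun _ _ => by positivity]
  exact Finset.sum_le_sum fun k _ => bG j k x hx

/-! ### Bounds in the whole space and on balls -/

/-- Gradient bounds in the whole space. -/
theorem exists_gradNorm_zero_resolvent_le (hp : 1 < p) (hR : 0 < R) (c : Coeffs) :
    ∃ C : ℝ≥0, ∀ f ∈ XR (ENNReal.ofReal p) R,
      gradNorm 0 (ENNReal.ofReal p) Set.univ (Phi0 c f) +
        ∑ j, gradNorm 1 (ENNReal.ofReal p) Set.univ (Wvel0 c f j) +
        ∑ j, ∑ k, gradNorm 0 (ENNReal.ofReal p) Set.univ (Gdef0 c f j k) ≤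
          C * xNorm (ENNReal.ofReal p) f := by
  have hN := boundRel_lpNorm (one_le_ofReal hp) isOpen_univ
  choose C₁ h1 using fun l => controlled_Phi0 (p := p) (R := R) (hN.pd l) (gradBdd_pd_ofFun l)
    (fun k => suppBdd_pd_symR hp k l) c
  choose C₂ h2 using fun l j => controlled_Wvel0 (p := p) (R := R) (hN.pd l)
    (fun k => (suppBdd_pd_symR hp k l).grad (hN.pd l)) c j
  choose C₃ h3 using fun m l j => controlled_Wvel0 (p := p) (R := R) ((hN.pd m).pd l)
    (fun k => gradBdd_pd_pd_symR hp k l m) c j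
  choose C₄ h4 using fun m l j => controlled_Psi0 (p := p) (R := R) ((hN.pd m).pd l)
    (suppBdd_pd_pd_symN hp l m) (fun j k => suppBdd_pd_pd_symQ hp j k l m)
    (fun k => gradBdd_pd_pd_symR hp k l m) c j
  refine ⟨∑ l, C₁ l + ∑ j, ∑ l, (C₂ l j + ∑ m, C₃ m l j) + ∑ j, ∑ l, ∑ m, C₄ m l j,
    fun f hf => ?_⟩
  obtain ⟨d₁, d₃, hd⟩ := exists_datum hp hR hf
  simp only [gradNorm, sobNorm_zero, sobNorm_one, ENNReal.coe_add, add_mul,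
    ENNReal.ofNNReal_finsetSum, Finset.sum_mul]
  refine add_le_add (add_le_add (Finset.sum_le_sum fun l _ => h1 l f d₁ d₃ hd)
    (Finset.sum_le_sum fun j _ => Finset.sum_le_sum fun l _ => add_le_add (h2 l j f d₁ d₃ hd)
      (Finset.sum_le_sum fun m _ => h3 m l j f d₁ d₃ hd)))
    (Finset.sum_le_sum fun j _ => Finset.sum_le_sum fun l _ => Finset.sum_le_sum fun m _ => ?_)
  rw [hd.Gdef0_eq]
  exact h4 m l j f d₁ d₃ hd

end

section

/-! ### The constraints satisfied by the solution -/

theorem rep_zero : Rep 0 fun _ => 0 := by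
  have h : Mild fun _ => (0 : ℂ) := BddSym.mild ⟨measurable_const, 0, fun _ => by simp⟩
  exact ⟨_, h, finv_zero.symm, fun _ _ => rfl⟩

theorem Rep.eq {S T : 𝓢'(E3, ℂ)} {F G : E3 → ℂ} (hS : Rep S F) (hT : Rep T G)
    (e : ∀ ξ, ξ ≠ 0 → F ξ = G ξ) : S = T := by
  rw [← hS.finv_eq, ← hT.finv_eq]
  exact finv_congr_of_ne e

/-- Contraction with `ξ` removes the solenoidal mode. The force leaves `d₂⁻¹ ξ·f̂₂`, and the strain,
by the divergence constraint, a multiple of `f̂₁`; both cancel against the density. -/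
theorem Constrained.phiForm_add_div {f : Data} (h : Constrained f) {c : Coeffs} {z : ℂ}
    (h₁ : (c.mode₁ z).Ok) (h₂ : (c.mode₂ z).Ok) :
    phiForm (c.mode₂ z) f + ∑ k, pd k (psiForm (c.mode₁ z) (c.mode₂ z) f k) = 0 := by
  refine (((h₂.rep_K h.int₁).sub ((Rep.sum fun k => h₂.rep_E (h.int₂ k) k).smul Complex.I)).add
    (Rep.sum fun k => ((h.rep_force h₁ h₂ k).sub
      ((h.rep_H h₁ h₂ k).smul Complex.I)).pd k)).eq rep_zero fun ξ hξ => ?_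
  have hn := inv_nsq_mul_sum hξ
  have hA : ∑ j, (ξ j : ℂ) * Matrix.mulVec (symL c z ξ) (hat2 f ξ) j =
      (den₂ c z ξ)⁻¹ * ∑ k, ξ k * hat2 f ξ k := by
    simp only [symL_mulVec, Fin.sum_univ_three]
    linear_combination ((den₂ c z ξ)⁻¹ - (den₁ c z ξ)⁻¹) *
      (ξ 0 * hat2 f ξ 0 + ξ 1 * hat2 f ξ 1 + ξ 2 * hat2 f ξ 2) * hn
  have hB : ∑ j, (ξ j : ℂ) * Matrix.mulVec (symH c z ξ * hat3 f ξ) ((nsq ξ)⁻¹ • vec ξ) j =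
      -((z + (c.ν + c.νt) * nsq ξ) * (den₂ c z ξ)⁻¹ * fhat f.1 ξ) := by
    simp only [Matrix.mulVec, dotProduct, h.symH_hat3, Pi.smul_apply, vec, smul_eq_mul,
      Fin.sum_univ_three]
    generalize (z + c.ν * nsq ξ) * (den₁ c z ξ)⁻¹ = H1
    generalize (z + (c.ν + c.νt) * nsq ξ) * (den₂ c z ξ)⁻¹ = H2
    linear_combination H1 * (nsq ξ)⁻¹ * (ξ 0 * h.sum_coord_hat3 ξ 0 +
      ξ 1 * h.sum_coord_hat3 ξ 1 + ξ 2 * h.sum_coord_hat3 ξ 2) - H1 * fhat f.1 ξ * hn +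
      (H1 - H2) * fhat f.1 ξ * ((nsq ξ)⁻¹ * ((ξ 0 : ℂ) * ξ 0 + ξ 1 * ξ 1 + ξ 2 * ξ 2) + 1) * hn
  have e2 : (c.mode₂ z).d ξ = den₂ c z ξ := rfl
  have e3 : (c.mode₂ z).z = z := rfl
  have e4 : (c.mode₂ z).a = c.ν + c.νt := rfl
  rw [e2, e3, e4]
  simp only [Fin.sum_univ_three] at hA hB ⊢
  simp only [hat2] at hA ⊢
  linear_combination Complex.I * hA + hB - (ξ 0 * Matrix.mulVec (symH c z ξ * hat3 f ξ)
    ((nsq ξ)⁻¹ • vec ξ) 0 + ξ 1 * Matrix.mulVec (symH c z ξ * hat3 f ξ) ((nsq ξ)⁻¹ • vec ξ) 1 +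
    ξ 2 * Matrix.mulVec (symH c z ξ * hat3 f ξ) ((nsq ξ)⁻¹ • vec ξ) 2) * Complex.I_sq

variable {p R : ℝ}

/-- Commuting derivatives, the left side is the gradient of `φ + div ψ`, which is zero. -/
theorem Constrained.divConstraint {f : Data} (h : Constrained f) (c : Coeffs) (D : Set E3) :
    DivConstraint D (resolv0 c f).1 (resolv0 c f).2.2 := by
  intro j φ _ _
  have e := h.phiForm_add_div c.ok₁_zero c.ok₂_zero
  rw [← h.Phi0_eq] at e
  simp only [← h.Psi0_eq] at e
  have : pd j (resolv0 c f).1 + ∑ k, pd k ((resolv0 c f).2.2 k j) =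
      pd j (Phi0 c f + ∑ k, pd k (Psi0 c f k)) := by
    rw [pd_add, pd_sum]
    congr 1
    refine Finset.sum_congr rfl fun k _ => ?_
    change pd k (Gdef0 c f k j) = _
    rw [h.Gdef0_eq, pd_comm]
  rw [this, e, pd_zero]

theorem Constrained.isGradOn {f : Data} (h : Constrained f) (c : Coeffs) (D : Set E3) :
    IsGradOn D (resolv0 c f).2.2 (Psi0 c f) := by
  intro j k φ _ _
  change Gdef0 c f j k φ = _
  rw [h.Gdef0_eq]

theorem xNorm_lt_top {q : ℝ≥0∞} {f : Data} (hf : f ∈ XR q R) : xNorm q f < ⊤ := by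
  obtain ⟨h1, h2, h3, -⟩ := hf
  refine ENNReal.add_lt_top.2 ⟨ENNReal.add_lt_top.2 ⟨h1.2, ?_⟩, ?_⟩
  · exact ENNReal.sum_lt_top.2 fun j _ => (h2 j).2
  · exact ENNReal.sum_lt_top.2 fun j _ => ENNReal.sum_lt_top.2 fun k _ => (h3 j k).2

/-- Boundedness of `R(0)` and `Ψ(0)` on balls. -/
theorem exists_yNorm_zero_resolvent_le (hp : 1 < p) (hR : 0 < R) (c : Coeffs) (R' : ℝ) :
    ∃ C : ℝ≥0, ∀ f ∈ XR (ENNReal.ofReal p) R,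
      MemY (ENNReal.ofReal p) (B R') (resolv0 c f) ∧
      IsGradOn (B R') (resolv0 c f).2.2 (Psi0 c f) ∧
      yNorm (ENNReal.ofReal p) (B R') (resolv0 c f) ≤ C * xNorm (ENNReal.ofReal p) f ∧
      ∑ j, sobNorm 2 (ENNReal.ofReal p) (B R') (Psi0 c f j) ≤
        C * xNorm (ENNReal.ofReal p) f := by
  have hN := boundRel_sobSum (one_le_ofReal hp) (isOpen_B R')
  obtain ⟨C₁, h1⟩ := controlled_Phi0 (p := p) (R := R)
    (boundRel_sobNorm_one (one_le_ofReal hp) (isOpen_B R')) (gradBdd_sobNorm_ofFun R')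
    (fun k => exists_sobNorm_symR_le hp hR R' k) c
  choose C₂ h2 using fun j => controlled_Wvel0 (p := p) (R := R) hN
    (fun k => exists_sobSum_symR_le hp hR R' k) c j
  choose C₃ h3 using fun j => controlled_Psi0 (p := p) (R := R) hN
    (exists_sobSum_symN_le hp hR R') (fun j k => exists_sobSum_symQ_le hp hR R' j k)
    (fun k => exists_sobSum_symR_le hp hR R' k) c j
  simp only [leRel] at h1 h2 h3
  refine ⟨C₁ + ∑ j, C₂ j + ∑ j, ∑ _k : Fin 3, C₃ j + ∑ j, C₃ j, fun f hf => ?_⟩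
  obtain ⟨d₁, d₃, hd⟩ := exists_datum hp hR hf
  have hx := xNorm_lt_top hf
  have hP : ∀ j, sobNorm 2 (ENNReal.ofReal p) (B R') (Psi0 c f j) ≤
      C₃ j * xNorm (ENNReal.ofReal p) f := fun j =>
    (sobNorm_two_le _ _ _).trans (h3 j f d₁ d₃ hd)
  have hy : yNorm (ENNReal.ofReal p) (B R') (resolv0 c f) ≤
      (C₁ + ∑ j, C₂ j + ∑ j, ∑ _k : Fin 3, C₃ j + ∑ j, C₃ j : ℝ≥0) *
        xNorm (ENNReal.ofReal p) f := by
    simp only [ENNReal.coe_add, add_mul, ENNReal.ofNNReal_finsetSum, Finset.sum_mul]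
    refine le_trans (add_le_add (add_le_add (h1 f d₁ d₃ hd) (Finset.sum_le_sum fun j _ =>
      (sobNorm_two_le _ _ _).trans (h2 j f d₁ d₃ hd))) (Finset.sum_le_sum fun j _ =>
      Finset.sum_le_sum fun k _ => ?_)) le_self_add
    change sobNorm 1 _ _ (Gdef0 c f j k) ≤ _
    rw [hd.Gdef0_eq]
    exact (sobNorm_one_pd_le _ _ _ k).trans (h3 j f d₁ d₃ hd)
  refine ⟨⟨hy.trans_lt (ENNReal.mul_lt_top ENNReal.coe_lt_top hx), hd.divConstraint c _,
    Psi0 c f, fun j => (hP j).trans_lt (ENNReal.mul_lt_top ENNReal.coe_lt_top hx),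
    hd.isGradOn c _⟩, hd.isGradOn c _, hy, ?_⟩
  simp only [ENNReal.coe_add, add_mul, ENNReal.ofNNReal_finsetSum, Finset.sum_mul]
  exact (Finset.sum_le_sum fun j _ => hP j).trans le_add_self

/-! ### Linearity -/

theorem op_comb {m g h : E3 → ℂ} (hm : Mild m) (hg : Integrable g) (hh : Integrable h) (a b : ℂ) :
    op m (a • g + b • h) = a • op m g + b • op m h := by
  rw [op_add hm (hg.smul a) (hh.smul b), op_smul hm hg, op_smul hm hh]

theorem ofFun_comb {g h : E3 → ℂ} (hg : Integrable g) (hh : Integrable h) (a b : ℂ) :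
    ofFun (a • g + b • h) = a • ofFun g + b • ofFun h := by
  have h1 : Mild fun _ => (1 : ℂ) := BddSym.mild ⟨measurable_const, 1, fun _ => by simp⟩
  rw [← op_one hg, ← op_one hh, ← op_comb h1 hg hh, op_one ((hg.smul a).add (hh.smul b))]

theorem Constrained.comb {f g : Data} (hf : Constrained f) (hg : Constrained g) (a b : ℂ) :
    Constrained (a • f + b • g) where
  int₁ := (hf.int₁.smul a).add (hg.int₁.smul b)
  int₂ j := ((hf.int₂ j).smul a).add ((hg.int₂ j).smul b)
  int₃ j k := ((hf.int₃ j k).smul a).add ((hg.int₃ j k).smul b)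
  div ξ j := by
    have e1 : fhat (a • f + b • g).1 ξ = a * fhat f.1 ξ + b * fhat g.1 ξ := by
      rw [← fhat_smul, ← fhat_smul, ← fhat_add (hf.int₁.smul a) (hg.int₁.smul b)]; rfl
    have e3 : ∀ k, fhat ((a • f + b • g).2.2 k j) ξ =
        a * fhat (f.2.2 k j) ξ + b * fhat (g.2.2 k j) ξ := fun k => by
      rw [← fhat_smul, ← fhat_smul, ← fhat_add ((hf.int₃ k j).smul a) ((hg.int₃ k j).smul b)]; rfl
    have h1 := hf.div ξ j
    have h2 := hg.div ξ j
    simp only [e1, e3, Fin.sum_univ_three] at h1 h2 ⊢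
    linear_combination a * h1 + b * h2
  curl ξ j k l := by
    have e3 : ∀ j k, fhat ((a • f + b • g).2.2 j k) ξ =
        a * fhat (f.2.2 j k) ξ + b * fhat (g.2.2 j k) ξ := fun j k => by
      rw [← fhat_smul, ← fhat_smul, ← fhat_add ((hf.int₃ j k).smul a) ((hg.int₃ j k).smul b)]; rfl
    rw [e3, e3]
    linear_combination a * hf.curl ξ j k l + b * hg.curl ξ j k l

section

variable {f g : Data} (c : Coeffs) (a b : ℂ)

theorem Constrained.Psi0_comb (hf : Constrained f) (hg : Constrained g) (j : Fin 3) :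
    Psi0 c (a • f + b • g) j = a • Psi0 c f j + b • Psi0 c g j := by
  have h1 := c.mode₁_zero_mu
  have h2 := c.mode₂_zero_mu
  have eN : op symN ((a • f + b • g).2.1 j) = _ :=
    op_comb mild_symN (hf.int₂ j) (hg.int₂ j) a b
  have eQ : ∀ k, op (symQ j k) ((a • f + b • g).2.1 k) = _ := fun k =>
    op_comb (mild_symQ j k) (hf.int₂ k) (hg.int₂ k) a b
  have e3 : ∀ k, op (symR k) ((a • f + b • g).2.2 j k) = _ := fun k =>
    op_comb (mild_symR k) (hf.int₃ j k) (hg.int₃ j k) a b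
  have e1 : op (symR j) (a • f + b • g).1 = _ := op_comb (mild_symR j) hf.int₁ hg.int₁ a b
  rw [(hf.comb hg a b).Psi0_eq, hf.Psi0_eq, hg.Psi0_eq]
  simp only [psiForm, forceForm, Mode.opD_of_zero h1, Mode.opF_of_zero h1, Mode.opF_of_zero h2,
    Mode.opH_of_zero h1 rfl, Mode.opH_of_zero h2 rfl, Mode.opE_of_zero h1,
    Mode.opE_of_zero h2, eN, eQ, e3, e1, Fin.sum_univ_three]
  module

theorem Constrained.Wvel0_comb (hf : Constrained f) (hg : Constrained g) (j : Fin 3) :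
    Wvel0 c (a • f + b • g) j = a • Wvel0 c f j + b • Wvel0 c g j := by
  have h1 := c.mode₁_zero_mu
  have h2 := c.mode₂_zero_mu
  have hz : (c.mode₁ 0).z = 0 := rfl
  have e3 : ∀ k, op (symR k) ((a • f + b • g).2.2 j k) = _ := fun k =>
    op_comb (mild_symR k) (hf.int₃ j k) (hg.int₃ j k) a b
  have e1 : op (symR j) (a • f + b • g).1 = _ := op_comb (mild_symR j) hf.int₁ hg.int₁ a b
  rw [(hf.comb hg a b).Wvel0_eq, hf.Wvel0_eq, hg.Wvel0_eq]
  simp only [velForm, hz, Mode.opE_of_zero h1, Mode.opE_of_zero h2, distrib_zero_smul, add_zero,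
    e3, e1, Fin.sum_univ_three]
  module

theorem Constrained.Phi0_comb (hf : Constrained f) (hg : Constrained g) :
    Phi0 c (a • f + b • g) = a • Phi0 c f + b • Phi0 c g := by
  have h2 := c.mode₂_zero_mu
  have e2 : ∀ k, op (symR k) ((a • f + b • g).2.1 k) = _ := fun k =>
    op_comb (mild_symR k) (hf.int₂ k) (hg.int₂ k) a b
  have e1 : ofFun (a • f + b • g).1 = _ := ofFun_comb hf.int₁ hg.int₁ a b
  rw [(hf.comb hg a b).Phi0_eq, hf.Phi0_eq, hg.Phi0_eq]
  simp only [phiForm, Mode.opE_of_zero h2, Mode.opK_of_zero h2 rfl, e2, e1, Fin.sum_univ_three]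
  module

/-- The defining formulas are additive only where transforms are additive, that is, for integrable
data. Linearity is therefore read off from the scalar multiplier form. -/
theorem Constrained.resolv0_comb (hf : Constrained f) (hg : Constrained g) :
    resolv0 c (a • f + b • g) = a • resolv0 c f + b • resolv0 c g ∧
      Psi0 c (a • f + b • g) = a • Psi0 c f + b • Psi0 c g := by
  have hP := hf.Psi0_comb c a b hg
  refine ⟨Prod.ext (hf.Phi0_comb c a b hg) (Prod.ext (funext fun j => hf.Wvel0_comb c a b hg j)
    (funext fun j => funext fun k => ?_)), funext hP⟩
  change Gdef0 c _ j k = a • Gdef0 c f j k + b • Gdef0 c g j k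
  rw [(hf.comb hg a b).Gdef0_eq, hf.Gdef0_eq, hg.Gdef0_eq, hP, pd_add, pd_smul, pd_smul]

end

end

/-! ### The limit `z → 0` in the closed right half plane -/

/-- The filter of the points `z ≠ 0` with `|arg z| ≤ π / 2` that tend to `0`. -/
def sector : Filter ℂ := 𝓝[{z : ℂ | z ≠ 0 ∧ |z.arg| ≤ Real.pi / 2}] 0

theorem sector_le : sector ≤ 𝓝 0 := nhdsWithin_le_nhds

theorem eventually_sector : ∀ᶠ z in sector, z ≠ 0 ∧ 0 ≤ z.re := by
  filter_upwards [self_mem_nhdsWithin] with z hz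
  exact ⟨hz.1, Complex.abs_arg_le_pi_div_two_iff.1 hz.2⟩

theorem sq_cpow_inv_two (w : ℂ) : (w ^ (2⁻¹ : ℂ)) ^ 2 = w := by
  simp

/-- Let `s` be the principal root of `w = az + b`. The sign of `Re (z/s)` is that of `Re z Re s + Im
z Im s`, and `2 Re s Im s = a Im z` turns the second summand into `a (Im z)² / (2 Re s) ≥ 0`. So
positivity persists on the imaginary axis away from `0`. -/
theorem re_div_sqrt_pos {a b : ℝ} (ha : 0 < a) (hb : 0 < b) {z : ℂ} (hz : z ≠ 0)
    (hre : 0 ≤ z.re) : 0 < (z / (a * z + b) ^ (2⁻¹ : ℂ)).re := by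
  set w : ℂ := a * z + b with hw
  set s : ℂ := w ^ (2⁻¹ : ℂ) with hs
  have hwre : 0 < w.re := by
    simp only [hw, Complex.add_re, Complex.mul_re, Complex.ofReal_re, Complex.ofReal_im, zero_mul,
      sub_zero]
    positivity
  have hwim : w.im = a * z.im := by simp [hw]
  have hsre : 0 < s.re := by
    rw [hs, Complex.cpow_inv_two_re]
    have := norm_nonneg w
    positivity
  have h2 : s ^ 2 = w := sq_cpow_inv_two w
  have him : 2 * (s.re * s.im) = a * z.im := by
    rw [← hwim, ← h2, sq, Complex.mul_im]; ring
  have hs0 : 0 < Complex.normSq s := Complex.normSq_pos.2 fun h => by simp [h] at hsre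
  rw [Complex.div_re, ← add_div]
  refine div_pos ?_ hs0
  have e : z.im * s.im = a * z.im ^ 2 / (2 * s.re) := by
    field_simp
    linear_combination z.im * him
  rw [e]
  rcases hre.lt_or_eq with h | h
  · positivity
  · have : z.im ≠ 0 := fun h' => hz (Complex.ext h.symm h')
    positivity

/-- A family of modes that converges to the mode at `z = 0`. -/
structure ModeFamily (M : ℂ → Mode) : Prop where
  a_eq : ∀ z, (M z).a = (M 0).a
  z_eq : ∀ z, (M z).z = z
  μ_zero : (M 0).μ = 0
  κ_ne : (M 0).κ ≠ 0
  tendsto_κ : Tendsto (fun z => (M z).κ) sector (𝓝 (M 0).κ)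
  tendsto_μ : Tendsto (fun z => (M z).μ) sector (𝓝 0)
  ok : ∀ᶠ z in sector, (M z).Ok
  par : ∀ᶠ z in sector, 0 < (M z).μ.re ∧ ‖(M z).μ‖ ≤ 1

theorem modeFamily_of {a b : ℝ} (ha : 0 < a) (hb : 0 < b) :
    ModeFamily fun z => ⟨a, a * z + b, z / (a * z + b) ^ (2⁻¹ : ℂ), z⟩ := by
  have hκ : Tendsto (fun z : ℂ => (a : ℂ) * z + b) sector (𝓝 (a * 0 + b)) :=
    ((continuous_const.mul continuous_id).add continuous_const).continuousAt.tendsto.mono_left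
      sector_le
  have hb0 : (a : ℂ) * 0 + b ≠ 0 := by simpa using hb.ne'
  have hs : Tendsto (fun z : ℂ => ((a : ℂ) * z + b) ^ (2⁻¹ : ℂ)) sector
      (𝓝 ((a * 0 + b) ^ (2⁻¹ : ℂ))) := by
    refine (continuousAt_cpow_const ?_).tendsto.comp hκ
    rw [mul_zero, zero_add]
    exact Complex.ofReal_mem_slitPlane.2 hb
  have hs0 : ((a : ℂ) * 0 + b) ^ (2⁻¹ : ℂ) ≠ 0 := fun h => hb0 <| by
    rw [← sq_cpow_inv_two ((a : ℂ) * 0 + b), h]; simp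
  have hμ : Tendsto (fun z : ℂ => z / ((a : ℂ) * z + b) ^ (2⁻¹ : ℂ)) sector (𝓝 0) := by
    have := (tendsto_id.mono_left sector_le : Tendsto (fun z : ℂ => z) sector (𝓝 0)).div hs hs0
    rwa [zero_div] at this
  have hpar : ∀ᶠ z : ℂ in sector, 0 < (z / ((a : ℂ) * z + b) ^ (2⁻¹ : ℂ)).re ∧
      ‖z / ((a : ℂ) * z + b) ^ (2⁻¹ : ℂ)‖ ≤ 1 := by
    have h1 : ∀ᶠ z : ℂ in sector, ‖z / ((a : ℂ) * z + b) ^ (2⁻¹ : ℂ)‖ < 1 :=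
      hμ.norm.eventually (gt_mem_nhds (by simp))
    filter_upwards [eventually_sector, h1] with z hz h1
    exact ⟨re_div_sqrt_pos ha hb hz.1 hz.2, h1.le⟩
  refine ⟨fun _ => rfl, fun _ => rfl, by simp, hb0, hκ, hμ, ?_, hpar⟩
  filter_upwards [hpar, hκ.eventually_ne hb0] with z hz hz0
  refine ⟨hz0, ?_, Or.inr hz⟩
  simp only [div_pow, sq_cpow_inv_two]
  field_simp

/-- Here `ν + ν̃ = 2ν + ν'`, and `ν' ≥ -2ν/3` leaves at least `4ν/3`. -/
theorem Coeffs.nu_add_pos (c : Coeffs) : 0 < c.ν + c.νt := by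
  have h1 := c.ν_pos
  have h2 := c.ν'_cond
  unfold Coeffs.νt
  linarith

theorem Coeffs.modeFamily₁ (c : Coeffs) : ModeFamily c.mode₁ := by
  have := c.β_pos
  have h := modeFamily_of c.ν_pos (by positivity : 0 < c.β ^ 2)
  have e : c.mode₁ = fun z => ⟨c.ν, c.ν * z + (c.β ^ 2 : ℝ),
      z / (c.ν * z + (c.β ^ 2 : ℝ)) ^ (2⁻¹ : ℂ), z⟩ := by
    funext z
    simp only [Coeffs.mode₁, Coeffs.κ₁]
    push_cast
    rfl
  rw [e]
  exact h

theorem Coeffs.modeFamily₂ (c : Coeffs) : ModeFamily c.mode₂ := by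
  have := c.β_pos
  have h := modeFamily_of c.nu_add_pos (by positivity : 0 < c.β ^ 2 + c.γ ^ 2)
  have e : c.mode₂ = fun z => ⟨(c.ν + c.νt : ℝ), (c.ν + c.νt : ℝ) * z + (c.β ^ 2 + c.γ ^ 2 : ℝ),
      z / ((c.ν + c.νt : ℝ) * z + (c.β ^ 2 + c.γ ^ 2 : ℝ)) ^ (2⁻¹ : ℂ), z⟩ := by
    funext z
    simp only [Coeffs.mode₂, Coeffs.κ₂]
    push_cast
    rw [add_assoc]
  rw [e]
  exact h

/-! ### Convergence of the scalar operators -/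

section

variable {n : 𝓢'(E3, ℂ) → ℝ≥0∞}

theorem BoundRel.add_le (hN : BoundRel (leRel n)) (S T : 𝓢'(E3, ℂ)) : n (S + T) ≤ n S + n T :=
  hN.add le_rfl le_rfl

theorem BoundRel.smul_le (hN : BoundRel (leRel n)) (a : ℂ) (T : 𝓢'(E3, ℂ)) :
    n (a • T) ≤ ‖a‖ₑ * n T :=
  hN.smul a le_rfl

theorem tendsto_enorm_mul_zero {α : ℂ → ℂ} (h : Tendsto α sector (𝓝 0)) {C : ℝ≥0∞} (hC : C ≠ ⊤) :
    Tendsto (fun z => ‖α z‖ₑ * C) sector (𝓝 0) := by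
  have h1 : Tendsto (fun z => ‖α z‖ₑ) sector (𝓝 0) := by
    have := (continuous_enorm.tendsto (0 : ℂ)).comp h
    rw [enorm_zero] at this
    exact this
  simpa using ENNReal.Tendsto.mul_const h1 (Or.inr hC)

/-- `n (T z)` tends to `0`. -/
def Vanishes (n : 𝓢'(E3, ℂ) → ℝ≥0∞) (T : ℂ → 𝓢'(E3, ℂ)) : Prop :=
  Tendsto (fun z => n (T z)) sector (𝓝 0)

theorem Vanishes.of_le {S : ℂ → 𝓢'(E3, ℂ)} {u : ℂ → ℝ≥0∞} (hu : Tendsto u sector (𝓝 0))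
    (h : ∀ᶠ z in sector, n (S z) ≤ u z) : Vanishes n S :=
  tendsto_of_tendsto_of_tendsto_of_le_of_le' tendsto_const_nhds hu
    (Eventually.of_forall fun _ => zero_le) h

theorem Vanishes.add (hN : BoundRel (leRel n)) {S T : ℂ → 𝓢'(E3, ℂ)} (hS : Vanishes n S)
    (hT : Vanishes n T) : Vanishes n fun z => S z + T z :=
  Vanishes.of_le (by simpa using Tendsto.add hS hT) (Eventually.of_forall fun _ => hN.add_le _ _)

theorem Vanishes.smul (hN : BoundRel (leRel n)) {T : ℂ → 𝓢'(E3, ℂ)} (hT : Vanishes n T) (a : ℂ) :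
    Vanishes n fun z => a • T z := by
  refine Vanishes.of_le (u := fun z => ‖a‖ₑ * n (T z)) ?_
    (Eventually.of_forall fun _ => hN.smul_le _ _)
  simpa using ENNReal.Tendsto.const_mul hT (Or.inr (enorm_ne_top (x := a)))

theorem Vanishes.sub (hN : BoundRel (leRel n)) {S T : ℂ → 𝓢'(E3, ℂ)} (hS : Vanishes n S)
    (hT : Vanishes n T) : Vanishes n fun z => S z - T z := by
  have := hS.add hN (hT.smul hN (-1))
  simpa only [distrib_neg_one_smul, ← sub_eq_add_neg] using this

theorem Vanishes.sum (hN : BoundRel (leRel n)) {T : Fin 3 → ℂ → 𝓢'(E3, ℂ)}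
    (hT : ∀ k, Vanishes n (T k)) : Vanishes n fun z => ∑ k, T k z := by
  simp only [Fin.sum_univ_three]
  exact ((hT 0).add hN (hT 1)).add hN (hT 2)

theorem Vanishes.of_smul (hN : BoundRel (leRel n)) {α : ℂ → ℂ} (hα : Tendsto α sector (𝓝 0))
    {T : ℂ → 𝓢'(E3, ℂ)} {C : ℝ≥0∞} (hC : C ≠ ⊤) (hT : ∀ᶠ z in sector, n (T z) ≤ C) :
    Vanishes n fun z => α z • T z :=
  Vanishes.of_le (tendsto_enorm_mul_zero hα hC) (hT.mono fun _ hz =>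
    (hN.smul_le _ _).trans (mul_le_mul' le_rfl hz))

theorem Vanishes.eventually_le (hN : BoundRel (leRel n)) {T : ℂ → 𝓢'(E3, ℂ)} {S : 𝓢'(E3, ℂ)}
    (h : Vanishes n fun z => T z - S) : ∀ᶠ z in sector, n (T z) ≤ 1 + n S := by
  filter_upwards [h.eventually (gt_mem_nhds zero_lt_one)] with z hz
  calc n (T z) = n ((T z - S) + S) := by rw [sub_add_cancel]
    _ ≤ _ := (hN.add_le _ _).trans (add_le_add hz.le le_rfl)

variable {M : ℂ → Mode} {g : E3 → ℂ}

theorem ModeFamily.tendsto_inv (hM : ModeFamily M) :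
    Tendsto (fun z => (M z).κ⁻¹) sector (𝓝 (M 0).κ⁻¹) := hM.tendsto_κ.inv₀ hM.κ_ne

theorem ModeFamily.tendsto_inv_sub (hM : ModeFamily M) (a : ℂ) :
    Tendsto (fun z => a * ((M z).κ⁻¹ - (M 0).κ⁻¹)) sector (𝓝 0) := by
  simpa using (hM.tendsto_inv.sub_const (M 0).κ⁻¹).const_mul a

theorem ModeFamily.tendsto_coef (hM : ModeFamily M) :
    Tendsto (fun z => z - (M z).a * (M z).μ ^ 2) sector (𝓝 0) := by
  have h1 : Tendsto (fun z : ℂ => z) sector (𝓝 0) := tendsto_id.mono_left sector_le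
  have h2 := h1.sub ((hM.tendsto_μ.pow 2).const_mul (M 0).a)
  simp only [hM.a_eq]
  simpa using h2

/-- The common form of all scalar limits: a fixed distribution of finite size and a uniformly
bounded family, each with a coefficient tending to zero. The first coefficient comes from `κ(z)⁻¹ →
κ(0)⁻¹`, the second from `z` and `μ(z)` tending to zero. -/
theorem Vanishes.of_two (hN : BoundRel (leRel n)) {α β : ℂ → ℂ} (hα : Tendsto α sector (𝓝 0))
    (hβ : Tendsto β sector (𝓝 0)) {S : 𝓢'(E3, ℂ)} (hS : n S ≠ ⊤) {U : ℂ → 𝓢'(E3, ℂ)} {C : ℝ≥0∞}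
    (hC : C ≠ ⊤) (hU : ∀ᶠ z in sector, n (U z) ≤ C) {T : ℂ → 𝓢'(E3, ℂ)}
    (e : ∀ z, T z = α z • S + β z • U z) : Vanishes n T := by
  have : T = fun z => α z • S + β z • U z := funext e
  rw [this]
  exact (Vanishes.of_smul hN hα hS (Eventually.of_forall fun _ => le_rfl)).add hN
    (Vanishes.of_smul hN hβ hC hU)

theorem ModeFamily.vanishes_D (hM : ModeFamily M) (hN : BoundRel (leRel n))
    (hS : n (op symN g) ≠ ⊤) {C : ℝ≥0∞} (hC : C ≠ ⊤)
    (hU : ∀ μ : Par, n (op (fun ξ => (μ : ℂ) * symU μ ξ) g) ≤ C) :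
    Vanishes n fun z => (M z).opD g - (M 0).opD g := by
  refine Vanishes.of_two hN (hM.tendsto_inv_sub 1) (β := fun z => -((M z).κ⁻¹ * (M z).μ)) ?_
    hS (U := fun z => op (fun ξ => (M z).μ * symU (M z).μ ξ) g) hC
    (hM.par.mono fun z hz => hU ⟨_, hz⟩) fun z => ?_
  · simpa using (hM.tendsto_inv.mul hM.tendsto_μ).neg
  · rw [Mode.opD_of_zero hM.μ_zero, Mode.opD]
    module

theorem ModeFamily.vanishes_E (hM : ModeFamily M) (hN : BoundRel (leRel n)) (k : Fin 3)
    (hS : n (op (symR k) g) ≠ ⊤) {C : ℝ≥0∞} (hC : C ≠ ⊤)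
    (hU : ∀ μ : Par, n (op (fun ξ => ξ k * symU μ ξ) g) ≤ C) :
    Vanishes n fun z => (M z).opE k g - (M 0).opE k g := by
  refine Vanishes.of_two hN (hM.tendsto_inv_sub 1) (β := fun z => -((M z).κ⁻¹ * (M z).μ ^ 2)) ?_
    hS (U := fun z => op (fun ξ => ξ k * symU (M z).μ ξ) g) hC
    (hM.par.mono fun z hz => hU ⟨_, hz⟩) fun z => ?_
  · simpa using (hM.tendsto_inv.mul (hM.tendsto_μ.pow 2)).neg
  · rw [Mode.opE_of_zero hM.μ_zero, Mode.opE]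
    module

theorem ModeFamily.vanishes_F (hM : ModeFamily M) (hN : BoundRel (leRel n)) (j k : Fin 3)
    (hS : n (op (symQ j k) g) ≠ ⊤) {C : ℝ≥0∞} (hC : C ≠ ⊤)
    (hU : ∀ μ : Par, n (op (fun ξ => (μ : ℂ)⁻¹ * symW μ j k ξ) g) ≤ C) :
    Vanishes n fun z => (M z).opF j k g - (M 0).opF j k g := by
  refine Vanishes.of_two hN (hM.tendsto_inv_sub 1) (β := fun z => (M z).κ⁻¹ * (M z).μ) ?_
    hS (U := fun z => op (fun ξ => (M z).μ⁻¹ * symW (M z).μ j k ξ) g) hC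
    (hM.par.mono fun z hz => hU ⟨_, hz⟩) fun z => ?_
  · simpa using hM.tendsto_inv.mul hM.tendsto_μ
  · rw [Mode.opF_of_zero hM.μ_zero, Mode.opF]
    module

theorem ModeFamily.vanishes_H (hM : ModeFamily M) (hN : BoundRel (leRel n)) (k : Fin 3)
    (hS : n (op (symR k) g) ≠ ⊤) {C : ℝ≥0∞} (hC : C ≠ ⊤)
    (hU : ∀ μ : Par, n (op (fun ξ => ξ k * symU μ ξ) g) ≤ C) :
    Vanishes n fun z => (M z).opH k g - (M 0).opH k g := by
  refine Vanishes.of_two hN (hM.tendsto_inv_sub (M 0).a)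
    (β := fun z => (z - (M z).a * (M z).μ ^ 2) * (M z).κ⁻¹) ?_
    hS (U := fun z => op (fun ξ => ξ k * symU (M z).μ ξ) g) hC
    (hM.par.mono fun z hz => hU ⟨_, hz⟩) fun z => ?_
  · simpa using hM.tendsto_coef.mul hM.tendsto_inv
  · rw [Mode.opH_of_zero hM.μ_zero (hM.z_eq 0), Mode.opE_of_zero hM.μ_zero, Mode.opH, hM.z_eq,
      hM.a_eq z]
    module

/-- The coefficient `z - aμ²` tends to zero, so it suffices that `opD g` stays bounded near `z = 0`;
its convergence is not needed at this point. -/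
theorem ModeFamily.vanishes_K (hM : ModeFamily M) (hN : BoundRel (leRel n))
    (hS : n (ofFun g) ≠ ⊤) {C : ℝ≥0∞} (hC : C ≠ ⊤)
    (hU : ∀ᶠ z in sector, n ((M z).opD g) ≤ C) :
    Vanishes n fun z => (M z).opK g - (M 0).opK g := by
  refine Vanishes.of_two hN (hM.tendsto_inv_sub (M 0).a)
    (β := fun z => z - (M z).a * (M z).μ ^ 2) hM.tendsto_coef hS hC hU fun z => ?_
  rw [Mode.opK_of_zero hM.μ_zero (hM.z_eq 0), Mode.opK, hM.z_eq, hM.a_eq z]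
  module

end

/-! ### Convergence of the resolvent operators -/

theorem Vanishes.congr {n : 𝓢'(E3, ℂ) → ℝ≥0∞} {S T : ℂ → 𝓢'(E3, ℂ)} (h : Vanishes n S)
    (e : ∀ z, T z = S z) : Vanishes n T := by
  rwa [show T = S from funext e]

section

variable {p R : ℝ} {f : Data} {d₁ : Fin 3 → E3 → ℂ} {d₃ : Fin 3 → Fin 3 → Fin 3 → E3 → ℂ}

theorem HasGrad.norm_ne_top {g : E3 → ℂ} {d : Fin 3 → E3 → ℂ} (h : HasGrad p R g d) :
    eLpNorm g (ENNReal.ofReal p) volume + ∑ k, eLpNorm (d k) (ENNReal.ofReal p) volume ≠ ⊤ :=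
  (ENNReal.add_lt_top.2 ⟨h.mem.2, ENNReal.sum_lt_top.2 fun k _ => (h.memd k).2⟩).ne

theorem mul_norm_ne_top {C : ℝ≥0} {a : ℝ≥0∞} (h : a ≠ ⊤) : (C : ℝ≥0∞) * a ≠ ⊤ :=
  ENNReal.mul_ne_top ENNReal.coe_ne_top h

variable {M : ℂ → Mode}

theorem ModeFamily.vanishes_sobSum_D (hM : ModeFamily M) (hp : 1 < p) (hR : 0 < R) (R' : ℝ)
    {g : E3 → ℂ} (hg : SuppIn R g) (hgp : MemLp g (ENNReal.ofReal p)) :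
    Vanishes (sobSum (ENNReal.ofReal p) (B R')) fun z => (M z).opD g - (M 0).opD g := by
  obtain ⟨C, hC⟩ := exists_sobSum_symN_le hp hR R'
  obtain ⟨D, hD⟩ := exists_sobSum_symU_le hp hR R'
  exact hM.vanishes_D (boundRel_sobSum (one_le_ofReal hp) (isOpen_B R'))
    (ne_top_of_le_ne_top (mul_norm_ne_top hgp.2.ne) (hC g hg hgp))
    (mul_norm_ne_top hgp.2.ne) fun μ => hD μ g hg hgp

theorem ModeFamily.vanishes_sobSum_F (hM : ModeFamily M) (hp : 1 < p) (hR : 0 < R) (R' : ℝ)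
    {g : E3 → ℂ} (hg : SuppIn R g) (hgp : MemLp g (ENNReal.ofReal p)) (j k : Fin 3) :
    Vanishes (sobSum (ENNReal.ofReal p) (B R')) fun z => (M z).opF j k g - (M 0).opF j k g := by
  obtain ⟨C, hC⟩ := exists_sobSum_symQ_le hp hR R' j k
  obtain ⟨D, hD⟩ := exists_sobSum_symW_le hp hR R' j k
  exact hM.vanishes_F (boundRel_sobSum (one_le_ofReal hp) (isOpen_B R')) j k
    (ne_top_of_le_ne_top (mul_norm_ne_top hgp.2.ne) (hC g hg hgp))
    (mul_norm_ne_top hgp.2.ne) fun μ => hD μ g hg hgp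

theorem ModeFamily.vanishes_sobNorm_E (hM : ModeFamily M) (hp : 1 < p) (hR : 0 < R) (R' : ℝ)
    {g : E3 → ℂ} (hg : SuppIn R g) (hgp : MemLp g (ENNReal.ofReal p)) (k : Fin 3) :
    Vanishes (sobNorm 1 (ENNReal.ofReal p) (B R')) fun z => (M z).opE k g - (M 0).opE k g := by
  obtain ⟨C, hC⟩ := exists_sobNorm_symR_le hp hR R' k
  obtain ⟨D, hD⟩ := exists_sobNorm_symU₁_le hp hR R' k
  exact hM.vanishes_E (boundRel_sobNorm_one (one_le_ofReal hp) (isOpen_B R')) k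
    (ne_top_of_le_ne_top (mul_norm_ne_top hgp.2.ne) (hC g hg hgp))
    (mul_norm_ne_top hgp.2.ne) fun μ => hD μ g hg hgp

theorem ModeFamily.vanishes_sobSum_E (hM : ModeFamily M) (hp : 1 < p) (hR : 0 < R) (R' : ℝ)
    {g : E3 → ℂ} {d : Fin 3 → E3 → ℂ} (hg : HasGrad p R g d) (k : Fin 3) :
    Vanishes (sobSum (ENNReal.ofReal p) (B R')) fun z => (M z).opE k g - (M 0).opE k g := by
  obtain ⟨C, hC⟩ := exists_sobSum_symR_le hp hR R' k
  obtain ⟨D, hD⟩ := exists_sobSum_symU₁_le hp hR R' k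
  exact hM.vanishes_E (boundRel_sobSum (one_le_ofReal hp) (isOpen_B R')) k
    (ne_top_of_le_ne_top (mul_norm_ne_top hg.norm_ne_top) (hC g d hg))
    (mul_norm_ne_top hg.norm_ne_top) fun μ => hD μ g d hg

theorem ModeFamily.vanishes_sobSum_H (hM : ModeFamily M) (hp : 1 < p) (hR : 0 < R) (R' : ℝ)
    {g : E3 → ℂ} {d : Fin 3 → E3 → ℂ} (hg : HasGrad p R g d) (k : Fin 3) :
    Vanishes (sobSum (ENNReal.ofReal p) (B R')) fun z => (M z).opH k g - (M 0).opH k g := by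
  obtain ⟨C, hC⟩ := exists_sobSum_symR_le hp hR R' k
  obtain ⟨D, hD⟩ := exists_sobSum_symU₁_le hp hR R' k
  exact hM.vanishes_H (boundRel_sobSum (one_le_ofReal hp) (isOpen_B R')) k
    (ne_top_of_le_ne_top (mul_norm_ne_top hg.norm_ne_top) (hC g d hg))
    (mul_norm_ne_top hg.norm_ne_top) fun μ => hD μ g d hg

theorem ModeFamily.vanishes_sobNorm_K (hM : ModeFamily M) (hp : 1 < p) (hR : 0 < R) (R' : ℝ)
    {g : E3 → ℂ} {d : Fin 3 → E3 → ℂ} (hg : HasGrad p R g d) :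
    Vanishes (sobNorm 1 (ENNReal.ofReal p) (B R')) fun z => (M z).opK g - (M 0).opK g := by
  have hN := boundRel_sobSum (one_le_ofReal hp) (isOpen_B R')
  obtain ⟨C, hC⟩ := gradBdd_sobNorm_ofFun (p := p) (R := R) R'
  obtain ⟨D, hD⟩ := exists_sobSum_symN_le hp hR R'
  have h0 : sobSum (ENNReal.ofReal p) (B R') ((M 0).opD g) ≠ ⊤ := by
    rw [Mode.opD_of_zero hM.μ_zero]
    refine ne_top_of_le_ne_top (ENNReal.mul_ne_top enorm_ne_top ?_) (hN.smul_le _ _)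
    exact ne_top_of_le_ne_top (mul_norm_ne_top hg.mem.2.ne) (hD g hg.supp hg.mem)
  exact hM.vanishes_K (boundRel_sobNorm_one (one_le_ofReal hp) (isOpen_B R'))
    (ne_top_of_le_ne_top (mul_norm_ne_top hg.norm_ne_top) (hC g d hg))
    (ENNReal.add_ne_top.2 ⟨ENNReal.one_ne_top, h0⟩)
    (((hM.vanishes_sobSum_D hp hR R' hg.supp hg.mem).eventually_le hN).mono
      fun z hz => (sobNorm_one_le _ _ _).trans hz)

variable (R' : ℝ) (c : Coeffs)

theorem Datum.vanishes_forceForm (hd : Datum p R f d₁ d₃) (hp : 1 < p) (hR : 0 < R) (j : Fin 3) :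
    Vanishes (sobSum (ENNReal.ofReal p) (B R')) fun z =>
      forceForm (c.mode₁ z) (c.mode₂ z) f j - forceForm (c.mode₁ 0) (c.mode₂ 0) f j := by
  have hN := boundRel_sobSum (one_le_ofReal hp) (isOpen_B R')
  refine ((c.modeFamily₁.vanishes_sobSum_D hp hR R' (hd.supp₂ j) (hd.mem₂ j)).add hN
    ((Vanishes.sum hN fun k => c.modeFamily₂.vanishes_sobSum_F hp hR R' (hd.supp₂ k) (hd.mem₂ k)
      j k).sub hN (Vanishes.sum hN fun k => c.modeFamily₁.vanishes_sobSum_F hp hR R' (hd.supp₂ k)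
      (hd.mem₂ k) j k))).congr fun z => ?_
  simp only [forceForm, Finset.sum_sub_distrib]
  module

theorem Datum.vanishes_psiForm (hd : Datum p R f d₁ d₃) (hp : 1 < p) (hR : 0 < R) (j : Fin 3) :
    Vanishes (sobSum (ENNReal.ofReal p) (B R')) fun z =>
      psiForm (c.mode₁ z) (c.mode₂ z) f j - psiForm (c.mode₁ 0) (c.mode₂ 0) f j := by
  have hN := boundRel_sobSum (one_le_ofReal hp) (isOpen_B R')
  refine ((hd.vanishes_forceForm R' c hp hR j).sub hN ((((Vanishes.sum hN fun k =>
    c.modeFamily₁.vanishes_sobSum_H hp hR R' (hd.grad₃ j k) k).add hN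
    (c.modeFamily₁.vanishes_sobSum_H hp hR R' hd.grad₁ j)).sub hN
    (c.modeFamily₂.vanishes_sobSum_H hp hR R' hd.grad₁ j)).smul hN Complex.I)).congr fun z => ?_
  simp only [psiForm, Finset.sum_sub_distrib]
  module

theorem Datum.vanishes_velForm (hd : Datum p R f d₁ d₃) (hp : 1 < p) (hR : 0 < R)
    (hx : xNorm (ENNReal.ofReal p) f ≠ ⊤) (j : Fin 3) :
    Vanishes (sobSum (ENNReal.ofReal p) (B R')) fun z =>
      velForm c (c.mode₁ z) (c.mode₂ z) f j - velForm c (c.mode₁ 0) (c.mode₂ 0) f j := by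
  have hN := boundRel_sobSum (one_le_ofReal hp) (isOpen_B R')
  obtain ⟨C, hC⟩ := controlled_forceForm (p := p) (R := R) hN (exists_sobSum_symN_le hp hR R')
    (fun j k => exists_sobSum_symQ_le hp hR R' j k) c j
  have h0 : sobSum (ENNReal.ofReal p) (B R') (forceForm (c.mode₁ 0) (c.mode₂ 0) f j) ≠ ⊤ :=
    ne_top_of_le_ne_top (mul_norm_ne_top hx) (hC f d₁ d₃ hd)
  -- The force enters the velocity with the factor `z`. Its potential converges, hence stays
  -- bounded, and the product tends to zero in agreement with the absence of `f₂` from the zero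
  -- velocity.
  have hforce := Vanishes.of_smul hN (α := fun z => z) (tendsto_id.mono_left sector_le)
    (ENNReal.add_ne_top.2 ⟨ENNReal.one_ne_top, h0⟩)
    ((hd.vanishes_forceForm R' c hp hR j).eventually_le hN)
  refine ((((c.modeFamily₂.vanishes_sobSum_E hp hR R' hd.grad₁ j).smul hN
    (-(Complex.I * (c.γ : ℂ) ^ 2))).add hN hforce).add hN ((((Vanishes.sum hN fun k =>
    c.modeFamily₁.vanishes_sobSum_E hp hR R' (hd.grad₃ j k) k).add hN
    (c.modeFamily₁.vanishes_sobSum_E hp hR R' hd.grad₁ j)).sub hN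
    (c.modeFamily₂.vanishes_sobSum_E hp hR R' hd.grad₁ j)).smul hN
    (Complex.I * (c.β : ℂ) ^ 2))).congr fun z => ?_
  have e1 : (c.mode₁ z).z = z := rfl
  have e2 : (c.mode₁ 0).z = 0 := rfl
  simp only [velForm, Finset.sum_sub_distrib, e1, e2, distrib_zero_smul]
  module

theorem Datum.vanishes_phiForm (hd : Datum p R f d₁ d₃) (hp : 1 < p) (hR : 0 < R) :
    Vanishes (sobNorm 1 (ENNReal.ofReal p) (B R')) fun z =>
      phiForm (c.mode₂ z) f - phiForm (c.mode₂ 0) f := by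
  have hN := boundRel_sobNorm_one (one_le_ofReal hp) (isOpen_B R')
  refine ((c.modeFamily₂.vanishes_sobNorm_K hp hR R' hd.grad₁).sub hN ((Vanishes.sum hN fun k =>
    c.modeFamily₂.vanishes_sobNorm_E hp hR R' (hd.supp₂ k) (hd.mem₂ k) k).smul hN
      Complex.I)).congr fun z => ?_
  simp only [phiForm, Finset.sum_sub_distrib]
  module

end

/-- Convergence of `R(z)` and `Ψ(z)` as `z → 0` in the closed right half plane. -/
theorem tendsto_resolvent {p R : ℝ} (hp : 1 < p) (hR : 0 < R) (c : Coeffs) (R' : ℝ) {f : Data}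
    (hf : f ∈ XR (ENNReal.ofReal p) R) :
    Tendsto (fun z : ℂ => yNorm (ENNReal.ofReal p) (B R') (resolv c z f - resolv0 c f) +
        ∑ j, sobNorm 2 (ENNReal.ofReal p) (B R') (Psi c z f j - Psi0 c f j)) sector (𝓝 0) := by
  obtain ⟨d₁, d₃, hd⟩ := exists_datum hp hR hf
  have hx := (xNorm_lt_top hf).ne
  have h1 := hd.vanishes_phiForm R' c hp hR
  have h2 := hd.vanishes_velForm R' c hp hR hx
  have h3 := hd.vanishes_psiForm R' c hp hR
  have hlim := ((Tendsto.add h1 (tendsto_finsetSum Finset.univ fun j _ => h2 j)).add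
    (tendsto_finsetSum Finset.univ fun j _ => tendsto_finsetSum
      (Finset.univ : Finset (Fin 3)) fun _ _ => h3 j)).add
    (tendsto_finsetSum Finset.univ fun j _ => h3 j)
  simp only [Finset.sum_const_zero, add_zero] at hlim
  refine tendsto_of_tendsto_of_tendsto_of_le_of_le' tendsto_const_nhds hlim
    (Eventually.of_forall fun _ => zero_le) ?_
  -- The scalar multiplier form requires `κ ≠ 0` and `μ` in the admissible range, which holds only
  -- for `z` close to zero.
  filter_upwards [c.modeFamily₁.ok, c.modeFamily₂.ok] with z o₁ o₂
  have eP : ∀ j, Psi c z f j - Psi0 c f j =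
      psiForm (c.mode₁ z) (c.mode₂ z) f j - psiForm (c.mode₁ 0) (c.mode₂ 0) f j := fun j => by
    rw [hd.Psi_eq o₁ o₂, hd.Psi0_eq]
  refine add_le_add (add_le_add (add_le_add ?_ (Finset.sum_le_sum fun j _ => ?_))
    (Finset.sum_le_sum fun j _ => Finset.sum_le_sum fun k _ => ?_))
    (Finset.sum_le_sum fun j _ => ?_)
  · change sobNorm 1 _ _ (Phi c z f - Phi0 c f) ≤ _
    rw [hd.Phi_eq o₂, hd.Phi0_eq]
  · change sobNorm 2 _ _ (Wvel c z f j - Wvel0 c f j) ≤ _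
    rw [hd.Wvel_eq o₁ o₂, hd.Wvel0_eq]
    exact sobNorm_two_le _ _ _
  · change sobNorm 1 _ _ (Gdef c z f j k - Gdef0 c f j k) ≤ _
    rw [hd.Gdef_eq o₁ o₂, hd.Gdef0_eq, hd.Psi0_eq, ← pd_sub]
    exact sobNorm_one_pd_le _ _ _ k
  · rw [eP]
    exact sobNorm_two_le _ _ _

end Viscoelastic

end

/-! ### The assembled statement. -/

theorem proposition3p4 (c : Coeffs) (p : ℝ≥0∞) (hp1 : 1 < p) (hp : p < ⊤)
    (R : ℝ) (hR : 0 < R) :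
    -- linearity of the two operators on `X_R^p(ℝ³)`
    (∀ f ∈ XR p R, ∀ g ∈ XR p R, ∀ a b : ℂ,
      resolv0 c (a • f + b • g) = a • resolv0 c f + b • resolv0 c g ∧
      Psi0 c (a • f + b • g) = a • Psi0 c f + b • Psi0 c g) ∧
    -- (i) boundedness into `Y^p(B_{R'})` and `W^{2,p}(B_{R'})³`; moreover `G(0)f = ∇Ψ(0)f`
    (∀ R' : ℝ, 0 < R' → ∃ C : ℝ≥0, ∀ f ∈ XR p R,
      MemY p (B R') (resolv0 c f) ∧
      IsGradOn (B R') (resolv0 c f).2.2 (Psi0 c f) ∧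
      yNorm p (B R') (resolv0 c f) ≤ C * xNorm p f ∧
      ∑ j, sobNorm 2 p (B R') (Psi0 c f j) ≤ C * xNorm p f) ∧
    -- (ii) gradient bounds in the whole space
    (∃ C : ℝ≥0, ∀ f ∈ XR p R,
      gradNorm 0 p Set.univ (Phi0 c f) + ∑ j, gradNorm 1 p Set.univ (Wvel0 c f j) +
        ∑ j, ∑ k, gradNorm 0 p Set.univ (Gdef0 c f j k) ≤ C * xNorm p f) ∧
    -- (iii) pointwise decay; `R(0)f` and `Ψ(0)f` are continuous functions for `|x| > R`
    (∃ C : ℝ≥0, ∀ f ∈ XR p R,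
      ∃ (φ : E3 → ℂ) (w : Fin 3 → E3 → ℂ) (G : Fin 3 → Fin 3 → E3 → ℂ) (ψ : Fin 3 → E3 → ℂ),
        (ContinuousOn φ {x | R < ‖x‖} ∧ RepresentedOn (Phi0 c f) {x | R < ‖x‖} φ) ∧
        (∀ j, ContinuousOn (w j) {x | R < ‖x‖} ∧
          RepresentedOn (Wvel0 c f j) {x | R < ‖x‖} (w j)) ∧
        (∀ j k, ContinuousOn (G j k) {x | R < ‖x‖} ∧
          RepresentedOn (Gdef0 c f j k) {x | R < ‖x‖} (G j k)) ∧
        (∀ j, ContinuousOn (ψ j) {x | R < ‖x‖} ∧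
          RepresentedOn (Psi0 c f j) {x | R < ‖x‖} (ψ j)) ∧
        ∀ x : E3, 2 * R ≤ ‖x‖ →
          ENNReal.ofReal
            (‖x‖ ^ 2 * (‖φ x‖ + ∑ j, ‖w j x‖ + ∑ j, ∑ k, ‖G j k x‖) + ‖x‖ * ∑ j, ‖ψ j x‖) ≤
              C * xNorm p f) ∧
    -- (iv) convergence as `z → 0`, `z ≠ 0`, `|arg z| ≤ π / 2`
    (∀ R' : ℝ, 0 < R' → ∀ f ∈ XR p R,
      Tendsto (fun z : ℂ => yNorm p (B R') (resolv c z f - resolv0 c f) +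
          ∑ j, sobNorm 2 p (B R') (Psi c z f j - Psi0 c f j))
        (𝓝[{z : ℂ | z ≠ 0 ∧ |z.arg| ≤ Real.pi / 2}] 0) (𝓝 0)) := by
  -- As `p` is finite it comes from a real exponent, the form in which the estimates are proved.
  obtain ⟨q, rfl⟩ : ∃ q : ℝ, p = ENNReal.ofReal q := ⟨p.toReal, (ENNReal.ofReal_toReal hp.ne).symm⟩
  have hq : 1 < q := by simpa using hp1
  refine ⟨fun f hf g hg a b => ?_, fun R' _ => exists_yNorm_zero_resolvent_le hq hR c R',
    exists_gradNorm_zero_resolvent_le hq hR c, exists_decay_zero_resolvent hq hR c,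
    fun R' _ f hf => tendsto_resolvent hq hR c R' hf⟩
  obtain ⟨_, _, df⟩ := exists_datum hq hR hf
  obtain ⟨_, _, dg⟩ := exists_datum hq hR hg
  exact df.toConstrained.resolv0_comb c a b dg.toConstrained
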